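/- Let $\widehat K=[-1,1]^3$, let $P_2$ be the space of real polynomials of degree at most $2$ in three variables, and define the shape spaces \[ \widehat{\mathbb P}^{(1)}=P_2\oplus\mathrm{Span}\{x_1x_2x_3,\;x_1^2x_2,\;x_2^2x_3,\;x_3^2x_1\},\qquad \widehat{\mathbb P}^{(2)}=P_2\oplus\mathrm{Span}\{x_1x_2x_3,\;x_1x_2^2,\;x_2x_3^2,\;x_3x_1^2\}, \] \[ \widehat{\mathbb P}^{(5)}=P_2\oplus\mathrm{Span}\{x_1x_2x_3,\;x_1^2x_2+x_1x_2^2,\;x_2^2x_3+x_2x_3^2,\;x_3^2x_1+x_3x_1^2\} \] of the Smith–Kidger 14-node elements of Types 1, 2 and 5. Let $\Omega\subset\mathbb R^3$ be an open parallelepiped with boundary $\Gamma$. Let $\mathcal T_h$ be a finite face-to-face mesh of $\overline\Omega$ into closed parallelepipeds $K=T_K(\widehat K)$ with $T_K$ an invertible affine map (the cells cover $\overline\Omega$, have disjoint interiors, and any two distinct cells are disjoint or meet in a common closed face, edge or vertex), and let $h=\max_K\operatorname{diam}K$. The mesh is shape-regular with constant $\sigma$ if every cell $K$ contains a ball of some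 diameter $\rho>0$ with $\operatorname{diam}K\le\sigma\rho$. For $t\in\{1,2,5\}$ let $\mathcal{NC}^h_0$ be the space of piecewise functions $w$ such that $w|_K\circ T_K\in\widehat{\mathbb P}^{(t)}$ for every cell $K$, $w$ is continuous at all vertices and all face-centroids of the cells, and $w$ vanishes at those of these points that lie on $\Gamma$. Put $a(u,v)=\int_\Omega\nabla u\cdot\nabla v$, $a_h(v,w)=\sum_K\int_K\nabla v\cdot\nabla w$ and $\|v\|_h=\sqrt{a_h(v,v)}$. Theorem 1. For every $t\in\{1,2,5\}$, every $\Omega$ and every $\sigma$ there is a constant $C$, depending on nothing else, such that for every mesh $\mathcal T_h$ of $\Omega$ that is shape-regular with constant $\sigma$ the following holds. Let $f\in H^1(\Omega)$, and let $u\in H^3(\Omega)\cap H^1_0(\Omega)$ be the weak solution of $-\Delta u=f$ in $\Omega$, $u=0$ on $\Gamma$, that is, $a(u,v)=\int_\Omega fv$ for all $v\in H_0^1(\Omega)$. Let $u_h\in\mathcal{NC}^h_0$ satisfy $a_h(u_h,v_h)=\int_\Omega f\,v_h$ for all $v_h\in\mathcal{NC}^h_0$. Then \[ \|u-u_h\|_h\le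 C\,h^2\,\|u\|_{H^3(\Omega)} . \] -/

import Mathlib

open MeasureTheory Set
open scoped ContDiff

noncomputable section

namespace BrickFEM

/-- Three-dimensional Euclidean space. -/
abbrev E3 : Type := EuclideanSpace ℝ (Fin 3)

/-! ### Sobolev spaces through weak derivatives -/

/-- The classical partial derivative `∂ᵢ φ`. -/
def partialDeriv (i : Fin 3) (φ : E3 → ℝ) : E3 → ℝ :=
  fun x => fderiv ℝ φ x (EuclideanSpace.single i (1 : ℝ))

/-- The classical derivative `∂^α φ` of a smooth function, for a multi-index `α`. -/
def multiDeriv (α : Fin 3 → ℕ) (φ : E3 → ℝ) : E3 → ℝ :=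
  (partialDeriv 0)^[α 0] ((partialDeriv 1)^[α 1] ((partialDeriv 2)^[α 2] φ))

/-- `φ ∈ C_c^∞(Ω)`. -/
def IsTestFunction (Ω : Set E3) (φ : E3 → ℝ) : Prop :=
  ContDiff ℝ ∞ φ ∧ HasCompactSupport φ ∧ tsupport φ ⊆ Ω

/-- `g` is the weak derivative `∂^α u` on the open set `Ω`, within `L²(Ω)`. -/
def IsWeakDeriv (Ω : Set E3) (α : Fin 3 → ℕ) (u g : E3 → ℝ) : Prop :=
  MemLp g 2 (volume.restrict Ω) ∧
    ∀ φ : E3 → ℝ, IsTestFunction Ω φ →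
      ∫ x in Ω, u x * multiDeriv α φ x = (-1) ^ (∑ i, α i) * ∫ x in Ω, g x * φ x

/-- `u ∈ H^m(Ω)`. -/
def MemSobolev (Ω : Set E3) (m : ℕ) (u : E3 → ℝ) : Prop :=
  MemLp u 2 (volume.restrict Ω) ∧
    ∀ α : Fin 3 → ℕ, ∑ i, α i ≤ m → ∃ g, IsWeakDeriv Ω α u g

open Classical in
/-- The weak derivative `∂^α u ∈ L²(Ω)` (unique up to null sets; `0` if there is none). -/
def weakDeriv (Ω : Set E3) (α : Fin 3 → ℕ) (u : E3 → ℝ) : E3 → ℝ :=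
  if h : ∃ g, IsWeakDeriv Ω α u g then h.choose else 0

/-- The multi-indices of order at most `m`. -/
def multiIndices (m : ℕ) : Finset (Fin 3 → ℕ) :=
  (Finset.range (m + 1)).biUnion fun k => Finset.piAntidiag Finset.univ k

/-- The norm `‖u‖_m` of `H^m(Ω)`. -/
def sobolevNorm (Ω : Set E3) (m : ℕ) (u : E3 → ℝ) : ℝ :=
  Real.sqrt (∑ α ∈ multiIndices m, ∫ x in Ω, (weakDeriv Ω α u x) ^ 2)

/-- `u ∈ H¹₀(Ω)`: the closure of `C_c^∞(Ω)` in `H¹(Ω)`. -/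
def MemH10 (Ω : Set E3) (u : E3 → ℝ) : Prop :=
  MemSobolev Ω 1 u ∧
    ∀ ε : ℝ, 0 < ε → ∃ φ : E3 → ℝ, IsTestFunction Ω φ ∧ sobolevNorm Ω 1 (u - φ) < ε

/-- `a(u, v) = (∇u, ∇v)` on `Ω`, with weak gradients. -/
def dirichletForm (Ω : Set E3) (u v : E3 → ℝ) : ℝ :=
  ∑ i : Fin 3, ∫ x in Ω, weakDeriv Ω (Pi.single i 1) u x * weakDeriv Ω (Pi.single i 1) v x

/-- `u` solves `-Δu = f` in `Ω`, `u = 0` on `∂Ω`, in the weak sense. -/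
def IsWeakSolution (Ω : Set E3) (f u : E3 → ℝ) : Prop :=
  MemH10 Ω u ∧ ∀ v : E3 → ℝ, MemH10 Ω v → dirichletForm Ω u v = ∫ x in Ω, f x * v x

/-! ### The reference element -/

/-- The reference cube `[-1, 1]³`. -/
def refCube : Set E3 := {x | ∀ i, |x i| ≤ 1}

/-- The closed face of the reference cube with sign vector `s`: the coordinate `i` is fixed to
`s i` where `s i = ±1` and is free where `s i = 0`. These are all the closed faces of the cube
(vertices, edges, two-dimensional faces, and the cube itself). -/
def refFace (s : Fin 3 → SignType) : Set E3 :=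
  {x | x ∈ refCube ∧ ∀ i, s i ≠ 0 → x i = (s i : ℝ)}

/-- The eight vertices and the six face-centroids of the reference cube. -/
def refNodes : Set E3 :=
  {x | ∀ i, |x i| = 1} ∪ {x | ∃ i, |x i| = 1 ∧ ∀ j, j ≠ i → x j = 0}

/-- The types of Smith-Kidger elements under consideration. -/
inductive SKType where
  | type1
  | type2
  | type5

open MvPolynomial in
/-- The four higher-order polynomials of each type. -/
def SKType.extra : SKType → Set (MvPolynomial (Fin 3) ℝ)
  | .type1 => {X 0 * X 1 * X 2, X 0 ^ 2 * X 1, X 1 ^ 2 * X 2, X 2 ^ 2 * X 0}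
  | .type2 => {X 0 * X 1 * X 2, X 0 * X 1 ^ 2, X 1 * X 2 ^ 2, X 2 * X 0 ^ 2}
  | .type5 => {X 0 * X 1 * X 2, X 0 ^ 2 * X 1 + X 0 * X 1 ^ 2,
      X 1 ^ 2 * X 2 + X 1 * X 2 ^ 2, X 2 ^ 2 * X 0 + X 2 * X 0 ^ 2}

/-- The reference shape function space `P₂ ⊕ Span {four higher-order polynomials}`. -/
def SKType.shapeSpace (t : SKType) : Submodule ℝ (MvPolynomial (Fin 3) ℝ) :=
  MvPolynomial.restrictTotalDegree (Fin 3) ℝ 2 ⊔ Submodule.span ℝ t.extra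

/-- `φ` belongs to the shape function space of the cell `T(refCube)`: `φ = p ∘ T⁻¹` with `p` in
the reference space. -/
def IsShapeFunction (t : SKType) (T : E3 ≃ᵃ[ℝ] E3) (φ : E3 → ℝ) : Prop :=
  ∃ p ∈ t.shapeSpace, ∀ x, φ x = MvPolynomial.eval (fun i => T.symm x i) p

/-! ### Meshes -/

/-- The open parallelepiped which is the image of the open cube under the affine map `S`. -/
def boxDomain (S : E3 ≃ᵃ[ℝ] E3) : Set E3 := interior (S '' refCube)

/-- A face-to-face mesh of `Ω` into finitely many closed parallelepipeds, each given with an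
affine map of the reference cube onto it. -/
structure BrickMesh (Ω : Set E3) where
  /-- the number of cells -/
  n : ℕ
  /-- the affine maps `T_K` -/
  T : Fin n → (E3 ≃ᵃ[ℝ] E3)
  cover : (⋃ k, T k '' refCube) = closure Ω
  disjoint_interiors : ∀ k l, k ≠ l →
    Disjoint (interior (T k '' refCube)) (interior (T l '' refCube))
  face_to_face : ∀ k l, k ≠ l →
    (T k '' refCube) ∩ (T l '' refCube) = ∅ ∨
      ∃ s s' : Fin 3 → SignType,
        (T k '' refCube) ∩ (T l '' refCube) = T k '' refFace s ∧
        (T k '' refCube) ∩ (T l '' refCube) = T l '' refFace s'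

namespace BrickMesh

variable {Ω : Set E3} (𝒯 : BrickMesh Ω)

/-- The closed cells. -/
def cell (k : Fin 𝒯.n) : Set E3 := 𝒯.T k '' refCube

/-- The mesh size: the largest diameter of a cell. -/
def h : ℝ := ⨆ k : Fin 𝒯.n, Metric.diam (𝒯.cell k)

/-- Shape regularity with constant `σ`: every cell `K` contains a ball of some diameter `ρ > 0`
with `diam K ≤ σ ρ`. -/
def IsShapeRegular (σ : ℝ) : Prop :=
  ∀ k, ∃ (c : E3) (ρ : ℝ), 0 < ρ ∧ Metric.closedBall c (ρ / 2) ⊆ 𝒯.cell k ∧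
    Metric.diam (𝒯.cell k) ≤ σ * ρ

/-- All vertices and face-centroids of the cells of the mesh. -/
def nodes : Set E3 := ⋃ k, 𝒯.T k '' refNodes

/-- Membership in the nonconforming space with homogeneous boundary values. A piecewise
function is the family `w` of its restrictions to the cells; it has to be continuous at all nodes
and to vanish at the nodes on the boundary. -/
def MemNC0 (t : SKType) (w : Fin 𝒯.n → E3 → ℝ) : Prop :=
  (∀ k, IsShapeFunction t (𝒯.T k) (w k)) ∧
  (∀ z ∈ 𝒯.nodes, ∀ k l, z ∈ 𝒯.cell k → z ∈ 𝒯.cell l → w k z = w l z) ∧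
  (∀ z ∈ 𝒯.nodes, z ∈ frontier Ω → ∀ k, z ∈ 𝒯.cell k → w k z = 0)

/-- The broken form `a_h(v, w)`: the sum over all cells `K` of `(∇v, ∇w)_K`. -/
def brokenForm (v w : Fin 𝒯.n → E3 → ℝ) : ℝ :=
  ∑ k, dirichletForm (interior (𝒯.cell k)) (v k) (w k)

/-- The broken energy norm. -/
def brokenNorm (v : Fin 𝒯.n → E3 → ℝ) : ℝ := Real.sqrt (𝒯.brokenForm v v)

/-- `u_h` solves the nonconforming discrete problem with right-hand side `f`. -/
def IsDiscreteSolution (t : SKType) (f : E3 → ℝ) (uh : Fin 𝒯.n → E3 → ℝ) : Prop :=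
  𝒯.MemNC0 t uh ∧ ∀ w : Fin 𝒯.n → E3 → ℝ, 𝒯.MemNC0 t w →
    𝒯.brokenForm uh w = ∑ k, ∫ x in interior (𝒯.cell k), f x * w k x

end BrickMesh

end BrickFEM

end

open BrickFEM

noncomputable section

namespace BrickFEM

/-! ### Classical derivatives of smooth functions -/

/-! The proof follows Strang's second lemma, with both error terms estimated cell by cell. Let w be
the nodal interpolant of u minus u_h. Then a_h(w, w) equals the consistency error a_h(u, w) − ∫ f w
minus a_h(u − interpolant, w). Both are bounded by C h² |u|₃ ‖w‖_h, and the triangle inequality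
concludes (`BrickMesh.sum_integral_error_le`).

Consistency. On its cell every shape function has a polynomial `companion`: the trilinear
interpolant of its vertex values plus face bubbles. The trace of the companion on a face depends
only on the nodes of this face, and the construction commutes with the symmetries of the cube. Hence
the companions of a discrete function glue to a Lipschitz function vanishing outside Ω
(`BrickMesh.conforming_eq`, `BrickMesh.conforming_eq_zero`). Against this function integration by
parts is exact, so only the remainder `CubicCoeff.rem` contributes (`BrickMesh.consistency_eq`). The
remainder satisfies ∫ ∂ᵢ(q · rem) = 0 for all affine q
(`CubicCoeff.integral_partialDeriv_affine_mul_rem`). Therefore an affine approximation of ∇u may be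
subtracted at no cost, which gains two powers of h (`HasWeakGrad.sq_consistency_le`). All of this
takes place in one polynomial space containing the three types.

Interpolation. The interpolant reproduces quadratics, and a shape function is controlled by its
nodal values. What remains is to approximate u by a quadratic (`HasWeakGrad.exists_quadratic`, three
Poincaré inequalities) and to bound the nodal values of the difference
(`HasWeakGrad.sq_mul_affDet_le`, a scaled Sobolev embedding). Both estimates are obtained by
duality. Along coordinate lines a test function is the derivative of another test function plus a
fixed profile times its line integral (`partialDeriv_lineLift`); pairing with this splitting moves
derivatives onto the Sobolev function, which never has to be smoothed.

Nodal values. The solution is only a class of functions modulo null sets. Since u lies in H¹₀, its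
mixed third derivative along the edges of Ω can be integrated by parts up to the boundary, and u is
the integral of this derivative over the part of the box below the point
(`MemH10.exists_ae_eq_lowerIntegral`). This gives a continuous representative that vanishes on Γ
(`MemH10.exists_continuous`) and can be interpolated. -/

theorem multiDeriv_single (i : Fin 3) (φ : E3 → ℝ) :
    multiDeriv (Pi.single i 1) φ = partialDeriv i φ := by
  fin_cases i <;> simp [multiDeriv]

theorem contDiff_partialDeriv (i : Fin 3) {φ : E3 → ℝ} (hφ : ContDiff ℝ ∞ φ) :
    ContDiff ℝ ∞ (partialDeriv i φ) :=
  (hφ.fderiv_right (m := ∞) (by simp)).clm_apply contDiff_const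

theorem contDiff_iterate_partialDeriv (i : Fin 3) (n : ℕ) {φ : E3 → ℝ} (hφ : ContDiff ℝ ∞ φ) :
    ContDiff ℝ ∞ ((partialDeriv i)^[n] φ) := by
  induction n with
  | zero => exact hφ
  | succ n ih => rw [Function.iterate_succ_apply']; exact contDiff_partialDeriv i ih

theorem partialDeriv_comm (i j : Fin 3) {φ : E3 → ℝ} (hφ : ContDiff ℝ ∞ φ) :
    partialDeriv i (partialDeriv j φ) = partialDeriv j (partialDeriv i φ) := by
  have hd : Differentiable ℝ (fderiv ℝ φ) :=
    (hφ.fderiv_right (m := ∞) (by simp)).differentiable (by simp)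
  have key : ∀ (v w : E3) x, fderiv ℝ (fun y => fderiv ℝ φ y v) x w
      = fderiv ℝ (fderiv ℝ φ) x w v := by
    intro v w x
    rw [fderiv_clm_apply (hd x) (differentiableAt_const v)]
    simp
  funext x
  unfold partialDeriv
  rw [key, key]
  exact (hφ.contDiffAt.isSymmSndFDerivAt
    (by rw [minSmoothness_of_isRCLikeNormedField]; exact WithTop.coe_le_coe.2 le_top)) _ _

theorem partialDeriv_iterate_comm (i j : Fin 3) (n : ℕ) {φ : E3 → ℝ} (hφ : ContDiff ℝ ∞ φ) :
    partialDeriv i ((partialDeriv j)^[n] φ) = (partialDeriv j)^[n] (partialDeriv i φ) := by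
  induction n with
  | zero => rfl
  | succ n ih =>
    rw [Function.iterate_succ_apply', partialDeriv_comm i j (contDiff_iterate_partialDeriv j n hφ),
      ih, Function.iterate_succ_apply']

theorem multiDeriv_partialDeriv (α : Fin 3 → ℕ) (i : Fin 3) {φ : E3 → ℝ} (hφ : ContDiff ℝ ∞ φ) :
    multiDeriv α (partialDeriv i φ) = partialDeriv i (multiDeriv α φ) := by
  unfold multiDeriv
  have h2 := contDiff_iterate_partialDeriv 2 (α 2) hφ
  have h1 := contDiff_iterate_partialDeriv 1 (α 1) h2
  rw [← partialDeriv_iterate_comm i 2 _ hφ, ← partialDeriv_iterate_comm i 1 _ h2,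
    ← partialDeriv_iterate_comm i 0 _ h1]

theorem multiDeriv_add_single (α : Fin 3 → ℕ) (i : Fin 3) {φ : E3 → ℝ} (hφ : ContDiff ℝ ∞ φ) :
    multiDeriv (α + Pi.single i 1) φ = partialDeriv i (multiDeriv α φ) := by
  have h2 := contDiff_iterate_partialDeriv 2 (α 2) hφ
  have h1 := contDiff_iterate_partialDeriv 1 (α 1) h2
  have h0 := contDiff_iterate_partialDeriv 0 (α 0) h1
  fin_cases i
  · simp [multiDeriv, Function.iterate_succ_apply']
  · simp only [multiDeriv]
    simp only [Fin.mk_one, Fin.isValue, Pi.add_apply, ne_eq, zero_ne_one, not_false_eq_true,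
      Pi.single_eq_of_ne, add_zero, Pi.single_eq_same, Function.iterate_succ_apply',
      Fin.reduceEq]
    rw [partialDeriv_iterate_comm 1 0 _ h1]
  · simp only [multiDeriv]
    simp only [Fin.reduceFinMk, Fin.isValue, Pi.add_apply, ne_eq, not_false_eq_true,
      Pi.single_eq_of_ne, add_zero, Pi.single_eq_same, Function.iterate_succ_apply',
      Fin.reduceEq]
    rw [partialDeriv_iterate_comm 2 0 _ h1, partialDeriv_iterate_comm 2 1 _ h2]

theorem partialDeriv_eq_zero_of_notMem_tsupport (i : Fin 3) {φ : E3 → ℝ} {x : E3}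
    (hx : x ∉ tsupport φ) : partialDeriv i φ x = 0 := by
  have : fderiv ℝ φ x = 0 := by
    by_contra h
    exact hx (support_fderiv_subset ℝ h)
  simp [partialDeriv, this]

theorem tsupport_partialDeriv_subset (i : Fin 3) (φ : E3 → ℝ) :
    tsupport (partialDeriv i φ) ⊆ tsupport φ := by
  apply closure_minimal _ (isClosed_tsupport φ)
  intro x hx
  by_contra h
  exact hx (partialDeriv_eq_zero_of_notMem_tsupport i h)

theorem IsTestFunction.partialDeriv {Ω : Set E3} {φ : E3 → ℝ} (h : IsTestFunction Ω φ)
    (i : Fin 3) : IsTestFunction Ω (partialDeriv i φ) :=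
  ⟨contDiff_partialDeriv i h.1, h.2.1.mono' ((subset_tsupport _).trans
    (tsupport_partialDeriv_subset i φ)), (tsupport_partialDeriv_subset i φ).trans h.2.2⟩

theorem IsTestFunction.mono {U V : Set E3} (hUV : U ⊆ V) {φ : E3 → ℝ} (h : IsTestFunction U φ) :
    IsTestFunction V φ := ⟨h.1, h.2.1, h.2.2.trans hUV⟩

theorem IsTestFunction.memLp {U : Set E3} {φ : E3 → ℝ} (h : IsTestFunction U φ)
    (μ : Measure E3) [IsFiniteMeasureOnCompacts μ] : MemLp φ 2 μ :=
  h.1.continuous.memLp_of_hasCompactSupport h.2.1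

theorem IsTestFunction.eq_zero {U : Set E3} {φ : E3 → ℝ} (h : IsTestFunction U φ) {x : E3}
    (hx : x ∉ U) : φ x = 0 := image_eq_zero_of_notMem_tsupport fun hx' => hx (h.2.2 hx')

/-! ### Weak derivatives -/

/-- The fundamental lemma of the calculus of variations. It makes weak derivatives unique, so that
the arbitrary choice inside `weakDeriv` can be exchanged for any explicit weak derivative. -/
theorem ae_eq_of_forall_isTestFunction {U : Set E3} (hU : IsOpen U) {g g' : E3 → ℝ}
    (hg : MemLp g 2 (volume.restrict U)) (hg' : MemLp g' 2 (volume.restrict U))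
    (h : ∀ φ, IsTestFunction U φ → ∫ x in U, g x * φ x = ∫ x in U, g' x * φ x) :
    g =ᵐ[volume.restrict U] g' := by
  have hloc : LocallyIntegrableOn (g - g') U volume :=
    locallyIntegrableOn_of_locallyIntegrable_restrict ((hg.sub hg').locallyIntegrable (by norm_num))
  have key := hU.ae_eq_zero_of_integral_contDiff_smul_eq_zero hloc ?_
  · rw [Filter.EventuallyEq, ae_restrict_iff' hU.measurableSet]
    filter_upwards [key] with x hx hxU
    have := hx hxU
    simpa [sub_eq_zero] using this
  · intro φ h1 h2 h3
    have ht : IsTestFunction U φ := ⟨h1, h2, h3⟩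
    have e : ∫ x, φ x • (g - g') x = ∫ x in U, φ x • (g - g') x := by
      symm
      apply setIntegral_eq_integral_of_forall_compl_eq_zero
      intro x hx
      simp [ht.eq_zero hx]
    rw [e]
    have hm := ht.memLp (volume.restrict U)
    have i1 : Integrable (fun x => g x * φ x) (volume.restrict U) := hg.integrable_mul hm
    have i2 : Integrable (fun x => g' x * φ x) (volume.restrict U) := hg'.integrable_mul hm
    have : (fun x => φ x • (g - g') x) = fun x => g x * φ x - g' x * φ x := by
      funext x; simp; ring
    rw [this, integral_sub i1 i2, h φ ht, sub_self]

theorem MemLp.integrable_mul_fun {μ : Measure E3} {f g : E3 → ℝ} (hf : MemLp f 2 μ)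
    (hg : MemLp g 2 μ) : Integrable (fun x => f x * g x) μ := hf.integrable_mul hg

theorem IsWeakDeriv.ae_eq {U : Set E3} (hU : IsOpen U) {α : Fin 3 → ℕ} {u g g' : E3 → ℝ}
    (h : IsWeakDeriv U α u g) (h' : IsWeakDeriv U α u g') : g =ᵐ[volume.restrict U] g' := by
  refine ae_eq_of_forall_isTestFunction hU h.1 h'.1 fun φ hφ => ?_
  have := (h.2 φ hφ).symm.trans (h'.2 φ hφ)
  exact mul_left_cancel₀ (pow_ne_zero _ (by norm_num)) this

theorem IsWeakDeriv.weakDeriv {U : Set E3} {α : Fin 3 → ℕ} {u g : E3 → ℝ}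
    (h : IsWeakDeriv U α u g) : IsWeakDeriv U α u (weakDeriv U α u) := by
  have hex : ∃ g, IsWeakDeriv U α u g := ⟨g, h⟩
  rw [BrickFEM.weakDeriv, dif_pos hex]
  exact hex.choose_spec

theorem IsWeakDeriv.weakDeriv_ae_eq {U : Set E3} (hU : IsOpen U) {α : Fin 3 → ℕ} {u g : E3 → ℝ}
    (h : IsWeakDeriv U α u g) : BrickFEM.weakDeriv U α u =ᵐ[volume.restrict U] g :=
  h.weakDeriv.ae_eq hU h

theorem isWeakDeriv_zero {U : Set E3} {u : E3 → ℝ} (h : MemLp u 2 (volume.restrict U)) :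
    IsWeakDeriv U 0 u u := ⟨h, fun φ _ => by simp [multiDeriv]⟩

/-- `G` is the weak gradient of `g` on `U`, within `L²(U)`. -/
def HasWeakGrad (U : Set E3) (g : E3 → ℝ) (G : Fin 3 → E3 → ℝ) : Prop :=
  MemLp g 2 (volume.restrict U) ∧ (∀ i, MemLp (G i) 2 (volume.restrict U)) ∧
    ∀ φ, IsTestFunction U φ → ∀ i,
      ∫ x in U, g x * partialDeriv i φ x = -∫ x in U, G i x * φ x

theorem HasWeakGrad.isWeakDeriv {U : Set E3} {g : E3 → ℝ} {G : Fin 3 → E3 → ℝ}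
    (h : HasWeakGrad U g G) (i : Fin 3) : IsWeakDeriv U (Pi.single i 1) g (G i) := by
  refine ⟨h.2.1 i, fun φ hφ => ?_⟩
  rw [multiDeriv_single, h.2.2 φ hφ i]
  simp

/-- Test the defining identity of ∂^α u with ∂ᵢφ; the signs (-1)^|α| cancel. From here on higher
derivatives are handled as chains of first-order gradients instead of multi-indices. -/
theorem IsWeakDeriv.hasWeakGrad {U : Set E3} {α : Fin 3 → ℕ} {u g : E3 → ℝ} {G : Fin 3 → E3 → ℝ}
    (h : IsWeakDeriv U α u g) (hG : ∀ i, IsWeakDeriv U (α + Pi.single i 1) u (G i)) :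
    HasWeakGrad U g G := by
  refine ⟨h.1, fun i => (hG i).1, fun φ hφ i => ?_⟩
  have h1 := h.2 _ (hφ.partialDeriv i)
  have h2 := (hG i).2 φ hφ
  rw [multiDeriv_add_single α i hφ.1, ← multiDeriv_partialDeriv α i hφ.1, h1] at h2
  have e : ∑ j, (α + Pi.single i 1 : Fin 3 → ℕ) j = ∑ j, α j + 1 := by
    simp [Finset.sum_add_distrib]
  rw [e, pow_succ, mul_assoc, neg_one_mul] at h2
  exact mul_left_cancel₀ (pow_ne_zero _ (by norm_num)) h2

theorem HasWeakGrad.weakDeriv_ae_eq {U : Set E3} (hU : IsOpen U) {g : E3 → ℝ}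
    {G : Fin 3 → E3 → ℝ} (h : HasWeakGrad U g G) (i : Fin 3) :
    weakDeriv U (Pi.single i 1) g =ᵐ[volume.restrict U] G i :=
  (h.isWeakDeriv i).weakDeriv_ae_eq hU

theorem HasWeakGrad.dirichletForm_eq {U : Set E3} (hU : IsOpen U) {g g' : E3 → ℝ}
    {G G' : Fin 3 → E3 → ℝ} (h : HasWeakGrad U g G) (h' : HasWeakGrad U g' G') :
    dirichletForm U g g' = ∑ i, ∫ x in U, G i x * G' i x := by
  unfold dirichletForm
  refine Finset.sum_congr rfl fun i _ => integral_congr_ae ?_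
  filter_upwards [h.weakDeriv_ae_eq hU i, h'.weakDeriv_ae_eq hU i] with x h1 h2
  rw [h1, h2]

theorem setIntegral_mul_isTestFunction {U V : Set E3} (hUV : U ⊆ V) (hV : MeasurableSet V)
    (g : E3 → ℝ) {φ : E3 → ℝ} (hφ : IsTestFunction U φ) :
    ∫ x in V, g x * φ x = ∫ x in U, g x * φ x := by
  refine setIntegral_eq_of_subset_of_forall_sdiff_eq_zero hV hUV fun x hx => ?_
  simp [hφ.eq_zero hx.2]

theorem HasWeakGrad.mono {U V : Set E3} (hUV : U ⊆ V) (hV : MeasurableSet V) {g : E3 → ℝ}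
    {G : Fin 3 → E3 → ℝ} (h : HasWeakGrad V g G) : HasWeakGrad U g G := by
  refine ⟨h.1.mono_measure (Measure.restrict_mono hUV le_rfl),
    fun i => (h.2.1 i).mono_measure (Measure.restrict_mono hUV le_rfl), fun φ hφ i => ?_⟩
  rw [← setIntegral_mul_isTestFunction hUV hV _ (hφ.partialDeriv i),
    ← setIntegral_mul_isTestFunction hUV hV _ hφ]
  exact h.2.2 φ (hφ.mono hUV) i

theorem HasWeakGrad.sub {U : Set E3} {g g' : E3 → ℝ} {G G' : Fin 3 → E3 → ℝ}
    (h : HasWeakGrad U g G) (h' : HasWeakGrad U g' G') :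
    HasWeakGrad U (fun x => g x - g' x) (fun i x => G i x - G' i x) := by
  refine ⟨h.1.sub h'.1, fun i => (h.2.1 i).sub (h'.2.1 i), fun φ hφ i => ?_⟩
  have hm := hφ.memLp (volume.restrict U)
  have hd := (hφ.partialDeriv i).memLp (volume.restrict U)
  simp only [sub_mul]
  rw [integral_sub (MemLp.integrable_mul_fun h.1 hd) (MemLp.integrable_mul_fun h'.1 hd),
    integral_sub (MemLp.integrable_mul_fun (h.2.1 i) hm) (MemLp.integrable_mul_fun (h'.2.1 i) hm), h.2.2 φ hφ i,
    h'.2.2 φ hφ i]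
  ring

theorem memLp_of_continuous_of_isBounded {U : Set E3} (hU : Bornology.IsBounded U) {φ : E3 → ℝ}
    (hφ : Continuous φ) : MemLp φ 2 (volume.restrict U) := by
  have hc : IsCompact (closure U) := hU.isCompact_closure
  have : MemLp φ 2 (volume.restrict (closure U)) := by
    obtain ⟨C, hC⟩ := hc.exists_bound_of_continuousOn hφ.continuousOn
    have : IsFiniteMeasure (volume.restrict (closure U)) := ⟨by simpa using hc.measure_lt_top⟩
    refine MemLp.of_bound hφ.aestronglyMeasurable C ?_
    exact (ae_restrict_iff' isClosed_closure.measurableSet).2 (Filter.Eventually.of_forall hC)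
  exact this.mono_measure (Measure.restrict_mono subset_closure le_rfl)

theorem integral_mul_partialDeriv {ψ φ : E3 → ℝ} (hψ : ContDiff ℝ ∞ ψ) (hφ : ContDiff ℝ ∞ φ)
    (hc : HasCompactSupport φ) (i : Fin 3) :
    ∫ x, ψ x * partialDeriv i φ x = -∫ x, partialDeriv i ψ x * φ x := by
  have hc' : HasCompactSupport (partialDeriv i φ) :=
    hc.mono' ((subset_tsupport _).trans (tsupport_partialDeriv_subset i φ))
  have c1 := (contDiff_partialDeriv i hψ).continuous
  have c2 := (contDiff_partialDeriv i hφ).continuous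
  exact integral_mul_fderiv_eq_neg_fderiv_mul_of_integrable
    ((c1.mul hφ.continuous).integrable_of_hasCompactSupport hc.mul_left)
    ((hψ.continuous.mul c2).integrable_of_hasCompactSupport hc'.mul_left)
    ((hψ.continuous.mul hφ.continuous).integrable_of_hasCompactSupport hc.mul_left)
    (fun x _ => hψ.differentiable (by simp) x) (fun x _ => hφ.differentiable (by simp) x)

theorem hasWeakGrad_of_contDiff {U : Set E3} (hU : Bornology.IsBounded U)
    {ψ : E3 → ℝ} (hψ : ContDiff ℝ ∞ ψ) : HasWeakGrad U ψ (fun i => partialDeriv i ψ) := by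
  refine ⟨memLp_of_continuous_of_isBounded hU hψ.continuous, fun i =>
    memLp_of_continuous_of_isBounded hU (contDiff_partialDeriv i hψ).continuous, fun φ hφ i => ?_⟩
  have := integral_mul_partialDeriv hψ hφ.1 hφ.2.1 i
  rwa [← setIntegral_univ, ← setIntegral_univ (f := fun x => BrickFEM.partialDeriv i ψ x * φ x),
    setIntegral_mul_isTestFunction (subset_univ U) MeasurableSet.univ _ (hφ.partialDeriv i),
    setIntegral_mul_isTestFunction (subset_univ U) MeasurableSet.univ _ hφ] at this

/-! ### Sobolev functions and the Sobolev norm -/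

theorem mem_multiIndices {m : ℕ} {α : Fin 3 → ℕ} : α ∈ multiIndices m ↔ ∑ i, α i ≤ m := by
  simp [multiIndices]

theorem MemSobolev.isWeakDeriv {U : Set E3} {m : ℕ} {u : E3 → ℝ} (h : MemSobolev U m u)
    {α : Fin 3 → ℕ} (hα : ∑ i, α i ≤ m) : IsWeakDeriv U α u (weakDeriv U α u) := by
  obtain ⟨g, hg⟩ := h.2 α hα
  exact hg.weakDeriv

theorem integral_weakDeriv_sq_le {U : Set E3} {m : ℕ} {u : E3 → ℝ} {α : Fin 3 → ℕ}
    (hα : ∑ i, α i ≤ m) : ∫ x in U, (weakDeriv U α u x) ^ 2 ≤ sobolevNorm U m u ^ 2 := by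
  rw [sobolevNorm, Real.sq_sqrt (Finset.sum_nonneg fun _ _ => integral_nonneg fun _ => sq_nonneg _)]
  exact Finset.single_le_sum (f := fun α => ∫ x in U, (weakDeriv U α u x) ^ 2)
    (fun _ _ => integral_nonneg fun _ => sq_nonneg _) (mem_multiIndices.2 hα)

theorem sobolevNorm_nonneg (U : Set E3) (m : ℕ) (u : E3 → ℝ) : 0 ≤ sobolevNorm U m u :=
  Real.sqrt_nonneg _

theorem IsTestFunction.memSobolev_one {U : Set E3} {φ : E3 → ℝ}
    (h : IsTestFunction U φ) : MemSobolev U 1 φ := by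
  have main : ∀ α : Fin 3 → ℕ, IsTestFunction U (multiDeriv α φ) := by
    intro α
    have it : ∀ (i : Fin 3) (n : ℕ) (ψ : E3 → ℝ), IsTestFunction U ψ →
        IsTestFunction U ((BrickFEM.partialDeriv i)^[n] ψ) := by
      intro i n ψ hψ
      induction n with
      | zero => exact hψ
      | succ n ih => rw [Function.iterate_succ_apply']; exact ih.partialDeriv i
    exact it 0 _ _ (it 1 _ _ (it 2 _ _ h))
  refine ⟨h.memLp _, fun α hα => ?_⟩
  by_cases h0 : α = 0
  · subst h0; exact ⟨φ, isWeakDeriv_zero (h.memLp _)⟩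
  obtain ⟨i, hi⟩ : ∃ i, α i ≠ 0 := by
    by_contra hcon
    push Not at hcon
    exact h0 (funext hcon)
  have hα' : α = Pi.single i 1 := by
    rw [Fin.sum_univ_three] at hα
    funext j
    fin_cases i <;> fin_cases j <;> simp at hi ⊢ <;> omega
  subst hα'
  refine ⟨BrickFEM.partialDeriv i φ, (h.partialDeriv i).memLp _, fun ψ hψ => ?_⟩
  rw [multiDeriv_single]
  have := integral_mul_partialDeriv h.1 hψ.1 hψ.2.1 i
  rw [← setIntegral_univ, ← setIntegral_univ (f := fun x => BrickFEM.partialDeriv i φ x * ψ x),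
    setIntegral_mul_isTestFunction (subset_univ U) MeasurableSet.univ _ (hψ.partialDeriv i),
    setIntegral_mul_isTestFunction (subset_univ U) MeasurableSet.univ _ hψ] at this
  rw [this]
  simp

theorem MemSobolev.hasWeakGrad {U : Set E3} {u : E3 → ℝ} {m : ℕ} (h : MemSobolev U m u)
    (hm : 1 ≤ m) : HasWeakGrad U u (fun i => weakDeriv U (Pi.single i 1) u) :=
  (isWeakDeriv_zero h.1).hasWeakGrad fun i => by
    rw [zero_add]; exact h.isWeakDeriv (by simpa using hm)

theorem IsTestFunction.hasWeakGrad {U : Set E3} {φ : E3 → ℝ}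
    (h : IsTestFunction U φ) : HasWeakGrad U φ (fun i => BrickFEM.partialDeriv i φ) := by
  refine ⟨h.memLp _, fun i => (h.partialDeriv i).memLp _, fun ψ hψ i => ?_⟩
  have := integral_mul_partialDeriv h.1 hψ.1 hψ.2.1 i
  rwa [← setIntegral_univ, ← setIntegral_univ (f := fun x => BrickFEM.partialDeriv i φ x * ψ x),
    setIntegral_mul_isTestFunction (subset_univ U) MeasurableSet.univ _ (hψ.partialDeriv i),
    setIntegral_mul_isTestFunction (subset_univ U) MeasurableSet.univ _ hψ] at this

theorem IsTestFunction.memH10 {U : Set E3} (hU : IsOpen U) {φ : E3 → ℝ}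
    (h : IsTestFunction U φ) : MemH10 U φ := by
  refine ⟨h.memSobolev_one, fun ε hε => ⟨φ, h, ?_⟩⟩
  have hz : ∀ α, weakDeriv U α (φ - φ) =ᵐ[volume.restrict U] 0 := by
    intro α
    apply IsWeakDeriv.weakDeriv_ae_eq hU
    exact ⟨MemLp.zero, fun ψ _ => by simp⟩
  have : sobolevNorm U 1 (φ - φ) = 0 := by
    rw [sobolevNorm, Finset.sum_eq_zero, Real.sqrt_zero]
    intro α _
    rw [integral_congr_ae (g := fun _ => (0:ℝ)), integral_zero]
    filter_upwards [hz α] with x hx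
    rw [hx]
    simp
  rwa [this]

/-- The weak formulation of the Poisson equation, tested with `C_c^∞`: `f = -Δu` almost
everywhere. -/
theorem IsWeakSolution.ae_eq_neg_laplacian {U : Set E3} (hU : IsOpen U) {f u : E3 → ℝ}
    {D1 : Fin 3 → E3 → ℝ} {D2 : Fin 3 → Fin 3 → E3 → ℝ} (hf : MemLp f 2 (volume.restrict U))
    (h1 : HasWeakGrad U u D1) (h2 : ∀ j, HasWeakGrad U (D1 j) (D2 j)) (h : IsWeakSolution U f u) :
    f =ᵐ[volume.restrict U] fun x => -∑ i, D2 i i x := by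
  have hm : MemLp (fun x => -∑ i, D2 i i x) 2 (volume.restrict U) :=
    (memLp_finsetSum _ fun i _ => (h2 i).2.1 i).neg
  refine ae_eq_of_forall_isTestFunction hU hf hm fun φ hφ => ?_
  rw [← h.2 φ (hφ.memH10 hU), h1.dirichletForm_eq hU hφ.hasWeakGrad]
  have e : (fun x => (-∑ i, D2 i i x) * φ x) = fun x => ∑ i, -(D2 i i x * φ x) := by
    funext x
    rw [Finset.sum_neg_distrib, neg_mul, Finset.sum_mul]
  rw [e, integral_finsetSum]
  · refine Finset.sum_congr rfl fun i _ => ?_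
    rw [(h2 i).2.2 φ hφ i, integral_neg]
  · intro i _
    exact (((h2 i).2.1 i).integrable_mul (hφ.memLp _)).neg

/-! ### Smooth dependence of integrals on parameters -/

theorem hasFDerivAt_integral_of_contDiff {E F : Type} [NormedAddCommGroup E] [NormedSpace ℝ E]
    [FiniteDimensional ℝ E] [NormedAddCommGroup F] [NormedSpace ℝ F] [CompleteSpace F]
    {f : E → ℝ → F} (hf : ContDiff ℝ ∞ (Function.uncurry f)) (a b : ℝ) (x : E) :
    HasFDerivAt (fun x => ∫ t in a..b, f x t) (∫ t in a..b, fderiv ℝ (fun y => f y t) x) x := by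
  have hd : Continuous (Function.uncurry fun x t => fderiv ℝ (fun y => f y t) x) := by
    have : ContDiff ℝ ∞ fun p : E × ℝ => fderiv ℝ (fun y => f y p.2) p.1 := by
      refine ContDiff.fderiv (m := ∞) (n := ∞) (f := fun (p : E × ℝ) y => f y p.2) ?_ contDiff_fst
        (by simp)
      exact hf.comp (contDiff_snd.prodMk (contDiff_snd.comp contDiff_fst))
    exact this.continuous
  -- The derivative is jointly continuous, hence bounded on a compact neighbourhood times the
  -- interval; this constant is the dominating function.
  have hc : IsCompact (Metric.closedBall x 1 ×ˢ uIcc a b) :=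
    (ProperSpace.isCompact_closedBall x 1).prod isCompact_uIcc
  obtain ⟨C, hC⟩ := hc.exists_bound_of_continuousOn hd.continuousOn
  have hx : ∀ y, Continuous (f y) := fun y =>
    hf.continuous.comp (Continuous.prodMk_right y)
  refine (intervalIntegral.hasFDerivAt_integral_of_dominated_of_fderiv_le
    (Metric.closedBall_mem_nhds x one_pos) (F := f) (F' := fun x t => fderiv ℝ (fun y => f y t) x)
    (bound := fun _ => C) (Filter.Eventually.of_forall fun y => (hx y).aestronglyMeasurable)
    ((hx x).intervalIntegrable a b) ?_ ?_ intervalIntegrable_const ?_)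
  · have : Continuous fun t => fderiv ℝ (fun y => f y t) x :=
      hd.comp (by fun_prop : Continuous fun t : ℝ => (x, t))
    exact this.aestronglyMeasurable
  · refine Filter.Eventually.of_forall fun t ht y hy => ?_
    exact hC (y, t) ⟨hy, uIoc_subset_uIcc ht⟩
  · refine Filter.Eventually.of_forall fun t _ y _ => ?_
    have : ContDiff ℝ ∞ fun y => f y t := hf.comp (contDiff_id.prodMk contDiff_const)
    exact (this.differentiable (by simp) y).hasFDerivAt

theorem contDiff_integral_param {E : Type} [NormedAddCommGroup E] [NormedSpace ℝ E]
    [FiniteDimensional ℝ E] {F : Type} [NormedAddCommGroup F] [NormedSpace ℝ F] [CompleteSpace F]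
    {f : E → ℝ → F} (hf : ContDiff ℝ ∞ (Function.uncurry f)) (a b : ℝ) :
    ContDiff ℝ ∞ fun x => ∫ t in a..b, f x t := by
  rw [contDiff_infty]
  intro n
  -- The derivative is again a parameter integral, but with values in `E →L[ℝ] F`, so the target
  -- space has to vary in the induction.
  induction n generalizing F with
  | zero =>
    refine contDiff_zero.2 (continuous_iff_continuousAt.2 fun x => ?_)
    exact (hasFDerivAt_integral_of_contDiff hf a b x).continuousAt
  | succ n ih =>
    refine contDiff_succ_iff_hasFDerivAt.2 ⟨_, ?_, hasFDerivAt_integral_of_contDiff hf a b⟩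
    apply ih
    refine ContDiff.fderiv (m := ∞) (n := ∞) (f := fun (p : E × ℝ) y => f y p.2) ?_ contDiff_fst
        (by simp)
    exact hf.comp (contDiff_snd.prodMk (contDiff_snd.comp contDiff_fst))

/-! ### Integration along coordinate lines -/

/-- The point `x` with its coordinate `i` replaced by `t`. -/
def setCoord (i : Fin 3) (t : ℝ) (x : E3) : E3 := x + (t - x i) • EuclideanSpace.single i (1 : ℝ)

theorem setCoord_same (i : Fin 3) (t : ℝ) (x : E3) : setCoord i t x i = t := by
  simp [setCoord]

theorem setCoord_of_ne {i j : Fin 3} (h : j ≠ i) (t : ℝ) (x : E3) : setCoord i t x j = x j := by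
  simp [setCoord, h]

theorem setCoord_self (i : Fin 3) (x : E3) : setCoord i (x i) x = x := by simp [setCoord]

theorem setCoord_add_smul (i : Fin 3) (t s : ℝ) (x : E3) :
    setCoord i t (x + s • EuclideanSpace.single i (1 : ℝ)) = setCoord i t x := by
  ext j
  by_cases h : j = i
  · subst h; simp [setCoord]
  · simp [setCoord, h]

theorem contDiff_coord (i : Fin 3) : ContDiff ℝ ∞ fun x : E3 => x i :=
  (EuclideanSpace.proj i : E3 →L[ℝ] ℝ).contDiff

theorem continuous_coord (i : Fin 3) : Continuous fun x : E3 => x i := (contDiff_coord i).continuous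

theorem contDiff_setCoord (i : Fin 3) : ContDiff ℝ ∞ fun p : E3 × ℝ => setCoord i p.2 p.1 := by
  unfold setCoord
  exact contDiff_fst.add ((contDiff_snd.sub ((contDiff_coord i).comp contDiff_fst)).smul
    contDiff_const)

theorem continuous_setCoord (i : Fin 3) (x : E3) : Continuous fun t => setCoord i t x :=
  (contDiff_setCoord i).continuous.comp (by fun_prop : Continuous fun t : ℝ => (x, t))

/-- The integral over the line through `x` in direction `i`, within the cube. -/
def lineInt (i : Fin 3) (η : E3 → ℝ) (x : E3) : ℝ := ∫ t in (-1)..1, η (setCoord i t x)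

/-- The integral over the part of this line before `x`. -/
def linePrim (i : Fin 3) (η : E3 → ℝ) (x : E3) : ℝ := ∫ t in (-1)..(x i), η (setCoord i t x)

theorem contDiff_lineInt (i : Fin 3) {η : E3 → ℝ} (h : ContDiff ℝ ∞ η) :
    ContDiff ℝ ∞ (lineInt i η) :=
  contDiff_integral_param (f := fun x t => η (setCoord i t x)) (h.comp (contDiff_setCoord i)) _ _

theorem contDiff_linePrim (i : Fin 3) {η : E3 → ℝ} (h : ContDiff ℝ ∞ η) :
    ContDiff ℝ ∞ (linePrim i η) := by
  -- The substitution t = (x i + 1) s − 1 makes the limits of integration independent of x.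
  have e : linePrim i η = fun x => (x i + 1) *
      ∫ s in (0 : ℝ)..1, η (setCoord i ((x i + 1) * s + (-1)) x) := by
    funext x
    have := intervalIntegral.smul_integral_comp_mul_add (a := 0) (b := 1)
      (fun t => η (setCoord i t x)) (x i + 1) (-1)
    simp only [smul_eq_mul] at this
    rw [this, linePrim]
    simp
  have h0 : ContDiff ℝ ∞ fun p : E3 × ℝ => p.1 i := (contDiff_coord i).comp contDiff_fst
  have h1 : ContDiff ℝ ∞ fun p : E3 × ℝ => (p.1 i + 1) * p.2 + (-1) :=
    ((h0.add contDiff_const).mul contDiff_snd).add contDiff_const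
  have h2 : ContDiff ℝ ∞ fun p : E3 × ℝ => (p.1, (p.1 i + 1) * p.2 + (-1)) :=
    contDiff_fst.prodMk h1
  have h3 : ContDiff ℝ ∞ fun p : E3 × ℝ => setCoord i ((p.1 i + 1) * p.2 + (-1)) p.1 :=
    (contDiff_setCoord i).comp h2
  have h4 := contDiff_integral_param (f := fun x s => η (setCoord i ((x i + 1) * s + (-1)) x))
    (h.comp h3) 0 1
  have h5 : ContDiff ℝ ∞ fun x : E3 => x i + 1 := (contDiff_coord i).add contDiff_const
  rw [e]
  exact h5.mul h4

theorem partialDeriv_eq_of_hasDerivAt {φ : E3 → ℝ} (hφ : ContDiff ℝ ∞ φ) {i : Fin 3} {x : E3}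
    {d : ℝ} (h : HasDerivAt (fun s : ℝ => φ (x + s • EuclideanSpace.single i (1 : ℝ))) d 0) :
    partialDeriv i φ x = d := by
  have h1 : HasFDerivAt φ (fderiv ℝ φ x) (x + (0 : ℝ) • EuclideanSpace.single i (1 : ℝ)) := by
    simpa using (hφ.differentiable (by simp) x).hasFDerivAt
  have h2 : HasDerivAt (fun s : ℝ => x + s • EuclideanSpace.single i (1 : ℝ))
      (EuclideanSpace.single i (1 : ℝ)) 0 := by
    simpa using ((hasDerivAt_id (0 : ℝ)).smul_const (EuclideanSpace.single i (1 : ℝ))).const_add x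
  exact (h1.comp_hasDerivAt 0 h2).unique h

theorem partialDeriv_lineInt (i : Fin 3) {η : E3 → ℝ} (h : ContDiff ℝ ∞ η) (x : E3) :
    partialDeriv i (lineInt i η) x = 0 := by
  refine partialDeriv_eq_of_hasDerivAt (contDiff_lineInt i h) ?_
  simp only [lineInt, setCoord_add_smul]
  exact hasDerivAt_const _ _

theorem partialDeriv_linePrim (i : Fin 3) {η : E3 → ℝ} (h : ContDiff ℝ ∞ η) (x : E3) :
    partialDeriv i (linePrim i η) x = η x := by
  refine partialDeriv_eq_of_hasDerivAt (contDiff_linePrim i h) ?_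
  simp only [linePrim, setCoord_add_smul]
  have hc : Continuous fun t => η (setCoord i t x) := h.continuous.comp (continuous_setCoord i x)
  have h1 := (hc.integral_hasStrictDerivAt (-1) (x i)).hasDerivAt
  have h2 : HasDerivAt (fun s : ℝ => x i + s) 1 0 := by
    simpa using (hasDerivAt_id (0 : ℝ)).const_add (x i)
  have h3 : HasDerivAt (fun u => ∫ t in (-1)..u, η (setCoord i t x)) (η (setCoord i (x i) x))
      (x i + 0) := by simpa using h1
  have := h3.comp (0 : ℝ) h2
  simpa [Function.comp_def, setCoord_self] using this

theorem partialDeriv_mul {φ ψ : E3 → ℝ} (hφ : ContDiff ℝ ∞ φ) (hψ : ContDiff ℝ ∞ ψ) (i : Fin 3)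
    (x : E3) : partialDeriv i (fun x => φ x * ψ x) x
      = partialDeriv i φ x * ψ x + φ x * partialDeriv i ψ x := by
  unfold partialDeriv
  rw [fderiv_fun_mul (hφ.differentiable (by simp) x) (hψ.differentiable (by simp) x)]
  simp
  ring

theorem partialDeriv_sub {φ ψ : E3 → ℝ} (hφ : ContDiff ℝ ∞ φ) (hψ : ContDiff ℝ ∞ ψ) (i : Fin 3)
    (x : E3) : partialDeriv i (fun x => φ x - ψ x) x
      = partialDeriv i φ x - partialDeriv i ψ x := by
  unfold partialDeriv
  rw [fderiv_fun_sub (hφ.differentiable (by simp) x) (hψ.differentiable (by simp) x)]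
  simp

theorem partialDeriv_comp_coord {Θ : ℝ → ℝ} (hΘ : ContDiff ℝ ∞ Θ) (i j : Fin 3) (x : E3) :
    partialDeriv i (fun x => Θ (x j)) x = if i = j then deriv Θ (x j) else 0 := by
  refine partialDeriv_eq_of_hasDerivAt (hΘ.comp (contDiff_coord j)) ?_
  by_cases h : i = j
  · subst h
    have h2 : HasDerivAt (fun s : ℝ => x i + s) 1 0 := by
      simpa using (hasDerivAt_id (0 : ℝ)).const_add (x i)
    have h3 : HasDerivAt Θ (deriv Θ (x i)) (x i + 0) := by
      simpa using (hΘ.differentiable (by simp) (x i)).hasDerivAt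
    simpa [Function.comp_def] using h3.comp (0 : ℝ) h2
  · have : ∀ s : ℝ, (x + s • EuclideanSpace.single i (1 : ℝ)) j = x j := by
      intro s; simp [Ne.symm h]
    rw [if_neg h]
    exact (hasDerivAt_const (0 : ℝ) (Θ (x j))).congr_of_eventuallyEq
      (Filter.Eventually.of_forall fun s => congrArg Θ (this s))

/-- The line integral spread over the line by the weight `Θ'`. -/
def lineMean (Θ : ℝ → ℝ) (i : Fin 3) (η : E3 → ℝ) (x : E3) : ℝ :=
  deriv Θ (x i) * lineInt i η x

/-- The primitive along lines of `η - lineMean Θ i η`. -/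
def lineLift (Θ : ℝ → ℝ) (i : Fin 3) (η : E3 → ℝ) (x : E3) : ℝ :=
  linePrim i η x - Θ (x i) * lineInt i η x

theorem contDiff_lineMean {Θ : ℝ → ℝ} (hΘ : ContDiff ℝ ∞ Θ) (i : Fin 3) {η : E3 → ℝ}
    (hη : ContDiff ℝ ∞ η) : ContDiff ℝ ∞ (lineMean Θ i η) :=
  ((contDiff_infty_iff_deriv.1 hΘ).2.comp (contDiff_coord i)).mul (contDiff_lineInt i hη)

theorem contDiff_lineLift {Θ : ℝ → ℝ} (hΘ : ContDiff ℝ ∞ Θ) (i : Fin 3) {η : E3 → ℝ}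
    (hη : ContDiff ℝ ∞ η) : ContDiff ℝ ∞ (lineLift Θ i η) :=
  (contDiff_linePrim i hη).sub ((hΘ.comp (contDiff_coord i)).mul (contDiff_lineInt i hη))

/-- The splitting η = ∂ᵢ(lift) + mean on which all duality arguments rest. With Θ = `smoothStep`
both parts stay compactly supported in the cube; with Θ constant the mean vanishes and the lift is a
pure primitive. -/
theorem partialDeriv_lineLift {Θ : ℝ → ℝ} (hΘ : ContDiff ℝ ∞ Θ) (i : Fin 3) {η : E3 → ℝ}
    (hη : ContDiff ℝ ∞ η) (x : E3) :
    partialDeriv i (lineLift Θ i η) x = η x - lineMean Θ i η x := by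
  have h1 : ContDiff ℝ ∞ fun x : E3 => Θ (x i) := hΘ.comp (contDiff_coord i)
  unfold lineLift
  rw [partialDeriv_sub (contDiff_linePrim i hη) (h1.mul (contDiff_lineInt i hη)),
    partialDeriv_mul h1 (contDiff_lineInt i hη), partialDeriv_linePrim i hη,
    partialDeriv_lineInt i hη, partialDeriv_comp_coord hΘ, if_pos rfl, lineMean]
  ring

/-! ### The open reference cube and its test functions -/

/-- The open cube `(-1, 1)³`. -/
def openCube : Set E3 := {x | ∀ i, |x i| < 1}

theorem isOpen_openCube : IsOpen openCube := by
  have : openCube = ⋂ i, {x : E3 | |x i| < 1} := by ext x; simp [openCube]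
  rw [this]
  exact isOpen_iInter_of_finite fun i => isOpen_lt (continuous_coord i).abs continuous_const

theorem isClosed_refCube : IsClosed refCube := by
  have : refCube = ⋂ i, {x : E3 | |x i| ≤ 1} := by ext x; simp [refCube]
  rw [this]
  exact isClosed_iInter fun i => isClosed_le (continuous_coord i).abs continuous_const

theorem openCube_subset_refCube : openCube ⊆ refCube := fun _ hx i => (hx i).le

theorem isBounded_refCube : Bornology.IsBounded refCube := by
  refine (Metric.isBounded_closedBall (x := (0 : E3)) (r := 2)).subset fun x hx => ?_
  rw [mem_closedBall_zero_iff, EuclideanSpace.norm_eq]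
  refine Real.sqrt_le_iff.2 ⟨by norm_num, ?_⟩
  have h : ∀ i, ‖x i‖ ^ 2 ≤ 1 := fun i => by
    have := hx i
    rw [Real.norm_eq_abs]
    nlinarith [abs_nonneg (x i)]
  rw [Fin.sum_univ_three]
  linarith [h 0, h 1, h 2]

theorem isCompact_refCube : IsCompact refCube :=
  Metric.isCompact_of_isClosed_isBounded isClosed_refCube isBounded_refCube

theorem interior_refCube : interior refCube = openCube := by
  apply subset_antisymm
  · intro x hx i
    obtain ⟨ε, hε, hb⟩ := Metric.mem_nhds_iff.1 (mem_interior_iff_mem_nhds.1 hx)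
    have key : ∀ s : ℝ, |s| < ε → |x i + s| ≤ 1 := by
      intro s hs
      have : x + s • EuclideanSpace.single i (1 : ℝ) ∈ Metric.ball x ε := by
        simp [Metric.mem_ball, dist_eq_norm, norm_smul, hs]
      simpa using hb this i
    have h1 := abs_le.1 (key (ε / 2) (by rw [abs_of_pos (by positivity)]; linarith))
    have h2 := abs_le.1 (key (-(ε / 2)) (by rw [abs_neg, abs_of_pos (by positivity)]; linarith))
    exact abs_lt.2 ⟨by linarith, by linarith⟩
  · exact interior_maximal openCube_subset_refCube isOpen_openCube

/-- A function vanishing off the cube `[-r, r]³`. -/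
def VanishesOff (r : ℝ) (η : E3 → ℝ) : Prop := ∀ x : E3, (∃ j, r < |x j|) → η x = 0

/-- The lower bound 1/2 on r is imposed because `smoothStep` is constant outside [-1/2, 1/2]: its
derivative then vanishes wherever a coordinate exceeds r in absolute value. -/
theorem IsTestFunction.exists_vanishesOff {η : E3 → ℝ} (h : IsTestFunction openCube η) :
    ∃ r, 1 / 2 ≤ r ∧ r < 1 ∧ VanishesOff r η := by
  have key : ∀ j, ∃ r, 1 / 2 ≤ r ∧ r < 1 ∧ ∀ x ∈ tsupport η, |x j| ≤ r := by
    intro j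
    rcases (tsupport η).eq_empty_or_nonempty with he | hne
    · exact ⟨1 / 2, le_rfl, by norm_num, by simp [he]⟩
    · obtain ⟨x, hx, hmax⟩ := h.2.1.isCompact.exists_isMaxOn hne
        (continuous_coord j).abs.continuousOn
      exact ⟨max (1 / 2) |x j|, le_max_left _ _, max_lt (by norm_num) (h.2.2 hx j),
        fun y hy => le_max_of_le_right (hmax hy)⟩
  choose r h1 h2 h3 using key
  refine ⟨max (r 0) (max (r 1) (r 2)), le_max_of_le_left (h1 0),
    max_lt (h2 0) (max_lt (h2 1) (h2 2)), fun x ⟨j, hj⟩ => ?_⟩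
  by_contra hx
  have := h3 j x (subset_tsupport _ hx)
  have hr : r j ≤ max (r 0) (max (r 1) (r 2)) := by
    fin_cases j <;> simp
  linarith

theorem VanishesOff.isTestFunction {η : E3 → ℝ} (hη : ContDiff ℝ ∞ η) {r : ℝ} (hr : r < 1)
    (h : VanishesOff r η) : IsTestFunction openCube η := by
  have hs : tsupport η ⊆ {x : E3 | ∀ j, |x j| ≤ r} := by
    apply closure_minimal
    · intro x hx j
      by_contra hj
      exact hx (h x ⟨j, not_le.1 hj⟩)
    · have : {x : E3 | ∀ j, |x j| ≤ r} = ⋂ j, {x : E3 | |x j| ≤ r} := by ext; simp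
      rw [this]
      exact isClosed_iInter fun j => isClosed_le (continuous_coord j).abs continuous_const
  have hs' : tsupport η ⊆ openCube := hs.trans fun x hx j => (hx j).trans_lt hr
  exact ⟨hη, isCompact_refCube.of_isClosed_subset (isClosed_tsupport η)
    (hs'.trans openCube_subset_refCube), hs'⟩

/-- A smooth step from `0` on `(-∞, -1/2]` to `1` on `[1/2, ∞)`. -/
def smoothStep (t : ℝ) : ℝ := Real.smoothTransition (t + 1 / 2)

theorem contDiff_smoothStep : ContDiff ℝ ∞ smoothStep :=
  Real.smoothTransition.contDiff.comp (contDiff_id.add contDiff_const)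

theorem smoothStep_of_le {t : ℝ} (h : t ≤ -(1 / 2)) : smoothStep t = 0 :=
  Real.smoothTransition.zero_of_nonpos (by linarith)

theorem smoothStep_of_ge {t : ℝ} (h : 1 / 2 ≤ t) : smoothStep t = 1 :=
  Real.smoothTransition.one_of_one_le (by linarith)

theorem smoothStep_nonneg (t : ℝ) : 0 ≤ smoothStep t := Real.smoothTransition.nonneg _

theorem smoothStep_le_one (t : ℝ) : smoothStep t ≤ 1 := Real.smoothTransition.le_one _

theorem deriv_smoothStep {t : ℝ} (h : 1 / 2 < |t|) : deriv smoothStep t = 0 := by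
  rcases lt_abs.1 h with h | h
  · have : smoothStep =ᶠ[nhds t] fun _ => 1 := by
      filter_upwards [lt_mem_nhds h] with s hs using smoothStep_of_ge hs.le
    rw [this.deriv_eq, deriv_const]
  · have : smoothStep =ᶠ[nhds t] fun _ => 0 := by
      filter_upwards [gt_mem_nhds (show t < -(1 / 2) by linarith)] with s hs using
        smoothStep_of_le hs.le
    rw [this.deriv_eq, deriv_const]

/-- Requiring the bound to be at least 2 lets the same constant serve for `lineLift`, a difference
of two terms each dominated by the line integral. -/
theorem exists_abs_deriv_smoothStep_le : ∃ C : ℝ, 2 ≤ C ∧ ∀ t, |deriv smoothStep t| ≤ C := by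
  have hc : Continuous (deriv smoothStep) := (contDiff_infty_iff_deriv.1 contDiff_smoothStep).2.continuous
  obtain ⟨C, hC⟩ := (isCompact_Icc (a := (-(1 / 2) : ℝ)) (b := 1 / 2)).exists_bound_of_continuousOn
    hc.continuousOn
  refine ⟨max 2 C, le_max_left _ _, fun t => ?_⟩
  by_cases h : 1 / 2 < |t|
  · rw [deriv_smoothStep h, abs_zero]; positivity
  · exact le_max_of_le_right (hC t (abs_le.1 (not_lt.1 h)))

/-- A common bound for the operators `lineMean smoothStep` and `lineLift smoothStep`. -/
def lineConst : ℝ := exists_abs_deriv_smoothStep_le.choose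

theorem two_le_lineConst : 2 ≤ lineConst := exists_abs_deriv_smoothStep_le.choose_spec.1

theorem abs_deriv_smoothStep_le (t : ℝ) : |deriv smoothStep t| ≤ lineConst :=
  exists_abs_deriv_smoothStep_le.choose_spec.2 t

theorem lineInt_eq_zero {η : E3 → ℝ} {r : ℝ} (h : VanishesOff r η) {i j : Fin 3} (hij : j ≠ i)
    {x : E3} (hx : r < |x j|) : lineInt i η x = 0 := by
  have : ∀ t, η (setCoord i t x) = 0 := fun t => h _ ⟨j, by rwa [setCoord_of_ne hij]⟩
  simp [lineInt, this]

theorem linePrim_eq_zero {η : E3 → ℝ} {r : ℝ} (h : VanishesOff r η) {i j : Fin 3} (hij : j ≠ i)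
    {x : E3} (hx : r < |x j|) : linePrim i η x = 0 := by
  have : ∀ t, η (setCoord i t x) = 0 := fun t => h _ ⟨j, by rwa [setCoord_of_ne hij]⟩
  simp [linePrim, this]

theorem linePrim_of_lt {η : E3 → ℝ} {r : ℝ} (hr : r < 1) (h : VanishesOff r η) {i : Fin 3}
    {x : E3} (hx : x i < -r) : linePrim i η x = 0 := by
  rw [linePrim, intervalIntegral.integral_congr (g := fun _ => (0 : ℝ)), intervalIntegral.integral_zero]
  intro t ht
  refine h _ ⟨i, ?_⟩
  rw [setCoord_same]
  have : t ≤ max (-1) (x i) := ht.2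
  exact lt_abs.2 (Or.inr (by linarith [max_lt (by linarith : (-1 : ℝ) < -r) hx]))

theorem linePrim_of_gt {η : E3 → ℝ} {r : ℝ} (hr : r < 1) (hη : Continuous η)
    (h : VanishesOff r η) {i : Fin 3}
    {x : E3} (hx : r < x i) : linePrim i η x = lineInt i η x := by
  have hc : Continuous fun t => η (setCoord i t x) := hη.comp (continuous_setCoord i x)
  have h0 : ∫ t in (x i)..1, η (setCoord i t x) = 0 := by
    rw [intervalIntegral.integral_congr (g := fun _ => (0 : ℝ)), intervalIntegral.integral_zero]
    intro t ht
    refine h _ ⟨i, ?_⟩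
    rw [setCoord_same]
    have : min (x i) 1 ≤ t := ht.1
    exact lt_abs.2 (Or.inl (by linarith [lt_min hx hr]))
  rw [linePrim, lineInt, ← intervalIntegral.integral_add_adjacent_intervals
    (hc.intervalIntegrable (-1) (x i)) (hc.intervalIntegrable (x i) 1), h0, add_zero]

theorem vanishesOff_lineMean {η : E3 → ℝ} {r : ℝ} (hr : 1 / 2 ≤ r) (h : VanishesOff r η)
    (i : Fin 3) : VanishesOff r (lineMean smoothStep i η) := by
  rintro x ⟨j, hj⟩
  unfold lineMean
  by_cases hij : j = i
  · subst hij; rw [deriv_smoothStep (by linarith), zero_mul]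
  · rw [lineInt_eq_zero h hij hj, mul_zero]

/-- In direction i, before −r the primitive and `smoothStep` both vanish; beyond r the primitive has
reached the full line integral and `smoothStep` is 1. The subtraction in `lineLift` is designed for
this cancellation. -/
theorem vanishesOff_lineLift {η : E3 → ℝ} (hη : Continuous η) {r : ℝ} (hr : 1 / 2 ≤ r)
    (hr1 : r < 1) (h : VanishesOff r η) (i : Fin 3) :
    VanishesOff r (lineLift smoothStep i η) := by
  rintro x ⟨j, hj⟩
  unfold lineLift
  by_cases hij : j = i
  · subst hij
    rcases lt_abs.1 hj with hj | hj
    · rw [linePrim_of_gt hr1 hη h hj, smoothStep_of_ge (by linarith), one_mul, sub_self]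
    · rw [linePrim_of_lt hr1 h (by linarith), smoothStep_of_le (by linarith), zero_mul, sub_self]
  · rw [linePrim_eq_zero h hij hj, lineInt_eq_zero h hij hj, mul_zero, sub_self]

theorem IsTestFunction.lineMean {η : E3 → ℝ} (h : IsTestFunction openCube η) (i : Fin 3) :
    IsTestFunction openCube (lineMean smoothStep i η) := by
  obtain ⟨r, h1, h2, h3⟩ := h.exists_vanishesOff
  exact (vanishesOff_lineMean h1 h3 i).isTestFunction
    (contDiff_lineMean contDiff_smoothStep i h.1) h2

theorem IsTestFunction.lineLift {η : E3 → ℝ} (h : IsTestFunction openCube η) (i : Fin 3) :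
    IsTestFunction openCube (lineLift smoothStep i η) := by
  obtain ⟨r, h1, h2, h3⟩ := h.exists_vanishesOff
  exact (vanishesOff_lineLift h.1.continuous h1 h2 h3 i).isTestFunction
    (contDiff_lineLift contDiff_smoothStep i h.1) h2

/-! ### Bounds -/

/-- The integral along the coordinate line through `x`, for nonnegative functions. -/
def lineLInt (i : Fin 3) (F : E3 → ENNReal) (x : E3) : ENNReal :=
  ∫⁻ t in Ioo (-1 : ℝ) 1, F (setCoord i t x)

theorem lineLInt_mono (i : Fin 3) {F G : E3 → ENNReal} (h : ∀ x, F x ≤ G x) (x : E3) :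
    lineLInt i F x ≤ lineLInt i G x := lintegral_mono fun _ => h _

theorem lineLInt_const_mul (i : Fin 3) {c : ENNReal} (hc : c ≠ ⊤) (F : E3 → ENNReal) (x : E3) :
    lineLInt i (fun x => c * F x) x = c * lineLInt i F x := lintegral_const_mul' _ _ hc

theorem enorm_lineInt_le (i : Fin 3) (η : E3 → ℝ) (x : E3) :
    ‖lineInt i η x‖ₑ ≤ lineLInt i (fun x => ‖η x‖ₑ) x := by
  rw [lineInt, intervalIntegral.integral_of_le (by norm_num), lineLInt,
    restrict_Ioo_eq_restrict_Ioc]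
  exact enorm_integral_le_lintegral_enorm _

theorem enorm_linePrim_le (i : Fin 3) (η : E3 → ℝ) {x : E3} (hx : |x i| ≤ 1) :
    ‖linePrim i η x‖ₑ ≤ lineLInt i (fun x => ‖η x‖ₑ) x := by
  rw [linePrim, intervalIntegral.integral_of_le (abs_le.1 hx).1, lineLInt,
    restrict_Ioo_eq_restrict_Ioc]
  exact (enorm_integral_le_lintegral_enorm _).trans
    (lintegral_mono_set (Ioc_subset_Ioc_right (abs_le.1 hx).2))

theorem enorm_lineMean_le (i : Fin 3) (η : E3 → ℝ) (x : E3) :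
    ‖lineMean smoothStep i η x‖ₑ
      ≤ ENNReal.ofReal lineConst * lineLInt i (fun x => ‖η x‖ₑ) x := by
  rw [lineMean, enorm_mul]
  refine mul_le_mul' ?_ (enorm_lineInt_le i η x)
  rw [Real.enorm_eq_ofReal_abs]
  exact ENNReal.ofReal_le_ofReal (abs_deriv_smoothStep_le _)

theorem enorm_lineLift_le {η : E3 → ℝ} (h : IsTestFunction openCube η) (i : Fin 3) (x : E3) :
    ‖lineLift smoothStep i η x‖ₑ
      ≤ ENNReal.ofReal lineConst * lineLInt i (fun x => ‖η x‖ₑ) x := by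
  by_cases hx : |x i| ≤ 1
  · have h1 : ‖lineLift smoothStep i η x‖ₑ ≤ 2 * lineLInt i (fun x => ‖η x‖ₑ) x := by
      rw [lineLift, two_mul]
      refine (enorm_sub_le).trans (add_le_add (enorm_linePrim_le i η hx) ?_)
      rw [enorm_mul]
      refine (mul_le_mul' (b := 1) ?_ (enorm_lineInt_le i η x)).trans (by rw [one_mul])
      rw [Real.enorm_eq_ofReal_abs, abs_of_nonneg (smoothStep_nonneg _)]
      exact (ENNReal.ofReal_le_ofReal (smoothStep_le_one _)).trans (by simp)
    refine h1.trans (mul_le_mul' ?_ le_rfl)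
    have := ENNReal.ofReal_le_ofReal two_le_lineConst
    simpa using this
  · have : lineLift smoothStep i η x = 0 :=
      (h.lineLift i).eq_zero fun hx' => hx (hx' i).le
    simp [this]

theorem lineLInt_toLp (i : Fin 3) (F : E3 → ENNReal) (y : Fin 3 → ℝ) :
    lineLInt i F (WithLp.toLp 2 y) = lmarginal (fun _ : Fin 3 => volume.restrict (Ioo (-1 : ℝ) 1))
      {i} (fun y => F (WithLp.toLp 2 y)) y := by
  rw [lmarginal_singleton, lineLInt]
  refine lintegral_congr fun t => ?_
  congr 1
  ext j
  by_cases h : j = i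
  · subst h; simp [setCoord]
  · simp [setCoord, h]

theorem setLIntegral_openCube {F : E3 → ENNReal} (hF : Measurable F) :
    ∫⁻ x in openCube, F x = ∫⁻ y, F (WithLp.toLp 2 y)
      ∂(Measure.pi fun _ : Fin 3 => volume.restrict (Ioo (-1 : ℝ) 1)) := by
  rw [← (PiLp.volume_preserving_toLp (Fin 3)).setLIntegral_comp_preimage
    isOpen_openCube.measurableSet hF, ← Measure.restrict_pi_pi, ← volume_pi]
  congr 2
  ext y
  simp [openCube, abs_lt]

theorem measurable_lineLInt (i : Fin 3) {F : E3 → ENNReal} (hF : Measurable F) :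
    Measurable (lineLInt i F) := by
  have h : Measurable fun p : E3 × ℝ => F (setCoord i p.2 p.1) :=
    hF.comp (contDiff_setCoord i).continuous.measurable
  exact h.lintegral_prod_right'

/-- Tonelli: after integrating along all three directions nothing depends on the starting point any
more. -/
theorem lineLInt_lineLInt_lineLInt {F : E3 → ENNReal} (hF : Measurable F) (x : E3) :
    lineLInt 0 (lineLInt 1 (lineLInt 2 F)) x = ∫⁻ y in openCube, F y := by
  have hm : Measurable fun y : Fin 3 → ℝ => F (WithLp.toLp 2 y) :=
    hF.comp (PiLp.volume_preserving_toLp (Fin 3)).measurable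
  rw [setLIntegral_openCube hF, ← WithLp.toLp_ofLp (p := 2) x, lineLInt_toLp,
    lintegral_eq_lmarginal_univ x.ofLp]
  have e : (Finset.univ : Finset (Fin 3)) = {0} ∪ ({1} ∪ {2}) := by decide
  rw [e, lmarginal_union _ _ hm (by decide), lmarginal_union _ _ hm (by decide)]
  congr 1
  funext y
  rw [lineLInt_toLp]
  congr 1
  funext z
  rw [lineLInt_toLp]

theorem sq_setLIntegral_Ioo_le {f : ℝ → ENNReal} (hf : Measurable f) :
    (∫⁻ t in Ioo (-1 : ℝ) 1, f t) ^ 2 ≤ 2 * ∫⁻ t in Ioo (-1 : ℝ) 1, f t ^ 2 := by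
  have h := ENNReal.lintegral_mul_le_Lp_mul_Lq (volume.restrict (Ioo (-1 : ℝ) 1))
    (Real.HolderConjugate.two_two) (f := f) (g := fun _ => 1) hf.aemeasurable aemeasurable_const
  simp only [Pi.mul_apply, mul_one, ENNReal.one_rpow, lintegral_const, one_mul,
    Measure.restrict_apply MeasurableSet.univ, univ_inter, Real.volume_Ioo] at h
  have h2 := pow_le_pow_left' h 2
  rw [mul_pow, ← ENNReal.rpow_natCast, ← ENNReal.rpow_natCast, ← ENNReal.rpow_natCast,
    ← ENNReal.rpow_mul, ← ENNReal.rpow_mul] at h2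
  norm_num at h2
  rw [mul_comm]
  exact h2

/-- Cauchy–Schwarz on a segment of length 2 gives one factor 2; the line integral is constant along
direction i, and integrating it over that segment gives the other. -/
theorem setLIntegral_sq_lineLInt_le (i : Fin 3) {F : E3 → ENNReal} (hF : Measurable F) :
    ∫⁻ x in openCube, lineLInt i F x ^ 2 ≤ 4 * ∫⁻ x in openCube, F x ^ 2 := by
  rw [← lintegral_const_mul _ (hF.pow_const 2), setLIntegral_openCube
    ((measurable_lineLInt i hF).pow_const 2), setLIntegral_openCube ((hF.pow_const 2).const_mul 4)]
  have mt := (PiLp.volume_preserving_toLp (Fin 3)).measurable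
  refine lintegral_le_of_lmarginal_le {i} (((measurable_lineLInt i hF).pow_const 2).comp mt)
    (((hF.pow_const 2).const_mul 4).comp mt) fun y => ?_
  rw [← lineLInt_toLp i (fun x => lineLInt i F x ^ 2), ← lineLInt_toLp i (fun x => 4 * F x ^ 2),
    lineLInt_const_mul i (by norm_num)]
  set x : E3 := WithLp.toLp 2 y
  have e : ∀ t, lineLInt i F (setCoord i t x) = lineLInt i F x := by
    intro t
    unfold lineLInt
    congr 1
    funext s
    congr 1
    ext j
    by_cases h : j = i
    · subst h; rw [setCoord_same, setCoord_same]
    · rw [setCoord_of_ne h, setCoord_of_ne h, setCoord_of_ne h]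
  have h1 : lineLInt i (fun x => lineLInt i F x ^ 2) x = lineLInt i F x ^ 2 * 2 := by
    rw [lineLInt]
    simp only [e]
    rw [lintegral_const, Measure.restrict_apply MeasurableSet.univ, univ_inter, Real.volume_Ioo]
    norm_num
  rw [h1]
  have h2 := sq_setLIntegral_Ioo_le (hF.comp (continuous_setCoord i x).measurable)
  calc lineLInt i F x ^ 2 * 2 ≤ (2 * lineLInt i (fun x => F x ^ 2) x) * 2 :=
        mul_le_mul' h2 le_rfl
    _ = 4 * lineLInt i (fun x => F x ^ 2) x := by ring

/-! ### Square-integrable functions -/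

/-- Cauchy–Schwarz, from the discriminant of the nonnegative quadratic t ↦ ∫ (t f + g)². -/
theorem sq_integral_mul_le {μ : Measure E3} {f g : E3 → ℝ} (hf : MemLp f 2 μ) (hg : MemLp g 2 μ) :
    (∫ x, f x * g x ∂μ) ^ 2 ≤ (∫ x, f x ^ 2 ∂μ) * ∫ x, g x ^ 2 ∂μ := by
  have h : ∀ t : ℝ, 0 ≤ (∫ x, f x ^ 2 ∂μ) * (t * t) + (2 * ∫ x, f x * g x ∂μ) * t
      + ∫ x, g x ^ 2 ∂μ := by
    intro t
    have h0 : 0 ≤ ∫ x, (t * f x + g x) ^ 2 ∂μ := integral_nonneg fun _ => sq_nonneg _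
    have e : (fun x => (t * f x + g x) ^ 2)
        = fun x => (t * t) * f x ^ 2 + ((2 * t) * (f x * g x) + g x ^ 2) := by
      funext x; ring
    have i1 : Integrable (fun x => (2 * t) * (f x * g x)) μ :=
      (MemLp.integrable_mul_fun hf hg).const_mul _
    have i2 : Integrable (fun x => (2 * t) * (f x * g x) + g x ^ 2) μ := i1.add hg.integrable_sq
    rw [e, integral_add (hf.integrable_sq.const_mul _) i2, integral_add i1 hg.integrable_sq,
      integral_const_mul, integral_const_mul] at h0
    linarith
  have := discrim_le_zero h
  unfold discrim at this
  linarith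

/-- The test functions, as a subspace of `L²(U)`. -/
def testSubspace (U : Set E3) : Submodule ℝ (Lp ℝ 2 (volume.restrict U)) where
  carrier := {f | ∃ φ, IsTestFunction U φ ∧ f =ᵐ[volume.restrict U] φ}
  zero_mem' := ⟨0, ⟨contDiff_const, HasCompactSupport.zero, by simp [tsupport]⟩, Lp.coeFn_zero _ _ _⟩
  add_mem' := by
    rintro f g ⟨φ, hφ, hf⟩ ⟨ψ, hψ, hg⟩
    refine ⟨φ + ψ, ⟨hφ.1.add hψ.1, hφ.2.1.add hψ.2.1,
      (tsupport_add φ ψ).trans (union_subset hφ.2.2 hψ.2.2)⟩, ?_⟩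
    exact (Lp.coeFn_add f g).trans (hf.add hg)
  smul_mem' := by
    rintro c f ⟨φ, hφ, hf⟩
    refine ⟨c • φ, ⟨hφ.1.const_smul c, hφ.2.1.smul_left (f := fun _ => c),
      (closure_mono (Function.support_const_smul_subset c φ)).trans hφ.2.2⟩, ?_⟩
    exact (Lp.coeFn_smul c f).trans (hf.const_smul c)

/-- An element orthogonal to all test functions vanishes by the fundamental lemma. -/
theorem dense_testSubspace {U : Set E3} (hU : IsOpen U) :
    Dense (testSubspace U : Set (Lp ℝ 2 (volume.restrict U))) := by
  rw [Submodule.dense_iff_topologicalClosure_eq_top, Submodule.topologicalClosure_eq_top_iff,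
    Submodule.eq_bot_iff]
  intro f hf
  have h0 : (f : E3 → ℝ) =ᵐ[volume.restrict U] 0 := by
    refine ae_eq_of_forall_isTestFunction hU (Lp.memLp f) MemLp.zero fun φ hφ => ?_
    have hm := hφ.memLp (volume.restrict U)
    have h1 := (Submodule.mem_orthogonal _ f).1 hf (hm.toLp φ) ⟨φ, hφ, hm.coeFn_toLp⟩
    rw [L2.inner_def] at h1
    simp only [Pi.zero_apply, zero_mul, integral_zero]
    rw [← h1]
    refine integral_congr_ae ?_
    filter_upwards [hm.coeFn_toLp] with x hx
    rw [hx]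
    simp
  exact Lp.ext (h0.trans (Lp.coeFn_zero _ _ _).symm)

/-- L² duality: by density the inequality extends to every L² function in place of φ, in particular
to g itself, and one factor ∫ g² is cancelled. -/
theorem integral_sq_le_of_forall_isTestFunction {U : Set E3} (hU : IsOpen U) {g : E3 → ℝ}
    (hg : MemLp g 2 (volume.restrict U)) {B : ℝ} (hB : 0 ≤ B)
    (h : ∀ φ, IsTestFunction U φ → (∫ x in U, g x * φ x) ^ 2 ≤ B * ∫ x in U, φ x ^ 2) :
    ∫ x in U, g x ^ 2 ≤ B := by
  set G := hg.toLp g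
  have key : ∀ f : Lp ℝ 2 (volume.restrict U), (inner ℝ G f) ^ 2 ≤ B * inner ℝ f f := by
    refine isClosed_property (dense_testSubspace hU).denseRange_val ?_ ?_
    · exact isClosed_le (by fun_prop) (by fun_prop)
    · rintro ⟨f, φ, hφ, hf⟩
      have h1 := h φ hφ
      have e1 : inner ℝ G f = ∫ x in U, g x * φ x := by
        rw [L2.inner_def]
        refine integral_congr_ae ?_
        filter_upwards [hf, hg.coeFn_toLp] with x hx hx'
        rw [hx, hx']
        simp [mul_comm]
      have e2 : inner ℝ f f = ∫ x in U, φ x ^ 2 := by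
        rw [L2.inner_def]
        refine integral_congr_ae ?_
        filter_upwards [hf] with x hx
        rw [hx]
        simp [sq]
      simpa only [e1, e2] using h1
  have e : inner ℝ G G = ∫ x in U, g x ^ 2 := by
    rw [L2.inner_def]
    refine integral_congr_ae ?_
    filter_upwards [hg.coeFn_toLp] with x hx'
    rw [hx']
    simp [sq]
  have hk := key G
  rw [e] at hk
  have h0 : 0 ≤ ∫ x in U, g x ^ 2 := integral_nonneg fun _ => sq_nonneg _
  rcases h0.eq_or_lt with h0 | h0
  · rwa [← h0]
  · have : (∫ x in U, g x ^ 2) * (∫ x in U, g x ^ 2) ≤ B * ∫ x in U, g x ^ 2 := by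
      rw [← sq]; exact hk
    exact le_of_mul_le_mul_right this h0

/-! ### Affine maps -/

theorem affine_eq (T : E3 ≃ᵃ[ℝ] E3) (x : E3) : T x = T.linear x + T 0 := by
  have := T.map_vadd 0 x
  simpa using this

theorem contDiff_affine (T : E3 ≃ᵃ[ℝ] E3) : ContDiff ℝ ∞ T := by
  have : (T : E3 → E3) = fun x => T.linear.toLinearMap.toContinuousLinearMap x + T 0 := by
    funext x; exact affine_eq T x
  rw [this]
  exact (ContinuousLinearMap.contDiff _).add contDiff_const

theorem continuous_affine (T : E3 ≃ᵃ[ℝ] E3) : Continuous T := (contDiff_affine T).continuous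

theorem hasFDerivAt_affine (T : E3 ≃ᵃ[ℝ] E3) (x : E3) :
    HasFDerivAt T (T.linear.toLinearMap.toContinuousLinearMap) x := by
  have : (T : E3 → E3) = fun x => T.linear.toLinearMap.toContinuousLinearMap x + T 0 := by
    funext x; exact affine_eq T x
  rw [this]
  exact (ContinuousLinearMap.hasFDerivAt _).add_const _

/-- An affine automorphism as a homeomorphism. -/
def affineHomeo (T : E3 ≃ᵃ[ℝ] E3) : E3 ≃ₜ E3 where
  toEquiv := T.toEquiv
  continuous_toFun := continuous_affine T
  continuous_invFun := continuous_affine T.symm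

/-- The entry `(j, i)` of the matrix of the linear part. -/
def affEntry (T : E3 ≃ᵃ[ℝ] E3) (j i : Fin 3) : ℝ := T.linear (EuclideanSpace.single i (1 : ℝ)) j

theorem euclidean_eq_sum (v : E3) : v = ∑ j, v j • EuclideanSpace.single j (1 : ℝ) := by
  ext k
  simp [Fin.sum_univ_three]
  fin_cases k <;> simp

theorem fderiv_eq_sum_partialDeriv (φ : E3 → ℝ) (x v : E3) :
    fderiv ℝ φ x v = ∑ j, v j * partialDeriv j φ x := by
  conv_lhs => rw [euclidean_eq_sum v, map_sum]
  simp [partialDeriv]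

theorem partialDeriv_comp_affine {φ : E3 → ℝ} (hφ : ContDiff ℝ ∞ φ) (T : E3 ≃ᵃ[ℝ] E3) (i : Fin 3)
    (x : E3) : partialDeriv i (fun x => φ (T x)) x
      = ∑ j, affEntry T j i * partialDeriv j φ (T x) := by
  have h := (hφ.differentiable (by simp) (T x)).hasFDerivAt.comp x (hasFDerivAt_affine T x)
  have e : partialDeriv i (fun x => φ (T x)) x
      = fderiv ℝ φ (T x) (T.linear (EuclideanSpace.single i (1 : ℝ))) := by
    unfold partialDeriv
    have h' : HasFDerivAt (fun x => φ (T x)) _ x := h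
    rw [h'.fderiv]
    rfl
  rw [e, fderiv_eq_sum_partialDeriv]
  rfl

theorem interior_affine_image (T : E3 ≃ᵃ[ℝ] E3) : interior (T '' refCube) = T '' openCube := by
  rw [← interior_refCube]
  exact ((affineHomeo T).image_interior refCube).symm

theorem isOpen_affine_image (T : E3 ≃ᵃ[ℝ] E3) : IsOpen (T '' openCube) :=
  (affineHomeo T).isOpenMap _ isOpen_openCube

theorem isBounded_affine_image (T : E3 ≃ᵃ[ℝ] E3) : Bornology.IsBounded (T '' openCube) :=
  ((isCompact_refCube.image (continuous_affine T)).isBounded).subset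
    (image_mono openCube_subset_refCube)

theorem closure_openCube : closure openCube = refCube := by
  apply subset_antisymm (closure_minimal openCube_subset_refCube isClosed_refCube)
  intro x hx
  have h : Filter.Tendsto (fun n : ℕ => (1 - 1 / ((n : ℝ) + 1)) • x) Filter.atTop
      (nhds ((1 - 0 : ℝ) • x)) :=
    (tendsto_const_nhds.sub tendsto_one_div_add_atTop_nhds_zero_nat).smul_const x
  rw [sub_zero, one_smul] at h
  refine mem_closure_of_tendsto h (Filter.Eventually.of_forall fun n i => ?_)
  have hn : (0 : ℝ) < 1 / ((n : ℝ) + 1) := by positivity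
  have hn' : 1 / ((n : ℝ) + 1) ≤ 1 := by
    rw [div_le_one (by positivity)]; linarith [(Nat.cast_nonneg n : (0 : ℝ) ≤ n)]
  simp only [PiLp.smul_apply, smul_eq_mul, abs_mul]
  rw [abs_of_nonneg (by linarith)]
  calc (1 - 1 / ((n : ℝ) + 1)) * |x i| ≤ (1 - 1 / ((n : ℝ) + 1)) * 1 :=
        mul_le_mul_of_nonneg_left (hx i) (by linarith)
    _ < 1 := by linarith

theorem closure_affine_image (T : E3 ≃ᵃ[ℝ] E3) : closure (T '' openCube) = T '' refCube := by
  rw [← closure_openCube]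
  exact ((affineHomeo T).image_closure openCube).symm

theorem IsTestFunction.comp_affine {U : Set E3} {φ : E3 → ℝ} (h : IsTestFunction U φ)
    (T : E3 ≃ᵃ[ℝ] E3) : IsTestFunction (T '' U) (fun x => φ (T.symm x)) := by
  refine ⟨h.1.comp (contDiff_affine T.symm),
    h.2.1.comp_homeomorph (affineHomeo T.symm), ?_⟩
  have e : tsupport (fun x => φ (T.symm x)) = T '' tsupport φ := by
    have h1 := tsupport_comp_eq_preimage φ (affineHomeo T.symm)
    have h2 : (fun x => φ (T.symm x)) = φ ∘ (affineHomeo T.symm) := rfl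
    rw [h2, h1]
    exact (T.toEquiv.image_eq_preimage_symm _).symm
  rw [e]
  exact image_mono h.2.2

/-- The absolute value of the Jacobian determinant. -/
def affDet (T : E3 ≃ᵃ[ℝ] E3) : ℝ := |LinearMap.det (T.linear : E3 →ₗ[ℝ] E3)|

theorem affDet_pos (T : E3 ≃ᵃ[ℝ] E3) : 0 < affDet T :=
  abs_pos.2 (LinearEquiv.isUnit_det' T.linear).ne_zero

theorem setIntegral_affine_image (T : E3 ≃ᵃ[ℝ] E3) (F : E3 → ℝ) :
    ∫ x in T '' openCube, F x = affDet T * ∫ x in openCube, F (T x) := by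
  rw [integral_image_eq_integral_abs_det_fderiv_smul volume isOpen_openCube.measurableSet
    (fun x _ => (hasFDerivAt_affine T x).hasFDerivWithinAt) T.injective.injOn, ← integral_const_mul]
  rfl

/-! ### The decomposition of test functions along a line, on a cell -/

/-- The derivative in the direction of the `i`-th edge of the cell, from the partial derivatives. -/
def edgeDeriv (T : E3 ≃ᵃ[ℝ] E3) (i : Fin 3) (G : Fin 3 → E3 → ℝ) (x : E3) : ℝ :=
  ∑ j, affEntry T j i * G j x

theorem integral_mul_edgeDeriv {U : Set E3} (T : E3 ≃ᵃ[ℝ] E3) {g φ : E3 → ℝ}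
    {G : Fin 3 → E3 → ℝ} (hg : MemLp g 2 (volume.restrict U))
    (hG : ∀ j, MemLp (G j) 2 (volume.restrict U)) (hφ : MemLp φ 2 (volume.restrict U))
    (hdφ : ∀ j, MemLp (partialDeriv j φ) 2 (volume.restrict U))
    (h : ∀ j, ∫ x in U, g x * partialDeriv j φ x = -∫ x in U, G j x * φ x) (i : Fin 3) :
    ∫ x in U, g x * edgeDeriv T i (fun j => partialDeriv j φ) x
      = -∫ x in U, edgeDeriv T i G x * φ x := by
  have e1 : (fun x => g x * edgeDeriv T i (fun j => partialDeriv j φ) x)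
      = fun x => ∑ j, affEntry T j i * (g x * partialDeriv j φ x) := by
    funext x; rw [edgeDeriv, Finset.mul_sum]; exact Finset.sum_congr rfl fun _ _ => by ring
  have e2 : (fun x => edgeDeriv T i G x * φ x)
      = fun x => ∑ j, affEntry T j i * (G j x * φ x) := by
    funext x; rw [edgeDeriv, Finset.sum_mul]; exact Finset.sum_congr rfl fun _ _ => by ring
  rw [e1, e2, integral_finsetSum, integral_finsetSum, ← Finset.sum_neg_distrib]
  · refine Finset.sum_congr rfl fun j _ => ?_
    rw [integral_const_mul, integral_const_mul, h j, mul_neg]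
  · exact fun j _ => (MemLp.integrable_mul_fun (hG j) hφ).const_mul _
  · exact fun j _ => (MemLp.integrable_mul_fun hg (hdφ j)).const_mul _

theorem HasWeakGrad.integral_mul_edgeDeriv {U : Set E3} (T : E3 ≃ᵃ[ℝ] E3) {g : E3 → ℝ}
    {G : Fin 3 → E3 → ℝ} (h : HasWeakGrad U g G) (i : Fin 3) {φ : E3 → ℝ}
    (hφ : IsTestFunction U φ) :
    ∫ x in U, g x * edgeDeriv T i (fun j => partialDeriv j φ) x
      = -∫ x in U, edgeDeriv T i G x * φ x :=
  BrickFEM.integral_mul_edgeDeriv T h.1 h.2.1 (hφ.memLp _) (fun j => (hφ.partialDeriv j).memLp _)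
    (fun j => h.2.2 φ hφ j) i

theorem edgeDeriv_comp_symm {ζ : E3 → ℝ} (hζ : ContDiff ℝ ∞ ζ) (T : E3 ≃ᵃ[ℝ] E3) (i : Fin 3)
    (x : E3) : edgeDeriv T i (fun j => partialDeriv j fun x => ζ (T.symm x)) x
      = partialDeriv i ζ (T.symm x) := by
  have h := partialDeriv_comp_affine (hζ.comp (contDiff_affine T.symm)) T i (T.symm x)
  simp only [Function.comp_def, AffineEquiv.symm_apply_apply, AffineEquiv.apply_symm_apply] at h
  exact h.symm

/-- The splitting of `partialDeriv_lineLift`, transported to the cell. By the chain rule ∂ᵢ in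
reference coordinates is the derivative along the i-th edge, so this derivative moves onto g. -/
theorem HasWeakGrad.integral_mul_comp_symm {T : E3 ≃ᵃ[ℝ] E3} {g : E3 → ℝ}
    {G : Fin 3 → E3 → ℝ} (h : HasWeakGrad (T '' openCube) g G) (i : Fin 3) {ξ : E3 → ℝ}
    (hξ : IsTestFunction openCube ξ) :
    ∫ x in T '' openCube, g x * ξ (T.symm x)
      = (∫ x in T '' openCube, g x * lineMean smoothStep i ξ (T.symm x))
        - ∫ x in T '' openCube, edgeDeriv T i G x * lineLift smoothStep i ξ (T.symm x) := by
  have h1 := h.integral_mul_edgeDeriv T i ((hξ.lineLift i).comp_affine T)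
  simp only [edgeDeriv_comp_symm (hξ.lineLift i).1 T i,
    partialDeriv_lineLift contDiff_smoothStep i hξ.1, mul_sub] at h1
  rw [integral_sub (MemLp.integrable_mul_fun h.1 ((hξ.comp_affine T).memLp _))
    (MemLp.integrable_mul_fun h.1 (((hξ.lineMean i).comp_affine T).memLp _))] at h1
  linarith

/-! ### The Poincaré inequality on a cell -/

/-- The weight defining the mean values on the reference cube. -/
def refWeight (x : E3) : ℝ :=
  deriv smoothStep (x 0) * deriv smoothStep (x 1) * deriv smoothStep (x 2)

theorem contDiff_refWeight : ContDiff ℝ ∞ refWeight := by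
  have h : ∀ i : Fin 3, ContDiff ℝ ∞ fun x : E3 => deriv smoothStep (x i) := fun i =>
    (contDiff_infty_iff_deriv.1 contDiff_smoothStep).2.comp (contDiff_coord i)
  exact ((h 0).mul (h 1)).mul (h 2)

theorem isTestFunction_refWeight : IsTestFunction openCube refWeight := by
  refine VanishesOff.isTestFunction contDiff_refWeight (r := 1 / 2) (by norm_num) ?_
  rintro x ⟨j, hj⟩
  have := deriv_smoothStep hj
  unfold refWeight
  fin_cases j <;> simp at this <;> simp [this]

/-- Averaging in all three directions leaves a multiple of one fixed weight, which a function of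
weighted mean zero does not see. -/
theorem lineMean_lineMean_lineMean (ξ : E3 → ℝ) (x : E3) :
    lineMean smoothStep 2 (lineMean smoothStep 1 (lineMean smoothStep 0 ξ)) x
      = lineInt 2 (lineInt 1 (lineInt 0 ξ)) 0 * refWeight x := by
  have h1 : ∀ y, lineMean smoothStep 1 (lineMean smoothStep 0 ξ) y
      = deriv smoothStep (y 1) * deriv smoothStep (y 0) * lineInt 1 (lineInt 0 ξ) y := by
    intro y
    rw [lineMean, lineInt]
    simp only [lineMean, setCoord_of_ne (show (0 : Fin 3) ≠ 1 by decide)]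
    rw [intervalIntegral.integral_const_mul, ← mul_assoc]
    rfl
  have h2 : lineInt 2 (lineInt 1 (lineInt 0 ξ)) 0 = lineInt 2 (lineInt 1 (lineInt 0 ξ)) x := by
    unfold lineInt
    congr 1; funext t; congr 1; funext s; congr 1; funext r; congr 1
    ext j
    fin_cases j <;> simp [setCoord]
  rw [h2, lineMean, lineInt]
  simp only [h1, setCoord_of_ne (show (0 : Fin 3) ≠ 2 by decide),
    setCoord_of_ne (show (1 : Fin 3) ≠ 2 by decide)]
  rw [intervalIntegral.integral_const_mul, refWeight]
  unfold lineInt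
  ring

theorem ofReal_integral_sq {μ : Measure E3} {F : E3 → ℝ} (hF : MemLp F 2 μ) :
    ENNReal.ofReal (∫ x, F x ^ 2 ∂μ) = ∫⁻ x, ‖F x‖ₑ ^ 2 ∂μ := by
  rw [ofReal_integral_eq_lintegral_ofReal hF.integrable_sq
    (Filter.Eventually.of_forall fun _ => sq_nonneg _)]
  refine lintegral_congr fun x => ?_
  rw [← sq_abs, ENNReal.ofReal_pow (abs_nonneg _), Real.enorm_eq_ofReal_abs]

theorem integral_sq_le_of_enorm_le_lineLInt {F ξ : E3 → ℝ} (hF : IsTestFunction openCube F)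
    (hξ : IsTestFunction openCube ξ) (i : Fin 3)
    (h : ∀ x, ‖F x‖ₑ ≤ ENNReal.ofReal lineConst * lineLInt i (fun x => ‖ξ x‖ₑ) x) :
    ∫ x in openCube, F x ^ 2 ≤ 4 * lineConst ^ 2 * ∫ x in openCube, ξ x ^ 2 := by
  have hc : 0 ≤ lineConst := by linarith [two_le_lineConst]
  have hm : Measurable fun x => ‖ξ x‖ₑ := hξ.1.continuous.measurable.enorm
  have h0 : 0 ≤ ∫ x in openCube, ξ x ^ 2 := integral_nonneg fun _ => sq_nonneg _
  rw [← ENNReal.ofReal_le_ofReal_iff (by positivity), ofReal_integral_sq (hF.memLp _),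
    ENNReal.ofReal_mul (by positivity), ofReal_integral_sq (hξ.memLp _)]
  calc ∫⁻ x in openCube, ‖F x‖ₑ ^ 2
      ≤ ∫⁻ x in openCube, ENNReal.ofReal lineConst ^ 2 * lineLInt i (fun x => ‖ξ x‖ₑ) x ^ 2 :=
        lintegral_mono fun x => by
          rw [← mul_pow]; exact pow_le_pow_left' (h x) 2
    _ = ENNReal.ofReal lineConst ^ 2 * ∫⁻ x in openCube, lineLInt i (fun x => ‖ξ x‖ₑ) x ^ 2 :=
        lintegral_const_mul' _ _ (by simp)
    _ ≤ ENNReal.ofReal lineConst ^ 2 * (4 * ∫⁻ x in openCube, ‖ξ x‖ₑ ^ 2) :=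
        mul_le_mul' le_rfl (setLIntegral_sq_lineLInt_le i hm)
    _ = _ := by
        rw [ENNReal.ofReal_mul (by norm_num), ENNReal.ofReal_pow hc]
        simp only [ENNReal.ofReal_ofNat]
        ring

theorem integral_sq_lineMean_le {ξ : E3 → ℝ} (hξ : IsTestFunction openCube ξ) (i : Fin 3) :
    ∫ x in openCube, lineMean smoothStep i ξ x ^ 2
      ≤ 4 * lineConst ^ 2 * ∫ x in openCube, ξ x ^ 2 :=
  integral_sq_le_of_enorm_le_lineLInt (hξ.lineMean i) hξ i (enorm_lineMean_le i ξ)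

theorem integral_sq_lineLift_le {ξ : E3 → ℝ} (hξ : IsTestFunction openCube ξ) (i : Fin 3) :
    ∫ x in openCube, lineLift smoothStep i ξ x ^ 2
      ≤ 4 * lineConst ^ 2 * ∫ x in openCube, ξ x ^ 2 :=
  integral_sq_le_of_enorm_le_lineLInt (hξ.lineLift i) hξ i (enorm_lineLift_le hξ i)

/-- The constant of the Poincaré inequality. -/
def poincareConst : ℝ := 27 * (4 * lineConst ^ 2) ^ 3

theorem poincareConst_pos : 0 < poincareConst := by
  have := two_le_lineConst
  unfold poincareConst
  positivity

theorem memLp_edgeDeriv {U : Set E3} (T : E3 ≃ᵃ[ℝ] E3) {G : Fin 3 → E3 → ℝ}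
    (hG : ∀ j, MemLp (G j) 2 (volume.restrict U)) (i : Fin 3) :
    MemLp (edgeDeriv T i G) 2 (volume.restrict U) :=
  memLp_finsetSum _ fun j _ => (hG j).const_mul _

theorem integral_sq_edgeDeriv_le {U : Set E3} {T : E3 ≃ᵃ[ℝ] E3} {d : ℝ}
    (hd : ∀ j i, |affEntry T j i| ≤ d) {G : Fin 3 → E3 → ℝ}
    (hG : ∀ j, MemLp (G j) 2 (volume.restrict U)) (i : Fin 3) : ∫ x in U, edgeDeriv T i G x ^ 2 ≤ 3 * d ^ 2 * ∑ j, ∫ x in U, G j x ^ 2 := by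
  rw [← integral_finsetSum _ fun j _ => (hG j).integrable_sq, ← integral_const_mul]
  refine integral_mono (memLp_edgeDeriv T hG i).integrable_sq
    ((integrable_finsetSum _ fun j _ => (hG j).integrable_sq).const_mul _) fun x => ?_
  have hs : ∀ j, (affEntry T j i * G j x) ^ 2 ≤ d ^ 2 * G j x ^ 2 := fun j => by
    rw [mul_pow]
    exact mul_le_mul_of_nonneg_right (sq_le_sq' (neg_le_of_abs_le (hd j i)) (le_of_abs_le (hd j i)))
      (sq_nonneg _)
  simp only [edgeDeriv, Fin.sum_univ_three]
  have := hs 0; have := hs 1; have := hs 2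
  nlinarith [sq_nonneg (affEntry T 0 i * G 0 x - affEntry T 1 i * G 1 x),
    sq_nonneg (affEntry T 0 i * G 0 x - affEntry T 2 i * G 2 x),
    sq_nonneg (affEntry T 1 i * G 1 x - affEntry T 2 i * G 2 x)]

/-- The Poincaré inequality by duality. A test function is split successively in the three
directions; its last mean is a multiple of `refWeight` and is annihilated by `hmean`. Each lift
pairs with an edge derivative of g, and lifting is bounded in L². -/
theorem HasWeakGrad.integral_sq_le {T : E3 ≃ᵃ[ℝ] E3} {d : ℝ} (hd : ∀ j i, |affEntry T j i| ≤ d)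
    {g : E3 → ℝ} {G : Fin 3 → E3 → ℝ} (h : HasWeakGrad (T '' openCube) g G)
    (hmean : ∫ x in T '' openCube, g x * refWeight (T.symm x) = 0) :
    ∫ x in T '' openCube, g x ^ 2
      ≤ poincareConst * d ^ 2 * ∑ j, ∫ x in T '' openCube, G j x ^ 2 := by
  set S := ∑ j, ∫ x in T '' openCube, G j x ^ 2 with hS
  have hS0 : 0 ≤ S := Finset.sum_nonneg fun _ _ => integral_nonneg fun _ => sq_nonneg _
  refine integral_sq_le_of_forall_isTestFunction (isOpen_affine_image T) h.1
    (mul_nonneg (mul_nonneg poincareConst_pos.le (sq_nonneg _)) hS0) fun η hη => ?_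
  set ξ : E3 → ℝ := fun x => η (T x) with hξdef
  have hξ : IsTestFunction openCube ξ := by
    have := hη.comp_affine T.symm
    rwa [show T.symm.symm = T from rfl, ← image_comp, show (T.symm : E3 → E3) ∘ T = id by
      funext x; simp, image_id] at this
  have hη' : ∀ x, η x = ξ (T.symm x) := fun x => by simp [hξdef]
  have hξ1 := hξ.lineMean 0
  have hξ2 := hξ1.lineMean 1
  set c := 4 * lineConst ^ 2 with hc
  have hc1 : 1 ≤ c := by nlinarith [two_le_lineConst]
  set q := ∫ x in openCube, ξ x ^ 2 with hq
  have hq0 : 0 ≤ q := integral_nonneg fun _ => sq_nonneg _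
  have n1 := integral_sq_lineMean_le hξ 0
  have n2 := integral_sq_lineMean_le hξ1 1
  have l0 := integral_sq_lineLift_le hξ 0
  have l1 := integral_sq_lineLift_le hξ1 1
  have l2 := integral_sq_lineLift_le hξ2 2
  rw [← hc] at n1 n2 l0 l1 l2
  -- Every averaging and every lifting costs one factor c; since c ≥ 1, all three lifts are bounded
  -- by the worst power c³.
  have b2 : ∫ x in openCube, lineLift smoothStep 2
      (lineMean smoothStep 1 (lineMean smoothStep 0 ξ)) x ^ 2 ≤ c ^ 3 * q := by
    calc _ ≤ _ := l2
      _ ≤ c * (c * (c * q)) := by gcongr; exact n2.trans (by gcongr)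
      _ = c ^ 3 * q := by ring
  have b1 : ∫ x in openCube, lineLift smoothStep 1 (lineMean smoothStep 0 ξ) x ^ 2
      ≤ c ^ 3 * q := by
    calc _ ≤ _ := l1
      _ ≤ c * (c * q) := by gcongr
      _ = c ^ 2 * q := by ring
      _ ≤ c ^ 3 * q := by gcongr; norm_num
  have b0 : ∫ x in openCube, lineLift smoothStep 0 ξ x ^ 2 ≤ c ^ 3 * q := by
    calc _ ≤ _ := l0
      _ = c ^ 1 * q := by ring
      _ ≤ c ^ 3 * q := by gcongr; norm_num
  have key : ∀ (i : Fin 3) (ζ : E3 → ℝ), IsTestFunction openCube ζ →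
      ∫ x in openCube, ζ x ^ 2 ≤ c ^ 3 * q →
      (∫ x in T '' openCube, edgeDeriv T i G x * ζ (T.symm x)) ^ 2
        ≤ 3 * d ^ 2 * S * (c ^ 3 * ∫ x in T '' openCube, η x ^ 2) := by
    intro i ζ hζ hb
    refine (sq_integral_mul_le (memLp_edgeDeriv T h.2.1 i) ((hζ.comp_affine T).memLp _)).trans ?_
    refine mul_le_mul (integral_sq_edgeDeriv_le hd h.2.1 i) ?_ (integral_nonneg fun _ => sq_nonneg _)
      (by positivity)
    rw [setIntegral_affine_image, setIntegral_affine_image]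
    simp only [AffineEquiv.symm_apply_apply]
    have := mul_le_mul_of_nonneg_left hb (affDet_pos T).le
    linarith
  have k0 := key 0 _ (hξ.lineLift 0) b0
  have k1 := key 1 _ (hξ1.lineLift 1) b1
  have k2 := key 2 _ (hξ2.lineLift 2) b2
  have s0 := h.integral_mul_comp_symm 0 hξ
  have s1 := h.integral_mul_comp_symm 1 hξ1
  have s2 := h.integral_mul_comp_symm 2 hξ2
  have z : ∫ x in T '' openCube, g x * lineMean smoothStep 2
      (lineMean smoothStep 1 (lineMean smoothStep 0 ξ)) (T.symm x) = 0 := by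
    simp only [lineMean_lineMean_lineMean]
    have e : ∀ x, g x * (lineInt 2 (lineInt 1 (lineInt 0 ξ)) 0 * refWeight (T.symm x))
      = lineInt 2 (lineInt 1 (lineInt 0 ξ)) 0 * (g x * refWeight (T.symm x)) := fun x => by ring
    simp only [e]
    rw [integral_const_mul, hmean, mul_zero]
  simp only [← hη'] at s0
  rw [s0, s1, s2, z]
  set A0 := ∫ x in T '' openCube, edgeDeriv T 0 G x * lineLift smoothStep 0 ξ (T.symm x)
  set A1 := ∫ x in T '' openCube, edgeDeriv T 1 G x *
    lineLift smoothStep 1 (lineMean smoothStep 0 ξ) (T.symm x)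
  set A2 := ∫ x in T '' openCube, edgeDeriv T 2 G x *
    lineLift smoothStep 2 (lineMean smoothStep 1 (lineMean smoothStep 0 ξ)) (T.symm x)
  -- The factor 27 is 9 · 3: the square of a sum of three terms costs 9 times the common bound of
  -- their squares, and each edge derivative costs 3.
  have e : poincareConst * d ^ 2 * S * ∫ x in T '' openCube, η x ^ 2
      = 9 * (3 * d ^ 2 * S * (c ^ 3 * ∫ x in T '' openCube, η x ^ 2)) := by
    rw [poincareConst, ← hc]; ring
  rw [e]
  nlinarith [sq_nonneg (A0 - A1), sq_nonneg (A0 - A2), sq_nonneg (A1 - A2)]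

/-! ### Weighted means and quadratic approximation -/

/-- The weighted mean value on a cell. -/
def cellMean (T : E3 ≃ᵃ[ℝ] E3) (g : E3 → ℝ) : ℝ :=
  (∫ x in T '' openCube, g x * refWeight (T.symm x)) /
    ∫ x in T '' openCube, refWeight (T.symm x)

theorem memLp_refWeight (T : E3 ≃ᵃ[ℝ] E3) :
    MemLp (fun x => refWeight (T.symm x)) 2 (volume.restrict (T '' openCube)) :=
  (isTestFunction_refWeight.comp_affine T).memLp _

theorem memLp_const_cell (T : E3 ≃ᵃ[ℝ] E3) (c : ℝ) :
    MemLp (fun _ : E3 => c) 2 (volume.restrict (T '' openCube)) :=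
  memLp_of_continuous_of_isBounded (isBounded_affine_image T) continuous_const

theorem partialDeriv_const (c : ℝ) (i : Fin 3) (x : E3) : partialDeriv i (fun _ => c) x = 0 := by
  simp [partialDeriv]

/-- Otherwise the constant 1 would have weighted mean zero, and the Poincaré inequality would force
the cell to have volume zero. -/
theorem integral_refWeight_ne_zero (T : E3 ≃ᵃ[ℝ] E3) :
    ∫ x in T '' openCube, refWeight (T.symm x) ≠ 0 := by
  intro h0
  have hg : HasWeakGrad (T '' openCube) (fun _ => (1 : ℝ)) (fun _ _ => 0) := by
    have := hasWeakGrad_of_contDiff (isBounded_affine_image T) (ψ := fun _ => (1 : ℝ))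
      contDiff_const
    have e : (fun i => partialDeriv i fun _ : E3 => (1 : ℝ)) = fun _ _ => 0 := by
      funext i x; exact partialDeriv_const 1 i x
    rwa [e] at this
  have hd : ∀ j i, |affEntry T j i| ≤ ∑ j, ∑ i, |affEntry T j i| := fun j i =>
    (Finset.single_le_sum (f := fun i => |affEntry T j i|) (fun _ _ => abs_nonneg _)
      (Finset.mem_univ i)).trans (Finset.single_le_sum (f := fun j => ∑ i, |affEntry T j i|)
      (fun _ _ => Finset.sum_nonneg fun _ _ => abs_nonneg _) (Finset.mem_univ j))
  have := hg.integral_sq_le hd (by simpa using h0)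
  simp only [one_pow, ne_eq, OfNat.ofNat_ne_zero, not_false_eq_true, zero_pow, integral_zero,
    Finset.sum_const_zero, mul_zero] at this
  rw [setIntegral_affine_image, integral_const, smul_eq_mul, mul_one, measureReal_restrict_apply
    MeasurableSet.univ, univ_inter] at this
  have hpos : 0 < volume.real openCube := by
    refine ENNReal.toReal_pos (isOpen_openCube.measure_pos volume ⟨0, fun i => by simp⟩).ne' ?_
    exact ((measure_mono openCube_subset_refCube).trans_lt isCompact_refCube.measure_lt_top).ne
  have := mul_pos (affDet_pos T) hpos
  linarith

theorem cellMean_sub (T : E3 ≃ᵃ[ℝ] E3) {g g' : E3 → ℝ}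
    (h : MemLp g 2 (volume.restrict (T '' openCube)))
    (h' : MemLp g' 2 (volume.restrict (T '' openCube))) :
    cellMean T (fun x => g x - g' x) = cellMean T g - cellMean T g' := by
  unfold cellMean
  simp only [sub_mul]
  rw [integral_sub (MemLp.integrable_mul_fun h (memLp_refWeight T))
    (MemLp.integrable_mul_fun h' (memLp_refWeight T)), sub_div]

theorem cellMean_const (T : E3 ≃ᵃ[ℝ] E3) (c : ℝ) : cellMean T (fun _ => c) = c := by
  unfold cellMean
  rw [integral_const_mul, mul_div_cancel_right₀ _ (integral_refWeight_ne_zero T)]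

theorem integral_mul_refWeight_eq_zero {T : E3 ≃ᵃ[ℝ] E3} {g : E3 → ℝ} (h : cellMean T g = 0) :
    ∫ x in T '' openCube, g x * refWeight (T.symm x) = 0 :=
  (div_eq_zero_iff.1 h).resolve_right (integral_refWeight_ne_zero T)

/-- The quadratic polynomial with the given Taylor coefficients at `0`. -/
def quadratic (a : ℝ) (b : Fin 3 → ℝ) (m : Fin 3 → Fin 3 → ℝ) (x : E3) : ℝ :=
  a + ∑ j, b j * x j + (∑ j, ∑ k, m j k * (x j * x k)) / 2

/-- The affine function `c + ∑ b k x k`. -/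
def affineFun (c : ℝ) (b : Fin 3 → ℝ) (x : E3) : ℝ := c + ∑ k, b k * x k

theorem contDiff_affineFun (c : ℝ) (b : Fin 3 → ℝ) : ContDiff ℝ ∞ (affineFun c b) :=
  contDiff_const.add (ContDiff.sum fun k _ => contDiff_const.mul (contDiff_coord k))

theorem contDiff_quadratic (a : ℝ) (b : Fin 3 → ℝ) (m : Fin 3 → Fin 3 → ℝ) :
    ContDiff ℝ ∞ (quadratic a b m) :=
  (contDiff_const.add (ContDiff.sum fun k _ => contDiff_const.mul (contDiff_coord k))).add
    ((ContDiff.sum fun j _ => ContDiff.sum fun k _ =>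
      contDiff_const.mul ((contDiff_coord j).mul (contDiff_coord k))).div_const 2)

theorem hasDerivAt_line_coord (x : E3) (i j : Fin 3) :
    HasDerivAt (fun s : ℝ => (x + s • EuclideanSpace.single i (1 : ℝ)) j)
      (if j = i then 1 else 0) 0 := by
  by_cases h : j = i
  · subst h
    simpa using (hasDerivAt_id (0 : ℝ)).const_add (x j)
  · simpa [h] using hasDerivAt_const (0 : ℝ) (x j)

theorem partialDeriv_affineFun (c : ℝ) (b : Fin 3 → ℝ) (i : Fin 3) (x : E3) :
    partialDeriv i (affineFun c b) x = b i := by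
  refine partialDeriv_eq_of_hasDerivAt (contDiff_affineFun c b) ?_
  have := (HasDerivAt.fun_sum (u := Finset.univ) fun k _ =>
    (hasDerivAt_line_coord x i k).const_mul (b k)).const_add c
  exact this.congr_deriv (by simp)

theorem partialDeriv_quadratic (a : ℝ) (b : Fin 3 → ℝ) {m : Fin 3 → Fin 3 → ℝ}
    (hm : ∀ j k, m j k = m k j) (i : Fin 3) (x : E3) :
    partialDeriv i (quadratic a b m) x = affineFun (b i) (m i) x := by
  refine partialDeriv_eq_of_hasDerivAt (contDiff_quadratic a b m) ?_
  have h1 := (HasDerivAt.fun_sum (u := Finset.univ) fun k _ =>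
    (hasDerivAt_line_coord x i k).const_mul (b k)).const_add a
  have h2 := (HasDerivAt.fun_sum (u := Finset.univ) fun j _ =>
    HasDerivAt.fun_sum (u := Finset.univ) fun k _ =>
    ((hasDerivAt_line_coord x i j).mul (hasDerivAt_line_coord x i k)).const_mul (m j k)).div_const 2
  have h3 := h1.add h2
  refine h3.congr_deriv ?_
  have e10 := hm 1 0
  have e20 := hm 2 0
  have e21 := hm 2 1
  simp only [affineFun, Fin.sum_univ_three, e10, e20, e21]
  fin_cases i <;> simp [e10, e20, e21] <;> ring

/-- The coefficients are chosen from the top down as weighted means: first `m` for the second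
derivatives, then `b`, then `a`. Every residual then has weighted mean zero, and Poincaré applied
once, twice and three times yields the three bounds. -/
theorem HasWeakGrad.exists_quadratic {T : E3 ≃ᵃ[ℝ] E3} {d : ℝ}
    (hd : ∀ j i, |affEntry T j i| ≤ d) {u : E3 → ℝ} {D1 : Fin 3 → E3 → ℝ}
    {D2 : Fin 3 → Fin 3 → E3 → ℝ} {D3 : Fin 3 → Fin 3 → Fin 3 → E3 → ℝ}
    (h1 : HasWeakGrad (T '' openCube) u D1) (h2 : ∀ j, HasWeakGrad (T '' openCube) (D1 j) (D2 j))
    (h3 : ∀ j k, HasWeakGrad (T '' openCube) (D2 j k) (D3 j k))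
    (hs : ∀ j k, D2 j k = D2 k j) :
    ∃ (a : ℝ) (b : Fin 3 → ℝ) (m : Fin 3 → Fin 3 → ℝ), (∀ j k, m j k = m k j) ∧
      HasWeakGrad (T '' openCube) (fun x => u x - quadratic a b m x)
        (fun j x => D1 j x - affineFun (b j) (m j) x) ∧
      (∀ j, HasWeakGrad (T '' openCube) (fun x => D1 j x - affineFun (b j) (m j) x)
        (fun k x => D2 j k x - m j k)) ∧
      (∀ j k, HasWeakGrad (T '' openCube) (fun x => D2 j k x - m j k) (D3 j k)) ∧
      ∑ j, ∑ k, ∫ x in T '' openCube, (D2 j k x - m j k) ^ 2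
        ≤ poincareConst * d ^ 2 * ∑ j, ∑ k, ∑ l, ∫ x in T '' openCube, D3 j k l x ^ 2 ∧
      ∑ j, ∫ x in T '' openCube, (D1 j x - affineFun (b j) (m j) x) ^ 2
        ≤ (poincareConst * d ^ 2) ^ 2 * ∑ j, ∑ k, ∑ l, ∫ x in T '' openCube, D3 j k l x ^ 2 ∧
      ∫ x in T '' openCube, (u x - quadratic a b m x) ^ 2
        ≤ (poincareConst * d ^ 2) ^ 3 * ∑ j, ∑ k, ∑ l, ∫ x in T '' openCube, D3 j k l x ^ 2 := by
  have hB := isBounded_affine_image T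
  have hPd : 0 ≤ poincareConst * d ^ 2 := mul_nonneg poincareConst_pos.le (sq_nonneg _)
  set m : Fin 3 → Fin 3 → ℝ := fun j k => cellMean T (D2 j k) with hm
  have hms : ∀ j k, m j k = m k j := fun j k => by rw [hm]; simp only [hs j k]
  set b : Fin 3 → ℝ := fun j => cellMean T fun x => D1 j x - affineFun 0 (m j) x with hb
  set a : ℝ := cellMean T fun x => u x - quadratic 0 b m x with ha
  have hconst : ∀ c : ℝ, HasWeakGrad (T '' openCube) (fun _ => c) (fun _ _ => 0) := fun c => by
    have := hasWeakGrad_of_contDiff hB (ψ := fun _ => c) contDiff_const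
    have e : (fun i => partialDeriv i fun _ : E3 => c) = fun _ _ => 0 := by
      funext i x; exact partialDeriv_const c i x
    rwa [e] at this
  have haff : ∀ c v, HasWeakGrad (T '' openCube) (affineFun c v) (fun i _ => v i) := fun c v => by
    have := hasWeakGrad_of_contDiff hB (contDiff_affineFun c v)
    have e : (fun i => partialDeriv i (affineFun c v)) = fun i _ => v i := by
      funext i x; exact partialDeriv_affineFun c v i x
    rwa [e] at this
  have hquad : HasWeakGrad (T '' openCube) (quadratic a b m) (fun i => affineFun (b i) (m i)) := by
    have := hasWeakGrad_of_contDiff hB (contDiff_quadratic a b m)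
    have e : (fun i => partialDeriv i (quadratic a b m)) = fun i => affineFun (b i) (m i) := by
      funext i x; exact partialDeriv_quadratic a b hms i x
    rwa [e] at this
  have w1 := h1.sub hquad
  have w2 := fun j => (h2 j).sub (haff (b j) (m j))
  have w3 : ∀ j k, HasWeakGrad (T '' openCube) (fun x => D2 j k x - m j k) (D3 j k) := fun j k => by
    simpa using (h3 j k).sub (hconst (m j k))
  have z3 : ∀ j k, cellMean T (fun x => D2 j k x - m j k) = 0 := fun j k => by
    rw [cellMean_sub T (h3 j k).1 (memLp_const_cell T _), cellMean_const, sub_self]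
  have z2 : ∀ j, cellMean T (fun x => D1 j x - affineFun (b j) (m j) x) = 0 := fun j => by
    have e : (fun x => D1 j x - affineFun (b j) (m j) x)
        = fun x => (D1 j x - affineFun 0 (m j) x) - b j := by
      funext x; simp only [affineFun]; ring
    rw [e, cellMean_sub T ((h2 j).sub (haff 0 (m j))).1 (memLp_const_cell T _), cellMean_const,
      sub_self]
  have z1 : cellMean T (fun x => u x - quadratic a b m x) = 0 := by
    have e : (fun x => u x - quadratic a b m x)
        = fun x => (u x - quadratic 0 b m x) - a := by
      funext x; simp only [quadratic]; ring
    rw [e, cellMean_sub T (g := fun x => u x - quadratic 0 b m x) (h1.1.sub (memLp_of_continuous_of_isBounded hB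
      (contDiff_quadratic 0 b m).continuous)) (memLp_const_cell T _), cellMean_const, sub_self]
  have p3 : ∑ j, ∑ k, ∫ x in T '' openCube, (D2 j k x - m j k) ^ 2
      ≤ poincareConst * d ^ 2 * ∑ j, ∑ k, ∑ l, ∫ x in T '' openCube, D3 j k l x ^ 2 := by
    simp only [Finset.mul_sum (s := Finset.univ) (f := fun j => ∑ k, ∑ l, _),
      Finset.mul_sum (s := Finset.univ) (f := fun k => ∑ l, _)]
    exact Finset.sum_le_sum fun j _ => Finset.sum_le_sum fun k _ =>
      (w3 j k).integral_sq_le hd (integral_mul_refWeight_eq_zero (z3 j k))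
  have p2 : ∑ j, ∫ x in T '' openCube, (D1 j x - affineFun (b j) (m j) x) ^ 2
      ≤ poincareConst * d ^ 2 * ∑ j, ∑ k, ∫ x in T '' openCube, (D2 j k x - m j k) ^ 2 := by
    rw [Finset.mul_sum]
    exact Finset.sum_le_sum fun j _ =>
      (w2 j).integral_sq_le hd (integral_mul_refWeight_eq_zero (z2 j))
  have p1 := w1.integral_sq_le hd (integral_mul_refWeight_eq_zero z1)
  refine ⟨a, b, m, hms, w1, w2, w3, p3, ?_, ?_⟩
  · calc _ ≤ _ := p2
      _ ≤ _ := mul_le_mul_of_nonneg_left p3 hPd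
      _ = _ := by ring
  · calc _ ≤ _ := p1
      _ ≤ _ := mul_le_mul_of_nonneg_left (p2.trans (mul_le_mul_of_nonneg_left p3 hPd)) hPd
      _ = _ := by ring

/-! ### A Sobolev embedding on a cell -/

/-- The pairings of `g` with the test functions of the cell are bounded by `M` times the supremum
of the transforms `B |ξ|`. -/
def PairingBound (T : E3 ≃ᵃ[ℝ] E3) (B : (E3 → ENNReal) → E3 → ENNReal) (g : E3 → ℝ)
    (M : ENNReal) : Prop :=
  ∀ ξ, IsTestFunction openCube ξ →
    ‖∫ x in T '' openCube, g x * ξ (T.symm x)‖ₑ ≤ M * ⨆ x, B (fun x => ‖ξ x‖ₑ) x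

theorem pairingBound_id (T : E3 ≃ᵃ[ℝ] E3) (g : E3 → ℝ) :
    PairingBound T id g (∫⁻ x in T '' openCube, ‖g x‖ₑ) := by
  intro ξ hξ
  refine (enorm_integral_le_lintegral_enorm _).trans ?_
  have hfin : (⨆ x, ‖ξ x‖ₑ) ≠ ⊤ := by
    obtain ⟨C, hC⟩ := hξ.1.continuous.bounded_above_of_compact_support hξ.2.1
    refine ne_top_of_le_ne_top (ENNReal.ofReal_ne_top (r := C)) (iSup_le fun x => ?_)
    rw [Real.enorm_eq_ofReal_abs]
    exact ENNReal.ofReal_le_ofReal (hC x)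
  rw [← lintegral_mul_const' _ _ (by simpa using hfin)]
  refine lintegral_mono fun x => ?_
  rw [enorm_mul]
  exact mul_le_mul' le_rfl (le_iSup (fun x => ‖ξ x‖ₑ) (T.symm x))

/-- One derivative in direction i buys one line integral in direction i: both parts of the splitting
of ξ are dominated by `lineConst` times the line integral of |ξ|. The supremum of |ξ| is thus
weakened step by step towards the integral of |ξ|. -/
theorem PairingBound.step {T : E3 ≃ᵃ[ℝ] E3} {B : (E3 → ENNReal) → E3 → ENNReal}
    (hmono : ∀ F F' : E3 → ENNReal, (∀ x, F x ≤ F' x) → ∀ x, B F x ≤ B F' x)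
    (hmul : ∀ (c : ENNReal) (F : E3 → ENNReal), c ≠ ⊤ → ∀ x, B (fun x => c * F x) x = c * B F x)
    {g : E3 → ℝ} {G : Fin 3 → E3 → ℝ} (h : HasWeakGrad (T '' openCube) g G) (i : Fin 3)
    {M M' : ENNReal} (hg : PairingBound T B g M) (hG : PairingBound T B (edgeDeriv T i G) M') :
    PairingBound T (fun F => B (lineLInt i F)) g (ENNReal.ofReal lineConst * (M + M')) := by
  intro ξ hξ
  have key : ∀ ζ : E3 → ℝ, (∀ x, ‖ζ x‖ₑ ≤ ENNReal.ofReal lineConst *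
      lineLInt i (fun x => ‖ξ x‖ₑ) x) → ⨆ x, B (fun x => ‖ζ x‖ₑ) x ≤
      ENNReal.ofReal lineConst * ⨆ x, B (lineLInt i fun x => ‖ξ x‖ₑ) x := by
    intro ζ hζ
    refine iSup_le fun x => (hmono _ _ hζ x).trans ?_
    rw [hmul _ _ ENNReal.ofReal_ne_top]
    exact mul_le_mul' le_rfl (le_iSup (fun x => B (lineLInt i fun x => ‖ξ x‖ₑ) x) x)
  rw [h.integral_mul_comp_symm i hξ]
  refine enorm_sub_le.trans ((add_le_add (hg _ (hξ.lineMean i)) (hG _ (hξ.lineLift i))).trans ?_)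
  refine (add_le_add (mul_le_mul' le_rfl (key _ (enorm_lineMean_le i ξ)))
    (mul_le_mul' le_rfl (key _ (enorm_lineLift_le hξ i)))).trans (le_of_eq ?_)
  ring

theorem HasWeakGrad.edgeDeriv {U : Set E3} (T : E3 ≃ᵃ[ℝ] E3) (i : Fin 3) {G : Fin 3 → E3 → ℝ}
    {H : Fin 3 → Fin 3 → E3 → ℝ} (h : ∀ j, HasWeakGrad U (G j) (H j)) :
    HasWeakGrad U (edgeDeriv T i G) (fun k => edgeDeriv T i fun j => H j k) := by
  refine ⟨memLp_finsetSum _ fun j _ => (h j).1.const_mul _,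
    fun k => memLp_finsetSum _ fun j _ => ((h j).2.1 k).const_mul _, fun φ hφ k => ?_⟩
  have e1 : (fun x => BrickFEM.edgeDeriv T i G x * partialDeriv k φ x)
      = fun x => ∑ j, affEntry T j i * (G j x * partialDeriv k φ x) := by
    funext x; rw [BrickFEM.edgeDeriv, Finset.sum_mul]; exact Finset.sum_congr rfl fun _ _ => by ring
  have e2 : (fun x => BrickFEM.edgeDeriv T i (fun j => H j k) x * φ x)
      = fun x => ∑ j, affEntry T j i * (H j k x * φ x) := by
    funext x; rw [BrickFEM.edgeDeriv, Finset.sum_mul]; exact Finset.sum_congr rfl fun _ _ => by ring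
  rw [e1, e2, integral_finsetSum, integral_finsetSum, ← Finset.sum_neg_distrib]
  · refine Finset.sum_congr rfl fun j _ => ?_
    rw [integral_const_mul, integral_const_mul, (h j).2.2 φ hφ k, mul_neg]
  · exact fun j _ => (MemLp.integrable_mul_fun ((h j).2.1 k) (hφ.memLp _)).const_mul _
  · exact fun j _ => (MemLp.integrable_mul_fun (h j).1 ((hφ.partialDeriv k).memLp _)).const_mul _

/-- The source of the factors 8 in the estimates below. -/
theorem measureReal_openCube_le : volume.real openCube ≤ 8 := by
  have h := setLIntegral_openCube (F := fun _ => 1) measurable_const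
  rw [setLIntegral_one, lintegral_one, Measure.pi_univ] at h
  simp only [Measure.restrict_apply MeasurableSet.univ, univ_inter, Real.volume_Ioo,
    Finset.prod_const] at h
  rw [measureReal_def, h]
  norm_num

theorem lintegral_enorm_le_of_integral_sq_le {T : E3 ≃ᵃ[ℝ] E3} {g : E3 → ℝ} {X : ℝ}
    (hg : MemLp g 2 (volume.restrict (T '' openCube)))
    (h : ∫ x in T '' openCube, g x ^ 2 ≤ X) :
    ∫⁻ x in T '' openCube, ‖g x‖ₑ ≤ ENNReal.ofReal (Real.sqrt (8 * affDet T * X)) := by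
  have h1 : MemLp (fun x => |g x|) 2 (volume.restrict (T '' openCube)) := hg.abs
  have h2 := sq_integral_mul_le h1 (memLp_const_cell T 1)
  simp only [mul_one, sq_abs, one_pow] at h2
  rw [setIntegral_affine_image T (fun _ => (1 : ℝ)), integral_const, smul_eq_mul, mul_one,
    measureReal_restrict_apply MeasurableSet.univ, univ_inter] at h2
  have hi : Integrable (fun x => |g x|) (volume.restrict (T '' openCube)) := by
    simpa using MemLp.integrable_mul_fun h1 (memLp_const_cell T 1)
  have e : ∫⁻ x in T '' openCube, ‖g x‖ₑ = ENNReal.ofReal (∫ x in T '' openCube, |g x|) := by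
    rw [ofReal_integral_eq_lintegral_ofReal hi (Filter.Eventually.of_forall fun _ => abs_nonneg _)]
    simp only [Real.enorm_eq_ofReal_abs]
  rw [e]
  refine ENNReal.ofReal_le_ofReal (Real.le_sqrt_of_sq_le (h2.trans ?_))
  have hX : 0 ≤ X := (integral_nonneg fun _ => sq_nonneg _).trans h
  calc _ ≤ X * (affDet T * 8) := by
        gcongr
        · exact mul_nonneg (affDet_pos T).le measureReal_nonneg
        · exact (affDet_pos T).le
        · exact measureReal_openCube_le
    _ = _ := by ring

theorem le_of_forall_integral_mul_le {U : Set E3} (hU : IsOpen U) {v : E3 → ℝ}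
    (hv : ContinuousOn v U) {K : ℝ}
    (h : ∀ φ, IsTestFunction U φ → (∀ x, 0 ≤ φ x) → ∫ x in U, v x * φ x ≤ K * ∫ x in U, φ x)
    {x : E3} (hx : x ∈ U) : v x ≤ K := by
  by_contra hcon
  push Not at hcon
  have hnhds : ∀ᶠ y in nhds x, y ∈ U ∧ K < v y :=
    (hU.eventually_mem hx).and ((hv.continuousAt (hU.mem_nhds hx)).eventually_const_lt hcon)
  obtain ⟨r, hr, hball⟩ := Metric.eventually_nhds_iff_ball.1 hnhds
  let b : ContDiffBump x := ⟨r / 4, r / 2, by positivity, by linarith⟩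
  have hts : tsupport b ⊆ Metric.ball x r := by
    rw [b.tsupport_eq]
    exact Metric.closedBall_subset_ball (by change r / 2 < r; linarith)
  have hb : IsTestFunction U b := ⟨b.contDiff, b.hasCompactSupport, fun y hy => (hball y (hts hy)).1⟩
  have h1 := h b hb fun y => b.nonneg
  have hcont : Continuous fun y => (v y - K) * b y := by
    have hcU : ContinuousOn (fun y => (v y - K) * b y) U :=
      (hv.sub continuousOn_const).mul b.continuous.continuousOn
    rw [continuous_iff_continuousAt]
    intro y
    by_cases hy : y ∈ tsupport b
    · exact hcU.continuousAt (hU.mem_nhds (hball y (hts hy)).1)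
    · have : (fun y => (v y - K) * b y) =ᶠ[nhds y] fun _ => 0 := by
        filter_upwards [(isClosed_tsupport b).isOpen_compl.mem_nhds hy] with z hz
        rw [image_eq_zero_of_notMem_tsupport hz, mul_zero]
      exact continuousAt_const.congr this.symm
  have hcs : HasCompactSupport fun y => (v y - K) * b y := b.hasCompactSupport.mul_left
  have hpos : 0 < ∫ y, (v y - K) * b y := by
    refine hcont.integral_pos_of_hasCompactSupport_nonneg_nonzero hcs (fun y => ?_) (x := x) ?_
    · by_cases hy : y ∈ tsupport b
      · exact mul_nonneg (by linarith [(hball y (hts hy)).2]) b.nonneg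
      · simp [image_eq_zero_of_notMem_tsupport hy]
    · rw [b.one_of_mem_closedBall (Metric.mem_closedBall_self (by change 0 ≤ r / 4; positivity)), mul_one]
      exact (sub_pos.2 hcon).ne'
  have e : ∫ y, (v y - K) * b y = ∫ y in U, (v y - K) * b y := by
    symm
    refine setIntegral_eq_integral_of_forall_compl_eq_zero fun y hy => ?_
    rw [hb.eq_zero hy, mul_zero]
  have i0 : Integrable (fun y => K * b y) (volume.restrict U) :=
    ((b.continuous.integrable_of_hasCompactSupport b.hasCompactSupport).integrableOn).const_mul K
  have i1 : Integrable (fun y => v y * b y) (volume.restrict U) := by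
    have : Integrable (fun y => (v y - K) * b y) (volume.restrict U) :=
      (hcont.integrable_of_hasCompactSupport hcs).integrableOn
    have := this.add i0
    refine this.congr (Filter.Eventually.of_forall fun y => ?_)
    simp only [Pi.add_apply]; ring
  rw [e] at hpos
  simp only [sub_mul] at hpos
  rw [integral_sub i1 i0, integral_const_mul] at hpos
  linarith

/-- The Sobolev embedding by duality. The step in the directions 0, 1, 2 uses only mixed edge
derivatives with each direction at most once. Afterwards the transform of |ξ| is the constant ∫ |ξ|,
so the pairing bound is an L^∞ bound, and continuity makes it pointwise. -/
theorem HasWeakGrad.sq_mul_affDet_le {T : E3 ≃ᵃ[ℝ] E3} {d : ℝ}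
    (hd : ∀ j i, |affEntry T j i| ≤ d) {v : E3 → ℝ} {D1 : Fin 3 → E3 → ℝ}
    {D2 : Fin 3 → Fin 3 → E3 → ℝ} {D3 : Fin 3 → Fin 3 → Fin 3 → E3 → ℝ}
    (h1 : HasWeakGrad (T '' openCube) v D1) (h2 : ∀ j, HasWeakGrad (T '' openCube) (D1 j) (D2 j))
    (h3 : ∀ j k, HasWeakGrad (T '' openCube) (D2 j k) (D3 j k))
    (hv : ContinuousOn v (T '' refCube)) {x : E3} (hx : x ∈ T '' refCube) {X : ℝ}
    (X0 : ∫ x in T '' openCube, v x ^ 2 ≤ X)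
    (X1 : 3 * d ^ 2 * ∑ j, ∫ x in T '' openCube, D1 j x ^ 2 ≤ X)
    (X2 : (3 * d ^ 2) ^ 2 * ∑ j, ∑ k, ∫ x in T '' openCube, D2 j k x ^ 2 ≤ X)
    (X3 : (3 * d ^ 2) ^ 3 * ∑ j, ∑ k, ∑ l, ∫ x in T '' openCube, D3 j k l x ^ 2 ≤ X) :
    v x ^ 2 * affDet T ≤ 512 * lineConst ^ 6 * X := by
  classical
  have hX : 0 ≤ X := (integral_nonneg fun _ => sq_nonneg _).trans X0
  have hdet := affDet_pos T
  have hc : 0 ≤ lineConst := by linarith [two_le_lineConst]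
  set M := Real.sqrt (8 * affDet T * X) with hM
  have hM0 : 0 ≤ M := Real.sqrt_nonneg _
  have hg2 := fun i => HasWeakGrad.edgeDeriv T i h2
  have hg3 := fun i k => HasWeakGrad.edgeDeriv T i fun j => h3 j k
  have hg4 := fun i j => HasWeakGrad.edgeDeriv T j (hg3 i)
  have ie : ∀ (G : Fin 3 → E3 → ℝ), (∀ j, MemLp (G j) 2 (volume.restrict (T '' openCube))) →
      ∀ i, ∫ x in T '' openCube, BrickFEM.edgeDeriv T i G x ^ 2
        ≤ 3 * d ^ 2 * ∑ j, ∫ x in T '' openCube, G j x ^ 2 :=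
    fun G hG i => integral_sq_edgeDeriv_le hd hG i
  have hd3 : 0 ≤ 3 * d ^ 2 := by positivity
  generalize 3 * d ^ 2 = w at ie X1 X2 X3 hd3
  have b1 : ∀ i, ∫ x in T '' openCube, BrickFEM.edgeDeriv T i D1 x ^ 2 ≤ X := fun i =>
    (ie _ h1.2.1 i).trans X1
  have b2 : ∀ i j, ∫ x in T '' openCube,
      BrickFEM.edgeDeriv T j (fun k => BrickFEM.edgeDeriv T i fun j' => D2 j' k) x ^ 2 ≤ X := by
    intro i j
    refine (ie _ (hg2 i).2.1 j).trans (le_trans ?_ X2)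
    rw [sq w, mul_assoc, Finset.sum_comm]
    refine mul_le_mul_of_nonneg_left ?_ hd3
    rw [Finset.mul_sum]
    exact Finset.sum_le_sum fun k _ => ie _ (fun j' => (h2 j').2.1 k) i
  have b3 : ∀ i j k, ∫ x in T '' openCube, BrickFEM.edgeDeriv T k (fun l =>
      BrickFEM.edgeDeriv T j fun k' => BrickFEM.edgeDeriv T i fun j' => D3 j' k' l) x ^ 2
      ≤ X := by
    intro i j k
    refine (ie _ (hg4 i j).2.1 k).trans (le_trans ?_ X3)
    have e : ∑ j, ∑ k, ∑ l, ∫ x in T '' openCube, D3 j k l x ^ 2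
        = ∑ l, ∑ k, ∑ j, ∫ x in T '' openCube, D3 j k l x ^ 2 := by
      rw [Finset.sum_comm]
      simp_rw [Finset.sum_comm (f := fun x y => ∫ z in T '' openCube, D3 x _ y z ^ 2)]
      rw [Finset.sum_comm]
    rw [e, pow_succ' w, mul_assoc]
    refine mul_le_mul_of_nonneg_left ?_ hd3
    rw [Finset.mul_sum]
    refine Finset.sum_le_sum fun l _ => ?_
    refine (ie _ (fun k' => (hg3 i k').2.1 l) j).trans ?_
    rw [sq w, mul_assoc]
    refine mul_le_mul_of_nonneg_left ?_ hd3
    rw [Finset.mul_sum]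
    exact Finset.sum_le_sum fun k _ =>
      ie _ (fun j' => (h3 j' k).2.1 l) i
  have base : ∀ g : E3 → ℝ, MemLp g 2 (volume.restrict (T '' openCube)) →
      ∫ x in T '' openCube, g x ^ 2 ≤ X → PairingBound T id g (ENNReal.ofReal M) := by
    intro g hg hb ξ hξ
    exact (pairingBound_id T g ξ hξ).trans
      (mul_le_mul' (lintegral_enorm_le_of_integral_sq_le hg hb) le_rfl)
  have st1 := fun (g : E3 → ℝ) (G : Fin 3 → E3 → ℝ) (h : HasWeakGrad (T '' openCube) g G)
      (hb : ∫ x in T '' openCube, g x ^ 2 ≤ X)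
      (hb' : ∫ x in T '' openCube, BrickFEM.edgeDeriv T 0 G x ^ 2 ≤ X) =>
    PairingBound.step (B := id) (fun F F' h x => h x) (fun c F _ x => rfl) h 0 (base g h.1 hb)
      (base _ (memLp_edgeDeriv T h.2.1 0) hb')
  have m1 : ∀ F F' : E3 → ENNReal, (∀ x, F x ≤ F' x) →
      ∀ x, id (lineLInt 0 F) x ≤ id (lineLInt 0 F') x := fun F F' h x => lineLInt_mono 0 h x
  have c1 : ∀ (c : ENNReal) (F : E3 → ENNReal), c ≠ ⊤ →
      ∀ x, id (lineLInt 0 fun x => c * F x) x = c * id (lineLInt 0 F) x :=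
    fun c F h x => lineLInt_const_mul 0 h F x
  have m2 : ∀ F F' : E3 → ENNReal, (∀ x, F x ≤ F' x) →
      ∀ x, id (lineLInt 0 (lineLInt 1 F)) x ≤ id (lineLInt 0 (lineLInt 1 F')) x :=
    fun F F' h x => lineLInt_mono 0 (lineLInt_mono 1 h) x
  have c2 : ∀ (c : ENNReal) (F : E3 → ENNReal), c ≠ ⊤ →
      ∀ x, id (lineLInt 0 (lineLInt 1 fun x => c * F x)) x
        = c * id (lineLInt 0 (lineLInt 1 F)) x := fun c F h x => by
    have : lineLInt 1 (fun x => c * F x) = fun x => c * lineLInt 1 F x :=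
      funext fun x => lineLInt_const_mul 1 h F x
    rw [this]
    exact c1 c _ h x
  -- Direction 0 is integrated for v and for its edge derivatives in the directions 1, 2 and both;
  -- these are combined pairwise in direction 1, and the two results in direction 2.
  have p0 := st1 v D1 h1 X0 (b1 0)
  have p1 := st1 _ _ (hg2 1) (b1 1) (b2 1 0)
  have p2 := st1 _ _ (hg2 2) (b1 2) (b2 2 0)
  have p12 := st1 _ _ (hg4 2 1) (b2 2 1) (b3 2 1 0)
  have q0 := PairingBound.step m1 c1 h1 1 p0 p1
  have q2 := PairingBound.step m1 c1 (hg2 2) 1 p2 p12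
  have r0 := PairingBound.step m2 c2 h1 2 q0 q2
  -- Each of the three steps doubles M and contributes `lineConst`; division by `affDet T` turns the
  -- integral of φ over the cube into the one over the cell.
  set K := 8 * lineConst ^ 3 * M / affDet T with hK
  have hK0 : 0 ≤ K := by positivity
  have fin : ∀ φ, IsTestFunction (T '' openCube) φ → (∀ x, 0 ≤ φ x) →
      |∫ x in T '' openCube, v x * φ x| ≤ K * ∫ x in T '' openCube, φ x := by
    intro φ hφ hpos
    have hξ : IsTestFunction openCube fun x => φ (T x) := by
      have := hφ.comp_affine T.symm
      rwa [show T.symm.symm = T from rfl, ← image_comp, show (T.symm : E3 → E3) ∘ T = id by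
        funext x; simp, image_id] at this
    have hr := r0 _ hξ
    simp only [AffineEquiv.apply_symm_apply, id] at hr
    have hmeas : Measurable fun x => ‖φ (T x)‖ₑ := hξ.1.continuous.measurable.enorm
    simp only [lineLInt_lineLInt_lineLInt hmeas, ciSup_const] at hr
    have hint : Integrable (fun x => φ (T x)) (volume.restrict openCube) :=
      (hξ.1.continuous.integrable_of_hasCompactSupport hξ.2.1).integrableOn
    have e1 : ∫⁻ x in openCube, ‖φ (T x)‖ₑ = ENNReal.ofReal (∫ x in openCube, φ (T x)) := by
      rw [ofReal_integral_eq_lintegral_ofReal hint (Filter.Eventually.of_forall fun _ => hpos _)]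
      refine lintegral_congr fun x => ?_
      rw [Real.enorm_eq_ofReal_abs, abs_of_nonneg (hpos _)]
    rw [e1, Real.enorm_eq_ofReal_abs, ← ENNReal.ofReal_add hM0 hM0,
      ← ENNReal.ofReal_mul hc, ← ENNReal.ofReal_add (by positivity) (by positivity),
      ← ENNReal.ofReal_mul hc, ← ENNReal.ofReal_add (by positivity) (by positivity),
      ← ENNReal.ofReal_mul hc, ← ENNReal.ofReal_mul (by positivity),
      ENNReal.ofReal_le_ofReal_iff (mul_nonneg (by positivity) (integral_nonneg fun _ => hpos _))]
      at hr
    rw [setIntegral_affine_image T φ]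
    refine hr.trans (le_of_eq ?_)
    rw [hK]
    field_simp
    ring
  have hvU : ContinuousOn v (T '' openCube) := hv.mono (image_mono openCube_subset_refCube)
  have hU := isOpen_affine_image T
  have up : ∀ y ∈ T '' openCube, v y ^ 2 ≤ K ^ 2 := by
    intro y hy
    have h1 := le_of_forall_integral_mul_le hU hvU (K := K)
      (fun φ hφ hp => (le_abs_self _).trans (fin φ hφ hp)) hy
    have h2 := le_of_forall_integral_mul_le hU (v := fun y => -v y) hvU.neg (K := K) (fun φ hφ hp => by
      simp only [neg_mul, integral_neg]
      exact (neg_le_abs _).trans (fin φ hφ hp)) hy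
    exact sq_le_sq' (by linarith) h1
  have hcl : ContinuousOn (fun y => v y ^ 2) (closure (T '' openCube)) := by
    rw [closure_affine_image]; exact hv.pow 2
  have := le_on_closure up hcl continuousOn_const (by rwa [closure_affine_image])
  calc v x ^ 2 * affDet T ≤ K ^ 2 * affDet T := mul_le_mul_of_nonneg_right this hdet.le
    _ = 64 * lineConst ^ 6 * M ^ 2 / affDet T := by rw [hK]; field_simp; ring
    _ = 512 * lineConst ^ 6 * X := by
      rw [hM, Real.sq_sqrt (by positivity)]; field_simp; ring

/-! ### Functions vanishing on the boundary of a parallelepiped -/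

/-- For u ∈ H¹₀ the smooth factor need not vanish at the boundary: the identity holds for test
functions in place of u, and it survives the limit in the H¹ norm. -/
theorem MemH10.integral_mul_partialDeriv {U : Set E3} (hU : IsOpen U) (hb : Bornology.IsBounded U)
    {u : E3 → ℝ} {D1 : Fin 3 → E3 → ℝ} (h1 : HasWeakGrad U u D1) (h : MemH10 U u)
    {ψ : E3 → ℝ} (hψ : ContDiff ℝ ∞ ψ) (j : Fin 3) :
    ∫ x in U, u x * partialDeriv j ψ x = -∫ x in U, D1 j x * ψ x := by
  have mψ := memLp_of_continuous_of_isBounded hb hψ.continuous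
  have mdψ := memLp_of_continuous_of_isBounded hb (contDiff_partialDeriv j hψ).continuous
  set A := ∫ x in U, partialDeriv j ψ x ^ 2 with hA
  set B := ∫ x in U, ψ x ^ 2 with hB
  have hA0 : 0 ≤ A := integral_nonneg fun _ => sq_nonneg _
  have hB0 : 0 ≤ B := integral_nonneg fun _ => sq_nonneg _
  set X := (∫ x in U, u x * partialDeriv j ψ x) + ∫ x in U, D1 j x * ψ x with hX
  have key : ∀ ε : ℝ, 0 < ε → X ^ 2 ≤ 2 * ε ^ 2 * (A + B) := by
    intro ε hε
    obtain ⟨φ, hφ, hn⟩ := h.2 ε hε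
    have hw := h1.sub hφ.hasWeakGrad
    have hn2 : sobolevNorm U 1 (u - φ) ^ 2 ≤ ε ^ 2 :=
      pow_le_pow_left₀ (sobolevNorm_nonneg _ _ _) hn.le 2
    have n0 : ∫ x in U, (u x - φ x) ^ 2 ≤ ε ^ 2 := by
      refine le_trans (le_of_eq ?_) ((integral_weakDeriv_sq_le (α := 0) (by simp)).trans hn2)
      refine integral_congr_ae ?_
      filter_upwards [(isWeakDeriv_zero (h1.1.sub hφ.hasWeakGrad.1)).weakDeriv_ae_eq hU] with x hx
      rw [hx]; rfl
    have n1 : ∫ x in U, (D1 j x - partialDeriv j φ x) ^ 2 ≤ ε ^ 2 := by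
      refine le_trans (le_of_eq ?_)
        ((integral_weakDeriv_sq_le (α := Pi.single j 1) (by simp)).trans hn2)
      refine integral_congr_ae ?_
      filter_upwards [hw.weakDeriv_ae_eq hU j] with x hx
      have : weakDeriv U (Pi.single j 1) (u - φ) x = D1 j x - partialDeriv j φ x := hx
      rw [this]
    have s0 := sq_integral_mul_le hw.1 mdψ
    have s1 := sq_integral_mul_le (hw.2.1 j) mψ
    have z : (∫ x in U, φ x * partialDeriv j ψ x) + ∫ x in U, partialDeriv j φ x * ψ x = 0 := by
      have := BrickFEM.integral_mul_partialDeriv hψ hφ.1 hφ.2.1 j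
      rw [← setIntegral_univ, ← setIntegral_univ (f := fun x => partialDeriv j ψ x * φ x),
        setIntegral_mul_isTestFunction (subset_univ U) MeasurableSet.univ _ (hφ.partialDeriv j),
        setIntegral_mul_isTestFunction (subset_univ U) MeasurableSet.univ _ hφ] at this
      simp only [mul_comm (φ _), mul_comm (partialDeriv j φ _), this]
      ring
    have e : X = (∫ x in U, (u x - φ x) * partialDeriv j ψ x)
        + ∫ x in U, (D1 j x - partialDeriv j φ x) * ψ x := by
      simp only [sub_mul]
      rw [integral_sub (MemLp.integrable_mul_fun h1.1 mdψ)
        (MemLp.integrable_mul_fun hφ.hasWeakGrad.1 mdψ),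
        integral_sub (MemLp.integrable_mul_fun (h1.2.1 j) mψ)
        (MemLp.integrable_mul_fun (hφ.hasWeakGrad.2.1 j) mψ), hX]
      linarith
    rw [e]
    have t0 := s0.trans (mul_le_mul_of_nonneg_right n0 hA0)
    have t1 := s1.trans (mul_le_mul_of_nonneg_right n1 hB0)
    nlinarith [sq_nonneg ((∫ x in U, (u x - φ x) * partialDeriv j ψ x)
        - ∫ x in U, (D1 j x - partialDeriv j φ x) * ψ x)]
  have hX0 : X ^ 2 ≤ 0 := by
    refine le_of_forall_pos_le_add fun δ hδ => ?_
    have hpos : 0 < 2 * (A + B) + 1 := by positivity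
    have := key (Real.sqrt (δ / (2 * (A + B) + 1))) (Real.sqrt_pos.2 (by positivity))
    rw [Real.sq_sqrt (by positivity)] at this
    calc X ^ 2 ≤ _ := this
      _ = δ * ((2 * (A + B)) / (2 * (A + B) + 1)) := by ring
      _ ≤ δ * 1 := by
        gcongr
        rw [div_le_one hpos]; linarith
      _ = 0 + δ := by ring
  have : X = 0 := by nlinarith
  linarith

/-- Integration by parts in direction `i`, on the image of the cube under `S`, against the smooth
functions which vanish near the faces in the directions of `J`. -/
def EdgeIBP (S : E3 ≃ᵃ[ℝ] E3) (J : Finset (Fin 3)) (i : Fin 3) (g H : E3 → ℝ) : Prop :=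
  ∀ ψ : E3 → ℝ, ContDiff ℝ ∞ ψ → (∀ j ∈ J, ∃ r < 1, ∀ x : E3, r < |x j| → ψ x = 0) →
    ∫ x in S '' openCube, g x * partialDeriv i ψ (S.symm x)
      = -∫ x in S '' openCube, H x * ψ (S.symm x)

theorem memLp_comp_symm (S : E3 ≃ᵃ[ℝ] E3) {ψ : E3 → ℝ} (hψ : Continuous ψ) :
    MemLp (fun x => ψ (S.symm x)) 2 (volume.restrict (S '' openCube)) :=
  memLp_of_continuous_of_isBounded (isBounded_affine_image S)
    (hψ.comp (continuous_affine S.symm))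

theorem HasWeakGrad.edgeIBP {S : E3 ≃ᵃ[ℝ] E3} {g : E3 → ℝ} {G : Fin 3 → E3 → ℝ}
    (h : HasWeakGrad (S '' openCube) g G) (i : Fin 3) :
    EdgeIBP S Finset.univ i g (BrickFEM.edgeDeriv S i G) := by
  intro ψ hψ hr
  choose r hr1 hr2 using fun j => hr j (Finset.mem_univ j)
  have ht : IsTestFunction openCube ψ := by
    refine VanishesOff.isTestFunction hψ (r := max (r 0) (max (r 1) (r 2)))
      (max_lt (hr1 0) (max_lt (hr1 1) (hr1 2))) fun x ⟨j, hj⟩ => hr2 j x (lt_of_le_of_lt ?_ hj)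
    fin_cases j <;> simp
  have := h.integral_mul_edgeDeriv S i (ht.comp_affine S)
  simpa only [edgeDeriv_comp_symm hψ S i] using this

theorem MemH10.edgeIBP {S : E3 ≃ᵃ[ℝ] E3} {u : E3 → ℝ} {D1 : Fin 3 → E3 → ℝ}
    (h1 : HasWeakGrad (S '' openCube) u D1) (h : MemH10 (S '' openCube) u) (i : Fin 3) :
    EdgeIBP S ∅ i u (BrickFEM.edgeDeriv S i D1) := by
  intro ψ hψ _
  have hb := isBounded_affine_image S
  have hψ' : ContDiff ℝ ∞ fun x => ψ (S.symm x) := hψ.comp (contDiff_affine S.symm)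
  have := BrickFEM.integral_mul_edgeDeriv S h1.1 h1.2.1
    (memLp_of_continuous_of_isBounded hb hψ'.continuous) (fun j =>
    memLp_of_continuous_of_isBounded hb (contDiff_partialDeriv j hψ').continuous)
    (fun j => h.integral_mul_partialDeriv (isOpen_affine_image S) hb h1 hψ' j) i
  simpa only [edgeDeriv_comp_symm hψ S i] using this

/-- Smooth cutoff functions on the line, exhausting `(-1, 1)`. -/
def lineCutoff (n : ℕ) (t : ℝ) : ℝ := Real.smoothTransition (((n : ℝ) + 2) * (1 - t ^ 2) - 1)

theorem contDiff_lineCutoff (n : ℕ) : ContDiff ℝ ∞ (lineCutoff n) :=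
  Real.smoothTransition.contDiff.comp
    ((contDiff_const.mul (contDiff_const.sub (contDiff_id.pow 2))).sub contDiff_const)

theorem abs_lineCutoff_le (n : ℕ) (t : ℝ) : |lineCutoff n t| ≤ 1 := by
  rw [lineCutoff, abs_of_nonneg (Real.smoothTransition.nonneg _)]
  exact Real.smoothTransition.le_one _

theorem lineCutoff_eq_zero (n : ℕ) : ∃ r < 1, ∀ t : ℝ, r < |t| → lineCutoff n t = 0 := by
  have hn : (0 : ℝ) < (n : ℝ) + 2 := by positivity
  refine ⟨Real.sqrt (1 - 1 / ((n : ℝ) + 2)), ?_, fun t ht => ?_⟩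
  · rw [Real.sqrt_lt' one_pos]
    have : 0 < 1 / ((n : ℝ) + 2) := by positivity
    linarith
  · refine Real.smoothTransition.zero_of_nonpos ?_
    have h := Real.lt_sq_of_sqrt_lt ht
    rw [sq_abs] at h
    have : ((n : ℝ) + 2) * (1 - t ^ 2) ≤ ((n : ℝ) + 2) * (1 / ((n : ℝ) + 2)) := by
      gcongr; linarith
    rw [mul_one_div_cancel hn.ne'] at this
    linarith

theorem tendsto_lineCutoff {t : ℝ} (ht : |t| < 1) :
    Filter.Tendsto (fun n => lineCutoff n t) Filter.atTop (nhds 1) := by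
  have h1 : 0 < 1 - t ^ 2 := by
    have := (sq_lt_one_iff_abs_lt_one t).2 ht
    linarith
  refine tendsto_const_nhds.congr' ?_
  filter_upwards [Filter.eventually_ge_atTop ⌈2 / (1 - t ^ 2)⌉₊] with n hn
  refine (Real.smoothTransition.one_of_one_le ?_).symm
  have h2 : 2 / (1 - t ^ 2) ≤ (n : ℝ) := (Nat.le_ceil _).trans (by exact_mod_cast hn)
  rw [div_le_iff₀ h1] at h2
  nlinarith

theorem tendsto_integral_lineCutoff {S : E3 ≃ᵃ[ℝ] E3} {g : E3 → ℝ}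
    (hg : MemLp g 2 (volume.restrict (S '' openCube))) {F : E3 → ℝ} (hF : Continuous F)
    (j : Fin 3) :
    Filter.Tendsto (fun n => ∫ x in S '' openCube,
      g x * (lineCutoff n (S.symm x j) * F (S.symm x))) Filter.atTop
      (nhds (∫ x in S '' openCube, g x * F (S.symm x))) := by
  have hFm := memLp_comp_symm S hF
  refine tendsto_integral_of_dominated_convergence (fun x => |g x * F (S.symm x)|) ?_
    (MemLp.integrable_mul_fun hg hFm).abs ?_ ?_
  · intro n
    refine hg.1.mul (((contDiff_lineCutoff n).continuous.comp
      ((continuous_coord j).comp (continuous_affine S.symm))).aestronglyMeasurable.mul hFm.1)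
  · intro n
    refine Filter.Eventually.of_forall fun x => ?_
    rw [Real.norm_eq_abs, abs_mul, abs_mul, abs_mul]
    have := abs_lineCutoff_le n (S.symm x j)
    gcongr
    exact mul_le_of_le_one_left (abs_nonneg _) this
  · rw [ae_restrict_iff' (isOpen_affine_image S).measurableSet]
    refine Filter.Eventually.of_forall fun x hx => ?_
    obtain ⟨y, hy, rfl⟩ := hx
    have := ((tendsto_lineCutoff (hy j)).mul_const (F y)).const_mul (g (S y))
    simpa using this

/-- A cutoff in the coordinate j ≠ i is constant in direction i, so the product rule produces no
extra term; the cutoffs exhaust the cube and dominated convergence removes them. Only the faces met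
by the direction of integration matter. -/
theorem EdgeIBP.erase {S : E3 ≃ᵃ[ℝ] E3} {J : Finset (Fin 3)} {i j : Fin 3} (hij : i ≠ j)
    {g H : E3 → ℝ} (hg : MemLp g 2 (volume.restrict (S '' openCube)))
    (hH : MemLp H 2 (volume.restrict (S '' openCube))) (h : EdgeIBP S J i g H) :
    EdgeIBP S (J.erase j) i g H := by
  intro ψ hψ hr
  have hc : ∀ n, ContDiff ℝ ∞ fun x : E3 => lineCutoff n (x j) := fun n =>
    (contDiff_lineCutoff n).comp (contDiff_coord j)
  have key : ∀ n, ∫ x in S '' openCube, g x * (lineCutoff n (S.symm x j) *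
      partialDeriv i ψ (S.symm x))
      = -∫ x in S '' openCube, H x * (lineCutoff n (S.symm x j) * ψ (S.symm x)) := by
    intro n
    have := h (fun x => lineCutoff n (x j) * ψ x) ((hc n).mul hψ) ?_
    · simpa only [partialDeriv_mul (hc n) hψ, partialDeriv_comp_coord (contDiff_lineCutoff n),
        if_neg hij, zero_mul, zero_add] using this
    · intro k hk
      by_cases hkj : k = j
      · subst hkj
        obtain ⟨r, h1, h2⟩ := lineCutoff_eq_zero n
        exact ⟨r, h1, fun x hx => by rw [h2 _ hx, zero_mul]⟩
      · obtain ⟨r, h1, h2⟩ := hr k (Finset.mem_erase.2 ⟨hkj, hk⟩)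
        exact ⟨r, h1, fun x hx => by rw [h2 _ hx, mul_zero]⟩
  have l1 := tendsto_integral_lineCutoff hg (contDiff_partialDeriv i hψ).continuous j
  have l2 := (tendsto_integral_lineCutoff hH hψ.continuous j).neg
  simp only [key] at l1
  exact tendsto_nhds_unique l1 l2

theorem partialDeriv_eq_zero_of_abs_gt {ψ : E3 → ℝ} {r : ℝ} {j : Fin 3}
    (h : ∀ x : E3, r < |x j| → ψ x = 0) (i : Fin 3) {x : E3} (hx : r < |x j|) :
    partialDeriv i ψ x = 0 := by
  have : ψ =ᶠ[nhds x] fun _ => 0 := by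
    filter_upwards [(isOpen_lt continuous_const (continuous_coord j).abs).mem_nhds hx] with y hy
      using h y hy
  rw [partialDeriv, this.fderiv_eq]
  simp

/-- For `u ∈ H¹₀` with mixed derivatives in `L²`, integration by parts holds up to the boundary for
the mixed derivatives, too. -/
theorem MemH10.exists_edgeIBP {S : E3 ≃ᵃ[ℝ] E3} {u : E3 → ℝ} {D1 : Fin 3 → E3 → ℝ}
    {D2 : Fin 3 → Fin 3 → E3 → ℝ} {D3 : Fin 3 → Fin 3 → Fin 3 → E3 → ℝ}
    (h1 : HasWeakGrad (S '' openCube) u D1) (h2 : ∀ j, HasWeakGrad (S '' openCube) (D1 j) (D2 j))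
    (h3 : ∀ j k, HasWeakGrad (S '' openCube) (D2 j k) (D3 j k)) (h : MemH10 (S '' openCube) u) :
    ∃ g g' g'' : E3 → ℝ, MemLp g'' 2 (volume.restrict (S '' openCube)) ∧
      EdgeIBP S ∅ 0 u g ∧ EdgeIBP S ∅ 1 g g' ∧ EdgeIBP S ∅ 2 g' g'' := by
  have A := fun i => h.edgeIBP h1 i
  have w2 := fun i => HasWeakGrad.edgeDeriv S i h2
  have w3 := fun i k => HasWeakGrad.edgeDeriv S i fun j => h3 j k
  have w4 := HasWeakGrad.edgeDeriv S 0 (w3 2)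
  have m1 := fun i => memLp_edgeDeriv S h1.2.1 i
  -- Interior weak derivatives require ψ to vanish near all faces; the condition is dropped for the
  -- directions 1 and 2 and stays for the direction 0 of differentiation.
  have P1 : EdgeIBP S {0} 0 (BrickFEM.edgeDeriv S 1 D1) _ :=
    (((w2 1).edgeIBP 0).erase (j := 1) (by decide) (w2 1).1
      (memLp_edgeDeriv S (w2 1).2.1 0)).erase (j := 2) (by decide) (w2 1).1
      (memLp_edgeDeriv S (w2 1).2.1 0)
  have P2 : EdgeIBP S {0} 0 (BrickFEM.edgeDeriv S 2 D1) _ :=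
    (((w2 2).edgeIBP 0).erase (j := 1) (by decide) (w2 2).1
      (memLp_edgeDeriv S (w2 2).2.1 0)).erase (j := 2) (by decide) (w2 2).1
      (memLp_edgeDeriv S (w2 2).2.1 0)
  have P3 := ((w4.edgeIBP 1).erase (j := 0) (by decide) w4.1
      (memLp_edgeDeriv S w4.2.1 1)).erase (j := 2) (by decide) w4.1
      (memLp_edgeDeriv S w4.2.1 1)
  have B : EdgeIBP S ∅ 1 (BrickFEM.edgeDeriv S 0 D1)
      (BrickFEM.edgeDeriv S 0 fun k => BrickFEM.edgeDeriv S 1 fun j => D2 j k) := by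
    refine EdgeIBP.erase (J := {0}) (j := 0) (by decide) (m1 0)
      (memLp_edgeDeriv S (w2 1).2.1 0) ?_
    -- Both first derivatives reach the boundary, so that ∫ D₀u ∂₁ψ = −∫ u ∂₀∂₁ψ = ∫ D₁u ∂₀ψ. In the
    -- last form `P1` applies, since ψ vanishes near the 0-faces; that condition is then erased
    -- because the identity concerns direction 1.
    intro ψ hψ hr
    have e1 := A 0 _ (contDiff_partialDeriv 1 hψ) (by simp)
    have e2 := A 1 _ (contDiff_partialDeriv 0 hψ) (by simp)
    have e3 := P1 ψ hψ hr
    rw [partialDeriv_comm 0 1 hψ] at e1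
    linarith
  refine ⟨_, _, BrickFEM.edgeDeriv S 1 fun k => BrickFEM.edgeDeriv S 0 fun j =>
    BrickFEM.edgeDeriv S 2 fun j_1 => D3 j_1 j k, ?_, A 0, B, ?_⟩
  · exact memLp_edgeDeriv S w4.2.1 1
  refine EdgeIBP.erase (J := {1}) (j := 1) (by decide) (memLp_edgeDeriv S (w2 1).2.1 0)
    (memLp_edgeDeriv S w4.2.1 1) (EdgeIBP.erase (J := {0, 1}) (j := 0) (by decide)
    (memLp_edgeDeriv S (w2 1).2.1 0) (memLp_edgeDeriv S w4.2.1 1) ?_)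
  -- The same exchange one order higher: ∫ D₀₁u ∂₂ψ is carried back to u and forward again through
  -- D₂u. This needs ψ to vanish near the 0- and 1-faces, and both conditions can be erased because
  -- the identity concerns direction 2.
  intro ψ hψ hr
  have c2 := contDiff_partialDeriv 2 hψ
  have c1 := contDiff_partialDeriv 1 hψ
  have e1 := B _ c2 (by simp)
  have e2 := A 0 _ (contDiff_partialDeriv 1 c2) (by simp)
  have e3 := A 2 _ (contDiff_partialDeriv 0 c1) (by simp)
  have e4 := P2 _ c1 (by
    intro j hj
    obtain ⟨r, hr1, hr2⟩ := hr j (by simp at hj; simp [hj])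
    exact ⟨r, hr1, fun x hx => partialDeriv_eq_zero_of_abs_gt hr2 1 hx⟩)
  have e5 := P3 ψ hψ (fun j hj => hr j (by revert hj; fin_cases j <;> decide))
  have comm : partialDeriv 0 (partialDeriv 1 (partialDeriv 2 ψ))
      = partialDeriv 2 (partialDeriv 0 (partialDeriv 1 ψ)) := by
    rw [partialDeriv_comm 1 2 hψ, partialDeriv_comm 0 2 c1]
  rw [comm] at e2
  linarith

/-! ### Iterated integrals over the cube -/

theorem measurePreserving_openCube : MeasurePreserving
    (fun p : ℝ × ℝ × ℝ => (!₂[p.2.1, p.2.2, p.1] : E3))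
    ((volume.restrict (Ioo (-1) 1)).prod ((volume.restrict (Ioo (-1) 1)).prod
      (volume.restrict (Ioo (-1) 1)))) (volume.restrict openCube) := by
  set μ : Measure ℝ := volume.restrict (Ioo (-1) 1) with hμ
  have h1 := (measurePreserving_piFinSuccAbove (fun _ : Fin 3 => μ) 2).symm
  have h2 := (measurePreserving_finTwoArrow μ).symm
  have h3 : MeasurePreserving (WithLp.toLp 2 : (Fin 3 → ℝ) → E3) (Measure.pi fun _ => μ)
      (volume.restrict openCube) := by
    have e : (Measure.pi fun _ : Fin 3 => μ)
        = volume.restrict ((WithLp.toLp 2 : (Fin 3 → ℝ) → E3) ⁻¹' openCube) := by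
      rw [hμ, ← Measure.restrict_pi_pi, ← volume_pi]
      congr 1
      ext y
      simp [openCube, abs_lt]
    rw [e]
    exact (PiLp.volume_preserving_toLp (Fin 3)).restrict_preimage isOpen_openCube.measurableSet
  have h4 := (h3.comp h1).comp ((MeasurePreserving.id μ).prod h2)
  convert h4 using 1
  funext p
  ext j
  fin_cases j <;> rfl

theorem measurableEmbedding_vec :
    MeasurableEmbedding (fun p : ℝ × ℝ × ℝ => (!₂[p.2.1, p.2.2, p.1] : E3)) := by
  have hm : Measurable (fun p : ℝ × ℝ × ℝ => (!₂[p.2.1, p.2.2, p.1] : E3)) := by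
    refine (PiLp.volume_preserving_toLp (Fin 3)).measurable.comp (measurable_pi_lambda _ fun j => ?_)
    fin_cases j
    · exact measurable_snd.fst
    · exact measurable_snd.snd
    · exact measurable_fst
  refine MeasurableEmbedding.of_measurable_inverse (g := fun x : E3 => (x 2, x 0, x 1)) hm ?_ ?_ ?_
  · have : range (fun p : ℝ × ℝ × ℝ => (!₂[p.2.1, p.2.2, p.1] : E3)) = univ := by
      refine eq_univ_of_forall fun x => ⟨(x 2, x 0, x 1), ?_⟩
      ext j; fin_cases j <;> rfl
    rw [this]; exact MeasurableSet.univ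
  · exact ((continuous_coord 2).measurable).prodMk
      (((continuous_coord 0).measurable).prodMk (continuous_coord 1).measurable)
  · intro p; rfl

theorem setIntegral_openCube {F : E3 → ℝ} (hF : IntegrableOn F openCube) :
    ∫ x in openCube, F x
      = ∫ t₂ in (-1 : ℝ)..1, ∫ t₁ in (-1 : ℝ)..1, ∫ t₀ in (-1 : ℝ)..1, F !₂[t₀, t₁, t₂] := by
  have hp := measurePreserving_openCube
  have hi : Integrable (fun p : ℝ × ℝ × ℝ => F !₂[p.2.1, p.2.2, p.1]) _ :=
    (hp.integrable_comp_emb measurableEmbedding_vec (g := F)).2 hF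
  rw [← hp.integral_comp measurableEmbedding_vec F, integral_prod _ hi,
    intervalIntegral.integral_of_le (by norm_num), ← restrict_Ioo_eq_restrict_Ioc]
  refine integral_congr_ae ?_
  filter_upwards [hi.prod_right_ae] with t₂ ht
  rw [integral_prod_symm _ ht, intervalIntegral.integral_of_le (by norm_num),
    ← restrict_Ioo_eq_restrict_Ioc]
  refine integral_congr_ae (Filter.Eventually.of_forall fun t₁ => ?_)
  simp only
  rw [intervalIntegral.integral_of_le (by norm_num), ← restrict_Ioo_eq_restrict_Ioc]

/-! ### A continuous representative -/

open Classical in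
/-- The integral of `w` over the part of the cube below `y`. -/
def lowerIntegral (w : E3 → ℝ) (y : E3) : ℝ :=
  ∫ x in openCube, if ∀ i, x i ≤ y i then w x else 0

theorem volume_hyperplane (i : Fin 3) (c : ℝ) : volume {x : E3 | x i = c} = 0 := by
  have h := (PiLp.volume_preserving_ofLp (Fin 3)).measure_preimage
    (s := {y : Fin 3 → ℝ | y i = c})
    (measurableSet_eq_fun (measurable_pi_apply i) measurable_const).nullMeasurableSet
  have h2 : volume {y : Fin 3 → ℝ | y i = c} = 0 := by
    rw [volume_pi]; exact Measure.pi_hyperplane (fun _ : Fin 3 => (volume : Measure ℝ)) i c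
  rw [h2] at h
  exact h

/-- Dominated convergence: for fixed x, the indicator jumps at y only if x lies on one of the three
hyperplanes through y, a null set. -/
theorem continuous_lowerIntegral {w : E3 → ℝ} (hw : IntegrableOn w openCube) :
    Continuous (lowerIntegral w) := by
  classical
  rw [continuous_iff_continuousAt]
  intro y
  refine continuousAt_of_dominated (bound := fun x => ‖w x‖) ?_ ?_ hw.norm ?_
  · refine Filter.Eventually.of_forall fun z => ?_
    have hm : MeasurableSet {x : E3 | ∀ i, x i ≤ z i} := by
      have : {x : E3 | ∀ i, x i ≤ z i} = ⋂ i, {x : E3 | x i ≤ z i} := by ext; simp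
      rw [this]
      exact MeasurableSet.iInter fun i => measurableSet_le (continuous_coord i).measurable
        measurable_const
    exact (hw.1.indicator hm).congr (Filter.Eventually.of_forall fun x => by
      simp [indicator])
  · refine Filter.Eventually.of_forall fun z => Filter.Eventually.of_forall fun x => ?_
    split_ifs
    · exact le_rfl
    · simp
  · have hae : ∀ i, ∀ᵐ x ∂(volume.restrict openCube), x i ≠ y i := fun i =>
      ae_restrict_of_ae (by
        have := volume_hyperplane i (y i)
        exact measure_eq_zero_iff_ae_notMem.1 this)
    filter_upwards [hae 0, hae 1, hae 2] with x h0 h1 h2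
    have hne : ∀ i, x i ≠ y i := by intro i; fin_cases i <;> assumption
    have hev : ∀ i, ∀ᶠ z : E3 in nhds y, (x i ≤ z i ↔ x i ≤ y i) := by
      intro i
      have hc := (continuous_coord i).continuousAt (x := y)
      rcases lt_or_gt_of_ne (hne i) with h | h
      · filter_upwards [hc.eventually_const_lt h] with z hz
        exact ⟨fun _ => h.le, fun _ => hz.le⟩
      · filter_upwards [hc.eventually_lt_const h] with z hz
        exact ⟨fun h' => absurd h' (not_le.2 hz), fun h' => absurd h' (not_le.2 h)⟩
    have : (fun z : E3 => if ∀ i, x i ≤ z i then w x else 0)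
        =ᶠ[nhds y] fun _ => if ∀ i, x i ≤ y i then w x else 0 := by
      filter_upwards [Filter.eventually_all.2 hev] with z hz
      simp only [hz]
    exact continuousAt_const.congr this.symm

theorem lowerIntegral_eq_zero {w : E3 → ℝ} {y : E3} {i : Fin 3} (hy : y i = -1) :
    lowerIntegral w y = 0 := by
  classical
  rw [lowerIntegral, setIntegral_congr_fun (g := fun _ => (0 : ℝ)) isOpen_openCube.measurableSet,
    integral_zero]
  intro x hx
  simp only
  rw [if_neg]
  intro h
  have h1 := h i
  have h2 := (abs_lt.1 (hx i)).1
  linarith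

/-- The primitive along lines which vanishes on the upper face of the cube. -/
theorem lineLift_one_eq {η : E3 → ℝ} (hη : Continuous η) (i : Fin 3) {x : E3} (hx : |x i| ≤ 1) :
    lineLift (fun _ => 1) i η x
      = -∫ t in (-1 : ℝ)..1, if x i ≤ t then η (setCoord i t x) else 0 := by
  have hc : Continuous fun t => η (setCoord i t x) := hη.comp (continuous_setCoord i x)
  have hx' := abs_le.1 hx
  have e1 : ∫ t in (-1 : ℝ)..(x i), (if x i ≤ t then η (setCoord i t x) else 0) = 0 := by
    rw [intervalIntegral.integral_congr_ae (g := fun _ => (0 : ℝ)), intervalIntegral.integral_zero]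
    have : ∀ᵐ t : ℝ, t ≠ x i := by simp [ae_iff]
    filter_upwards [this] with t ht hmem
    rw [uIoc_of_le hx'.1] at hmem
    rw [if_neg (not_le.2 (lt_of_le_of_ne hmem.2 ht))]
  have e2 : ∫ t in (x i)..1, (if x i ≤ t then η (setCoord i t x) else 0)
      = ∫ t in (x i)..1, η (setCoord i t x) := by
    refine intervalIntegral.integral_congr fun t ht => ?_
    rw [uIcc_of_le hx'.2] at ht
    simp only [if_pos ht.1]
  have i1 : IntervalIntegrable (fun t => if x i ≤ t then η (setCoord i t x) else 0) volume (-1)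
      (x i) := by
    rw [intervalIntegrable_iff]
    exact ((intervalIntegrable_iff.1 (hc.intervalIntegrable (-1) (x i))).indicator
      (measurableSet_Ici (a := x i))).congr (Filter.Eventually.of_forall fun t => by
        simp [indicator])
  have i2 : IntervalIntegrable (fun t => if x i ≤ t then η (setCoord i t x) else 0) volume (x i)
      1 := by
    rw [intervalIntegrable_iff]
    exact ((intervalIntegrable_iff.1 (hc.intervalIntegrable (x i) 1)).indicator
      (measurableSet_Ici (a := x i))).congr (Filter.Eventually.of_forall fun t => by
        simp [indicator])
  rw [← intervalIntegral.integral_add_adjacent_intervals i1 i2, e1, e2, lineLift, linePrim, lineInt,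
    ← intervalIntegral.integral_add_adjacent_intervals (hc.intervalIntegrable (-1) (x i))
      (hc.intervalIntegrable (x i) 1)]
  ring

/-- For constant Θ = 1 each lift is minus the integral over the part of the line beyond the point,
so three lifts give the integral over the upper box with sign (−1)³. -/
theorem lineLift_lineLift_lineLift {η : E3 → ℝ} (hη : ContDiff ℝ ∞ η) {x : E3}
    (hx : x ∈ openCube) :
    lineLift (fun _ => 1) 2 (lineLift (fun _ => 1) 1 (lineLift (fun _ => 1) 0 η)) x
      = -∫ y in openCube, if ∀ i, x i ≤ y i then η y else 0 := by
  classical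
  have hm : MeasurableSet {y : E3 | ∀ i, x i ≤ y i} := by
    have : {y : E3 | ∀ i, x i ≤ y i} = ⋂ i, {y : E3 | x i ≤ y i} := by ext; simp
    rw [this]
    exact MeasurableSet.iInter fun i => measurableSet_le measurable_const
      (continuous_coord i).measurable
  have hint : IntegrableOn (fun y => if ∀ i, x i ≤ y i then η y else 0) openCube := by
    have h0 : IntegrableOn η openCube :=
      ((hη.continuous.continuousOn (s := refCube)).integrableOn_compact isCompact_refCube).mono_set
        openCube_subset_refCube
    exact (h0.indicator hm).congr (Filter.Eventually.of_forall fun y => by simp [indicator])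
  have c0 := contDiff_lineLift (Θ := fun _ => 1) contDiff_const 0 hη
  have c1 := contDiff_lineLift (Θ := fun _ => 1) contDiff_const 1 c0
  rw [setIntegral_openCube hint, lineLift_one_eq c1.continuous 2 (hx 2).le]
  congr 1
  refine intervalIntegral.integral_congr fun t₂ _ => ?_
  simp only
  rw [lineLift_one_eq c0.continuous 1 (by rw [setCoord_of_ne (by decide)]; exact (hx 1).le)]
  by_cases h2 : x 2 ≤ t₂
  · rw [if_pos h2, ← intervalIntegral.integral_neg]
    refine intervalIntegral.integral_congr fun t₁ _ => ?_
    simp only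
    rw [lineLift_one_eq hη.continuous 0 (by
      rw [setCoord_of_ne (by decide), setCoord_of_ne (by decide)]; exact (hx 0).le)]
    by_cases h1 : x 1 ≤ t₁
    · rw [if_pos (by rwa [setCoord_of_ne (by decide)]), neg_neg]
      refine intervalIntegral.integral_congr fun t₀ _ => ?_
      have e : setCoord 0 t₀ (setCoord 1 t₁ (setCoord 2 t₂ x)) = !₂[t₀, t₁, t₂] := by
        ext j; fin_cases j <;> simp [setCoord]
      simp only [e]
      rw [setCoord_of_ne (by decide), setCoord_of_ne (by decide)]
      simp [Fin.forall_fin_succ, h1, h2]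
    · rw [if_neg (by rwa [setCoord_of_ne (by decide)]), neg_zero]
      simp [Fin.forall_fin_succ, h1]
  · rw [if_neg h2]
    simp [Fin.forall_fin_succ, h2]

theorem integrableOn_comp_affine {S : E3 ≃ᵃ[ℝ] E3} {g : E3 → ℝ}
    (hg : IntegrableOn g (S '' openCube)) : IntegrableOn (fun x => g (S x)) openCube := by
  have h := (integrableOn_image_iff_integrableOn_abs_det_fderiv_smul volume
    isOpen_openCube.measurableSet
    (fun x _ => (hasFDerivAt_affine S x).hasFDerivWithinAt) S.injective.injOn g).1 hg
  have h2 := h.const_mul (affDet S)⁻¹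
  refine Integrable.congr h2 (Filter.Eventually.of_forall fun x => ?_)
  have : (affDet S)⁻¹ * (affDet S * g (S x)) = g (S x) := by
    rw [← mul_assoc, inv_mul_cancel₀ (affDet_pos S).ne', one_mul]
  exact this

/-- Write a test function as ∂₀∂₁∂₂ of its triple lift. The lift is not compactly supported in the
cube, which is why integration by parts up to the boundary was needed. After three integrations by
parts, Fubini turns the integral of φ over the box above x into the integral of the mixed derivative
over the box below y. -/
theorem MemH10.exists_ae_eq_lowerIntegral {S : E3 ≃ᵃ[ℝ] E3} {u : E3 → ℝ} {D1 : Fin 3 → E3 → ℝ}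
    {D2 : Fin 3 → Fin 3 → E3 → ℝ} {D3 : Fin 3 → Fin 3 → Fin 3 → E3 → ℝ}
    (h1 : HasWeakGrad (S '' openCube) u D1) (h2 : ∀ j, HasWeakGrad (S '' openCube) (D1 j) (D2 j))
    (h3 : ∀ j k, HasWeakGrad (S '' openCube) (D2 j k) (D3 j k)) (h : MemH10 (S '' openCube) u) :
    ∃ w, IntegrableOn w openCube ∧
      u =ᵐ[volume.restrict (S '' openCube)] fun x => lowerIntegral w (S.symm x) := by
  classical
  obtain ⟨g, g', g'', hg, e1, e2, e3⟩ := h.exists_edgeIBP h1 h2 h3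
  have hfin : IsFiniteMeasure (volume.restrict (S '' openCube)) :=
    ⟨by simpa using (isBounded_affine_image S).measure_lt_top⟩
  have hw : IntegrableOn (fun x => g'' (S x)) openCube :=
    integrableOn_comp_affine (hg.integrable (by norm_num))
  refine ⟨fun x => g'' (S x), hw, ?_⟩
  refine ae_eq_of_forall_isTestFunction (isOpen_affine_image S) h1.1
    (memLp_comp_symm S (continuous_lowerIntegral hw)) fun φ hφ => ?_
  have hη : ContDiff ℝ ∞ fun x => φ (S x) := hφ.1.comp (contDiff_affine S)
  set η : E3 → ℝ := fun x => φ (S x) with hηd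
  have hc : ∀ i (ζ : E3 → ℝ), ContDiff ℝ ∞ ζ →
      partialDeriv i (lineLift (fun _ => 1) i ζ) = ζ := fun i ζ hζ => by
    funext x
    rw [partialDeriv_lineLift contDiff_const i hζ]
    simp [lineMean]
  have c0 := contDiff_lineLift (Θ := fun _ => 1) contDiff_const 0 hη
  have c1 := contDiff_lineLift (Θ := fun _ => 1) contDiff_const 1 c0
  have c2 := contDiff_lineLift (Θ := fun _ => 1) contDiff_const 2 c1
  have a1 := e1 _ c0 (by simp)
  have a2 := e2 _ c1 (by simp)
  have a3 := e3 _ c2 (by simp)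
  rw [hc 0 _ hη] at a1
  rw [hc 1 _ c0] at a2
  rw [hc 2 _ c1] at a3
  have l : ∫ x in S '' openCube, u x * φ x = ∫ x in S '' openCube, u x * η (S.symm x) := by
    simp [hηd]
  rw [l, a1, a2, a3, setIntegral_affine_image, setIntegral_affine_image]
  simp only [neg_neg, AffineEquiv.symm_apply_apply]
  rw [← mul_neg, ← integral_neg]
  congr 1
  have hηi : IntegrableOn η openCube :=
    ((hη.continuous.continuousOn (s := refCube)).integrableOn_compact isCompact_refCube).mono_set
      openCube_subset_refCube
  have hm : MeasurableSet {z : E3 × E3 | ∀ i, z.1 i ≤ z.2 i} := by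
    have : {z : E3 × E3 | ∀ i, z.1 i ≤ z.2 i} = ⋂ i, {z | z.1 i ≤ z.2 i} := by ext; simp
    rw [this]
    exact MeasurableSet.iInter fun i =>
      measurableSet_le ((continuous_coord i).measurable.comp measurable_fst)
        ((continuous_coord i).measurable.comp measurable_snd)
  have hp : Integrable (Function.uncurry fun x y : E3 => if ∀ i, x i ≤ y i then
      g'' (S x) * η y else 0) ((volume.restrict openCube).prod (volume.restrict openCube)) := by
    have hw' : Integrable (fun x => g'' (S x)) (volume.restrict openCube) := hw
    have hη' : Integrable η (volume.restrict openCube) := hηi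
    refine ((hw'.mul_prod hη').indicator hm).congr (Filter.Eventually.of_forall fun z => ?_)
    simp [indicator, Function.uncurry]
  have sw := integral_integral_swap hp
  have r : ∀ y : E3, lowerIntegral (fun x => g'' (S x)) y * φ (S y)
      = ∫ x in openCube, if ∀ i, x i ≤ y i then g'' (S x) * η y else 0 := by
    intro y
    rw [lowerIntegral, ← integral_mul_const]
    refine integral_congr_ae (Filter.Eventually.of_forall fun x => ?_)
    simp only [ite_mul, zero_mul, hηd]
  simp only [r]
  rw [← sw]
  refine setIntegral_congr_fun isOpen_openCube.measurableSet fun x hx => ?_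
  simp only
  rw [lineLift_lineLift_lineLift hη hx, ← mul_neg, neg_neg, ← integral_const_mul]
  simp only [mul_ite, mul_zero]

/-- A function of `H¹₀` of a parallelepiped which has mixed derivatives up to third order in `L²`
has a continuous representative which vanishes on the boundary. -/
theorem MemH10.exists_continuous {S : E3 ≃ᵃ[ℝ] E3} {u : E3 → ℝ} {D1 : Fin 3 → E3 → ℝ}
    {D2 : Fin 3 → Fin 3 → E3 → ℝ} {D3 : Fin 3 → Fin 3 → Fin 3 → E3 → ℝ}
    (h1 : HasWeakGrad (S '' openCube) u D1) (h2 : ∀ j, HasWeakGrad (S '' openCube) (D1 j) (D2 j))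
    (h3 : ∀ j k, HasWeakGrad (S '' openCube) (D2 j k) (D3 j k)) (h : MemH10 (S '' openCube) u) :
    ∃ v : E3 → ℝ, Continuous v ∧ u =ᵐ[volume.restrict (S '' openCube)] v ∧
      ∀ x ∈ S '' refCube, x ∉ S '' openCube → v x = 0 := by
  obtain ⟨w, hw, hu⟩ := h.exists_ae_eq_lowerIntegral h1 h2 h3
  -- The first representation vanishes only on the three lower faces. Reflecting the cube through
  -- its centre gives a second one which vanishes on the opposite faces, and the two continuous
  -- functions agree on the closed box.
  set N : E3 ≃ᵃ[ℝ] E3 := (LinearEquiv.neg ℝ).toAffineEquiv with hN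
  have hNx : ∀ x, N x = -x := fun x => rfl
  have hS : (N.trans S) '' openCube = S '' openCube := by
    ext x
    constructor
    · rintro ⟨y, hy, rfl⟩
      exact ⟨-y, fun i => by simpa using hy i, rfl⟩
    · rintro ⟨y, hy, rfl⟩
      exact ⟨-y, fun i => by simpa using hy i, by
        rw [AffineEquiv.trans_apply, hNx, neg_neg]⟩
  obtain ⟨w', hw', hu'⟩ := MemH10.exists_ae_eq_lowerIntegral (S := N.trans S)
    (by rwa [hS]) (by rwa [hS]) (by rwa [hS]) (by rwa [hS])
  rw [hS] at hu'
  have c := (continuous_lowerIntegral hw).comp (continuous_affine S.symm)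
  have c' := (continuous_lowerIntegral hw').comp (continuous_affine (N.trans S).symm)
  have heq : EqOn (lowerIntegral w ∘ S.symm) (lowerIntegral w' ∘ (N.trans S).symm)
      (S '' openCube) :=
    Measure.eqOn_open_of_ae_eq (hu.symm.trans hu') (isOpen_affine_image S) c.continuousOn
      c'.continuousOn
  have heq' := heq.closure c c'
  rw [closure_affine_image] at heq'
  refine ⟨_, c, hu, fun x hx hx' => ?_⟩
  obtain ⟨y, hy, rfl⟩ := hx
  have : ∃ i, ¬ |y i| < 1 := by
    by_contra! hcon
    exact hx' ⟨y, hcon, rfl⟩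
  obtain ⟨i, hi⟩ := this
  have hi' : |y i| = 1 := le_antisymm (hy i) (not_lt.1 hi)
  rcases (abs_eq zero_le_one).1 hi' with h' | h'
  · rw [heq' ⟨y, hy, rfl⟩]
    refine lowerIntegral_eq_zero (i := i) ?_
    have : (N.trans S).symm (S y) = -y := by
      rw [AffineEquiv.symm_apply_eq, AffineEquiv.trans_apply, hNx, neg_neg]
    rw [this]
    simp [h']
  · refine lowerIntegral_eq_zero (i := i) ?_
    rw [AffineEquiv.symm_apply_apply, h']

/-! ### The conforming companion on the reference cube -/

/-- The vertex of the reference cube with the given signs. -/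
def cubeVertex (v : Fin 3 → ℤˣ) : E3 := WithLp.toLp 2 fun i => ((v i : ℤ) : ℝ)

/-- The centroid of the face `xᵢ = τ` of the reference cube. -/
def faceCenter (i : Fin 3) (τ : ℤˣ) : E3 := EuclideanSpace.single i ((τ : ℤ) : ℝ)

@[simp] theorem cubeVertex_apply (v : Fin 3 → ℤˣ) (i : Fin 3) :
    cubeVertex v i = ((v i : ℤ) : ℝ) := rfl

theorem faceCenter_apply (i : Fin 3) (τ : ℤˣ) (j : Fin 3) :
    faceCenter i τ j = if j = i then ((τ : ℤ) : ℝ) else 0 := by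
  rw [faceCenter, PiLp.single_apply]

theorem abs_units (τ : ℤˣ) : |((τ : ℤ) : ℝ)| = 1 := by
  rcases Int.units_eq_one_or τ with h | h <;> simp [h]

theorem units_sq (τ : ℤˣ) : ((τ : ℤ) : ℝ) * ((τ : ℤ) : ℝ) = 1 := by
  rcases Int.units_eq_one_or τ with h | h <;> simp [h]

theorem exists_units_eq {a : ℝ} (h : |a| = 1) : ∃ τ : ℤˣ, a = ((τ : ℤ) : ℝ) := by
  rcases (abs_eq zero_le_one).1 h with h | h
  · exact ⟨1, by simp [h]⟩
  · exact ⟨-1, by simp [h]⟩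

theorem cubeVertex_mem_refNodes (v : Fin 3 → ℤˣ) : cubeVertex v ∈ refNodes :=
  Or.inl fun i => abs_units (v i)

theorem faceCenter_mem_refNodes (i : Fin 3) (τ : ℤˣ) : faceCenter i τ ∈ refNodes :=
  Or.inr ⟨i, by rw [faceCenter_apply, if_pos rfl, abs_units], fun j hj => by
    rw [faceCenter_apply, if_neg hj]⟩

theorem exists_of_mem_refNodes {x : E3} (hx : x ∈ refNodes) :
    (∃ v, x = cubeVertex v) ∨ ∃ i τ, x = faceCenter i τ := by
  rcases hx with hx | ⟨i, hi, hx⟩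
  · choose v hv using fun i => exists_units_eq (hx i)
    exact Or.inl ⟨v, by ext i; exact hv i⟩
  · obtain ⟨τ, hτ⟩ := exists_units_eq hi
    refine Or.inr ⟨i, τ, ?_⟩
    ext j
    rw [faceCenter_apply]
    split_ifs with h
    · rw [h, hτ]
    · exact hx j h

theorem refNodes_subset_refCube : refNodes ⊆ refCube := by
  intro x hx
  rcases hx with hx | ⟨i, hi, hx⟩
  · exact fun i => (hx i).le
  · intro j
    by_cases h : j = i
    · rw [h, hi]
    · rw [hx j h]; simp

/-- The coefficient of the face bubble of the companion. -/
def bubbleCoef (φ : E3 → ℝ) (i : Fin 3) (τ : ℤˣ) : ℝ :=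
  3 / 2 * (φ (faceCenter i τ) - 1 / 4 * ∑ v : Fin 3 → ℤˣ, if v i = τ then φ (cubeVertex v) else 0)

/-- The function with the same values at the vertices as `φ` and, on every face, the same weighted
means as the shape functions with the nodal values of `φ`. -/
def companion (φ : E3 → ℝ) (x : E3) : ℝ :=
  (∑ v : Fin 3 → ℤˣ, φ (cubeVertex v) * ∏ i, (1 + ((v i : ℤ) : ℝ) * x i) / 2) +
    ∑ i : Fin 3, ∑ τ : ℤˣ, bubbleCoef φ i τ *
      ((1 + ((τ : ℤ) : ℝ) * x i) / 2 * ∏ j ∈ Finset.univ.erase i, (1 - x j ^ 2))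

theorem companion_sub (φ ψ : E3 → ℝ) (x : E3) :
    companion (fun y => φ y - ψ y) x = companion φ x - companion ψ x := by
  have h : ∀ i τ, bubbleCoef (fun y => φ y - ψ y) i τ = bubbleCoef φ i τ - bubbleCoef ψ i τ := by
    intro i τ
    have : ∀ v : Fin 3 → ℤˣ, (if v i = τ then φ (cubeVertex v) - ψ (cubeVertex v) else 0)
        = (if v i = τ then φ (cubeVertex v) else 0) - if v i = τ then ψ (cubeVertex v) else 0 := by
      intro v; split_ifs <;> simp
    simp only [bubbleCoef, this, Finset.sum_sub_distrib]
    ring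
  simp only [companion, h, sub_mul, Finset.sum_sub_distrib]
  ring

/-- A signed permutation of the coordinates. -/
def signedPerm (π : Equiv.Perm (Fin 3)) (ε : Fin 3 → ℤˣ) (x : E3) : E3 :=
  WithLp.toLp 2 fun i => ((ε i : ℤ) : ℝ) * x (π i)

theorem signedPerm_apply (π : Equiv.Perm (Fin 3)) (ε : Fin 3 → ℤˣ) (x : E3) (i : Fin 3) :
    signedPerm π ε x i = ((ε i : ℤ) : ℝ) * x (π i) := rfl

theorem signedPerm_cubeVertex (π : Equiv.Perm (Fin 3)) (ε v : Fin 3 → ℤˣ) :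
    signedPerm π ε (cubeVertex v) = cubeVertex fun i => ε i * v (π i) := by
  ext i
  simp [signedPerm_apply]

theorem signedPerm_faceCenter (π : Equiv.Perm (Fin 3)) (ε : Fin 3 → ℤˣ) (i : Fin 3) (τ : ℤˣ) :
    signedPerm π ε (faceCenter (π i) τ) = faceCenter i (ε i * τ) := by
  ext j
  rw [signedPerm_apply, faceCenter_apply, faceCenter_apply]
  by_cases h : j = i
  · simp [h]
  · simp [h]

theorem signedPerm_mem_refNodes (π : Equiv.Perm (Fin 3)) (ε : Fin 3 → ℤˣ) {x : E3}
    (hx : x ∈ refNodes) : signedPerm π ε x ∈ refNodes := by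
  rcases exists_of_mem_refNodes hx with ⟨v, rfl⟩ | ⟨i, τ, rfl⟩
  · rw [signedPerm_cubeVertex]; exact cubeVertex_mem_refNodes _
  · obtain ⟨i, rfl⟩ := π.surjective i
    rw [signedPerm_faceCenter]; exact faceCenter_mem_refNodes _ _

/-- The action of a signed permutation on sign vectors. -/
def signedPermEquiv (π : Equiv.Perm (Fin 3)) (ε : Fin 3 → ℤˣ) : (Fin 3 → ℤˣ) ≃ (Fin 3 → ℤˣ) :=
  (π.symm.arrowCongr (Equiv.refl ℤˣ)).trans (Equiv.mulLeft ε)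

theorem signedPermEquiv_apply (π : Equiv.Perm (Fin 3)) (ε v : Fin 3 → ℤˣ) :
    signedPermEquiv π ε v = fun i => ε i * v (π i) := rfl

theorem bubbleCoef_signedPerm (π : Equiv.Perm (Fin 3)) (ε : Fin 3 → ℤˣ) (φ : E3 → ℝ) (i : Fin 3)
    (τ : ℤˣ) : bubbleCoef (fun y => φ (signedPerm π ε y)) (π i) τ = bubbleCoef φ i (ε i * τ) := by
  simp only [bubbleCoef, signedPerm_faceCenter, signedPerm_cubeVertex]
  congr 3
  refine Fintype.sum_equiv (signedPermEquiv π ε) _ _ fun v => ?_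
  simp only [signedPermEquiv_apply, mul_right_inj]

/-- The construction is invariant under the symmetry group of the cube. This is essential because
neighbouring cells may parametrize their common face differently. -/
theorem companion_signedPerm (π : Equiv.Perm (Fin 3)) (ε : Fin 3 → ℤˣ) (φ : E3 → ℝ) (x : E3) :
    companion (fun y => φ (signedPerm π ε y)) x = companion φ (signedPerm π ε x) := by
  unfold companion
  congr 1
  · refine Fintype.sum_equiv (signedPermEquiv π ε) _ _ fun v => ?_
    beta_reduce
    rw [signedPerm_cubeVertex, signedPermEquiv_apply, ← Equiv.prod_comp π]
    congr 1
    refine Finset.prod_congr rfl fun i _ => ?_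
    rw [signedPerm_apply]
    congr 2
    push_cast
    linear_combination (-((v (π i) : ℤ) : ℝ) * x (π i)) * units_sq (ε i)
  · refine (Fintype.sum_equiv π _ _ fun i => ?_).symm
    refine (Fintype.sum_equiv (Equiv.mulLeft (ε i)) _ _ fun τ => ?_).symm
    rw [bubbleCoef_signedPerm, Equiv.coe_mulLeft]
    have e1 : (1 + ((τ : ℤ) : ℝ) * x (π i)) / 2
        = (1 + (((ε i * τ : ℤˣ) : ℤ) : ℝ) * signedPerm π ε x i) / 2 := by
      rw [signedPerm_apply]
      congr 2
      push_cast
      linear_combination (-((τ : ℤ) : ℝ) * x (π i)) * units_sq (ε i)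
    have e2 : ∏ j ∈ Finset.univ.erase (π i), (1 - x j ^ 2)
        = ∏ j ∈ Finset.univ.erase i, (1 - signedPerm π ε x j ^ 2) := by
      have e : (Finset.univ.erase (π i)) = (Finset.univ.erase i).map π.toEmbedding := by
        ext j
        simp
      rw [e, Finset.prod_map]
      refine Finset.prod_congr rfl fun j _ => ?_
      rw [signedPerm_apply, mul_pow, sq ((ε j : ℤ) : ℝ), units_sq, one_mul]
      rfl
    rw [e1, e2]

theorem signType_cast_eq_or {s : SignType} (h : s ≠ 0) (τ : ℤˣ) :
    (s : ℝ) = ((τ : ℤ) : ℝ) ∨ (s : ℝ) = -((τ : ℤ) : ℝ) := by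
  rcases Int.units_eq_one_or τ with rfl | rfl <;> cases s <;> simp at h ⊢

/-- The restriction of the companion to a face depends only on the nodal values in this face. -/
theorem companion_eq_zero {φ : E3 → ℝ} {s : Fin 3 → SignType}
    (h : ∀ y ∈ refNodes, y ∈ refFace s → φ y = 0) {x : E3} (hx : x ∈ refFace s) :
    companion φ x = 0 := by
  have key : ∀ i (τ : ℤˣ), s i ≠ 0 → (s i : ℝ) ≠ ((τ : ℤ) : ℝ) → 1 + ((τ : ℤ) : ℝ) * x i = 0 := by
    intro i τ hi hne
    rw [hx.2 i hi, (signType_cast_eq_or hi τ).resolve_left hne]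
    linarith [units_sq τ]
  have hv : ∀ v, (∀ i, s i ≠ 0 → (s i : ℝ) = ((v i : ℤ) : ℝ)) → φ (cubeVertex v) = 0 := by
    intro v hv
    refine h _ (cubeVertex_mem_refNodes v)
      ⟨refNodes_subset_refCube (cubeVertex_mem_refNodes v), fun i hi => (hv i hi).symm⟩
  have h1 : ∀ v : Fin 3 → ℤˣ,
      φ (cubeVertex v) * ∏ i, (1 + ((v i : ℤ) : ℝ) * x i) / 2 = 0 := by
    intro v
    by_cases hs : ∀ i, s i ≠ 0 → (s i : ℝ) = ((v i : ℤ) : ℝ)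
    · rw [hv v hs, zero_mul]
    · push Not at hs
      obtain ⟨i, hi, hne⟩ := hs
      rw [Finset.prod_eq_zero (Finset.mem_univ i), mul_zero]
      rw [key i _ hi hne, zero_div]
  have h2 : ∀ i (τ : ℤˣ), bubbleCoef φ i τ *
      ((1 + ((τ : ℤ) : ℝ) * x i) / 2 * ∏ j ∈ Finset.univ.erase i, (1 - x j ^ 2)) = 0 := by
    intro i τ
    by_cases hs : ∃ j, j ≠ i ∧ s j ≠ 0
    · obtain ⟨j, hj, hsj⟩ := hs
      rw [Finset.prod_eq_zero (Finset.mem_erase.2 ⟨hj, Finset.mem_univ j⟩), mul_zero, mul_zero]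
      rw [hx.2 j hsj]
      rcases signType_cast_eq_or hsj 1 with h | h <;> rw [h] <;> simp
    · push Not at hs
      by_cases hi : s i ≠ 0 ∧ (s i : ℝ) ≠ ((τ : ℤ) : ℝ)
      · rw [key i τ hi.1 hi.2]; simp
      · have hi' : s i ≠ 0 → (s i : ℝ) = ((τ : ℤ) : ℝ) := fun h' => by
          by_contra hcon; exact hi ⟨h', hcon⟩
        have hc : φ (faceCenter i τ) = 0 := by
          refine h _ (faceCenter_mem_refNodes i τ)
            ⟨refNodes_subset_refCube (faceCenter_mem_refNodes i τ), fun j hj => ?_⟩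
          by_cases hji : j = i
          · subst hji
            rw [faceCenter_apply, if_pos rfl, hi' hj]
          · exact absurd (hs j hji) hj
        have hb : bubbleCoef φ i τ = 0 := by
          rw [bubbleCoef, hc, Finset.sum_eq_zero]
          · simp
          · intro v _
            split_ifs with hvi
            · refine hv v fun j hj => ?_
              by_cases hji : j = i
              · subst hji; rw [hi' hj, hvi]
              · exact absurd (hs j hji) hj
            · rfl
        rw [hb, zero_mul]
  simp only [companion, h1, h2, Finset.sum_const_zero, add_zero]

theorem companion_congr {φ ψ : E3 → ℝ} {s : Fin 3 → SignType}
    (h : ∀ y ∈ refNodes, y ∈ refFace s → φ y = ψ y) {x : E3} (hx : x ∈ refFace s) :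
    companion φ x = companion ψ x := by
  rw [← sub_eq_zero, ← companion_sub]
  exact companion_eq_zero (fun y hy hys => sub_eq_zero.2 (h y hy hys)) hx

theorem contDiff_companion (φ : E3 → ℝ) : ContDiff ℝ ∞ (companion φ) := by
  unfold companion
  have := contDiff_coord
  fun_prop

/-! ### Affine maps between faces -/

theorem abs_signType {s : SignType} (h : s ≠ 0) : |(s : ℝ)| = 1 := by
  cases s <;> simp at h ⊢

theorem abs_signType_le (s : SignType) : |(s : ℝ)| ≤ 1 := by
  cases s <;> simp

theorem affine_apply_sub (M : E3 ≃ᵃ[ℝ] E3) (x y : E3) (i : Fin 3) :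
    M x i - M y i = ∑ j, affEntry M i j * (x j - y j) := by
  have h : M x - M y = M.linear (x - y) := by
    rw [affine_eq M x, affine_eq M y, map_sub]; abel
  have h2 : M x i - M y i = (M.linear (x - y)) i := by rw [← h]; rfl
  rw [h2]
  nth_rewrite 1 [euclidean_eq_sum (x - y)]
  rw [map_sum]
  simp only [map_smul, WithLp.ofLp_sum, Finset.sum_apply, PiLp.smul_apply, smul_eq_mul, affEntry,
    PiLp.sub_apply]
  exact Finset.sum_congr rfl fun j _ => mul_comm _ _

/-- The vertices of the face `refFace s`. -/
def faceVertex (s : Fin 3 → SignType) (w : Fin 3 → ℤˣ) : E3 :=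
  WithLp.toLp 2 fun j => if s j = 0 then ((w j : ℤ) : ℝ) else (s j : ℝ)

theorem faceVertex_apply (s : Fin 3 → SignType) (w : Fin 3 → ℤˣ) (j : Fin 3) :
    faceVertex s w j = if s j = 0 then ((w j : ℤ) : ℝ) else (s j : ℝ) := rfl

theorem abs_faceVertex (s : Fin 3 → SignType) (w : Fin 3 → ℤˣ) (j : Fin 3) :
    |faceVertex s w j| = 1 := by
  rw [faceVertex_apply]
  split_ifs with h
  · exact abs_units _
  · exact abs_signType h

theorem faceVertex_mem (s : Fin 3 → SignType) (w : Fin 3 → ℤˣ) : faceVertex s w ∈ refFace s :=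
  ⟨fun j => (abs_faceVertex s w j).le, fun j hj => by rw [faceVertex_apply, if_neg hj]⟩

/-- The barycenter of the face `refFace s`. -/
def faceBase (s : Fin 3 → SignType) : E3 := WithLp.toLp 2 fun j => (s j : ℝ)

theorem faceBase_apply (s : Fin 3 → SignType) (j : Fin 3) : faceBase s j = (s j : ℝ) := rfl

theorem faceBase_mem (s : Fin 3 → SignType) : faceBase s ∈ refFace s :=
  ⟨fun j => abs_signType_le (s j), fun _ _ => rfl⟩

/-- Vertices are extreme points. If the image had a free coordinate of absolute value less than 1,
it could be moved both ways along it within the face, and the inverse map would make the vertex a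
midpoint of two distinct points of its own face. -/
theorem abs_faceVertex_image {M : E3 ≃ᵃ[ℝ] E3} {s s' : Fin 3 → SignType}
    (h : M '' refFace s = refFace s') (w : Fin 3 → ℤˣ) (i : Fin 3) :
    |M (faceVertex s w) i| = 1 := by
  have hm : M (faceVertex s w) ∈ refFace s' := h ▸ mem_image_of_mem M (faceVertex_mem s w)
  by_cases hi : s' i = 0
  swap
  · rw [hm.2 i hi]; exact abs_signType hi
  by_contra hne
  have hlt : |M (faceVertex s w) i| < 1 := lt_of_le_of_ne (hm.1 i) hne
  set y := M (faceVertex s w) with hy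
  set δ := 1 - |y i| with hδ
  have hδ0 : 0 < δ := by linarith
  have hpm : ∀ t : ℝ, |t| = 1 → y + (t * δ) • EuclideanSpace.single i (1 : ℝ) ∈ refFace s' := by
    intro t ht
    refine ⟨fun j => ?_, fun j hj => ?_⟩
    · by_cases hj : j = i
      · subst hj
        simp only [PiLp.add_apply, PiLp.smul_apply, PiLp.single_apply, if_true, smul_eq_mul,
          mul_one]
        refine (abs_add_le _ _).trans ?_
        rw [abs_mul, ht, one_mul, abs_of_pos hδ0]
        linarith
      · simpa [hj] using hm.1 j
    · have : j ≠ i := fun e => hj (e ▸ hi)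
      simpa [this] using hm.2 j hj
  have hback : ∀ t : ℝ, |t| = 1 → M.symm (y + (t * δ) • EuclideanSpace.single i (1 : ℝ)) ∈
      refFace s := by
    intro t ht
    have := hpm t ht
    rw [← h] at this
    obtain ⟨x, hx, hxe⟩ := this
    rw [← hxe, AffineEquiv.symm_apply_apply]
    exact hx
  have hy' : M.symm y = faceVertex s w := by rw [hy, AffineEquiv.symm_apply_apply]
  have e : ∀ j, M.symm (y + ((1 : ℝ) * δ) • EuclideanSpace.single i (1 : ℝ)) j
      = faceVertex s w j := by
    intro j
    have a1 := affine_apply_sub M.symm (y + ((1 : ℝ) * δ) • EuclideanSpace.single i (1 : ℝ)) y j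
    have a2 := affine_apply_sub M.symm (y + ((-1 : ℝ) * δ) • EuclideanSpace.single i (1 : ℝ)) y j
    have hs : ∑ k, affEntry M.symm j k *
        ((y + ((-1 : ℝ) * δ) • EuclideanSpace.single i (1 : ℝ) : E3) k - y k)
        = -∑ k, affEntry M.symm j k *
        ((y + ((1 : ℝ) * δ) • EuclideanSpace.single i (1 : ℝ) : E3) k - y k) := by
      rw [← Finset.sum_neg_distrib]
      refine Finset.sum_congr rfl fun k _ => ?_
      simp only [PiLp.add_apply, PiLp.smul_apply, smul_eq_mul]
      ring
    rw [hs, ← a1] at a2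
    have b1 := abs_le.1 ((hback 1 (by simp)).1 j)
    have b2 := abs_le.1 ((hback (-1) (by simp)).1 j)
    rw [hy'] at a2
    rcases (abs_eq zero_le_one).1 (abs_faceVertex s w j) with h1 | h1 <;> rw [h1] at a2 ⊢ <;>
      linarith [b1.1, b1.2, b2.1, b2.2]
  have e2 : M.symm (y + ((1 : ℝ) * δ) • EuclideanSpace.single i (1 : ℝ)) = M.symm y := by
    rw [hy']; ext j; exact e j
  have e3 := congrArg (fun z : E3 => z i) (M.symm.injective e2)
  simp at e3
  exact hδ0.ne' e3

/-- After squaring, the left-hand side is a multilinear polynomial in the signs that is constantly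
1. All mixed products of `m` and the `c j` therefore vanish, and only one of these numbers can
survive. -/
theorem exists_of_forall_abs_eq_one {m : ℝ} {c : Fin 3 → ℝ}
    (h : ∀ w : Fin 3 → ℤˣ, |m + ∑ j, c j * ((w j : ℤ) : ℝ)| = 1) (hc : ∃ j, c j ≠ 0) :
    m = 0 ∧ ∃ j, |c j| = 1 ∧ ∀ k, k ≠ j → c k = 0 := by
  have sq : ∀ a b d : ℤˣ, (m + (c 0 * ((a : ℤ) : ℝ) + c 1 * ((b : ℤ) : ℝ) +
      c 2 * ((d : ℤ) : ℝ))) ^ 2 = 1 := by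
    intro a b d
    have := h ![a, b, d]
    rw [Fin.sum_univ_three] at this
    rw [← sq_abs]
    simp only [Matrix.cons_val_zero, Matrix.cons_val_one, Matrix.cons_val] at this
    rw [this, one_pow]
  have h1 := sq 1 1 1
  have h2 := sq 1 1 (-1)
  have h3 := sq 1 (-1) 1
  have h4 := sq 1 (-1) (-1)
  have h5 := sq (-1) 1 1
  have h6 := sq (-1) 1 (-1)
  have h7 := sq (-1) (-1) 1
  have h8 := sq (-1) (-1) (-1)
  simp only [Units.val_one, Units.val_neg, Int.cast_one, Int.cast_neg] at h1 h2 h3 h4 h5 h6 h7 h8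
  have m0 : m * c 0 = 0 := by linarith
  have m1 : m * c 1 = 0 := by linarith
  have m2 : m * c 2 = 0 := by linarith
  have c01 : c 0 * c 1 = 0 := by linarith
  have c02 : c 0 * c 2 = 0 := by linarith
  have c12 : c 1 * c 2 = 0 := by linarith
  have tot : m ^ 2 + c 0 ^ 2 + c 1 ^ 2 + c 2 ^ 2 = 1 := by linarith
  have mz : ∀ j, m * c j = 0 := by intro j; fin_cases j <;> assumption
  have cz : ∀ j k, k ≠ j → c j * c k = 0 := by
    intro j k hjk
    fin_cases j <;> fin_cases k <;> first | exact absurd rfl hjk | assumption |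
      (rw [mul_comm]; assumption)
  obtain ⟨j, hj⟩ := hc
  have hm : m = 0 := (mul_eq_zero.1 (mz j)).resolve_right hj
  have hk : ∀ k, k ≠ j → c k = 0 := fun k hk => (mul_eq_zero.1 (cz j k hk)).resolve_left hj
  refine ⟨hm, j, ?_, hk⟩
  have hsq : c j ^ 2 = 1 := by
    rw [hm] at tot
    fin_cases j
    · have a1 := hk 1 (by decide)
      have a2 := hk 2 (by decide)
      rw [a1, a2] at tot
      simpa using tot
    · have a1 := hk 0 (by decide)
      have a2 := hk 2 (by decide)
      rw [a1, a2] at tot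
      simpa using tot
    · have a1 := hk 0 (by decide)
      have a2 := hk 1 (by decide)
      rw [a1, a2] at tot
      simpa using tot
  rwa [← sq_eq_sq₀ (abs_nonneg _) zero_le_one, sq_abs, one_pow]

theorem affine_apply_face (M : E3 ≃ᵃ[ℝ] E3) {s : Fin 3 → SignType} {x : E3} (hx : x ∈ refFace s)
    (i : Fin 3) : M x i = M (faceBase s) i + ∑ j, (if s j = 0 then affEntry M i j else 0) * x j := by
  have h := affine_apply_sub M x (faceBase s) i
  rw [sub_eq_iff_eq_add'] at h
  rw [h]
  congr 1
  refine Finset.sum_congr rfl fun j _ => ?_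
  rw [faceBase_apply]
  split_ifs with hj
  · rw [hj]; simp
  · rw [hx.2 j hj]; simp

/-- On the face the i-th coordinate of M is affine, takes values ±1 at all vertices and is not
constant because the image is a whole face; so it is plus or minus a single free coordinate. -/
theorem exists_single_entry {M : E3 ≃ᵃ[ℝ] E3} {s s' : Fin 3 → SignType}
    (h : M '' refFace s = refFace s') {i : Fin 3} (hi : s' i = 0) :
    ∃ j, s j = 0 ∧ ∃ ε : ℤˣ, ∀ x ∈ refFace s, M x i = ((ε : ℤ) : ℝ) * x j := by
  set c : Fin 3 → ℝ := fun j => if s j = 0 then affEntry M i j else 0 with hc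
  have h1 : ∀ w : Fin 3 → ℤˣ, |M (faceBase s) i + ∑ j, c j * ((w j : ℤ) : ℝ)| = 1 := by
    intro w
    rw [← abs_faceVertex_image h w i, affine_apply_face M (faceVertex_mem s w) i]
    congr 2
    refine Finset.sum_congr rfl fun j _ => ?_
    simp only [hc, faceVertex_apply]
    split_ifs <;> simp
  have hsurj : ∀ t : ℝ, |t| ≤ 1 → ∃ x ∈ refFace s, M x i = t := by
    intro t ht
    have hy : (WithLp.toLp 2 fun j => if j = i then t else (s' j : ℝ) : E3) ∈ refFace s' := by
      refine ⟨fun j => ?_, fun j hj => ?_⟩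
      · change |if j = i then t else (s' j : ℝ)| ≤ 1
        split_ifs
        · exact ht
        · exact abs_signType_le _
      · change (if j = i then t else (s' j : ℝ)) = _
        rw [if_neg]
        rintro rfl
        exact hj hi
    rw [← h] at hy
    obtain ⟨x, hx, hxe⟩ := hy
    refine ⟨x, hx, ?_⟩
    rw [hxe]
    change (if i = i then t else (s' i : ℝ)) = t
    rw [if_pos rfl]
  have hne : ∃ j, c j ≠ 0 := by
    by_contra! hz
    obtain ⟨x, hx, hx1⟩ := hsurj 1 (by simp)
    obtain ⟨y, hy, hy1⟩ := hsurj (-1) (by simp)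
    rw [affine_apply_face M hx i, Finset.sum_eq_zero fun j _ => by
      have := hz j; simp only [hc] at this; rw [this, zero_mul]] at hx1
    rw [affine_apply_face M hy i, Finset.sum_eq_zero fun j _ => by
      have := hz j; simp only [hc] at this; rw [this, zero_mul]] at hy1
    linarith
  obtain ⟨hm, j, hj, hk⟩ := exists_of_forall_abs_eq_one h1 hne
  obtain ⟨ε, hε⟩ := exists_units_eq hj
  refine ⟨j, ?_, ε, fun x hx => ?_⟩
  · by_contra hsj
    have : c j = 0 := by simp [hc, hsj]
    rw [this] at hj
    simp at hj
  · rw [affine_apply_face M hx i, hm, zero_add, Finset.sum_eq_single j, ← hε]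
    · intro k _ hkj
      have := hk k hkj
      simp only [hc] at this
      rw [this, zero_mul]
    · simp

/-- An affine bijection which maps a face of the reference cube onto another one coincides there
with a signed permutation of the coordinates. -/
theorem exists_signedPerm {M : E3 ≃ᵃ[ℝ] E3} {s s' : Fin 3 → SignType}
    (h : M '' refFace s = refFace s') :
    ∃ π ε, ∀ x ∈ refFace s, M x = signedPerm π ε x := by
  classical
  have key := fun i : {i // s' i = 0} => exists_single_entry h i.2
  choose J hJ ε hε using key
  -- If two free coordinates of the target came from the same source coordinate, they would always
  -- agree up to sign; but the target face has a point where one is 1 and the other 0.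
  have hinj : Function.Injective fun i => (⟨J i, hJ i⟩ : {j // s j = 0}) := by
    intro i k hik
    have hik' : J i = J k := congrArg Subtype.val hik
    by_contra hne
    have hy : (WithLp.toLp 2 fun j => if j = i then 1 else (s' j : ℝ) : E3) ∈ refFace s' := by
      refine ⟨fun j => ?_, fun j hj => ?_⟩
      · change |if j = i.1 then 1 else (s' j : ℝ)| ≤ 1
        split_ifs
        · simp
        · exact abs_signType_le _
      · change (if j = i.1 then 1 else (s' j : ℝ)) = _
        rw [if_neg]
        rintro rfl
        exact hj i.2
    rw [← h] at hy
    obtain ⟨x, hx, hxe⟩ := hy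
    have e1 := hε i x hx
    have e2 := hε k x hx
    rw [hxe] at e1 e2
    change (if i.1 = i.1 then 1 else (s' i : ℝ)) = _ at e1
    change (if k.1 = i.1 then 1 else (s' k : ℝ)) = _ at e2
    rw [if_pos rfl] at e1
    rw [if_neg fun e => hne (Subtype.ext e.symm), k.2, ← hik'] at e2
    have : x (J i) = 0 := by
      have h0 : ((ε k : ℤ) : ℝ) ≠ 0 := by
        intro h0
        have := abs_units (ε k)
        rw [h0] at this
        simp at this
      simpa [h0] using e2.symm
    rw [this] at e1
    simp at e1
  -- A free source coordinate that is not used could be changed without changing the image,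
  -- contradicting injectivity of M.
  have hsurj : Function.Surjective fun i => (⟨J i, hJ i⟩ : {j // s j = 0}) := by
    rintro ⟨j, hj⟩
    by_contra! hne
    have hp : (WithLp.toLp 2 fun k => if k = j then 1 else (s k : ℝ) : E3) ∈ refFace s := by
      refine ⟨fun k => ?_, fun k hk => ?_⟩
      · change |if k = j then 1 else (s k : ℝ)| ≤ 1
        split_ifs
        · simp
        · exact abs_signType_le _
      · change (if k = j then 1 else (s k : ℝ)) = _
        rw [if_neg]
        rintro rfl
        exact hk hj
    have e : M (WithLp.toLp 2 fun k => if k = j then 1 else (s k : ℝ) : E3) = M (faceBase s) := by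
      ext i
      by_cases hi : s' i = 0
      · rw [hε ⟨i, hi⟩ _ hp, hε ⟨i, hi⟩ _ (faceBase_mem s)]
        have : J ⟨i, hi⟩ ≠ j := fun e => hne ⟨i, hi⟩ (Subtype.ext e)
        change _ * (if J ⟨i, hi⟩ = j then 1 else (s (J ⟨i, hi⟩) : ℝ)) = _ * (s (J ⟨i, hi⟩) : ℝ)
        rw [if_neg this]
      · have m1 : M _ ∈ refFace s' := h ▸ mem_image_of_mem M hp
        have m2 : M _ ∈ refFace s' := h ▸ mem_image_of_mem M (faceBase_mem s)
        rw [m1.2 i hi, m2.2 i hi]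
    have e2 := congrArg (fun z : E3 => z j) (M.injective e)
    change (if j = j then 1 else (s j : ℝ)) = (s j : ℝ) at e2
    rw [if_pos rfl, hj] at e2
    simp at e2
  -- The matching of free coordinates extends to a permutation of all three. The fixed coordinates
  -- are constants ±1 on both faces, so a sign adjusts them.
  set q : {i // s' i = 0} ≃ {j // s j = 0} := Equiv.ofBijective _ ⟨hinj, hsurj⟩ with hq
  have hδ : ∀ i, ∃ τ : ℤˣ, ∀ x ∈ refFace s, M x i = ((τ : ℤ) : ℝ) * x (q.extendSubtype i) := by
    intro i
    by_cases hi : s' i = 0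
    · refine ⟨ε ⟨i, hi⟩, fun x hx => ?_⟩
      rw [hε ⟨i, hi⟩ x hx, Equiv.extendSubtype_apply_of_mem q i hi]
      rfl
    · have hn := Equiv.extendSubtype_not_mem q i hi
      have : |(s' i : ℝ) * (s (q.extendSubtype i) : ℝ)| = 1 := by
        rw [abs_mul, abs_signType hi, abs_signType hn, one_mul]
      obtain ⟨τ, hτ⟩ := exists_units_eq this
      refine ⟨τ, fun x hx => ?_⟩
      have m1 : M x ∈ refFace s' := h ▸ mem_image_of_mem M hx
      rw [m1.2 i hi, hx.2 _ hn, ← hτ, mul_assoc, ← sq, ← sq_abs, abs_signType hn]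
      simp
  choose τ hτ using hδ
  refine ⟨q.extendSubtype, τ, fun x hx => ?_⟩
  ext i
  rw [signedPerm_apply, hτ i x hx]

/-! ### Carriers -/

/-- The smallest face which contains a given point. -/
def carrier (x : E3) (i : Fin 3) : SignType := if x i = 1 then 1 else if x i = -1 then -1 else 0

theorem mem_refFace_carrier {x : E3} (hx : x ∈ refCube) : x ∈ refFace (carrier x) := by
  refine ⟨hx, fun i hi => ?_⟩
  unfold carrier at hi ⊢
  split_ifs at hi ⊢ with h1 h2
  · simp [h1]
  · simp [h2]
  · exact absurd rfl hi

/-- An affine function which is at most `1` on the cube, and `1` at `x`, is `1` on the smallest face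
containing `x`. -/
theorem eq_one_on_carrier {f : E3 → ℝ} (hf : ∀ (x y : E3) (t : ℝ),
    f (x + t • (x - y)) = f x + t * (f x - f y)) (hle : ∀ x ∈ refCube, f x ≤ 1) {x : E3}
    (hx : x ∈ refCube) (h1 : f x = 1) {y : E3} (hy : y ∈ refFace (carrier x)) : f y = 1 := by
  refine le_antisymm (hle y hy.1) ?_
  -- From x one can move slightly away from y without leaving the cube, since y differs from x only
  -- in coordinates in which x is interior. A value of f below 1 at y would push f above 1 there.
  have hev : ∀ i, ∀ᶠ t : ℝ in nhdsWithin 0 (Ioi 0), |(x + t • (x - y)) i| ≤ 1 := by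
    intro i
    by_cases hi : carrier x i = 0
    · have hlt : |x i| < 1 := by
        refine lt_of_le_of_ne (hx i) fun he => ?_
        rcases (abs_eq zero_le_one).1 he with h | h
        · simp [carrier, h] at hi
        · simp [carrier, h] at hi
          norm_num at hi
      have hcont : ContinuousAt (fun t : ℝ => |(x + t • (x - y)) i|) 0 := by
        have : (fun t : ℝ => |(x + t • (x - y)) i|) = fun t => |x i + t * (x i - y i)| := by
          funext t; simp
        rw [this]
        fun_prop
      have hz : |(x + (0 : ℝ) • (x - y)) i| < 1 := by simpa using hlt
      exact ((hcont.eventually_lt_const hz).filter_mono nhdsWithin_le_nhds).mono fun t ht => ht.le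
    · refine Filter.Eventually.of_forall fun t => ?_
      have e : y i = x i := by rw [hy.2 i hi, (mem_refFace_carrier hx).2 i hi]
      simpa [e] using hx i
  obtain ⟨t, ht, ht0⟩ := ((Filter.eventually_all.2 hev).and self_mem_nhdsWithin).exists
  have h2 := hle _ ht
  rw [hf, h1] at h2
  have ht0' : (0 : ℝ) < t := ht0
  nlinarith

theorem boxDomain_eq (S : E3 ≃ᵃ[ℝ] E3) : boxDomain S = S '' openCube := interior_affine_image S

theorem isOpen_boxDomain (S : E3 ≃ᵃ[ℝ] E3) : IsOpen (boxDomain S) := isOpen_interior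

theorem closure_boxDomain (S : E3 ≃ᵃ[ℝ] E3) : closure (boxDomain S) = S '' refCube := by
  rw [boxDomain_eq, closure_affine_image]

theorem mem_refFace_zero {x : E3} (hx : x ∈ refCube) : x ∈ refFace fun _ => 0 :=
  ⟨hx, fun _ h => absurd rfl h⟩

theorem signedPerm_one (x : E3) : signedPerm 1 (fun _ => 1) x = x := by
  ext i; simp [signedPerm_apply]

/-! ### Gluing the companions of adjacent cells -/

namespace BrickMesh

variable {Ω : Set E3} (𝒯 : BrickMesh Ω)

/-- On a common face, the change of reference coordinates between two cells is a signed permutation.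
For k = l the face is the whole cube and the permutation trivial. -/
theorem exists_signedPerm {k l : Fin 𝒯.n} {z : E3} (hk : z ∈ 𝒯.cell k) (hl : z ∈ 𝒯.cell l) :
    ∃ s π ε, (𝒯.T k).symm z ∈ refFace s ∧
      ∀ x ∈ refFace s, 𝒯.T k x ∈ 𝒯.cell l ∧ (𝒯.T l).symm (𝒯.T k x) = signedPerm π ε x := by
  by_cases hkl : k = l
  · subst hkl
    refine ⟨fun _ => 0, 1, fun _ => 1, mem_refFace_zero ?_, fun x hx => ⟨⟨x, hx.1, rfl⟩, ?_⟩⟩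
    · obtain ⟨x, hx, rfl⟩ := hk
      rwa [AffineEquiv.symm_apply_apply]
    · rw [AffineEquiv.symm_apply_apply, signedPerm_one]
  · rcases 𝒯.face_to_face k l hkl with h | ⟨s, s', h, h'⟩
    · exact absurd (show z ∈ (∅ : Set E3) from h ▸ ⟨hk, hl⟩) (notMem_empty z)
    · have hM : ((𝒯.T k).trans (𝒯.T l).symm) '' refFace s = refFace s' := by
        have e : ((𝒯.T k).trans (𝒯.T l).symm) '' refFace s
            = (𝒯.T l).symm '' (𝒯.T k '' refFace s) := by
          rw [image_image]; rfl
        rw [e, ← h, h', image_image]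
        simp
      obtain ⟨π, ε, hR⟩ := BrickFEM.exists_signedPerm hM
      refine ⟨s, π, ε, ?_, fun x hx => ⟨?_, hR x hx⟩⟩
      · have : z ∈ 𝒯.T k '' refFace s := h ▸ ⟨hk, hl⟩
        obtain ⟨x, hx, rfl⟩ := this
        rwa [AffineEquiv.symm_apply_apply]
      · have : 𝒯.T k x ∈ (𝒯.T k '' refCube) ∩ (𝒯.T l '' refCube) := by
          rw [h]; exact mem_image_of_mem _ hx
        exact this.2

/-- There are no hanging nodes: signed permutations preserve the reference nodes, so a node of one
cell is a node of every cell containing it. -/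
theorem symm_mem_refNodes {k : Fin 𝒯.n} {z : E3} (hz : z ∈ 𝒯.nodes) (hk : z ∈ 𝒯.cell k) :
    (𝒯.T k).symm z ∈ refNodes := by
  obtain ⟨l, x, hx, rfl⟩ := mem_iUnion.1 hz
  obtain ⟨s, π, ε, h1, h2⟩ := 𝒯.exists_signedPerm (k := l)
    ⟨x, refNodes_subset_refCube hx, rfl⟩ hk
  rw [AffineEquiv.symm_apply_apply] at h1
  rw [(h2 x h1).2]
  exact signedPerm_mem_refNodes π ε hx

theorem image_mem_nodes (k : Fin 𝒯.n) {y : E3} (hy : y ∈ refNodes) : 𝒯.T k y ∈ 𝒯.nodes :=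
  mem_iUnion.2 ⟨k, y, hy, rfl⟩

open Classical in
/-- The conforming companion of a piecewise function. -/
def conforming (w : Fin 𝒯.n → E3 → ℝ) (z : E3) : ℝ :=
  if h : ∃ k, z ∈ 𝒯.cell k then
    companion (fun y => w h.choose (𝒯.T h.choose y)) ((𝒯.T h.choose).symm z)
  else 0

/-- Independence of the chosen cell, which is conformity: on the common face the two companions have
the same nodal data and differ by a symmetry of the cube. -/
theorem conforming_eq {w : Fin 𝒯.n → E3 → ℝ}
    (hw : ∀ z ∈ 𝒯.nodes, ∀ k l, z ∈ 𝒯.cell k → z ∈ 𝒯.cell l → w k z = w l z) {k : Fin 𝒯.n}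
    {z : E3} (hz : z ∈ 𝒯.cell k) :
    𝒯.conforming w z = companion (fun y => w k (𝒯.T k y)) ((𝒯.T k).symm z) := by
  have h : ∃ k, z ∈ 𝒯.cell k := ⟨k, hz⟩
  rw [conforming, dif_pos h]
  generalize h.choose = l, h.choose_spec = hl
  obtain ⟨s, π, ε, h1, h2⟩ := 𝒯.exists_signedPerm hz hl
  have e : (𝒯.T l).symm z = signedPerm π ε ((𝒯.T k).symm z) := by
    rw [← (h2 _ h1).2, AffineEquiv.apply_symm_apply]
  rw [e, ← companion_signedPerm]
  refine companion_congr (fun y hy hys => ?_) h1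
  rw [← (h2 y hys).2, AffineEquiv.apply_symm_apply]
  exact hw _ (𝒯.image_mem_nodes k hy) l k (h2 y hys).1 ⟨y, hys.1, rfl⟩

/-- At a boundary point some coordinate of Ω equals ±1. This coordinate is affine and extremal
there, so it equals ±1 on the whole carrier face in the cell; all nodes of that face lie on Γ, and
the companion vanishes on it. -/
theorem conforming_eq_zero {S : E3 ≃ᵃ[ℝ] E3} (𝒯 : BrickMesh (boxDomain S)) {w : Fin 𝒯.n → E3 → ℝ}
    (hw : ∀ z ∈ 𝒯.nodes, ∀ k l, z ∈ 𝒯.cell k → z ∈ 𝒯.cell l → w k z = w l z)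
    (hw0 : ∀ z ∈ 𝒯.nodes, z ∈ frontier (boxDomain S) → ∀ k, z ∈ 𝒯.cell k → w k z = 0) {z : E3}
    (hz : z ∉ boxDomain S) : 𝒯.conforming w z = 0 := by
  by_cases h : ∃ k, z ∈ 𝒯.cell k
  swap
  · rw [conforming, dif_neg h]
  obtain ⟨k, hk⟩ := h
  rw [𝒯.conforming_eq hw hk]
  obtain ⟨x, hx, rfl⟩ := hk
  rw [AffineEquiv.symm_apply_apply]
  have hsub : ∀ y ∈ refCube, 𝒯.T k y ∈ S '' refCube := by
    intro y hy
    rw [← closure_boxDomain, ← 𝒯.cover]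
    exact mem_iUnion.2 ⟨k, y, hy, rfl⟩
  set M := (𝒯.T k).trans S.symm with hM
  have hMle : ∀ y ∈ refCube, ∀ i, |M y i| ≤ 1 := by
    intro y hy i
    obtain ⟨y', hy', he⟩ := hsub y hy
    have : M y = y' := by rw [hM, AffineEquiv.trans_apply, ← he, AffineEquiv.symm_apply_apply]
    rw [this]; exact hy' i
  have hex : ∃ i, |M x i| = 1 := by
    by_contra! hne
    refine hz ((boxDomain_eq S).ge ?_)
    refine ⟨M x, fun i => lt_of_le_of_ne (hMle x hx i) (hne i), ?_⟩
    rw [hM, AffineEquiv.trans_apply, AffineEquiv.apply_symm_apply]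
  obtain ⟨i, hi⟩ := hex
  obtain ⟨τ, hτ⟩ := exists_units_eq hi
  refine companion_eq_zero (fun y hy hys => ?_) (mem_refFace_carrier hx)
  refine hw0 _ (𝒯.image_mem_nodes k hy) ?_ k ⟨y, hys.1, rfl⟩
  have h1 : ((τ : ℤ) : ℝ) * M y i = 1 := by
    refine eq_one_on_carrier (f := fun y => ((τ : ℤ) : ℝ) * M y i) ?_ ?_ hx ?_ hys
    · intro a b t
      have e1 := affine_apply_sub M (a + t • (a - b)) a i
      have e2 := affine_apply_sub M a b i
      have e3 : ∑ j, affEntry M i j * ((a + t • (a - b) : E3) j - a j)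
          = t * ∑ j, affEntry M i j * (a j - b j) := by
        rw [Finset.mul_sum]
        refine Finset.sum_congr rfl fun j _ => ?_
        simp
        ring
      rw [e3, ← e2] at e1
      simp only
      linear_combination ((τ : ℤ) : ℝ) * e1
    · intro y hy
      refine (le_abs_self _).trans ?_
      rw [abs_mul, abs_units, one_mul]
      exact hMle y hy i
    · simp only
      rw [hτ, units_sq]
  rw [(isOpen_boxDomain S).frontier_eq]
  refine ⟨closure_boxDomain S ▸ hsub y hys.1, fun hmem => ?_⟩
  obtain ⟨y', hy', he⟩ := (boxDomain_eq S).le hmem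
  have : M y = y' := by rw [hM, AffineEquiv.trans_apply, ← he, AffineEquiv.symm_apply_apply]
  have h2 := hy' i
  rw [← this] at h2
  have h3 : |((τ : ℤ) : ℝ) * M y i| = |M y i| := by rw [abs_mul, abs_units, one_mul]
  rw [h1, abs_one] at h3
  linarith

theorem isCompact_cell (k : Fin 𝒯.n) : IsCompact (𝒯.cell k) :=
  isCompact_refCube.image (continuous_affine (𝒯.T k))

theorem convex_cell (k : Fin 𝒯.n) : Convex ℝ (𝒯.cell k) := by
  have h : Convex ℝ refCube := by
    have : refCube = ⋂ i : Fin 3, {x : E3 | x i ∈ Icc (-1 : ℝ) 1} := by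
      ext x; simp [refCube, abs_le]
    rw [this]
    refine convex_iInter fun i => ?_
    exact (convex_Icc (-1 : ℝ) 1).is_linear_preimage (f := fun x : E3 => x i)
      ⟨fun _ _ => rfl, fun _ _ => rfl⟩
  exact h.affine_image (𝒯.T k).toAffineMap

end BrickMesh

/-! ### Lipschitz continuity from a finite closed cover -/

/-- A function which is Lipschitz on each of finitely many closed sets covering the space is
Lipschitz. -/
theorem lipschitzWith_of_finite_cover {ι E : Type*} [Finite ι] [NormedAddCommGroup E]
    [NormedSpace ℝ E] {A : ι → Set E} (hA : ∀ i, IsClosed (A i)) (hcov : ⋃ i, A i = univ)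
    {W : E → ℝ} {C : NNReal} (h : ∀ i, LipschitzOnWith C W (A i)) : LipschitzWith C W := by
  have hnear : ∀ x, ∀ᶠ y in nhds x, |W y - W x| ≤ C * dist y x := by
    intro x
    -- Near x only those sets of the cover matter that contain x; hence the Lipschitz estimate holds
    -- between x and all nearby points.
    have : ∀ i, ∀ᶠ y in nhds x, y ∈ A i → x ∈ A i := by
      intro i
      by_cases hx : x ∈ A i
      · exact Filter.Eventually.of_forall fun _ _ => hx
      · filter_upwards [(hA i).isOpen_compl.mem_nhds hx] with y hy hy'
        exact absurd hy' hy
    filter_upwards [Filter.eventually_all.2 this] with y hy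
    obtain ⟨i, hi⟩ := mem_iUnion.1 (hcov ▸ mem_univ y)
    have := (h i).dist_le_mul y hi x (hy i hi)
    rwa [Real.dist_eq] at this
  have hcont : Continuous W := by
    rw [continuous_iff_continuousAt]
    intro x
    rw [ContinuousAt, tendsto_iff_dist_tendsto_zero]
    have h0 : Filter.Tendsto (fun y => (C : ℝ) * dist y x) (nhds x) (nhds 0) := by
      have : Continuous fun y => (C : ℝ) * dist y x := by fun_prop
      simpa using this.tendsto x
    refine squeeze_zero' (Filter.Eventually.of_forall fun _ => dist_nonneg) ?_ h0
    filter_upwards [hnear x] with y hy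
    rwa [Real.dist_eq]
  have key : ∀ x y, W y - W x ≤ C * dist y x := by
    intro x y
    set p : ℝ → E := fun t => x + t • (y - x) with hp
    have hpc : Continuous p := by fun_prop
    have hd : ∀ a b, dist (p a) (p b) = |a - b| * dist y x := by
      intro a b
      rw [dist_eq_norm, dist_eq_norm, ← Real.norm_eq_abs, ← norm_smul]
      congr 1
      simp only [hp]
      module
    -- The local estimate centred at each point bounds the right difference quotients along the
    -- segment, and a mean value inequality integrates them.
    have := image_le_of_liminf_slope_right_le_deriv_boundary (f := fun t => W (p t)) (a := 0)
      (b := 1) (B := fun t => W x + C * dist y x * t) (B' := fun _ => C * dist y x)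
      (hcont.comp hpc).continuousOn (by simp [hp]) (by fun_prop)
      (fun t _ => by
        have := ((hasDerivAt_id t).const_mul (C * dist y x)).const_add (W x)
        simpa using this.hasDerivWithinAt)
      (fun t _ r hr => by
        refine Filter.Eventually.frequently ?_
        have h1 := (hpc.continuousAt (x := t)).eventually (hnear (p t))
        filter_upwards [nhdsWithin_le_nhds h1, self_mem_nhdsWithin] with z hz hzt
        have hzt' : 0 < z - t := sub_pos.2 hzt
        rw [slope_def_field]
        refine lt_of_le_of_lt ?_ hr
        rw [div_le_iff₀ hzt']
        rw [hd, abs_of_pos hzt'] at hz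
        linarith [le_abs_self (W (p z) - W (p t))])
      (right_mem_Icc.2 zero_le_one)
    simp [hp] at this
    linarith
  refine LipschitzWith.of_dist_le_mul fun x y => ?_
  rw [Real.dist_eq, abs_sub_le_iff]
  refine ⟨key y x, ?_⟩
  rw [dist_comm]
  exact key x y

/-- The space is covered by the cells, on each of which the companion is smooth on a compact convex
set, and by the complement of Ω, where it is zero. -/
theorem BrickMesh.exists_lipschitzWith_conforming {S : E3 ≃ᵃ[ℝ] E3} (𝒯 : BrickMesh (boxDomain S))
    {w : Fin 𝒯.n → E3 → ℝ}
    (hw : ∀ z ∈ 𝒯.nodes, ∀ k l, z ∈ 𝒯.cell k → z ∈ 𝒯.cell l → w k z = w l z)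
    (hw0 : ∀ z ∈ 𝒯.nodes, z ∈ frontier (boxDomain S) → ∀ k, z ∈ 𝒯.cell k → w k z = 0) :
    ∃ C, LipschitzWith C (𝒯.conforming w) := by
  have hloc : ∀ k, ∃ C : NNReal, LipschitzOnWith C (𝒯.conforming w) (𝒯.cell k) := by
    intro k
    have hc : ContDiff ℝ ∞ fun z =>
        companion (fun y => w k (𝒯.T k y)) ((𝒯.T k).symm z) :=
      (contDiff_companion _).comp (contDiff_affine (𝒯.T k).symm)
    have hf := hc.continuous_fderiv (by simp)
    obtain ⟨C, hC⟩ := (𝒯.isCompact_cell k).exists_bound_of_continuousOn hf.continuousOn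
    refine ⟨C.toNNReal, ?_⟩
    have := (𝒯.convex_cell k).lipschitzOnWith_of_nnnorm_fderiv_le (𝕜 := ℝ) (C := C.toNNReal)
      (fun x _ => (hc.differentiable (by simp)) x) (fun x hx => by
        rw [← NNReal.coe_le_coe, coe_nnnorm]
        exact (hC x hx).trans (Real.le_coe_toNNReal C))
    intro x hx y hy
    rw [𝒯.conforming_eq hw hx, 𝒯.conforming_eq hw hy]
    exact this hx hy
  choose C hC using hloc
  refine ⟨∑ k, C k, lipschitzWith_of_finite_cover
    (A := fun o : Option (Fin 𝒯.n) => o.elim (boxDomain S)ᶜ 𝒯.cell) ?_ ?_ ?_⟩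
  · rintro (_ | k)
    · exact (isOpen_boxDomain S).isClosed_compl
    · exact (𝒯.isCompact_cell k).isClosed
  · refine eq_univ_of_forall fun x => mem_iUnion.2 ?_
    by_cases hx : x ∈ boxDomain S
    · have := subset_closure hx
      rw [← 𝒯.cover] at this
      obtain ⟨k, hk⟩ := mem_iUnion.1 this
      exact ⟨some k, hk⟩
    · exact ⟨none, hx⟩
  · rintro (_ | k)
    · intro x hx y hy
      rw [𝒯.conforming_eq_zero hw hw0 hx, 𝒯.conforming_eq_zero hw hw0 hy]
      simp
    · exact (hC k).weaken (Finset.single_le_sum (fun _ _ => zero_le) (Finset.mem_univ k))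

/-! ### Lipschitz functions as test functions, by mollification and dilation -/

open scoped Convolution in
/-- The mollification of a function by a bump function. -/
def mollify (φ : ContDiffBump (0 : E3)) (ψ : E3 → ℝ) : E3 → ℝ :=
  φ.normed volume ⋆[ContinuousLinearMap.lsmul ℝ ℝ, volume] ψ

theorem contDiff_mollify (φ : ContDiffBump (0 : E3)) {ψ : E3 → ℝ} (hψ : Continuous ψ) :
    ContDiff ℝ ∞ (mollify φ ψ) :=
  φ.hasCompactSupport_normed.contDiff_convolution_left _ φ.contDiff_normed hψ.locallyIntegrable

theorem abs_mollify_sub_le (φ : ContDiffBump (0 : E3)) {ψ : E3 → ℝ} {C : NNReal}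
    (hψ : LipschitzWith C ψ) (x : E3) : |mollify φ ψ x - ψ x| ≤ C * φ.rOut := by
  rw [← Real.dist_eq]
  refine φ.dist_normed_convolution_le hψ.continuous.aestronglyMeasurable fun y hy => ?_
  refine (hψ.dist_le_mul y x).trans ?_
  gcongr
  exact (Metric.mem_ball.1 hy).le

theorem abs_lineDeriv_le {ψ : E3 → ℝ} {C : NNReal} (hψ : LipschitzWith C ψ) (i : Fin 3) (x : E3) :
    |lineDeriv ℝ ψ x (EuclideanSpace.single i (1 : ℝ))| ≤ C := by
  have := norm_lineDeriv_le_of_lipschitz ℝ (v := EuclideanSpace.single i (1 : ℝ)) (x₀ := x) hψ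
  simpa using this

/-- The derivative first falls on the smooth kernel; integration by parts for Lipschitz functions
moves it to ψ. Thus the derivatives of the mollifications are bounded and converge at almost every
point. -/
theorem partialDeriv_mollify (φ : ContDiffBump (0 : E3)) {ψ : E3 → ℝ} {C : NNReal}
    (hψ : LipschitzWith C ψ) (i : Fin 3) :
    partialDeriv i (mollify φ ψ)
      = mollify φ fun x => lineDeriv ℝ ψ x (EuclideanSpace.single i (1 : ℝ)) := by
  funext x
  have h := (φ.hasCompactSupport_normed (μ := volume)).hasFDerivAt_convolution_left
    (ContinuousLinearMap.lsmul ℝ ℝ) (φ.contDiff_normed (n := 1))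
    hψ.continuous.locallyIntegrable (μ := volume) x
  have hc : HasCompactSupport (φ.normed volume) := φ.hasCompactSupport_normed
  have hd : ContDiff ℝ 1 (φ.normed (volume : Measure E3)) := φ.contDiff_normed
  obtain ⟨D, hD⟩ := hd.lipschitzWith_of_hasCompactSupport hc (by simp)
  have hg : LipschitzWith C fun t => ψ (x - t) := by
    refine LipschitzWith.of_dist_le_mul fun s t => ?_
    refine (hψ.dist_le_mul _ _).trans (le_of_eq ?_)
    rw [dist_sub_left]
  have ibp := hg.integral_lineDeriv_mul_eq (μ := volume) hD hc
    (-EuclideanSpace.single i (1 : ℝ))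
  have hint : Integrable fun t => ((ContinuousLinearMap.lsmul ℝ ℝ).precompL E3)
      (fderiv ℝ (φ.normed volume) t) (ψ (x - t)) := by
    have := (hc.fderiv (𝕜 := ℝ)).convolutionExists_left ((ContinuousLinearMap.lsmul ℝ ℝ).precompL E3)
      (hd.continuous_fderiv (by simp)) hψ.continuous.locallyIntegrable (μ := volume) x
    exact this
  have e1 : partialDeriv i (mollify φ ψ) x
      = ∫ t, fderiv ℝ (φ.normed volume) t (EuclideanSpace.single i (1 : ℝ)) * ψ (x - t) := by
    rw [partialDeriv]
    have : fderiv ℝ (mollify φ ψ) x = _ := h.fderiv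
    rw [this, convolution_def, ContinuousLinearMap.integral_apply hint]
    rfl
  rw [e1]
  have e2 : mollify φ (fun x => lineDeriv ℝ ψ x (EuclideanSpace.single i (1 : ℝ))) x
      = ∫ t, lineDeriv ℝ (fun t => ψ (x - t)) t (-EuclideanSpace.single i (1 : ℝ)) *
        φ.normed volume t := by
    change ∫ t, φ.normed volume t • lineDeriv ℝ ψ (x - t) (EuclideanSpace.single i (1 : ℝ)) = _
    refine integral_congr_ae (Filter.Eventually.of_forall fun t => ?_)
    simp only [smul_eq_mul]
    rw [mul_comm]
    congr 1
    unfold lineDeriv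
    congr 1
    funext s
    congr 1
    module
  rw [e2, ibp]
  refine integral_congr_ae (Filter.Eventually.of_forall fun t => ?_)
  simp only [neg_neg]
  rw [((hd.differentiable (by simp)) t).lineDeriv_eq_fderiv]

theorem isTestFunction_mollify {Ω : Set E3} {φ : ContDiffBump (0 : E3)} {ψ : E3 → ℝ}
    (hψ : Continuous ψ) (hc : HasCompactSupport ψ)
    (hr : Metric.cthickening φ.rOut (tsupport ψ) ⊆ Ω) : IsTestFunction Ω (mollify φ ψ) := by
  have hs : Function.support (mollify φ ψ) ⊆ Metric.cthickening φ.rOut (tsupport ψ) := by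
    intro x hx
    obtain ⟨a, ha, b, hb, rfl⟩ := support_convolution_subset _ hx
    rw [φ.support_normed_eq] at ha
    refine Metric.mem_cthickening_of_dist_le _ b _ _ (subset_tsupport _ hb) ?_
    rw [dist_eq_norm, add_sub_cancel_right]
    exact (mem_ball_zero_iff.1 ha).le
  have ht : tsupport (mollify φ ψ) ⊆ Metric.cthickening φ.rOut (tsupport ψ) :=
    closure_minimal hs Metric.isClosed_cthickening
  exact ⟨contDiff_mollify φ hψ, HasCompactSupport.of_support_subset_isCompact hc.cthickening hs,
    ht.trans hr⟩

theorem LipschitzWith.locallyIntegrable_lineDeriv {ψ : E3 → ℝ} {C : NNReal}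
    (hψ : LipschitzWith C ψ) (i : Fin 3) :
    LocallyIntegrable fun x => lineDeriv ℝ ψ x (EuclideanSpace.single i (1 : ℝ)) := by
  intro x
  refine ⟨Metric.ball x 1, Metric.ball_mem_nhds x one_pos, ?_⟩
  refine IntegrableOn.of_bound measure_ball_lt_top
    (measurable_lineDeriv hψ.continuous).aestronglyMeasurable (C : ℝ)
    (Filter.Eventually.of_forall fun y => abs_lineDeriv_le hψ i y)

/-- Mollify ψ within Ω and pass to the limit by dominated convergence: uniform bounds come from the
Lipschitz constant, convergence of the derivatives from Lebesgue's differentiation theorem. -/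
theorem HasWeakGrad.integral_mul_lineDeriv_of_hasCompactSupport {Ω : Set E3} (hΩ : IsOpen Ω)
    (hb : Bornology.IsBounded Ω) {g : E3 → ℝ} {G : Fin 3 → E3 → ℝ} (h : HasWeakGrad Ω g G)
    {ψ : E3 → ℝ} {C : NNReal} (hψ : LipschitzWith C ψ) (hc : HasCompactSupport ψ)
    (hs : tsupport ψ ⊆ Ω) (i : Fin 3) :
    ∫ x in Ω, g x * lineDeriv ℝ ψ x (EuclideanSpace.single i (1 : ℝ))
      = -∫ x in Ω, G i x * ψ x := by
  have hfin : IsFiniteMeasure (volume.restrict Ω) := ⟨by simpa using hb.measure_lt_top⟩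
  obtain ⟨δ, hδ, hδΩ⟩ := IsCompact.exists_cthickening_subset_open hc hΩ hs
  set r : ℕ → ℝ := fun n => min δ 1 / (n + 1) with hr
  have hm : 0 < min δ 1 := lt_min hδ one_pos
  have hr0 : ∀ n, 0 < r n := fun n => div_pos hm (by positivity)
  have hrle : ∀ n, r n ≤ min δ 1 := fun n => div_le_self hm.le (by linarith [n.cast_nonneg (α := ℝ)])
  have hrt : Filter.Tendsto r Filter.atTop (nhds 0) := by
    have := tendsto_one_div_add_atTop_nhds_zero_nat (𝕜 := ℝ)
    simpa [hr, div_eq_mul_inv] using this.const_mul (min δ 1)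
  let φ : ℕ → ContDiffBump (0 : E3) := fun n =>
    ⟨r n / 2, r n, by linarith [hr0 n], by linarith [hr0 n]⟩
  have hφt : ∀ n, IsTestFunction Ω (mollify (φ n) ψ) := fun n =>
    isTestFunction_mollify hψ.continuous hc
      ((Metric.cthickening_mono ((hrle n).trans (min_le_left _ _)) _).trans hδΩ)
  have key := fun n => h.2.2 _ (hφt n) i
  obtain ⟨B, hB⟩ := hc.exists_bound_of_continuous hψ.continuous
  have gi : Integrable g (volume.restrict Ω) := h.1.integrable (by norm_num)
  have Gi : Integrable (G i) (volume.restrict Ω) := (h.2.1 i).integrable (by norm_num)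
  have l1 : Filter.Tendsto (fun n => ∫ x in Ω, G i x * mollify (φ n) ψ x) Filter.atTop
      (nhds (∫ x in Ω, G i x * ψ x)) := by
    refine tendsto_integral_of_dominated_convergence (fun x => |G i x| * (B + C)) ?_
      (Gi.abs.mul_const _) ?_ ?_
    · exact fun n => Gi.1.mul (contDiff_mollify (φ n) hψ.continuous).continuous.aestronglyMeasurable
    · refine fun n => Filter.Eventually.of_forall fun x => ?_
      rw [Real.norm_eq_abs, abs_mul]
      gcongr
      have h1 := abs_mollify_sub_le (φ n) hψ x
      have h2 : C * (φ n).rOut ≤ (C : ℝ) * 1 := by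
        gcongr
        exact (hrle n).trans (min_le_right _ _)
      have h3 := hB x
      rw [Real.norm_eq_abs] at h3
      have h4 := abs_sub_abs_le_abs_sub (mollify (φ n) ψ x) (ψ x)
      linarith
    · refine Filter.Eventually.of_forall fun x => ?_
      refine Filter.Tendsto.const_mul _ ?_
      exact ContDiffBump.convolution_tendsto_right_of_continuous (φ := φ) hrt hψ.continuous x
  have l2 : Filter.Tendsto (fun n => ∫ x in Ω, g x * partialDeriv i (mollify (φ n) ψ) x)
      Filter.atTop
      (nhds (∫ x in Ω, g x * lineDeriv ℝ ψ x (EuclideanSpace.single i (1 : ℝ)))) := by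
    have hae := ContDiffBump.ae_convolution_tendsto_right_of_locallyIntegrable (μ := volume)
      (φ := φ) (K := 2) hrt (Filter.Eventually.of_forall fun n => by
        change r n ≤ 2 * (r n / 2); linarith)
      (LipschitzWith.locallyIntegrable_lineDeriv hψ i)
    refine tendsto_integral_of_dominated_convergence (fun x => |g x| * (C + 2 * C)) ?_
      (gi.abs.mul_const _) ?_ ?_
    · exact fun n => gi.1.mul (contDiff_partialDeriv i
        (contDiff_mollify (φ n) hψ.continuous)).continuous.aestronglyMeasurable
    · refine fun n => Filter.Eventually.of_forall fun x => ?_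
      rw [Real.norm_eq_abs, abs_mul, partialDeriv_mollify (φ n) hψ]
      gcongr
      have h1 : dist (mollify (φ n) (fun x => lineDeriv ℝ ψ x (EuclideanSpace.single i (1 : ℝ))) x)
          (lineDeriv ℝ ψ x (EuclideanSpace.single i (1 : ℝ))) ≤ 2 * C := by
        refine (φ n).dist_normed_convolution_le
          (measurable_lineDeriv hψ.continuous).aestronglyMeasurable fun y _ => ?_
        rw [Real.dist_eq]
        have a1 := abs_lineDeriv_le hψ i y
        have a2 := abs_lineDeriv_le hψ i x
        have a3 := abs_sub (lineDeriv ℝ ψ y (EuclideanSpace.single i (1 : ℝ)))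
          (lineDeriv ℝ ψ x (EuclideanSpace.single i (1 : ℝ)))
        linarith
      rw [Real.dist_eq] at h1
      have a2 := abs_lineDeriv_le hψ i x
      have a4 := abs_sub_abs_le_abs_sub
        (mollify (φ n) (fun x => lineDeriv ℝ ψ x (EuclideanSpace.single i (1 : ℝ))) x)
        (lineDeriv ℝ ψ x (EuclideanSpace.single i (1 : ℝ)))
      linarith
    · filter_upwards [ae_restrict_of_ae hae] with x hx
      refine Filter.Tendsto.const_mul _ ?_
      simp only [partialDeriv_mollify _ hψ]
      exact hx
  simp only [key] at l2
  exact tendsto_nhds_unique l2 l1.neg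

/-- Integration by parts against a Lipschitz function which vanishes outside the domain. -/
theorem HasWeakGrad.integral_mul_lineDeriv {S : E3 ≃ᵃ[ℝ] E3} {g : E3 → ℝ} {G : Fin 3 → E3 → ℝ}
    (h : HasWeakGrad (S '' openCube) g G) {W : E3 → ℝ} {C : NNReal} (hW : LipschitzWith C W)
    (h0 : ∀ x, x ∉ S '' openCube → W x = 0) (i : Fin 3)
    (hcont : ∀ᵐ x ∂(volume.restrict (S '' openCube)),
      ContinuousAt (fun x => lineDeriv ℝ W x (EuclideanSpace.single i (1 : ℝ))) x) :
    ∫ x in S '' openCube, g x * lineDeriv ℝ W x (EuclideanSpace.single i (1 : ℝ))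
      = -∫ x in S '' openCube, G i x * W x := by
  have hb := isBounded_affine_image S
  have hΩ := isOpen_affine_image S
  have hfin : IsFiniteMeasure (volume.restrict (S '' openCube)) :=
    ⟨by simpa using hb.measure_lt_top⟩
  have gi : Integrable g (volume.restrict (S '' openCube)) := h.1.integrable (by norm_num)
  have Gi : Integrable (G i) (volume.restrict (S '' openCube)) := (h.2.1 i).integrable (by norm_num)
  set e : E3 := EuclideanSpace.single i (1 : ℝ) with he
  set t : ℕ → ℝ := fun n => 1 + 1 / ((n : ℝ) + 1) with ht
  have ht1 : ∀ n, 1 < t n := fun n => by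
    have : (0 : ℝ) < 1 / ((n : ℝ) + 1) := by positivity
    simp only [ht]; linarith
  have ht2 : ∀ n, t n ≤ 2 := fun n => by
    have : 1 / ((n : ℝ) + 1) ≤ 1 := by
      rw [div_le_one (by positivity)]; linarith [n.cast_nonneg (α := ℝ)]
    simp only [ht]; linarith
  have htl : Filter.Tendsto t Filter.atTop (nhds 1) := by
    simpa [ht] using (tendsto_one_div_add_atTop_nhds_zero_nat (𝕜 := ℝ)).const_add 1
  -- The box is star-shaped about its centre `S 0`. Composition with a dilation by t > 1 shrinks the
  -- support of W into a compact subset of Ω, and t tends to 1.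
  set A : ℕ → E3 → E3 := fun n x => S 0 + t n • (x - S 0) with hA
  have hAl : ∀ x, Filter.Tendsto (fun n => A n x) Filter.atTop (nhds x) := by
    intro x
    have := (htl.smul_const (x - S 0)).const_add (S 0)
    simpa [hA] using this
  have hSA : ∀ n y, A n (S y) = S (t n • y) := by
    intro n y
    rw [hA]
    simp only
    rw [affine_eq S y, affine_eq S (t n • y), map_smul]
    module
  have hWA : ∀ n, LipschitzWith (C * 2) fun x => W (A n x) := by
    intro n
    refine LipschitzWith.of_dist_le_mul fun x y => ?_
    refine (hW.dist_le_mul _ _).trans ?_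
    have : dist (A n x) (A n y) = t n * dist x y := by
      rw [dist_eq_norm, dist_eq_norm]
      have : A n x - A n y = t n • (x - y) := by simp only [hA]; module
      rw [this, norm_smul, Real.norm_eq_abs, abs_of_pos (by linarith [ht1 n])]
    rw [this]
    push_cast
    rw [mul_assoc]
    gcongr
    exact ht2 n
  have hsupp : ∀ n, Function.support (fun x => W (A n x)) ⊆
      S '' {y | ∀ i, |y i| ≤ (t n)⁻¹} := by
    intro n x hx
    by_contra hcon
    refine hx (h0 _ fun hmem => hcon ?_)
    obtain ⟨y, rfl⟩ := S.surjective x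
    rw [hSA] at hmem
    obtain ⟨y', hy', hyy⟩ := hmem
    have e2 := S.injective hyy
    refine ⟨y, fun j => ?_, rfl⟩
    have h1 := hy' j
    rw [e2] at h1
    have h2 : |t n * y j| < 1 := by simpa using h1
    rw [abs_mul, abs_of_pos (by linarith [ht1 n])] at h2
    rw [← one_div, le_div_iff₀ (by linarith [ht1 n])]
    linarith
  have hcpt : ∀ n, IsCompact (S '' {y : E3 | ∀ i, |y i| ≤ (t n)⁻¹}) := by
    intro n
    refine IsCompact.image ?_ (continuous_affine S)
    refine isCompact_refCube.of_isClosed_subset ?_ ?_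
    · have : {y : E3 | ∀ i, |y i| ≤ (t n)⁻¹} = ⋂ i, {y : E3 | |y i| ≤ (t n)⁻¹} := by ext; simp
      rw [this]
      exact isClosed_iInter fun i => isClosed_le (continuous_coord i).abs continuous_const
    · exact fun y hy i => (hy i).trans (inv_le_one_of_one_le₀ (ht1 n).le)
  have hsub : ∀ n, S '' {y : E3 | ∀ i, |y i| ≤ (t n)⁻¹} ⊆ S '' openCube := fun n =>
    image_mono fun y hy i => (hy i).trans_lt (inv_lt_one_of_one_lt₀ (ht1 n))
  have key : ∀ n, ∫ x in S '' openCube, g x * (t n * lineDeriv ℝ W (A n x) e)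
      = -∫ x in S '' openCube, G i x * W (A n x) := by
    intro n
    have := h.integral_mul_lineDeriv_of_hasCompactSupport hΩ hb (hWA n)
      (HasCompactSupport.of_support_subset_isCompact (hcpt n) (hsupp n))
      ((closure_minimal (hsupp n) (hcpt n).isClosed).trans (hsub n)) i
    rw [← this]
    refine integral_congr_ae (Filter.Eventually.of_forall fun x => ?_)
    simp only
    congr 1
    unfold lineDeriv
    have h2 := deriv_comp_mul_left (t n) (fun s : ℝ => W (A n x + s • e)) 0
    rw [mul_zero, smul_eq_mul] at h2
    rw [← h2]
    congr 1
    funext s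
    congr 1
    simp only [hA]
    module
  have hWB : ∃ B, ∀ x, |W x| ≤ B := by
    have hcW : HasCompactSupport W := by
      refine HasCompactSupport.of_support_subset_isCompact
        (isCompact_refCube.image (continuous_affine S)) fun x hx => ?_
      by_contra hcon
      exact hx (h0 x fun hm => hcon (image_mono openCube_subset_refCube hm))
    exact hcW.exists_bound_of_continuous hW.continuous
  obtain ⟨B, hB⟩ := hWB
  have l1 : Filter.Tendsto (fun n => ∫ x in S '' openCube, G i x * W (A n x)) Filter.atTop
      (nhds (∫ x in S '' openCube, G i x * W x)) := by
    refine tendsto_integral_of_dominated_convergence (fun x => |G i x| * B) ?_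
      (Gi.abs.mul_const _) ?_ ?_
    · exact fun n => Gi.1.mul (hWA n).continuous.aestronglyMeasurable
    · refine fun n => Filter.Eventually.of_forall fun x => ?_
      rw [Real.norm_eq_abs, abs_mul]
      gcongr
      exact hB _
    · exact Filter.Eventually.of_forall fun x =>
        Filter.Tendsto.const_mul _ ((hW.continuous.tendsto x).comp (hAl x))
  have l2 : Filter.Tendsto
      (fun n => ∫ x in S '' openCube, g x * (t n * lineDeriv ℝ W (A n x) e)) Filter.atTop
      (nhds (∫ x in S '' openCube, g x * lineDeriv ℝ W x e)) := by
    refine tendsto_integral_of_dominated_convergence (fun x => |g x| * (2 * C)) ?_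
      (gi.abs.mul_const _) ?_ ?_
    · intro n
      refine gi.1.mul (AEStronglyMeasurable.const_mul ?_ _)
      have hAm : Measurable (A n) := by
        have : Continuous (A n) := by simp only [hA]; fun_prop
        exact this.measurable
      exact ((measurable_lineDeriv hW.continuous).comp hAm).aestronglyMeasurable
    · refine fun n => Filter.Eventually.of_forall fun x => ?_
      rw [Real.norm_eq_abs, abs_mul, abs_mul, abs_of_pos (show 0 < t n by linarith [ht1 n])]
      have := abs_lineDeriv_le hW i (A n x)
      have := ht2 n
      have := ht1 n
      gcongr
    -- The derivative is evaluated at the moving points A n x, hence the assumption of its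
    -- continuity at almost every point.
    · filter_upwards [hcont] with x hx
      refine Filter.Tendsto.const_mul _ ?_
      have := htl.mul (hx.tendsto.comp (hAl x))
      rwa [one_mul] at this
  simp only [key] at l2
  exact tendsto_nhds_unique l2 l1.neg

/-! ### Summation over the cells, and testing with the conforming companion -/

namespace BrickMesh

variable {S : E3 ≃ᵃ[ℝ] E3} (𝒯 : BrickMesh (boxDomain S))

theorem interior_cell_subset (k : Fin 𝒯.n) : interior (𝒯.cell k) ⊆ boxDomain S := by
  refine interior_mono ?_
  rw [← closure_boxDomain, ← 𝒯.cover]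
  exact subset_iUnion (fun k => 𝒯.T k '' refCube) k

theorem volume_diff_interior_cell :
    volume (boxDomain S \ ⋃ k, interior (𝒯.cell k)) = 0 := by
  have h : boxDomain S \ ⋃ k, interior (𝒯.cell k) ⊆ ⋃ k, frontier (𝒯.cell k) := by
    intro x hx
    have := subset_closure hx.1
    rw [← 𝒯.cover] at this
    obtain ⟨k, hk⟩ := mem_iUnion.1 this
    refine mem_iUnion.2 ⟨k, ?_⟩
    rw [(𝒯.isCompact_cell k).isClosed.frontier_eq]
    exact ⟨hk, fun hi => hx.2 (mem_iUnion.2 ⟨k, hi⟩)⟩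
  refine measure_mono_null h (measure_iUnion_null fun k => ?_)
  exact (𝒯.convex_cell k).addHaar_frontier volume

theorem setIntegral_boxDomain {F : E3 → ℝ} (hF : IntegrableOn F (boxDomain S)) :
    ∫ x in boxDomain S, F x = ∑ k, ∫ x in interior (𝒯.cell k), F x := by
  have hsub : (⋃ k, interior (𝒯.cell k)) ⊆ boxDomain S := iUnion_subset 𝒯.interior_cell_subset
  have e : (⋃ k, interior (𝒯.cell k)) =ᵐ[volume] boxDomain S :=
    hsub.eventuallyLE.antisymm (ae_le_set.2 𝒯.volume_diff_interior_cell)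
  rw [← setIntegral_congr_set e]
  refine integral_iUnion_fintype (fun k => isOpen_interior.measurableSet) ?_
    fun k => hF.mono_set (𝒯.interior_cell_subset k)
  intro k l hkl
  exact 𝒯.disjoint_interiors k l hkl

/-- Weak gradients can be tested with the conforming companion. -/
theorem sum_integral_companion {g : E3 → ℝ} {G : Fin 3 → E3 → ℝ}
    (h : HasWeakGrad (boxDomain S) g G) {w : Fin 𝒯.n → E3 → ℝ}
    (hw : ∀ z ∈ 𝒯.nodes, ∀ k l, z ∈ 𝒯.cell k → z ∈ 𝒯.cell l → w k z = w l z)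
    (hw0 : ∀ z ∈ 𝒯.nodes, z ∈ frontier (boxDomain S) → ∀ k, z ∈ 𝒯.cell k → w k z = 0)
    (i : Fin 3) :
    ∑ k, ∫ x in interior (𝒯.cell k), (g x * partialDeriv i (fun z =>
      companion (fun y => w k (𝒯.T k y)) ((𝒯.T k).symm z)) x
      + G i x * companion (fun y => w k (𝒯.T k y)) ((𝒯.T k).symm x)) = 0 := by
  obtain ⟨C, hC⟩ := 𝒯.exists_lipschitzWith_conforming hw hw0
  set W := 𝒯.conforming w with hW
  set c : Fin 𝒯.n → E3 → ℝ := fun k z => companion (fun y => w k (𝒯.T k y)) ((𝒯.T k).symm z)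
    with hc
  have hcd : ∀ k, ContDiff ℝ ∞ (c k) := fun k =>
    (contDiff_companion _).comp (contDiff_affine (𝒯.T k).symm)
  have hWc : ∀ k, ∀ x ∈ interior (𝒯.cell k), W x = c k x := fun k x hx =>
    𝒯.conforming_eq hw (interior_subset hx)
  have hline : ∀ k, ∀ x ∈ interior (𝒯.cell k),
      lineDeriv ℝ W x (EuclideanSpace.single i (1 : ℝ)) = partialDeriv i (c k) x := by
    intro k x hx
    have h1 : W =ᶠ[nhds x] c k := by
      filter_upwards [isOpen_interior.mem_nhds hx] with y hy using hWc k y hy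
    rw [h1.lineDeriv_eq, ((hcd k).differentiable (by simp) x).lineDeriv_eq_fderiv]
    rfl
  have hb := isBounded_affine_image S
  rw [← boxDomain_eq] at hb
  have hfin : IsFiniteMeasure (volume.restrict (boxDomain S)) :=
    ⟨by simpa using hb.measure_lt_top⟩
  have key : ∫ x in boxDomain S, g x * lineDeriv ℝ W x (EuclideanSpace.single i (1 : ℝ))
      = -∫ x in boxDomain S, G i x * W x := by
    have h' := h
    rw [boxDomain_eq] at h' ⊢
    refine h'.integral_mul_lineDeriv hC (fun x hx => ?_) i ?_
    · exact 𝒯.conforming_eq_zero hw hw0 (fun hm => hx ((boxDomain_eq S).le hm))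
    · rw [← boxDomain_eq]
      have hae : ∀ᵐ x ∂(volume.restrict (boxDomain S)), x ∈ ⋃ k, interior (𝒯.cell k) := by
        rw [ae_restrict_iff' (isOpen_boxDomain S).measurableSet, ae_iff]
        refine measure_mono_null ?_ 𝒯.volume_diff_interior_cell
        intro x hx
        simpa using hx
      filter_upwards [hae] with x hx
      obtain ⟨k, hk⟩ := mem_iUnion.1 hx
      have h1 : (fun x => lineDeriv ℝ W x (EuclideanSpace.single i (1 : ℝ)))
          =ᶠ[nhds x] partialDeriv i (c k) := by
        filter_upwards [isOpen_interior.mem_nhds hk] with y hy using hline k y hy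
      exact ((contDiff_partialDeriv i (hcd k)).continuous.continuousAt).congr h1.symm
  have i1 : IntegrableOn (fun x => g x * lineDeriv ℝ W x (EuclideanSpace.single i (1 : ℝ)))
      (boxDomain S) := by
    refine (h.1.integrable (by norm_num)).mul_bdd (c := (C : ℝ))
      (measurable_lineDeriv hC.continuous).aestronglyMeasurable
      (Filter.Eventually.of_forall fun x => abs_lineDeriv_le hC i x)
  have i2 : IntegrableOn (fun x => G i x * W x) (boxDomain S) := by
    have := memLp_of_continuous_of_isBounded hb hC.continuous
    exact MemLp.integrable_mul_fun (h.2.1 i) this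
  rw [𝒯.setIntegral_boxDomain i1, 𝒯.setIntegral_boxDomain i2, ← sub_eq_zero, sub_neg_eq_add,
    ← Finset.sum_add_distrib] at key
  rw [← key]
  refine Finset.sum_congr rfl fun k _ => ?_
  rw [← integral_add (i1.mono_set (𝒯.interior_cell_subset k))
    (i2.mono_set (𝒯.interior_cell_subset k))]
  refine setIntegral_congr_fun isOpen_interior.measurableSet fun x hx => ?_
  rw [hline k x hx, hWc k x hx]

end BrickMesh

/-! ### Exact quadrature for cubic polynomials -/

/-- The cubic polynomial with the given values at `-1, 0, 1, 2`. -/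
def cubicInterp (y₀ y₁ y₂ y₃ t : ℝ) : ℝ :=
  y₀ * (t * (t - 1) * (t - 2) / (-6)) + y₁ * ((t + 1) * (t - 1) * (t - 2) / 2)
    + y₂ * ((t + 1) * t * (t - 2) / (-2)) + y₃ * ((t + 1) * t * (t - 1) / 6)

/-- Simpson's rule on `[-1, 1]`. -/
def simpson (f : ℝ → ℝ) : ℝ := (f (-1) + 4 * f 0 + f 1) / 3

theorem integral_cubicInterp (y₀ y₁ y₂ y₃ : ℝ) :
    ∫ t in (-1 : ℝ)..1, cubicInterp y₀ y₁ y₂ y₃ t = (y₀ + 4 * y₁ + y₂) / 3 := by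
  set c0 := y₁
  set c1 := (-2 * y₀ - 3 * y₁ + 6 * y₂ - y₃) / 6
  set c2 := (y₀ - 2 * y₁ + y₂) / 2
  set c3 := (-y₀ + 3 * y₁ - 3 * y₂ + y₃) / 6
  have h : ∀ t, HasDerivAt (fun t : ℝ => c0 * t + c1 * t ^ 2 / 2 + c2 * t ^ 3 / 3 + c3 * t ^ 4 / 4)
      (cubicInterp y₀ y₁ y₂ y₃ t) t := by
    intro t
    have h1 := (hasDerivAt_id t).const_mul c0
    have h2 := ((hasDerivAt_pow 2 t).const_mul c1).div_const 2
    have h3 := ((hasDerivAt_pow 3 t).const_mul c2).div_const 3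
    have h4 := ((hasDerivAt_pow 4 t).const_mul c3).div_const 4
    refine (((h1.add h2).add h3).add h4).congr_deriv ?_
    simp only [cubicInterp, c0, c1, c2, c3]
    push_cast
    ring
  have hc : Continuous (cubicInterp y₀ y₁ y₂ y₃) := by unfold cubicInterp; fun_prop
  rw [intervalIntegral.integral_eq_sub_of_hasDerivAt (fun t _ => h t) (hc.intervalIntegrable _ _)]
  simp only [c0, c1, c2, c3]
  ring

theorem integral_eq_simpson {f : ℝ → ℝ}
    (h : ∀ t, f t = cubicInterp (f (-1)) (f 0) (f 1) (f 2) t) :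
    ∫ t in (-1 : ℝ)..1, f t = simpson f := by
  rw [intervalIntegral.integral_congr (g := cubicInterp (f (-1)) (f 0) (f 1) (f 2))
    (fun t _ => h t), integral_cubicInterp, simpson]

theorem integrableOn_openCube {F : E3 → ℝ} (hF : Continuous F) : IntegrableOn F openCube :=
  ((hF.continuousOn (s := refCube)).integrableOn_compact isCompact_refCube).mono_set
    openCube_subset_refCube

/-- Simpson's rule is exact for cubics. Being of degree at most 3 in each variable is stated as
equality with the interpolant through −1, 0, 1, 2, so that for concrete polynomials both hypotheses
and value are checked by `ring`. -/
theorem integral_openCube_eq_simpson {F : E3 → ℝ} (hF : Continuous F)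
    (h0 : ∀ t b c, F !₂[t, b, c]
      = cubicInterp (F !₂[-1, b, c]) (F !₂[0, b, c]) (F !₂[1, b, c]) (F !₂[2, b, c]) t)
    (h1 : ∀ a t c, F !₂[a, t, c]
      = cubicInterp (F !₂[a, -1, c]) (F !₂[a, 0, c]) (F !₂[a, 1, c]) (F !₂[a, 2, c]) t)
    (h2 : ∀ a b t, F !₂[a, b, t]
      = cubicInterp (F !₂[a, b, -1]) (F !₂[a, b, 0]) (F !₂[a, b, 1]) (F !₂[a, b, 2]) t) :
    ∫ x in openCube, F x
      = simpson fun t₂ => simpson fun t₁ => simpson fun t₀ => F !₂[t₀, t₁, t₂] := by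
  rw [setIntegral_openCube (integrableOn_openCube hF)]
  have e0 : ∀ b c : ℝ, ∫ t₀ in (-1 : ℝ)..1, F !₂[t₀, b, c]
      = simpson fun t₀ => F !₂[t₀, b, c] := fun b c =>
    integral_eq_simpson fun t => h0 t b c
  simp only [e0]
  have e1 : ∀ c : ℝ, ∫ t₁ in (-1 : ℝ)..1, simpson (fun t₀ => F !₂[t₀, t₁, c])
      = simpson fun t₁ => simpson fun t₀ => F !₂[t₀, t₁, c] := fun c =>
    integral_eq_simpson fun t => by
      simp only [simpson]
      rw [h1 (-1) t c, h1 0 t c, h1 1 t c]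
      simp only [cubicInterp]
      ring
  simp only [e1]
  refine integral_eq_simpson fun t => ?_
  simp only [simpson]
  rw [h2 (-1) (-1) t, h2 0 (-1) t, h2 1 (-1) t, h2 (-1) 0 t, h2 0 0 t, h2 1 0 t, h2 (-1) 1 t,
    h2 0 1 t, h2 1 1 t]
  simp only [cubicInterp]
  ring

theorem vec_zero (p q r : ℝ) : (![p, q, r] : Fin 3 → ℝ) 0 = p := rfl

theorem vec_one (p q r : ℝ) : (![p, q, r] : Fin 3 → ℝ) 1 = q := rfl

theorem vec_two (p q r : ℝ) : (![p, q, r] : Fin 3 → ℝ) 2 = r := rfl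

theorem fin_three_cases (i : Fin 3) : i = 0 ∨ i = 1 ∨ i = 2 := by
  fin_cases i <;> simp

theorem fin_three_add : (0 + 1 : Fin 3) = 1 ∧ (0 + 2 : Fin 3) = 2 ∧ (1 + 1 : Fin 3) = 2 ∧
    (1 + 2 : Fin 3) = 0 ∧ (2 + 1 : Fin 3) = 0 ∧ (2 + 2 : Fin 3) = 1 := by decide

/-! ### The polynomials of the reference element -/

/-- The coefficients of the monomials `1`, `x₀x₁x₂`, `xᵢ`, `xᵢ²`, `xᵢ₊₁xᵢ₊₂`, `xᵢ²xᵢ₊₁` and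
`xᵢxᵢ₊₁²`, indices modulo 3. -/
structure CubicCoeff where
  (a κ : ℝ)
  (b d m g k : Fin 3 → ℝ)

namespace CubicCoeff

/-- The polynomial with the given coefficients. -/
def fn (c : CubicCoeff) (x : E3) : ℝ :=
  c.a + c.κ * (x 0 * x 1 * x 2) + ∑ i, (c.b i * x i + c.d i * x i ^ 2
    + c.m i * (x (i + 1) * x (i + 2)) + c.g i * (x i ^ 2 * x (i + 1))
    + c.k i * (x i * x (i + 1) ^ 2))

/-- The partial derivatives of `fn`. -/
def gradFn (c : CubicCoeff) (i : Fin 3) (x : E3) : ℝ :=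
  c.b i + 2 * c.d i * x i + c.m (i + 1) * x (i + 2) + c.m (i + 2) * x (i + 1)
    + c.κ * (x (i + 1) * x (i + 2)) + 2 * c.g i * x i * x (i + 1) + c.g (i + 2) * x (i + 2) ^ 2
    + c.k i * x (i + 1) ^ 2 + 2 * c.k (i + 2) * x (i + 2) * x i

/-- The difference of `fn` and its companion. -/
def rem (c : CubicCoeff) (x : E3) : ℝ :=
  -∑ i, (c.d i * ((1 - x i ^ 2) * ((3 * x (i + 1) ^ 2 - 1) / 2 + (3 * x (i + 2) ^ 2 - 1) / 2 - 1))
    + c.g i * ((1 - x i ^ 2) * x (i + 1) * ((3 * x (i + 2) ^ 2 - 1) / 2))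
    + c.k i * ((1 - x (i + 1) ^ 2) * x i * ((3 * x (i + 2) ^ 2 - 1) / 2)))

/-- The partial derivatives of `rem`. -/
def gradRem (c : CubicCoeff) (i : Fin 3) (x : E3) : ℝ :=
  -(-2 * x i * c.d i * ((3 * x (i + 1) ^ 2 - 1) / 2 + (3 * x (i + 2) ^ 2 - 1) / 2 - 1)
    + 3 * x i * (c.d (i + 1) * (1 - x (i + 1) ^ 2) + c.d (i + 2) * (1 - x (i + 2) ^ 2))
    - 2 * x i * c.g i * x (i + 1) * ((3 * x (i + 2) ^ 2 - 1) / 2)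
    + 3 * x i * c.g (i + 1) * (1 - x (i + 1) ^ 2) * x (i + 2)
    + c.g (i + 2) * (1 - x (i + 2) ^ 2) * ((3 * x (i + 1) ^ 2 - 1) / 2)
    + c.k i * (1 - x (i + 1) ^ 2) * ((3 * x (i + 2) ^ 2 - 1) / 2)
    + 3 * x i * c.k (i + 1) * (1 - x (i + 2) ^ 2) * x (i + 1)
    - 2 * x i * c.k (i + 2) * x (i + 2) * ((3 * x (i + 1) ^ 2 - 1) / 2))

theorem contDiff_fn (c : CubicCoeff) : ContDiff ℝ ∞ c.fn := by
  have := contDiff_coord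
  unfold fn
  fun_prop

theorem contDiff_rem (c : CubicCoeff) : ContDiff ℝ ∞ c.rem := by
  have := contDiff_coord
  unfold rem
  fun_prop

end CubicCoeff

theorem partialDeriv_eq_of_forall {φ : E3 → ℝ} (hφ : ContDiff ℝ ∞ φ) {i : Fin 3} {x : E3} {d : ℝ}
    (A : ℝ) (h : ∀ s : ℝ, φ (x + s • EuclideanSpace.single i (1 : ℝ)) = φ x + d * s + A * s ^ 2) :
    partialDeriv i φ x = d := by
  refine partialDeriv_eq_of_hasDerivAt hφ ?_
  rw [funext h]
  have h1 := ((hasDerivAt_id (0 : ℝ)).const_mul d).const_add (φ x)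
  have h2 := (hasDerivAt_pow 2 (0 : ℝ)).const_mul A
  refine (h1.add h2).congr_deriv ?_
  simp

theorem CubicCoeff.partialDeriv_fn (c : CubicCoeff) (i : Fin 3) :
    partialDeriv i c.fn = c.gradFn i := by
  funext x
  refine partialDeriv_eq_of_forall c.contDiff_fn
    (c.d i + c.g i * x (i + 1) + c.k (i + 2) * x (i + 2)) fun s => ?_
  fin_cases i <;> simp [fn, gradFn, Fin.sum_univ_three] <;> ring

theorem CubicCoeff.partialDeriv_rem (c : CubicCoeff) (i : Fin 3) :
    partialDeriv i c.rem = c.gradRem i := by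
  funext x
  refine partialDeriv_eq_of_forall c.contDiff_rem
    (-(-c.d i * ((3 * x (i + 1) ^ 2 - 1) / 2 + (3 * x (i + 2) ^ 2 - 1) / 2 - 1)
    + 3 / 2 * (c.d (i + 1) * (1 - x (i + 1) ^ 2) + c.d (i + 2) * (1 - x (i + 2) ^ 2))
    - c.g i * x (i + 1) * ((3 * x (i + 2) ^ 2 - 1) / 2)
    + 3 / 2 * c.g (i + 1) * (1 - x (i + 1) ^ 2) * x (i + 2)
    + 3 / 2 * c.k (i + 1) * (1 - x (i + 2) ^ 2) * x (i + 1)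
    - c.k (i + 2) * x (i + 2) * ((3 * x (i + 1) ^ 2 - 1) / 2))) fun s => ?_
  fin_cases i <;> simp [rem, gradRem, Fin.sum_univ_three] <;> ring

theorem sum_units_pi (F : (Fin 3 → ℤˣ) → ℝ) :
    ∑ v, F v = F ![1, 1, 1] + F ![1, 1, -1] + F ![1, -1, 1] + F ![1, -1, -1]
      + F ![-1, 1, 1] + F ![-1, 1, -1] + F ![-1, -1, 1] + F ![-1, -1, -1] := by
  have h : (Finset.univ : Finset (Fin 3 → ℤˣ)) = {![1, 1, 1], ![1, 1, -1], ![1, -1, 1],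
      ![1, -1, -1], ![-1, 1, 1], ![-1, 1, -1], ![-1, -1, 1], ![-1, -1, -1]} := by decide
  rw [h]
  rw [Finset.sum_insert (by decide), Finset.sum_insert (by decide), Finset.sum_insert (by decide),
    Finset.sum_insert (by decide), Finset.sum_insert (by decide), Finset.sum_insert (by decide),
    Finset.sum_insert (by decide), Finset.sum_singleton]
  ring

theorem sum_units (F : ℤˣ → ℝ) : ∑ τ, F τ = F 1 + F (-1) := by
  rw [UnitsInt.univ, Finset.sum_pair (by decide)]

namespace CubicCoeff

theorem bubbleCoef_fn (c : CubicCoeff) (i : Fin 3) (τ : ℤˣ) :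
    bubbleCoef c.fn i τ = 3 / 2 * (-c.d (i + 1) - c.d (i + 2)
      - (c.g (i + 2) + c.k i) * ((τ : ℤ) : ℝ)) := by
  have n1 : (1 : ℤˣ) ≠ -1 := by decide
  have n2 : (-1 : ℤˣ) ≠ 1 := by decide
  rw [bubbleCoef, sum_units_pi]
  rcases Int.units_eq_one_or τ with rfl | rfl <;> fin_cases i <;>
    simp [fn, faceCenter_apply, Fin.sum_univ_three, n1, n2] <;> ring

theorem sum_fn_vertex (c : CubicCoeff) (x : E3) :
    ∑ v : Fin 3 → ℤˣ, c.fn (cubeVertex v) * ∏ i, (1 + ((v i : ℤ) : ℝ) * x i) / 2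
      = c.a + ∑ i, (c.b i * x i + c.d i + c.m i * (x (i + 1) * x (i + 2))
        + c.g i * x (i + 1) + c.k i * x i) + c.κ * (x 0 * x 1 * x 2) := by
  rw [sum_units_pi]
  simp [fn, Fin.sum_univ_three, Fin.prod_univ_three]
  ring

/-- This explains the factor 3/2 in `bubbleCoef`: since 1 − (3/2)(1 − t²) is the Legendre polynomial
(3t² − 1)/2, subtracting the bubbles replaces constants by Legendre polynomials in the terms 1 − x²
left by the trilinear part. -/
theorem fn_sub_companion (c : CubicCoeff) (x : E3) : c.fn x - companion c.fn x = c.rem x := by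
  have e0 : (Finset.univ.erase (0 : Fin 3)) = {1, 2} := by decide
  have e1 : (Finset.univ.erase (1 : Fin 3)) = {0, 2} := by decide
  have e2 : (Finset.univ.erase (2 : Fin 3)) = {0, 1} := by decide
  rw [companion, sum_fn_vertex]
  simp only [bubbleCoef_fn, sum_units, Fin.sum_univ_three, e0, e1, e2]
  rw [Finset.prod_pair (by decide), Finset.prod_pair (by decide), Finset.prod_pair (by decide)]
  simp [fn, rem, Fin.sum_univ_three]
  ring

theorem continuous_gradFn (c : CubicCoeff) (i : Fin 3) : Continuous (c.gradFn i) := by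
  rw [← partialDeriv_fn]; exact (contDiff_partialDeriv i c.contDiff_fn).continuous

theorem continuous_gradRem (c : CubicCoeff) (i : Fin 3) : Continuous (c.gradRem i) := by
  rw [← partialDeriv_rem]; exact (contDiff_partialDeriv i c.contDiff_rem).continuous

theorem gradFn_vec_zero (c : CubicCoeff) (p q r : ℝ) : c.gradFn 0 !₂[p, q, r]
    = c.b 0 + 2 * c.d 0 * p + c.m 1 * r + c.m 2 * q + c.κ * (q * r)
      + 2 * c.g 0 * p * q + c.g 2 * r ^ 2 + c.k 0 * q ^ 2
      + 2 * c.k 2 * r * p := rfl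

theorem gradFn_vec_one (c : CubicCoeff) (p q r : ℝ) : c.gradFn 1 !₂[p, q, r]
    = c.b 1 + 2 * c.d 1 * q + c.m 2 * p + c.m 0 * r + c.κ * (r * p)
      + 2 * c.g 1 * q * r + c.g 0 * p ^ 2 + c.k 1 * r ^ 2
      + 2 * c.k 0 * p * q := rfl

theorem gradFn_vec_two (c : CubicCoeff) (p q r : ℝ) : c.gradFn 2 !₂[p, q, r]
    = c.b 2 + 2 * c.d 2 * r + c.m 0 * q + c.m 1 * p + c.κ * (p * q)
      + 2 * c.g 2 * r * p + c.g 1 * q ^ 2 + c.k 2 * p ^ 2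
      + 2 * c.k 1 * q * r := rfl

theorem gradRem_vec_zero (c : CubicCoeff) (p q r : ℝ) : c.gradRem 0 !₂[p, q, r]
    = -(-2 * p * c.d 0 * ((3 * q ^ 2 - 1) / 2 + (3 * r ^ 2 - 1) / 2 - 1)
    + 3 * p * (c.d 1 * (1 - q ^ 2) + c.d 2 * (1 - r ^ 2))
    - 2 * p * c.g 0 * q * ((3 * r ^ 2 - 1) / 2)
    + 3 * p * c.g 1 * (1 - q ^ 2) * r
    + c.g 2 * (1 - r ^ 2) * ((3 * q ^ 2 - 1) / 2)
    + c.k 0 * (1 - q ^ 2) * ((3 * r ^ 2 - 1) / 2)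
    + 3 * p * c.k 1 * (1 - r ^ 2) * q
    - 2 * p * c.k 2 * r * ((3 * q ^ 2 - 1) / 2)) := rfl

theorem gradRem_vec_one (c : CubicCoeff) (p q r : ℝ) : c.gradRem 1 !₂[p, q, r]
    = -(-2 * q * c.d 1 * ((3 * r ^ 2 - 1) / 2 + (3 * p ^ 2 - 1) / 2 - 1)
    + 3 * q * (c.d 2 * (1 - r ^ 2) + c.d 0 * (1 - p ^ 2))
    - 2 * q * c.g 1 * r * ((3 * p ^ 2 - 1) / 2)
    + 3 * q * c.g 2 * (1 - r ^ 2) * p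
    + c.g 0 * (1 - p ^ 2) * ((3 * r ^ 2 - 1) / 2)
    + c.k 1 * (1 - r ^ 2) * ((3 * p ^ 2 - 1) / 2)
    + 3 * q * c.k 2 * (1 - p ^ 2) * r
    - 2 * q * c.k 0 * p * ((3 * r ^ 2 - 1) / 2)) := rfl

theorem gradRem_vec_two (c : CubicCoeff) (p q r : ℝ) : c.gradRem 2 !₂[p, q, r]
    = -(-2 * r * c.d 2 * ((3 * p ^ 2 - 1) / 2 + (3 * q ^ 2 - 1) / 2 - 1)
    + 3 * r * (c.d 0 * (1 - p ^ 2) + c.d 1 * (1 - q ^ 2))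
    - 2 * r * c.g 2 * p * ((3 * q ^ 2 - 1) / 2)
    + 3 * r * c.g 0 * (1 - p ^ 2) * q
    + c.g 1 * (1 - q ^ 2) * ((3 * p ^ 2 - 1) / 2)
    + c.k 2 * (1 - p ^ 2) * ((3 * q ^ 2 - 1) / 2)
    + 3 * r * c.k 0 * (1 - q ^ 2) * p
    - 2 * r * c.k 1 * q * ((3 * p ^ 2 - 1) / 2)) := rfl

theorem rem_vec (c : CubicCoeff) (p q r : ℝ) : c.rem !₂[p, q, r]
    = -((c.d 0 * ((1 - p ^ 2) * ((3 * q ^ 2 - 1) / 2 + (3 * r ^ 2 - 1) / 2 - 1))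
      + c.g 0 * ((1 - p ^ 2) * q * ((3 * r ^ 2 - 1) / 2))
      + c.k 0 * ((1 - q ^ 2) * p * ((3 * r ^ 2 - 1) / 2)))
      + (c.d 1 * ((1 - q ^ 2) * ((3 * r ^ 2 - 1) / 2 + (3 * p ^ 2 - 1) / 2 - 1))
      + c.g 1 * ((1 - q ^ 2) * r * ((3 * p ^ 2 - 1) / 2))
      + c.k 1 * ((1 - r ^ 2) * q * ((3 * p ^ 2 - 1) / 2)))
      + (c.d 2 * ((1 - r ^ 2) * ((3 * p ^ 2 - 1) / 2 + (3 * q ^ 2 - 1) / 2 - 1))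
      + c.g 2 * ((1 - r ^ 2) * p * ((3 * q ^ 2 - 1) / 2))
      + c.k 2 * ((1 - p ^ 2) * r * ((3 * q ^ 2 - 1) / 2)))) := by
  rw [rem, Fin.sum_univ_three]
  rfl

/-- The moments computed here and in the next two lemmas isolate single coefficients by parity, so
that `d`, `g` and `k`, the only ones in the remainder, are controlled by the energy. -/
theorem integral_coord_mul_gradFn (c : CubicCoeff) (i : Fin 3) :
    ∫ x in openCube, x i * c.gradFn i x = 16 / 3 * c.d i := by
  have hc : Continuous fun x : E3 => x i * c.gradFn i x :=
    (continuous_coord i).mul (c.continuous_gradFn i)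
  rw [integral_openCube_eq_simpson hc]
  · rcases fin_three_cases i with rfl | rfl | rfl <;>
      simp only [simpson, vec_zero, vec_one,
        vec_two, gradFn_vec_zero, gradFn_vec_one, gradFn_vec_two] <;> ring
  all_goals
    intro p q r
    rcases fin_three_cases i with rfl | rfl | rfl <;>
      simp only [cubicInterp, vec_zero, vec_one,
        vec_two, gradFn_vec_zero, gradFn_vec_one, gradFn_vec_two] <;> ring

theorem integral_coord_mul_coord_mul_gradFn (c : CubicCoeff) (i : Fin 3) :
    ∫ x in openCube, x i * x (i + 1) * c.gradFn i x = 16 / 9 * c.g i := by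
  have hc : Continuous fun x : E3 => x i * x (i + 1) * c.gradFn i x :=
    ((continuous_coord i).mul (continuous_coord _)).mul (c.continuous_gradFn i)
  obtain ⟨h1, -, h3, -, h5, -⟩ := fin_three_add
  rw [integral_openCube_eq_simpson hc]
  · rcases fin_three_cases i with rfl | rfl | rfl <;>
      simp only [simpson, h1, h3, h5, vec_zero, vec_one,
        vec_two, gradFn_vec_zero, gradFn_vec_one, gradFn_vec_two] <;> ring
  all_goals
    intro p q r
    rcases fin_three_cases i with rfl | rfl | rfl <;>
      simp only [cubicInterp, h1, h3, h5, vec_zero, vec_one,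
        vec_two, gradFn_vec_zero, gradFn_vec_one, gradFn_vec_two] <;> ring

theorem integral_coord_mul_coord_mul_gradFn_succ (c : CubicCoeff) (i : Fin 3) :
    ∫ x in openCube, x i * x (i + 1) * c.gradFn (i + 1) x = 16 / 9 * c.k i := by
  have hc : Continuous fun x : E3 => x i * x (i + 1) * c.gradFn (i + 1) x :=
    ((continuous_coord i).mul (continuous_coord _)).mul (c.continuous_gradFn _)
  obtain ⟨h1, -, h3, -, h5, -⟩ := fin_three_add
  rw [integral_openCube_eq_simpson hc]
  · rcases fin_three_cases i with rfl | rfl | rfl <;>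
      simp only [simpson, h1, h3, h5, vec_zero, vec_one,
        vec_two, gradFn_vec_zero, gradFn_vec_one, gradFn_vec_two] <;> ring
  all_goals
    intro p q r
    rcases fin_three_cases i with rfl | rfl | rfl <;>
      simp only [cubicInterp, h1, h3, h5, vec_zero, vec_one,
        vec_two, gradFn_vec_zero, gradFn_vec_one, gradFn_vec_two] <;> ring

/-- This and the next three lemmas are ∫ ∂ᵢ(q · rem) = 0 for q = 1 and for the three coordinates. By
the divergence theorem only the faces xᵢ = ±1 count. There the trace of the remainder has terms with
a Legendre factor in one tangential variable, orthogonal to affine functions, and the terms (1 −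
xᵢ₊₁²)xᵢ₊₂ and (1 − xᵢ₊₂²)xᵢ₊₁, which have mean zero and agree on the two opposite faces. Quadrature
verifies this. -/
theorem integral_gradRem (c : CubicCoeff) (i : Fin 3) : ∫ x in openCube, c.gradRem i x = 0 := by
  have hc := c.continuous_gradRem i
  rw [integral_openCube_eq_simpson hc]
  · rcases fin_three_cases i with rfl | rfl | rfl <;>
      simp only [simpson, gradRem_vec_zero, gradRem_vec_one, gradRem_vec_two] <;> ring
  all_goals
    intro p q r
    rcases fin_three_cases i with rfl | rfl | rfl <;>
      simp only [cubicInterp, gradRem_vec_zero, gradRem_vec_one, gradRem_vec_two] <;> ring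

theorem integral_coord_mul_gradRem (c : CubicCoeff) (i : Fin 3) :
    ∫ x in openCube, (c.rem x + x i * c.gradRem i x) = 0 := by
  have hc : Continuous fun x : E3 => c.rem x + x i * c.gradRem i x :=
    c.contDiff_rem.continuous.add ((continuous_coord i).mul (c.continuous_gradRem i))
  rw [integral_openCube_eq_simpson hc]
  · rcases fin_three_cases i with rfl | rfl | rfl <;>
      simp only [simpson, vec_zero, vec_one,
        vec_two, gradRem_vec_zero, gradRem_vec_one, gradRem_vec_two, rem_vec] <;> ring
  all_goals
    intro p q r
    rcases fin_three_cases i with rfl | rfl | rfl <;>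
      simp only [cubicInterp, vec_zero, vec_one,
        vec_two, gradRem_vec_zero, gradRem_vec_one, gradRem_vec_two, rem_vec] <;> ring

theorem integral_coord_succ_mul_gradRem (c : CubicCoeff) (i : Fin 3) :
    ∫ x in openCube, x (i + 1) * c.gradRem i x = 0 := by
  have hc : Continuous fun x : E3 => x (i + 1) * c.gradRem i x :=
    (continuous_coord _).mul (c.continuous_gradRem i)
  obtain ⟨h1, -, h3, -, h5, -⟩ := fin_three_add
  rw [integral_openCube_eq_simpson hc]
  · rcases fin_three_cases i with rfl | rfl | rfl <;>
      simp only [simpson, h1, h3, h5, vec_zero, vec_one,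
        vec_two, gradRem_vec_zero, gradRem_vec_one, gradRem_vec_two] <;> ring
  all_goals
    intro p q r
    rcases fin_three_cases i with rfl | rfl | rfl <;>
      simp only [cubicInterp, h1, h3, h5, vec_zero, vec_one,
        vec_two, gradRem_vec_zero, gradRem_vec_one, gradRem_vec_two] <;> ring

theorem integral_coord_pred_mul_gradRem (c : CubicCoeff) (i : Fin 3) :
    ∫ x in openCube, x (i + 2) * c.gradRem i x = 0 := by
  have hc : Continuous fun x : E3 => x (i + 2) * c.gradRem i x :=
    (continuous_coord _).mul (c.continuous_gradRem i)
  obtain ⟨-, h2, -, h4, -, h6⟩ := fin_three_add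
  rw [integral_openCube_eq_simpson hc]
  · rcases fin_three_cases i with rfl | rfl | rfl <;>
      simp only [simpson, h2, h4, h6, vec_zero, vec_one,
        vec_two, gradRem_vec_zero, gradRem_vec_one, gradRem_vec_two] <;> ring
  all_goals
    intro p q r
    rcases fin_three_cases i with rfl | rfl | rfl <;>
      simp only [cubicInterp, h2, h4, h6, vec_zero, vec_one,
        vec_two, gradRem_vec_zero, gradRem_vec_one, gradRem_vec_two] <;> ring

/-- The remainder satisfies the patch conditions with affine weights. -/
theorem integral_partialDeriv_affine_mul_rem (c : CubicCoeff) (α : ℝ) (β : Fin 3 → ℝ) (i : Fin 3) :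
    ∫ x in openCube, partialDeriv i (fun x => affineFun α β x * c.rem x) x = 0 := by
  simp only [partialDeriv_mul (contDiff_affineFun α β) c.contDiff_rem, partialDeriv_affineFun,
    partialDeriv_rem]
  have i0 : IntegrableOn (fun x : E3 => α * c.gradRem i x) openCube :=
    integrableOn_openCube (continuous_const.mul (c.continuous_gradRem i))
  have i1 : IntegrableOn (fun x : E3 => β i * (c.rem x + x i * c.gradRem i x)) openCube :=
    integrableOn_openCube (continuous_const.mul (c.contDiff_rem.continuous.add
      ((continuous_coord i).mul (c.continuous_gradRem i))))
  have i2 : ∀ j, IntegrableOn (fun x : E3 => β j * (x j * c.gradRem i x)) openCube := fun j =>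
    integrableOn_openCube (continuous_const.mul
      ((continuous_coord j).mul (c.continuous_gradRem i)))
  have e : ∀ x : E3, β i * c.rem x + affineFun α β x * c.gradRem i x
      = α * c.gradRem i x + β i * (c.rem x + x i * c.gradRem i x)
        + β (i + 1) * (x (i + 1) * c.gradRem i x) + β (i + 2) * (x (i + 2) * c.gradRem i x) := by
    intro x
    have : affineFun α β x = α + β i * x i + β (i + 1) * x (i + 1) + β (i + 2) * x (i + 2) := by
      fin_cases i <;> simp [affineFun, Fin.sum_univ_three] <;> ring
    rw [this]
    ring
  simp only [e]
  have i01 : IntegrableOn (fun x : E3 => α * c.gradRem i x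
      + β i * (c.rem x + x i * c.gradRem i x)) openCube := i0.add i1
  have i012 : IntegrableOn (fun x : E3 => α * c.gradRem i x
      + β i * (c.rem x + x i * c.gradRem i x) + β (i + 1) * (x (i + 1) * c.gradRem i x))
      openCube := i01.add (i2 _)
  rw [integral_add i012 (i2 _), integral_add i01 (i2 _), integral_add i0 i1]
  simp only [integral_const_mul, integral_gradRem, integral_coord_mul_gradRem,
    integral_coord_succ_mul_gradRem, integral_coord_pred_mul_gradRem, mul_zero, add_zero]

end CubicCoeff

theorem setIntegral_sq_le_of_abs_le {F : E3 → ℝ} {B : ℝ} (hB : ∀ x ∈ openCube, |F x| ≤ B) :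
    ∫ x in openCube, F x ^ 2 ≤ 8 * B ^ 2 := by
  have h1 : ‖∫ x in openCube, F x ^ 2‖ ≤ B ^ 2 * volume.real openCube := by
    refine norm_setIntegral_le_of_norm_le_const ?_ fun x hx => ?_
    · exact (isBounded_refCube.subset openCube_subset_refCube).measure_lt_top
    · rw [Real.norm_eq_abs, abs_pow]
      exact pow_le_pow_left₀ (abs_nonneg _) (hB x hx) 2
  have h2 : B ^ 2 * volume.real openCube ≤ B ^ 2 * 8 :=
    mul_le_mul_of_nonneg_left measureReal_openCube_le (sq_nonneg B)
  linarith [le_abs_self (∫ x in openCube, F x ^ 2), Real.norm_eq_abs (∫ x in openCube, F x ^ 2)]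

theorem memLp_openCube {F : E3 → ℝ} (hF : Continuous F) :
    MemLp F 2 (volume.restrict openCube) :=
  memLp_of_continuous_of_isBounded (isBounded_refCube.subset openCube_subset_refCube) hF

theorem sq_setIntegral_mul_le {F G : E3 → ℝ} (hF : Continuous F) (hG : Continuous G)
    (hB : ∀ x ∈ openCube, |F x| ≤ 1) :
    (∫ x in openCube, F x * G x) ^ 2 ≤ 8 * ∫ x in openCube, G x ^ 2 := by
  refine (sq_integral_mul_le (memLp_openCube hF) (memLp_openCube hG)).trans ?_
  have h := setIntegral_sq_le_of_abs_le hB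
  have h2 : 0 ≤ ∫ x in openCube, G x ^ 2 := integral_nonneg fun x => sq_nonneg _
  nlinarith

namespace CubicCoeff

/-- The squared `H¹` seminorm on the reference cube. -/
def energy (c : CubicCoeff) : ℝ := ∑ i, ∫ x in openCube, c.gradFn i x ^ 2

theorem integral_gradFn_sq_le (c : CubicCoeff) (i : Fin 3) :
    ∫ x in openCube, c.gradFn i x ^ 2 ≤ c.energy :=
  Finset.single_le_sum (f := fun i => ∫ x in openCube, c.gradFn i x ^ 2)
    (fun _ _ => integral_nonneg fun _ => sq_nonneg _) (Finset.mem_univ i)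

theorem energy_nonneg (c : CubicCoeff) : 0 ≤ c.energy :=
  Finset.sum_nonneg fun _ _ => integral_nonneg fun _ => sq_nonneg _

theorem abs_coord_mul_coord_le {x : E3} (hx : x ∈ openCube) (i j : Fin 3) : |x i * x j| ≤ 1 := by
  rw [abs_mul]
  exact mul_le_one₀ (hx i).le (abs_nonneg _) (hx j).le

/-- Cauchy–Schwarz for the moment above. The constant 3, common to `d`, `g` and `k`, rounds up 8 ·
(9/16)² from the latter two. -/
theorem d_sq_le (c : CubicCoeff) (i : Fin 3) : c.d i ^ 2 ≤ 3 * c.energy := by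
  have h := sq_setIntegral_mul_le (continuous_coord i) (c.continuous_gradFn i) fun x hx => (hx i).le
  rw [integral_coord_mul_gradFn] at h
  nlinarith [c.integral_gradFn_sq_le i, c.energy_nonneg]

theorem g_sq_le (c : CubicCoeff) (i : Fin 3) : c.g i ^ 2 ≤ 3 * c.energy := by
  have h := sq_setIntegral_mul_le (F := fun x => x i * x (i + 1))
    ((continuous_coord i).mul (continuous_coord (i + 1)))
    (c.continuous_gradFn i) fun x hx => abs_coord_mul_coord_le hx _ _
  rw [integral_coord_mul_coord_mul_gradFn] at h
  nlinarith [c.integral_gradFn_sq_le i, c.energy_nonneg]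

theorem k_sq_le (c : CubicCoeff) (i : Fin 3) : c.k i ^ 2 ≤ 3 * c.energy := by
  have h := sq_setIntegral_mul_le (F := fun x => x i * x (i + 1))
    ((continuous_coord i).mul (continuous_coord (i + 1)))
    (c.continuous_gradFn (i + 1)) fun x hx => abs_coord_mul_coord_le hx _ _
  rw [integral_coord_mul_coord_mul_gradFn_succ] at h
  nlinarith [c.integral_gradFn_sq_le (i + 1), c.energy_nonneg]

end CubicCoeff

theorem abs_mul_le_of_le_of_le {a b A B : ℝ} (ha : |a| ≤ A) (hb : |b| ≤ B) : |a * b| ≤ A * B := by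
  rw [abs_mul]
  exact mul_le_mul ha hb (abs_nonneg _) ((abs_nonneg _).trans ha)

theorem abs_one_sub_sq_le {t : ℝ} (h : |t| ≤ 1) : |1 - t ^ 2| ≤ 1 := by
  have := (sq_le_one_iff_abs_le_one t).2 h
  rw [abs_le]
  constructor <;> nlinarith [sq_nonneg t]

theorem abs_legendre_le {t : ℝ} (h : |t| ≤ 1) : |(3 * t ^ 2 - 1) / 2| ≤ 1 := by
  have := (sq_le_one_iff_abs_le_one t).2 h
  rw [abs_le]
  constructor <;> nlinarith [sq_nonneg t]

namespace CubicCoeff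

theorem abs_rem_le {c : CubicCoeff} {M : ℝ} (hd : ∀ i, |c.d i| ≤ M) (hg : ∀ i, |c.g i| ≤ M)
    (hk : ∀ i, |c.k i| ≤ M) {x : E3} (hx : x ∈ openCube) : |c.rem x| ≤ 15 * M := by
  have hx' := fun i => (hx i).le
  have hu := fun i => abs_one_sub_sq_le (hx' i)
  have hp := fun i => abs_legendre_le (hx' i)
  have term : ∀ i, |c.d i * ((1 - x i ^ 2) * ((3 * x (i + 1) ^ 2 - 1) / 2
      + (3 * x (i + 2) ^ 2 - 1) / 2 - 1))
    + c.g i * ((1 - x i ^ 2) * x (i + 1) * ((3 * x (i + 2) ^ 2 - 1) / 2))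
    + c.k i * ((1 - x (i + 1) ^ 2) * x i * ((3 * x (i + 2) ^ 2 - 1) / 2))| ≤ 5 * M := by
    intro i
    have e : |(3 * x (i + 1) ^ 2 - 1) / 2 + (3 * x (i + 2) ^ 2 - 1) / 2 - 1| ≤ 3 := by
      have h1 := abs_le.1 (hp (i + 1))
      have h2 := abs_le.1 (hp (i + 2))
      rw [abs_le]
      constructor <;> linarith [h1.1, h1.2, h2.1, h2.2]
    have t1 := abs_mul_le_of_le_of_le (hd i) (abs_mul_le_of_le_of_le (hu i) e)
    have t2 := abs_mul_le_of_le_of_le (hg i) (abs_mul_le_of_le_of_le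
      (abs_mul_le_of_le_of_le (hu i) (hx' (i + 1))) (hp (i + 2)))
    have t3 := abs_mul_le_of_le_of_le (hk i) (abs_mul_le_of_le_of_le
      (abs_mul_le_of_le_of_le (hu (i + 1)) (hx' i)) (hp (i + 2)))
    refine (abs_add_three _ _ _).trans ?_
    linarith
  rw [rem, abs_neg]
  refine (Finset.abs_sum_le_sum_abs _ _).trans ((Finset.sum_le_sum fun i _ => term i).trans ?_)
  simp
  linarith

theorem abs_gradRem_le {c : CubicCoeff} {M : ℝ} (hd : ∀ i, |c.d i| ≤ M) (hg : ∀ i, |c.g i| ≤ M)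
    (hk : ∀ i, |c.k i| ≤ M) (i : Fin 3) {x : E3} (hx : x ∈ openCube) :
    |c.gradRem i x| ≤ 24 * M := by
  have hx' := fun i => (hx i).le
  have hu := fun i => abs_one_sub_sq_le (hx' i)
  have hp := fun i => abs_legendre_le (hx' i)
  have e : |(3 * x (i + 1) ^ 2 - 1) / 2 + (3 * x (i + 2) ^ 2 - 1) / 2 - 1| ≤ 3 := by
    have h1 := abs_le.1 (hp (i + 1))
    have h2 := abs_le.1 (hp (i + 2))
    rw [abs_le]
    constructor <;> linarith [h1.1, h1.2, h2.1, h2.2]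
  have two : |-2 * x i| ≤ 2 := by
    rw [abs_mul]; norm_num; linarith [hx' i]
  have two' : |2 * x i| ≤ 2 := by
    rw [abs_mul]; norm_num; linarith [hx' i]
  have three : |3 * x i| ≤ 3 := by
    rw [abs_mul]; norm_num; linarith [hx' i]
  have t1 := abs_mul_le_of_le_of_le (abs_mul_le_of_le_of_le two (hd i)) e
  have t2 := abs_mul_le_of_le_of_le three ((abs_add_le _ _).trans (add_le_add
    (abs_mul_le_of_le_of_le (hd (i + 1)) (hu (i + 1)))
    (abs_mul_le_of_le_of_le (hd (i + 2)) (hu (i + 2)))))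
  have t3 := abs_mul_le_of_le_of_le (abs_mul_le_of_le_of_le (abs_mul_le_of_le_of_le two' (hg i))
    (hx' (i + 1))) (hp (i + 2))
  have t4 := abs_mul_le_of_le_of_le (abs_mul_le_of_le_of_le (abs_mul_le_of_le_of_le three
    (hg (i + 1))) (hu (i + 1))) (hx' (i + 2))
  have t5 := abs_mul_le_of_le_of_le (abs_mul_le_of_le_of_le (hg (i + 2)) (hu (i + 2))) (hp (i + 1))
  have t6 := abs_mul_le_of_le_of_le (abs_mul_le_of_le_of_le (hk i) (hu (i + 1))) (hp (i + 2))
  have t7 := abs_mul_le_of_le_of_le (abs_mul_le_of_le_of_le (abs_mul_le_of_le_of_le three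
    (hk (i + 1))) (hu (i + 2))) (hx' (i + 1))
  have t8 := abs_mul_le_of_le_of_le (abs_mul_le_of_le_of_le (abs_mul_le_of_le_of_le two'
    (hk (i + 2))) (hx' (i + 2))) (hp (i + 1))
  rw [abs_le] at t1 t2 t3 t4 t5 t6 t7 t8
  rw [gradRem, abs_neg, abs_le]
  constructor <;> linarith [t1.1, t1.2, t2.1, t2.2, t3.1, t3.2, t4.1, t4.2, t5.1, t5.2, t6.1, t6.2,
    t7.1, t7.2, t8.1, t8.2]

/-- The larger of the two constants is 8 · 24² · 3 = 13824, rounded up. -/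
theorem integral_rem_sq_le (c : CubicCoeff) :
    ∫ x in openCube, c.rem x ^ 2 ≤ 20000 * c.energy ∧
      ∀ i, ∫ x in openCube, c.gradRem i x ^ 2 ≤ 20000 * c.energy := by
  have hE : (0 : ℝ) ≤ 3 * c.energy := by linarith [c.energy_nonneg]
  set M := Real.sqrt (3 * c.energy) with hM
  have hM2 : M ^ 2 = 3 * c.energy := Real.sq_sqrt hE
  have hd : ∀ i, |c.d i| ≤ M := fun i => Real.abs_le_sqrt (c.d_sq_le i)
  have hg : ∀ i, |c.g i| ≤ M := fun i => Real.abs_le_sqrt (c.g_sq_le i)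
  have hk : ∀ i, |c.k i| ≤ M := fun i => Real.abs_le_sqrt (c.k_sq_le i)
  refine ⟨(setIntegral_sq_le_of_abs_le fun x hx => abs_rem_le hd hg hk hx).trans ?_,
    fun i => (setIntegral_sq_le_of_abs_le fun x hx => abs_gradRem_le hd hg hk i hx).trans ?_⟩
  · rw [mul_pow, hM2]; linarith [c.energy_nonneg]
  · rw [mul_pow, hM2]; linarith [c.energy_nonneg]

end CubicCoeff

/-! ### Nodal interpolation -/

/-- The weighted mean of the vertex values. -/
def vertexMean (f : (Fin 3 → ℤˣ) → ℝ) (ν : E3 → ℝ) : ℝ := 1 / 8 * ∑ v, f v * ν (cubeVertex v)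

theorem abs_vertexMean_le {f : (Fin 3 → ℤˣ) → ℝ} {ν : E3 → ℝ} {N : ℝ} (hf : ∀ v, |f v| ≤ 1)
    (hν : ∀ v, |ν (cubeVertex v)| ≤ N) : |vertexMean f ν| ≤ N := by
  have h : |∑ v, f v * ν (cubeVertex v)| ≤ ∑ _v : Fin 3 → ℤˣ, 1 * N :=
    (Finset.abs_sum_le_sum_abs _ _).trans
      (Finset.sum_le_sum fun v _ => abs_mul_le_of_le_of_le (hf v) (hν v))
  rw [Finset.sum_const, Finset.card_univ] at h
  have e : Fintype.card (Fin 3 → ℤˣ) = 8 := by decide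
  rw [e] at h
  rw [vertexMean, abs_mul]
  norm_num at h ⊢
  linarith

/-- The half difference of the values at two opposite face centroids. -/
def centerDiff (ν : E3 → ℝ) (i : Fin 3) : ℝ := (ν (faceCenter i 1) - ν (faceCenter i (-1))) / 2

/-- The mean of the values at two opposite face centroids. -/
def centerMean (ν : E3 → ℝ) (i : Fin 3) : ℝ := (ν (faceCenter i 1) + ν (faceCenter i (-1))) / 2

/-- The difference of two difference quotients, at the vertices and at the face centroids. -/
def diffDefect (ν : E3 → ℝ) (i : Fin 3) : ℝ :=
  vertexMean (fun v => ((v i : ℤ) : ℝ)) ν - centerDiff ν i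

/-- The value at the center of the quadratic part of the interpolant. -/
def centerValue (ν : E3 → ℝ) : ℝ :=
  (centerMean ν 0 + centerMean ν 1 + centerMean ν 2 - vertexMean (fun _ => 1) ν) / 2

/-- The coefficients `g` of the interpolant. -/
def SKType.interpG : SKType → (E3 → ℝ) → Fin 3 → ℝ
  | .type1, ν, i => diffDefect ν (i + 1)
  | .type2, _, _ => 0
  | .type5, ν, i => (diffDefect ν i + diffDefect ν (i + 1) - diffDefect ν (i + 2)) / 2

/-- The coefficients `k` of the interpolant. -/
def SKType.interpK : SKType → (E3 → ℝ) → Fin 3 → ℝ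
  | .type1, _, _ => 0
  | .type2, ν, i => diffDefect ν i
  | .type5, ν, i => (diffDefect ν i + diffDefect ν (i + 1) - diffDefect ν (i + 2)) / 2

/-- The coefficients of the nodal interpolant. -/
def SKType.interp (t : SKType) (ν : E3 → ℝ) : CubicCoeff where
  a := centerValue ν
  κ := vertexMean (fun v => ((v 0 : ℤ) : ℝ) * ((v 1 : ℤ) : ℝ) * ((v 2 : ℤ) : ℝ)) ν
  b := centerDiff ν
  d := fun i => centerMean ν i - centerValue ν
  m := fun i => vertexMean (fun v => ((v (i + 1) : ℤ) : ℝ) * ((v (i + 2) : ℤ) : ℝ)) ν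
  g := t.interpG ν
  k := t.interpK ν

/-- The coefficients belong to a polynomial in the shape function space. -/
def CubicCoeff.IsOfType (c : CubicCoeff) : SKType → Prop
  | .type1 => c.k = 0
  | .type2 => c.g = 0
  | .type5 => c.g = c.k

theorem SKType.isOfType_interp (t : SKType) (ν : E3 → ℝ) : (t.interp ν).IsOfType t := by
  cases t <;> rfl

/-- The vertices see `g` and `k` only through the sums g(i+2) + k(i). The linear relation defining
each type determines both from these sums; for type 5 this is the solution of a cyclic 3 × 3 system.
-/
theorem SKType.interpG_add_interpK (t : SKType) (ν : E3 → ℝ) (i : Fin 3) :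
    t.interpG ν (i + 2) + t.interpK ν i = diffDefect ν i := by
  cases t <;> rcases fin_three_cases i with rfl | rfl | rfl <;> simp [interpG, interpK] <;> ring

namespace CubicCoeff

theorem fn_faceCenter (c : CubicCoeff) (i : Fin 3) (τ : ℤˣ) :
    c.fn (faceCenter i τ) = c.a + ((τ : ℤ) : ℝ) * c.b i + c.d i := by
  have h : ((τ : ℤ) : ℝ) ^ 2 = 1 := by rw [sq, units_sq]
  rcases fin_three_cases i with rfl | rfl | rfl <;>
    simp [fn, faceCenter_apply, Fin.sum_univ_three, h] <;> ring

theorem fn_cubeVertex (c : CubicCoeff) (v : Fin 3 → ℤˣ) :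
    c.fn (cubeVertex v) = c.a + c.d 0 + c.d 1 + c.d 2
      + c.κ * (((v 0 : ℤ) : ℝ) * ((v 1 : ℤ) : ℝ) * ((v 2 : ℤ) : ℝ))
      + (c.b 0 + (c.g 2 + c.k 0)) * ((v 0 : ℤ) : ℝ) + (c.b 1 + (c.g 0 + c.k 1)) * ((v 1 : ℤ) : ℝ)
      + (c.b 2 + (c.g 1 + c.k 2)) * ((v 2 : ℤ) : ℝ)
      + c.m 0 * (((v 1 : ℤ) : ℝ) * ((v 2 : ℤ) : ℝ)) + c.m 1 * (((v 2 : ℤ) : ℝ) * ((v 0 : ℤ) : ℝ))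
      + c.m 2 * (((v 0 : ℤ) : ℝ) * ((v 1 : ℤ) : ℝ)) := by
  have h : ∀ i, ((v i : ℤ) : ℝ) ^ 2 = 1 := fun i => by rw [sq, units_sq]
  simp [fn, Fin.sum_univ_three, h]
  ring

end CubicCoeff

theorem SKType.interp_faceCenter (t : SKType) (ν : E3 → ℝ) (i : Fin 3) (τ : ℤˣ) :
    (t.interp ν).fn (faceCenter i τ) = ν (faceCenter i τ) := by
  rw [CubicCoeff.fn_faceCenter]
  rcases Int.units_eq_one_or τ with rfl | rfl <;> simp [interp, centerDiff, centerMean] <;> ring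

theorem SKType.interp_cubeVertex (t : SKType) (ν : E3 → ℝ) (v : Fin 3 → ℤˣ) :
    (t.interp ν).fn (cubeVertex v) = ν (cubeVertex v) := by
  rw [CubicCoeff.fn_cubeVertex]
  have h0 : (t.interp ν).g 2 + (t.interp ν).k 0 = diffDefect ν 0 := t.interpG_add_interpK ν 0
  have h1 : (t.interp ν).g 0 + (t.interp ν).k 1 = diffDefect ν 1 := t.interpG_add_interpK ν 1
  have h2 : (t.interp ν).g 1 + (t.interp ν).k 2 = diffDefect ν 2 := t.interpG_add_interpK ν 2
  rw [h0, h1, h2]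
  have hv : v = ![v 0, v 1, v 2] := by ext i; fin_cases i <;> rfl
  rw [hv]
  simp only [interp, centerValue, diffDefect, vertexMean, sum_units_pi]
  rcases Int.units_eq_one_or (v 0) with e0 | e0 <;> rcases Int.units_eq_one_or (v 1) with e1 | e1 <;>
    rcases Int.units_eq_one_or (v 2) with e2 | e2 <;> rw [e0, e1, e2] <;> simp <;> ring

theorem SKType.interp_eq (t : SKType) (ν : E3 → ℝ) {x : E3} (hx : x ∈ refNodes) :
    (t.interp ν).fn x = ν x := by
  rcases exists_of_mem_refNodes hx with ⟨v, rfl⟩ | ⟨i, τ, rfl⟩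
  · exact t.interp_cubeVertex ν v
  · exact t.interp_faceCenter ν i τ

section Bounds

variable {ν : E3 → ℝ} {N : ℝ}

theorem abs_centerDiff_le (hν : ∀ x ∈ refNodes, |ν x| ≤ N) (i : Fin 3) : |centerDiff ν i| ≤ N := by
  have h1 := abs_le.1 (hν _ (faceCenter_mem_refNodes i 1))
  have h2 := abs_le.1 (hν _ (faceCenter_mem_refNodes i (-1)))
  rw [centerDiff, abs_le]
  constructor <;> linarith [h1.1, h1.2, h2.1, h2.2]

theorem abs_centerMean_le (hν : ∀ x ∈ refNodes, |ν x| ≤ N) (i : Fin 3) : |centerMean ν i| ≤ N := by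
  have h1 := abs_le.1 (hν _ (faceCenter_mem_refNodes i 1))
  have h2 := abs_le.1 (hν _ (faceCenter_mem_refNodes i (-1)))
  rw [centerMean, abs_le]
  constructor <;> linarith [h1.1, h1.2, h2.1, h2.2]

theorem abs_vertexMean_le' (hν : ∀ x ∈ refNodes, |ν x| ≤ N) {f : (Fin 3 → ℤˣ) → ℝ}
    (hf : ∀ v, |f v| ≤ 1) : |vertexMean f ν| ≤ N :=
  abs_vertexMean_le hf fun v => hν _ (cubeVertex_mem_refNodes v)

theorem abs_diffDefect_le (hν : ∀ x ∈ refNodes, |ν x| ≤ N) (i : Fin 3) :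
    |diffDefect ν i| ≤ 2 * N := by
  have h1 := abs_le.1 (abs_vertexMean_le' hν (f := fun v => ((v i : ℤ) : ℝ))
    fun v => (abs_units _).le)
  have h2 := abs_le.1 (abs_centerDiff_le hν i)
  rw [diffDefect, abs_le]
  constructor <;> linarith [h1.1, h1.2, h2.1, h2.2]

theorem abs_centerValue_le (hν : ∀ x ∈ refNodes, |ν x| ≤ N) : |centerValue ν| ≤ 2 * N := by
  have h1 := abs_le.1 (abs_vertexMean_le' hν (f := fun _ => 1) fun v => by simp)
  have h2 := fun i => abs_le.1 (abs_centerMean_le hν i)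
  rw [centerValue, abs_le]
  constructor <;> linarith [h1.1, h1.2, (h2 0).1, (h2 0).2, (h2 1).1, (h2 1).2, (h2 2).1, (h2 2).2]

theorem SKType.abs_interp_g_le (t : SKType) (hν : ∀ x ∈ refNodes, |ν x| ≤ N) (i : Fin 3) :
    |(t.interp ν).g i| ≤ 3 * N ∧ |(t.interp ν).k i| ≤ 3 * N := by
  have h := fun i => abs_le.1 (abs_diffDefect_le hν i)
  have hN : 0 ≤ N := (abs_nonneg _).trans (hν _ (faceCenter_mem_refNodes 0 1))
  cases t <;> simp only [interp, interpG, interpK, abs_le] <;>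
    refine ⟨⟨?_, ?_⟩, ⟨?_, ?_⟩⟩ <;>
    linarith [(h i).1, (h i).2, (h (i + 1)).1, (h (i + 1)).2, (h (i + 2)).1, (h (i + 2)).2]

/-- The constant adds up the terms of `gradFn` in order: 28 = 1 + 6 + 1 + 1 + 1 + 6 + 3 + 3 + 6. -/
theorem SKType.abs_gradFn_interp_le (t : SKType) (hν : ∀ x ∈ refNodes, |ν x| ≤ N) (i : Fin 3)
    {x : E3} (hx : x ∈ openCube) : |(t.interp ν).gradFn i x| ≤ 28 * N := by
  have hx' := fun i => (hx i).le
  have hx2 : ∀ i, |x i ^ 2| ≤ 1 := fun i => by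
    rw [abs_pow]; exact pow_le_one₀ (abs_nonneg _) (hx' i)
  have gk := fun i => t.abs_interp_g_le hν i
  have hb : ∀ i, |(t.interp ν).b i| ≤ N := abs_centerDiff_le hν
  have hm : ∀ i, |(t.interp ν).m i| ≤ N := fun i => abs_vertexMean_le' hν fun v => by
    rw [abs_mul, abs_units, abs_units, one_mul]
  have hκ : |(t.interp ν).κ| ≤ N := abs_vertexMean_le' hν fun v => by
    rw [abs_mul, abs_mul, abs_units, abs_units, abs_units, one_mul, one_mul]
  have hd : ∀ i, |(t.interp ν).d i| ≤ 3 * N := fun i => by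
    have h1 := abs_le.1 (abs_centerMean_le hν i)
    have h2 := abs_le.1 (abs_centerValue_le hν)
    change |centerMean ν i - centerValue ν| ≤ _
    rw [abs_le]
    constructor <;> linarith [h1.1, h1.2, h2.1, h2.2]
  have two : ∀ {a A : ℝ}, |a| ≤ A → |2 * a| ≤ 2 * A := fun h => by
    rw [abs_mul, abs_two]; linarith
  have t1 := abs_le.1 (hb i)
  have t2 := abs_le.1 (abs_mul_le_of_le_of_le (two (hd i)) (hx' i))
  have t3 := abs_le.1 (abs_mul_le_of_le_of_le (hm (i + 1)) (hx' (i + 2)))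
  have t4 := abs_le.1 (abs_mul_le_of_le_of_le (hm (i + 2)) (hx' (i + 1)))
  have t5 := abs_le.1 (abs_mul_le_of_le_of_le hκ
    (abs_mul_le_of_le_of_le (hx' (i + 1)) (hx' (i + 2))))
  have t6 := abs_le.1 (abs_mul_le_of_le_of_le (abs_mul_le_of_le_of_le (two (gk i).1) (hx' i))
    (hx' (i + 1)))
  have t7 := abs_le.1 (abs_mul_le_of_le_of_le (gk (i + 2)).1 (hx2 (i + 2)))
  have t8 := abs_le.1 (abs_mul_le_of_le_of_le (gk i).2 (hx2 (i + 1)))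
  have t9 := abs_le.1 (abs_mul_le_of_le_of_le (abs_mul_le_of_le_of_le (two (gk (i + 2)).2)
    (hx' (i + 2))) (hx' i))
  rw [CubicCoeff.gradFn, abs_le]
  constructor <;> linarith [t1.1, t1.2, t2.1, t2.2, t3.1, t3.2, t4.1, t4.2, t5.1, t5.2, t6.1, t6.2,
    t7.1, t7.2, t8.1, t8.2, t9.1, t9.2]

end Bounds

theorem vertexMean_fn (c : CubicCoeff) :
    vertexMean (fun _ => 1) c.fn = c.a + c.d 0 + c.d 1 + c.d 2 ∧
    vertexMean (fun v => ((v 0 : ℤ) : ℝ) * ((v 1 : ℤ) : ℝ) * ((v 2 : ℤ) : ℝ)) c.fn = c.κ ∧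
    (∀ i, vertexMean (fun v => ((v i : ℤ) : ℝ)) c.fn = c.b i + (c.g (i + 2) + c.k i)) ∧
    ∀ i, vertexMean (fun v => ((v (i + 1) : ℤ) : ℝ) * ((v (i + 2) : ℤ) : ℝ)) c.fn = c.m i := by
  refine ⟨?_, ?_, fun i => ?_, fun i => ?_⟩
  · simp only [vertexMean, sum_units_pi, CubicCoeff.fn_cubeVertex]
    simp
    ring
  · simp only [vertexMean, sum_units_pi, CubicCoeff.fn_cubeVertex]
    simp
    ring
  · rcases fin_three_cases i with rfl | rfl | rfl <;>
      simp only [vertexMean, sum_units_pi, CubicCoeff.fn_cubeVertex] <;> simp <;> ring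
  · rcases fin_three_cases i with rfl | rfl | rfl <;>
      simp only [vertexMean, sum_units_pi, CubicCoeff.fn_cubeVertex] <;> simp <;> ring

/-- Interpolation reproduces the shape functions. -/
theorem CubicCoeff.IsOfType.interp_fn {c : CubicCoeff} {t : SKType} (h : c.IsOfType t) :
    t.interp c.fn = c := by
  obtain ⟨v1, v2, v3, v4⟩ := vertexMean_fn c
  have hb : ∀ i, centerDiff c.fn i = c.b i := fun i => by
    simp only [centerDiff, fn_faceCenter]; simp
  have hm : ∀ i, centerMean c.fn i = c.a + c.d i := fun i => by
    simp only [centerMean, fn_faceCenter]; simp; ring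
  have ha : centerValue c.fn = c.a := by
    simp only [centerValue, hm, v1]; ring
  have hδ : ∀ i, diffDefect c.fn i = c.g (i + 2) + c.k i := fun i => by
    simp only [diffDefect, hb, v3]; ring
  have e1 : ∀ i : Fin 3, i + 1 + 2 = i := by decide
  have e2 : ∀ i : Fin 3, i + 2 + 2 = i + 1 := by decide
  have hg : t.interpG c.fn = c.g := by
    funext i
    cases t
    · have h' : c.k = 0 := h
      simp only [SKType.interpG, hδ, h', e1, Pi.zero_apply, add_zero]
    · have h' : c.g = 0 := h
      simp only [SKType.interpG, h', Pi.zero_apply]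
    · have h' : c.g = c.k := h
      simp only [SKType.interpG, hδ, h', e1, e2]
      ring
  have hk : t.interpK c.fn = c.k := by
    funext i
    cases t
    · have h' : c.k = 0 := h
      simp only [SKType.interpK, h', Pi.zero_apply]
    · have h' : c.g = 0 := h
      simp only [SKType.interpK, hδ, h', Pi.zero_apply, zero_add]
    · have h' : c.g = c.k := h
      simp only [SKType.interpK, hδ, h', e1, e2]
      ring
  cases c
  simp only [SKType.interp, ha, v2, funext hb, hm, v4, hg, hk]
  simp

/-- A shape function is controlled by its nodal values. -/
theorem CubicCoeff.IsOfType.abs_gradFn_le {c : CubicCoeff} {t : SKType} (h : c.IsOfType t) {N : ℝ}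
    (hN : ∀ x ∈ refNodes, |c.fn x| ≤ N) (i : Fin 3) {x : E3} (hx : x ∈ openCube) :
    |c.gradFn i x| ≤ 28 * N := by
  have := t.abs_gradFn_interp_le hN i hx
  rwa [h.interp_fn] at this

/-! ### The shape function spaces -/

/-- The function belongs to the space of the functions `CubicCoeff.fn`. -/
def IsCubicFn (F : E3 → ℝ) : Prop := ∃ c : CubicCoeff, ∀ x, F x = c.fn x

theorem IsCubicFn.add {F G : E3 → ℝ} (hF : IsCubicFn F) (hG : IsCubicFn G) :
    IsCubicFn fun x => F x + G x := by
  obtain ⟨c, hc⟩ := hF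
  obtain ⟨e, he⟩ := hG
  refine ⟨⟨c.a + e.a, c.κ + e.κ, c.b + e.b, c.d + e.d, c.m + e.m, c.g + e.g, c.k + e.k⟩,
    fun x => ?_⟩
  beta_reduce
  rw [hc, he]
  simp only [CubicCoeff.fn, Fin.sum_univ_three, Pi.add_apply]
  ring

theorem IsCubicFn.const_mul {F : E3 → ℝ} (hF : IsCubicFn F) (r : ℝ) :
    IsCubicFn fun x => r * F x := by
  obtain ⟨c, hc⟩ := hF
  refine ⟨⟨r * c.a, r * c.κ, r • c.b, r • c.d, r • c.m, r • c.g, r • c.k⟩, fun x => ?_⟩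
  beta_reduce
  rw [hc]
  simp only [CubicCoeff.fn, Fin.sum_univ_three, Pi.smul_apply, smul_eq_mul]
  ring

/-- The polynomials whose values are given by `CubicCoeff.fn`. -/
def cubicSubmodule : Submodule ℝ (MvPolynomial (Fin 3) ℝ) where
  carrier := {p | IsCubicFn fun x => MvPolynomial.eval (fun i => x i) p}
  add_mem' := fun {p q} hp hq => by
    simp only [mem_ofPred_eq, map_add]
    exact IsCubicFn.add hp hq
  zero_mem' := ⟨⟨0, 0, 0, 0, 0, 0, 0⟩, fun x => by simp [CubicCoeff.fn]⟩
  smul_mem' := fun r p hp => by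
    simp only [mem_ofPred_eq, MvPolynomial.smul_eval]
    exact IsCubicFn.const_mul hp r

theorem monomial_mem_cubicSubmodule {s : Fin 3 →₀ ℕ} (hs : s 0 + s 1 + s 2 ≤ 2) :
    MvPolynomial.monomial s (1 : ℝ) ∈ cubicSubmodule := by
  have e : ∀ x : E3, MvPolynomial.eval (fun i => x i) (MvPolynomial.monomial s (1 : ℝ))
      = x 0 ^ s 0 * x 1 ^ s 1 * x 2 ^ s 2 := by
    intro x
    rw [MvPolynomial.eval_monomial, one_mul, Finsupp.prod_fintype _ _ (by simp),
      Fin.prod_univ_three]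
  change IsCubicFn _
  simp only [e]
  generalize s 0 = p at hs ⊢
  generalize s 1 = q at hs ⊢
  generalize s 2 = r at hs ⊢
  have hp : p ≤ 2 := by omega
  have hq : q ≤ 2 := by omega
  have hr : r ≤ 2 := by omega
  refine ⟨⟨if p = 0 ∧ q = 0 ∧ r = 0 then 1 else 0, 0,
    ![if p = 1 ∧ q = 0 ∧ r = 0 then 1 else 0, if p = 0 ∧ q = 1 ∧ r = 0 then 1 else 0,
      if p = 0 ∧ q = 0 ∧ r = 1 then 1 else 0],
    ![if p = 2 then 1 else 0, if q = 2 then 1 else 0, if r = 2 then 1 else 0],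
    ![if q = 1 ∧ r = 1 then 1 else 0, if r = 1 ∧ p = 1 then 1 else 0,
      if p = 1 ∧ q = 1 then 1 else 0], 0, 0⟩, fun x => ?_⟩
  interval_cases p <;> interval_cases q <;> interval_cases r <;> first
    | omega
    | simp [CubicCoeff.fn, Fin.sum_univ_three, mul_comm]

/-- All types are embedded in one space, in which the coefficients `g` and `k` are independent; the
consistency analysis then need not distinguish them. -/
theorem shapeSpace_le_cubicSubmodule (t : SKType) : t.shapeSpace ≤ cubicSubmodule := by
  refine sup_le ?_ ?_
  · intro p hp
    rw [MvPolynomial.mem_restrictTotalDegree] at hp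
    rw [p.as_sum]
    refine Submodule.sum_mem _ fun s hs => ?_
    have h1 : MvPolynomial.monomial s (MvPolynomial.coeff s p)
        = MvPolynomial.coeff s p • MvPolynomial.monomial s (1 : ℝ) := by
      rw [MvPolynomial.smul_monomial, smul_eq_mul, mul_one]
    rw [h1]
    refine Submodule.smul_mem _ _ (monomial_mem_cubicSubmodule ?_)
    have h2 := (MvPolynomial.le_totalDegree hs).trans hp
    rwa [Finsupp.sum_fintype _ _ (by simp), Fin.sum_univ_three] at h2
  · rw [Submodule.span_le]
    intro p hp
    change IsCubicFn _
    have key : ∀ κ (g k : Fin 3 → ℝ), (∀ x : E3, MvPolynomial.eval (fun i => x i) p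
        = κ * (x 0 * x 1 * x 2) + (g 0 * (x 0 ^ 2 * x 1) + g 1 * (x 1 ^ 2 * x 2)
          + g 2 * (x 2 ^ 2 * x 0)) + (k 0 * (x 0 * x 1 ^ 2) + k 1 * (x 1 * x 2 ^ 2)
          + k 2 * (x 2 * x 0 ^ 2))) → IsCubicFn fun x => MvPolynomial.eval (fun i => x i) p := by
      intro κ g k h
      refine ⟨⟨0, κ, 0, 0, 0, g, k⟩, fun x => ?_⟩
      beta_reduce
      rw [h x]
      simp [CubicCoeff.fn, Fin.sum_univ_three]
      ring
    cases t <;> simp only [SKType.extra, mem_insert_iff, mem_singleton_iff] at hp <;>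
      rcases hp with rfl | rfl | rfl | rfl
    · exact key 1 0 0 fun x => by simp
    · exact key 0 ![1, 0, 0] 0 fun x => by simp
    · exact key 0 ![0, 1, 0] 0 fun x => by simp
    · exact key 0 ![0, 0, 1] 0 fun x => by simp
    · exact key 1 0 0 fun x => by simp
    · exact key 0 0 ![1, 0, 0] fun x => by simp
    · exact key 0 0 ![0, 1, 0] fun x => by simp
    · exact key 0 0 ![0, 0, 1] fun x => by simp
    · exact key 1 0 0 fun x => by simp
    · exact key 0 ![1, 0, 0] ![1, 0, 0] fun x => by simp
    · exact key 0 ![0, 1, 0] ![0, 1, 0] fun x => by simp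
    · exact key 0 ![0, 0, 1] ![0, 0, 1] fun x => by simp

theorem IsShapeFunction.exists_eq_fn {t : SKType} {T : E3 ≃ᵃ[ℝ] E3} {φ : E3 → ℝ}
    (h : IsShapeFunction t T φ) : ∃ c : CubicCoeff, ∀ x, φ x = c.fn (T.symm x) := by
  obtain ⟨p, hp, hφ⟩ := h
  obtain ⟨c, hc⟩ := shapeSpace_le_cubicSubmodule t hp
  exact ⟨c, fun x => (hφ x).trans (hc (T.symm x))⟩

theorem IsShapeFunction.sub {t : SKType} {T : E3 ≃ᵃ[ℝ] E3} {φ ψ : E3 → ℝ}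
    (hφ : IsShapeFunction t T φ) (hψ : IsShapeFunction t T ψ) :
    IsShapeFunction t T fun x => φ x - ψ x := by
  obtain ⟨p, hp, hpe⟩ := hφ
  obtain ⟨q, hq, hqe⟩ := hψ
  exact ⟨p - q, Submodule.sub_mem _ hp hq, fun x => by
    beta_reduce
    rw [hpe, hqe, map_sub]⟩

-- The converse inclusion, by which the interpolant belongs to the discrete space.
open MvPolynomial in
theorem CubicCoeff.IsOfType.exists_eval {c : CubicCoeff} {t : SKType} (h : c.IsOfType t) :
    ∃ p ∈ t.shapeSpace, ∀ x : E3, eval (fun i => x i) p = c.fn x := by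
  have low : ∀ q : MvPolynomial (Fin 3) ℝ, q.totalDegree ≤ 2 → q ∈ t.shapeSpace := fun q hq =>
    (le_sup_left : restrictTotalDegree (Fin 3) ℝ 2 ≤ t.shapeSpace)
      ((mem_restrictTotalDegree _ _ _).2 hq)
  have ext : ∀ q ∈ t.extra, ∀ r : ℝ, r • q ∈ t.shapeSpace := fun q hq r =>
    Submodule.smul_mem _ _ ((le_sup_right : Submodule.span ℝ t.extra ≤ t.shapeSpace)
      (Submodule.subset_span hq))
  have hX : ∀ i, c.b i • (X i : MvPolynomial (Fin 3) ℝ) ∈ t.shapeSpace := fun i =>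
    Submodule.smul_mem _ _ (low _ (by simp))
  have hXX : ∀ (r : ℝ) i j, r • (X i * X j : MvPolynomial (Fin 3) ℝ) ∈ t.shapeSpace := fun r i j =>
    Submodule.smul_mem _ _ (low _ ((totalDegree_mul _ _).trans (by simp)))
  have hC : C c.a ∈ t.shapeSpace := low _ (by simp)
  have hlow : C c.a + ∑ i, (c.b i • X i + c.d i • (X i * X i) + c.m i • (X (i + 1) * X (i + 2)))
      ∈ t.shapeSpace :=
    Submodule.add_mem _ hC (Submodule.sum_mem _ fun i _ => Submodule.add_mem _
      (Submodule.add_mem _ (hX i) (hXX _ _ _)) (hXX _ _ _))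
  cases t
  · have hk : c.k = 0 := h
    refine ⟨_, Submodule.add_mem _ hlow (Submodule.add_mem _ (ext (X 0 * X 1 * X 2)
      (by simp [SKType.extra]) c.κ) (Submodule.add_mem _ (ext (X 0 ^ 2 * X 1)
      (by simp [SKType.extra]) (c.g 0)) (Submodule.add_mem _ (ext (X 1 ^ 2 * X 2)
      (by simp [SKType.extra]) (c.g 1)) (ext (X 2 ^ 2 * X 0) (by simp [SKType.extra])
      (c.g 2))))), fun x => ?_⟩
    simp [fn, Fin.sum_univ_three, smul_eval, hk]
    ring
  · have hg : c.g = 0 := h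
    refine ⟨_, Submodule.add_mem _ hlow (Submodule.add_mem _ (ext (X 0 * X 1 * X 2)
      (by simp [SKType.extra]) c.κ) (Submodule.add_mem _ (ext (X 0 * X 1 ^ 2)
      (by simp [SKType.extra]) (c.k 0)) (Submodule.add_mem _ (ext (X 1 * X 2 ^ 2)
      (by simp [SKType.extra]) (c.k 1)) (ext (X 2 * X 0 ^ 2) (by simp [SKType.extra])
      (c.k 2))))), fun x => ?_⟩
    simp [fn, Fin.sum_univ_three, smul_eval, hg]
    ring
  · have hg : c.g = c.k := h
    refine ⟨_, Submodule.add_mem _ hlow (Submodule.add_mem _ (ext (X 0 * X 1 * X 2)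
      (by simp [SKType.extra]) c.κ) (Submodule.add_mem _ (ext (X 0 ^ 2 * X 1 + X 0 * X 1 ^ 2)
      (by simp [SKType.extra]) (c.g 0)) (Submodule.add_mem _ (ext (X 1 ^ 2 * X 2 + X 1 * X 2 ^ 2)
      (by simp [SKType.extra]) (c.g 1)) (ext (X 2 ^ 2 * X 0 + X 2 * X 0 ^ 2)
      (by simp [SKType.extra]) (c.g 2))))), fun x => ?_⟩
    simp [fn, Fin.sum_univ_three, smul_eval, hg]
    ring

theorem CubicCoeff.IsOfType.isShapeFunction {c : CubicCoeff} {t : SKType} (h : c.IsOfType t)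
    (T : E3 ≃ᵃ[ℝ] E3) : IsShapeFunction t T fun x => c.fn (T.symm x) := by
  obtain ⟨p, hp, he⟩ := h.exists_eval
  exact ⟨p, hp, fun x => (he _).symm⟩

/-- Affine maps take quadratic polynomials to quadratic polynomials. -/
theorem exists_fn_eq_quadratic (a : ℝ) (b : Fin 3 → ℝ) (m : Fin 3 → Fin 3 → ℝ) (T : E3 ≃ᵃ[ℝ] E3)
    (t : SKType) : ∃ c : CubicCoeff, c.IsOfType t ∧ ∀ y, quadratic a b m (T y) = c.fn y := by
  set A := affEntry T with hA
  set z : Fin 3 → ℝ := fun i => T 0 i with hz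
  have hT : ∀ y i, T y i = z i + (A i 0 * y 0 + A i 1 * y 1 + A i 2 * y 2) := by
    intro y i
    have h := affine_apply_sub T y 0 i
    rw [Fin.sum_univ_three] at h
    simp only [PiLp.zero_apply, sub_zero] at h
    simp only [hz, hA]
    linarith
  refine ⟨⟨a + ∑ i, b i * z i + (∑ i, ∑ j, m i j * (z i * z j)) / 2, 0,
    fun l => ∑ i, b i * A i l + (∑ i, ∑ j, m i j * (A i l * z j + z i * A j l)) / 2,
    fun l => (∑ i, ∑ j, m i j * (A i l * A j l)) / 2,
    fun l => (∑ i, ∑ j, m i j * (A i (l + 1) * A j (l + 2) + A i (l + 2) * A j (l + 1))) / 2,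
    0, 0⟩, by cases t <;> rfl, fun y => ?_⟩
  obtain ⟨h1, h2, h3, h4, h5, h6⟩ := fin_three_add
  simp only [quadratic, hT, CubicCoeff.fn, Fin.sum_univ_three, Pi.zero_apply, h1, h2, h3, h4, h5,
    h6]
  ring

/-! ### Estimates on a single cell -/

/-- The squared broken seminorm of the transported polynomial on a cell. -/
def cellEnergy (T : E3 ≃ᵃ[ℝ] E3) (c : CubicCoeff) : ℝ :=
  ∑ j, ∫ x in T '' openCube, partialDeriv j (fun x => c.fn (T.symm x)) x ^ 2

theorem cellEnergy_nonneg (T : E3 ≃ᵃ[ℝ] E3) (c : CubicCoeff) : 0 ≤ cellEnergy T c :=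
  Finset.sum_nonneg fun _ _ => integral_nonneg fun _ => sq_nonneg _

theorem contDiff_fn_comp (T : E3 ≃ᵃ[ℝ] E3) (c : CubicCoeff) :
    ContDiff ℝ ∞ fun x => c.fn (T.symm x) := c.contDiff_fn.comp (contDiff_affine T.symm)

theorem contDiff_rem_comp (T : E3 ≃ᵃ[ℝ] E3) (c : CubicCoeff) :
    ContDiff ℝ ∞ fun x => c.rem (T.symm x) := c.contDiff_rem.comp (contDiff_affine T.symm)

theorem sq_sum_mul_le {a p : Fin 3 → ℝ} {d : ℝ} (ha : ∀ j, |a j| ≤ d) :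
    (∑ j, a j * p j) ^ 2 ≤ 3 * d ^ 2 * ∑ j, p j ^ 2 := by
  have h1 := Finset.sum_mul_sq_le_sq_mul_sq Finset.univ a p
  have h2 : ∑ j, a j ^ 2 ≤ 3 * d ^ 2 := by
    refine (Finset.sum_le_sum (g := fun _ => d ^ 2) fun j _ => ?_).trans (by simp)
    rw [← sq_abs]
    exact pow_le_pow_left₀ (abs_nonneg _) (ha j) 2
  exact h1.trans (mul_le_mul_of_nonneg_right h2 (Finset.sum_nonneg fun _ _ => sq_nonneg _))

theorem sum_integral_openCube_sq {f : Fin 3 → E3 → ℝ} (hf : ∀ j, Continuous (f j)) :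
    ∑ j, ∫ y in openCube, f j y ^ 2 = ∫ y in openCube, ∑ j, f j y ^ 2 :=
  (integral_finsetSum _ fun j _ => integrableOn_openCube ((hf j).pow 2)).symm

theorem affDet_mul_energy_le {T : E3 ≃ᵃ[ℝ] E3} {d : ℝ} (hd : ∀ j i, |affEntry T j i| ≤ d)
    (c : CubicCoeff) : affDet T * c.energy ≤ 9 * d ^ 2 * cellEnergy T c := by
  have hdet := affDet_pos T
  have e : ∀ i y, c.gradFn i y
      = ∑ j, affEntry T j i * partialDeriv j (fun x => c.fn (T.symm x)) (T y) := by
    intro i y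
    rw [← partialDeriv_comp_affine (contDiff_fn_comp T c) T i y]
    simp only [AffineEquiv.symm_apply_apply]
    exact (congrFun (c.partialDeriv_fn i) y).symm
  have hcont : ∀ j, Continuous fun y => partialDeriv j (fun x => c.fn (T.symm x)) (T y) := fun j =>
    (contDiff_partialDeriv j (contDiff_fn_comp T c)).continuous.comp (continuous_affine T)
  have h1 : ∀ i, ∫ y in openCube, c.gradFn i y ^ 2 ≤ 3 * d ^ 2 *
      ∑ j, ∫ y in openCube, partialDeriv j (fun x => c.fn (T.symm x)) (T y) ^ 2 := by
    intro i
    rw [sum_integral_openCube_sq hcont, ← integral_const_mul]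
    refine setIntegral_mono (integrableOn_openCube ((c.continuous_gradFn i).pow 2))
      (integrableOn_openCube (continuous_const.mul (continuous_finsetSum _
        fun j _ => (hcont j).pow 2))) fun y => ?_
    rw [e i y]
    exact sq_sum_mul_le fun j => hd j i
  have h2 : cellEnergy T c = affDet T *
      ∑ j, ∫ y in openCube, partialDeriv j (fun x => c.fn (T.symm x)) (T y) ^ 2 := by
    rw [cellEnergy, Finset.mul_sum]
    exact Finset.sum_congr rfl fun j _ => setIntegral_affine_image T _
  rw [h2, CubicCoeff.energy]
  calc affDet T * ∑ i, ∫ y in openCube, c.gradFn i y ^ 2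
      ≤ affDet T * ∑ _i : Fin 3, 3 * d ^ 2 *
        ∑ j, ∫ y in openCube, partialDeriv j (fun x => c.fn (T.symm x)) (T y) ^ 2 := by
        gcongr with i _; exact h1 i
    _ = _ := by simp; ring

theorem setIntegral_rem_sq_le {T : E3 ≃ᵃ[ℝ] E3} {d : ℝ} (hd : ∀ j i, |affEntry T j i| ≤ d)
    (c : CubicCoeff) :
    ∫ x in T '' openCube, c.rem (T.symm x) ^ 2 ≤ 180000 * d ^ 2 * cellEnergy T c := by
  rw [setIntegral_affine_image]
  simp only [AffineEquiv.symm_apply_apply]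
  have h1 := mul_le_mul_of_nonneg_left c.integral_rem_sq_le.1 (affDet_pos T).le
  have h2 := affDet_mul_energy_le hd c
  linarith

/-- Differentiation costs the entries of the inverse matrix and the passage to the energy costs d.
Shape regularity enters only through the bound τ on the product β d. -/
theorem setIntegral_partialDeriv_rem_sq_le {T : E3 ≃ᵃ[ℝ] E3} {d β τ : ℝ} (hd0 : 0 ≤ d)
    (hd : ∀ j i, |affEntry T j i| ≤ d) (hβ : ∀ i j, |affEntry T.symm i j| ≤ β) (hτ : β * d ≤ τ)
    (c : CubicCoeff) (j : Fin 3) :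
    ∫ x in T '' openCube, partialDeriv j (fun x => c.rem (T.symm x)) x ^ 2
      ≤ 1620000 * τ ^ 2 * cellEnergy T c := by
  have hβ0 : 0 ≤ β := (abs_nonneg _).trans (hβ 0 0)
  have e : ∀ y, partialDeriv j (fun x => c.rem (T.symm x)) (T y)
      = ∑ i, affEntry T.symm i j * c.gradRem i y := by
    intro y
    rw [partialDeriv_comp_affine c.contDiff_rem T.symm j (T y)]
    simp only [AffineEquiv.symm_apply_apply, c.partialDeriv_rem]
  have h1 : ∫ y in openCube, partialDeriv j (fun x => c.rem (T.symm x)) (T y) ^ 2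
      ≤ 3 * β ^ 2 * ∑ i, ∫ y in openCube, c.gradRem i y ^ 2 := by
    rw [sum_integral_openCube_sq c.continuous_gradRem, ← integral_const_mul]
    refine setIntegral_mono (integrableOn_openCube
      (((contDiff_partialDeriv j (contDiff_rem_comp T c)).continuous.comp
        (continuous_affine T)).pow 2))
      (integrableOn_openCube (continuous_const.mul (continuous_finsetSum _
        fun i _ => (c.continuous_gradRem i).pow 2))) fun y => ?_
    rw [e y]
    exact sq_sum_mul_le fun i => hβ i j
  have h2 : ∑ i, ∫ y in openCube, c.gradRem i y ^ 2 ≤ 60000 * c.energy := by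
    refine (Finset.sum_le_sum fun i _ => c.integral_rem_sq_le.2 i).trans ?_
    simp
    linarith
  rw [setIntegral_affine_image]
  have hdet := affDet_pos T
  have h3 := affDet_mul_energy_le hd c
  have h4 : (β * d) ^ 2 ≤ τ ^ 2 := pow_le_pow_left₀ (mul_nonneg hβ0 hd0) hτ 2
  have hE := cellEnergy_nonneg T c
  calc affDet T * ∫ y in openCube, partialDeriv j (fun x => c.rem (T.symm x)) (T y) ^ 2
      ≤ affDet T * (3 * β ^ 2 * (60000 * c.energy)) := by
        gcongr
        exact h1.trans (mul_le_mul_of_nonneg_left h2 (by positivity))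
    _ = 180000 * β ^ 2 * (affDet T * c.energy) := by ring
    _ ≤ 180000 * β ^ 2 * (9 * d ^ 2 * cellEnergy T c) := by gcongr
    _ = 1620000 * (β * d) ^ 2 * cellEnergy T c := by ring
    _ ≤ 1620000 * τ ^ 2 * cellEnergy T c := by gcongr

/-- On every cell, affine fluxes are annihilated by the remainder. -/
theorem setIntegral_partialDeriv_affineFun_mul_rem (T : E3 ≃ᵃ[ℝ] E3) (c : CubicCoeff) (α : ℝ)
    (γ : Fin 3 → ℝ) (j : Fin 3) :
    ∫ x in T '' openCube, (γ j * c.rem (T.symm x)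
      + affineFun α γ x * partialDeriv j (fun x => c.rem (T.symm x)) x) = 0 := by
  have hA : ∃ α' γ', ∀ y, affineFun α γ (T y) = affineFun α' γ' y := by
    refine ⟨affineFun α γ (T 0), fun k => ∑ i, γ i * affEntry T i k, fun y => ?_⟩
    have h := fun i => affine_apply_sub T y 0 i
    simp only [PiLp.zero_apply, sub_zero, sub_eq_iff_eq_add'] at h
    simp only [affineFun, h, Fin.sum_univ_three]
    ring
  obtain ⟨α', γ', hA⟩ := hA
  set ψ : E3 → ℝ := fun y => affineFun α' γ' y * c.rem y with hψ
  have hψc : ContDiff ℝ ∞ ψ := (contDiff_affineFun α' γ').mul c.contDiff_rem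
  have e : ∀ x, γ j * c.rem (T.symm x)
      + affineFun α γ x * partialDeriv j (fun x => c.rem (T.symm x)) x
      = ∑ i, affEntry T.symm i j * partialDeriv i ψ (T.symm x) := by
    intro x
    rw [← partialDeriv_comp_affine hψc T.symm j x]
    have : (fun x => ψ (T.symm x)) = fun x => affineFun α γ x * c.rem (T.symm x) := by
      funext x
      simp only [hψ]
      rw [← hA, AffineEquiv.apply_symm_apply]
    rw [this, partialDeriv_mul (contDiff_affineFun α γ) (contDiff_rem_comp T c),
      partialDeriv_affineFun]
  simp only [e]
  rw [setIntegral_affine_image]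
  simp only [AffineEquiv.symm_apply_apply]
  rw [integral_finsetSum _ fun i _ =>
    (integrableOn_openCube (contDiff_partialDeriv i hψc).continuous).const_mul _]
  simp only [integral_const_mul, hψ, CubicCoeff.integral_partialDeriv_affine_mul_rem, mul_zero,
    Finset.sum_const_zero]

/-- Here 6 = 3 · 2: three directions with two terms each. -/
theorem sq_add_six_le (a b : Fin 3 → ℝ) :
    (∑ j, (a j + b j)) ^ 2 ≤ 6 * ∑ j, (a j ^ 2 + b j ^ 2) := by
  have h := sq_sum_le_card_mul_sum_sq (s := Finset.univ) (f := fun j => a j + b j)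
  simp only [Finset.card_univ, Fintype.card_fin] at h
  refine h.trans ?_
  rw [Finset.mul_sum, Finset.mul_sum]
  refine Finset.sum_le_sum fun j _ => ?_
  push_cast
  nlinarith [sq_nonneg (a j - b j)]

theorem sum_sum_nonneg_single {f : Fin 3 → Fin 3 → ℝ} (hf : ∀ j k, 0 ≤ f j k) (j k : Fin 3) :
    f j k ≤ ∑ j, ∑ k, f j k :=
  (Finset.single_le_sum (f := fun k => f j k) (fun k _ => hf j k) (Finset.mem_univ k)).trans
    (Finset.single_le_sum (f := fun j => ∑ k, f j k)
      (fun j _ => Finset.sum_nonneg fun k _ => hf j k) (Finset.mem_univ j))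

/-- The constant of the local consistency estimate. -/
def consistencyConst (τ : ℝ) : ℝ :=
  6 * (3 * (poincareConst ^ 2 * (1620000 * τ ^ 2) + poincareConst * 180000))

/-- The local consistency error. -/
theorem HasWeakGrad.sq_consistency_le {T : E3 ≃ᵃ[ℝ] E3} {d β τ : ℝ} (hd0 : 0 ≤ d)
    (hd : ∀ j i, |affEntry T j i| ≤ d) (hβ : ∀ i j, |affEntry T.symm i j| ≤ β) (hτ : β * d ≤ τ)
    {u : E3 → ℝ} {D1 : Fin 3 → E3 → ℝ}
    {D2 : Fin 3 → Fin 3 → E3 → ℝ} {D3 : Fin 3 → Fin 3 → Fin 3 → E3 → ℝ}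
    (h1 : HasWeakGrad (T '' openCube) u D1) (h2 : ∀ j, HasWeakGrad (T '' openCube) (D1 j) (D2 j))
    (h3 : ∀ j k, HasWeakGrad (T '' openCube) (D2 j k) (D3 j k))
    (hs : ∀ j k, D2 j k = D2 k j) (c : CubicCoeff) :
    (∑ j, ∫ x in T '' openCube, (D1 j x * partialDeriv j (fun x => c.rem (T.symm x)) x
      + D2 j j x * c.rem (T.symm x))) ^ 2
      ≤ consistencyConst τ * d ^ 4 * (∑ j, ∑ k, ∑ l, ∫ x in T '' openCube, D3 j k l x ^ 2)
        * cellEnergy T c := by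
  obtain ⟨a, b, m, hm, q1, q2, q3, b2, b1, b0⟩ := HasWeakGrad.exists_quadratic hd h1 h2 h3 hs
  set Z := ∑ j, ∑ k, ∑ l, ∫ x in T '' openCube, D3 j k l x ^ 2 with hZ
  have hZ0 : 0 ≤ Z := Finset.sum_nonneg fun _ _ => Finset.sum_nonneg fun _ _ =>
    Finset.sum_nonneg fun _ _ => integral_nonneg fun _ => sq_nonneg _
  have hE := cellEnergy_nonneg T c
  have hB := isBounded_affine_image T
  set v : E3 → ℝ := fun x => c.rem (T.symm x) with hv
  have : IsFiniteMeasure (volume.restrict (T '' openCube)) := ⟨by simpa using hB.measure_lt_top⟩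
  have mv : MemLp v 2 (volume.restrict (T '' openCube)) :=
    memLp_of_continuous_of_isBounded hB (contDiff_rem_comp T c).continuous
  have mdv : ∀ j, MemLp (partialDeriv j v) 2 (volume.restrict (T '' openCube)) := fun j =>
    memLp_of_continuous_of_isBounded hB
      (contDiff_partialDeriv j (contDiff_rem_comp T c)).continuous
  have maff : ∀ j, MemLp (affineFun (b j) (m j)) 2 (volume.restrict (T '' openCube)) := fun j =>
    memLp_of_continuous_of_isBounded hB (contDiff_affineFun _ _).continuous
  -- The affine approximation of the flux contributes zero and is subtracted. Now D1 has a residual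
  -- of order d² against the derivative of the remainder, and D2 a residual of order d against the
  -- remainder, itself of order d.
  have e : ∀ j, ∫ x in T '' openCube, (D1 j x * partialDeriv j v x + D2 j j x * v x)
      = (∫ x in T '' openCube, (D1 j x - affineFun (b j) (m j) x) * partialDeriv j v x)
        + ∫ x in T '' openCube, (D2 j j x - m j j) * v x := by
    intro j
    have i1 := MemLp.integrable_mul_fun (q1.2.1 j) (mdv j)
    have i2 := MemLp.integrable_mul_fun (q2 j |>.2.1 j) mv
    have i3 := (mv.integrable (by norm_num)).const_mul (m j j)
    have i4 := MemLp.integrable_mul_fun (maff j) (mdv j)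
    have z := setIntegral_partialDeriv_affineFun_mul_rem T c (b j) (m j) j
    have s1 := integral_add i1 i2
    have s2 := integral_add (i1.add i2) (i3.add i4)
    have z' : ∫ x in T '' openCube, (m j j * v x
      + affineFun (b j) (m j) x * partialDeriv j v x) = 0 := z
    refine Eq.trans ?_ s1
    refine Eq.trans ?_ ((s2.trans (congrArg _ z')).trans (add_zero _))
    refine integral_congr_ae (Filter.Eventually.of_forall fun x => ?_)
    simp only [Pi.add_apply, affineFun]
    ring
  have hP := poincareConst_pos
  have r0 := setIntegral_rem_sq_le hd c
  have r1 := setIntegral_partialDeriv_rem_sq_le hd0 hd hβ hτ c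
  have t1 : ∀ j, (∫ x in T '' openCube, (D1 j x - affineFun (b j) (m j) x) * partialDeriv j v x) ^ 2
      ≤ (poincareConst * d ^ 2) ^ 2 * Z * (1620000 * τ ^ 2 * cellEnergy T c) := by
    intro j
    refine (sq_integral_mul_le (q1.2.1 j) (mdv j)).trans ?_
    refine mul_le_mul ?_ (r1 j) (integral_nonneg fun _ => sq_nonneg _) (by positivity)
    exact (Finset.single_le_sum (f := fun j => ∫ x in T '' openCube,
      (D1 j x - affineFun (b j) (m j) x) ^ 2) (fun _ _ => integral_nonneg fun _ => sq_nonneg _)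
      (Finset.mem_univ j)).trans b1
  have t2 : ∀ j, (∫ x in T '' openCube, (D2 j j x - m j j) * v x) ^ 2
      ≤ poincareConst * d ^ 2 * Z * (180000 * d ^ 2 * cellEnergy T c) := by
    intro j
    refine (sq_integral_mul_le ((q2 j).2.1 j) mv).trans ?_
    refine mul_le_mul ?_ r0 (integral_nonneg fun _ => sq_nonneg _) (by positivity)
    exact (sum_sum_nonneg_single (f := fun j k => ∫ x in T '' openCube, (D2 j k x - m j k) ^ 2)
      (fun _ _ => integral_nonneg fun _ => sq_nonneg _) j j).trans b2
  rw [Finset.sum_congr rfl fun j _ => e j]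
  refine (sq_add_six_le _ _).trans ?_
  refine (mul_le_mul_of_nonneg_left (Finset.sum_le_sum fun j _ => add_le_add (t1 j) (t2 j))
    (by norm_num)).trans (le_of_eq ?_)
  simp only [Finset.sum_const, Finset.card_univ, Fintype.card_fin, consistencyConst]
  ring

/-- The constant of the local interpolation estimate. -/
def interpConst (τ : ℝ) : ℝ :=
  2 * poincareConst ^ 2 + 6 * (8 * 84 ^ 2 * τ ^ 2 * (512 * lineConst ^ 6 *
    (poincareConst ^ 3 + 3 * poincareConst ^ 2 + 9 * poincareConst + 27)))

/-- The local interpolation error. -/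
theorem HasWeakGrad.interp_error_le {T : E3 ≃ᵃ[ℝ] E3} {d β τ : ℝ} (hd0 : 0 ≤ d)
    (hd : ∀ j i, |affEntry T j i| ≤ d) (hβ : ∀ i j, |affEntry T.symm i j| ≤ β) (hτ : β * d ≤ τ)
    {u : E3 → ℝ} {D1 : Fin 3 → E3 → ℝ}
    {D2 : Fin 3 → Fin 3 → E3 → ℝ} {D3 : Fin 3 → Fin 3 → Fin 3 → E3 → ℝ}
    (h1 : HasWeakGrad (T '' openCube) u D1) (h2 : ∀ j, HasWeakGrad (T '' openCube) (D1 j) (D2 j))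
    (h3 : ∀ j k, HasWeakGrad (T '' openCube) (D2 j k) (D3 j k))
    (hs : ∀ j k, D2 j k = D2 k j) (hu : Continuous u) (t : SKType) :
    ∑ j, ∫ x in T '' openCube, (D1 j x
      - partialDeriv j (fun x => (t.interp fun y => u (T y)).fn (T.symm x)) x) ^ 2
      ≤ interpConst τ * d ^ 4 * ∑ j, ∑ k, ∑ l, ∫ x in T '' openCube, D3 j k l x ^ 2 := by
  obtain ⟨a, b, m, hm, q1, q2, q3, b2, b1, b0⟩ := HasWeakGrad.exists_quadratic hd h1 h2 h3 hs
  set Z := ∑ j, ∑ k, ∑ l, ∫ x in T '' openCube, D3 j k l x ^ 2 with hZ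
  have hZ0 : 0 ≤ Z := Finset.sum_nonneg fun _ _ => Finset.sum_nonneg fun _ _ =>
    Finset.sum_nonneg fun _ _ => integral_nonneg fun _ => sq_nonneg _
  have hP := poincareConst_pos
  have hdet := affDet_pos T
  have hB := isBounded_affine_image T
  have hβ0 : 0 ≤ β := (abs_nonneg _).trans (hβ 0 0)
  have hL : 0 ≤ lineConst := by linarith [two_le_lineConst]
  -- The quadratic approximation is itself a shape function. Thus interpolant minus quadratic is the
  -- shape function whose nodal values are those of u minus quadratic, and these are small.
  obtain ⟨cq, hcq, hq⟩ := exists_fn_eq_quadratic a b m T t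
  set ci := t.interp fun y => u (T y) with hci
  have hcit : ci.IsOfType t := t.isOfType_interp _
  set c : CubicCoeff := ⟨ci.a - cq.a, ci.κ - cq.κ, ci.b - cq.b, ci.d - cq.d, ci.m - cq.m,
    ci.g - cq.g, ci.k - cq.k⟩ with hc
  have hct : c.IsOfType t := by
    cases t
    · have e1 : ci.k = 0 := hcit
      have e2 : cq.k = 0 := hcq
      change ci.k - cq.k = 0
      rw [e1, e2, sub_zero]
    · have e1 : ci.g = 0 := hcit
      have e2 : cq.g = 0 := hcq
      change ci.g - cq.g = 0
      rw [e1, e2, sub_zero]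
    · have e1 : ci.g = ci.k := hcit
      have e2 : cq.g = cq.k := hcq
      change ci.g - cq.g = ci.k - cq.k
      rw [e1, e2]
  have hcf : ∀ y, c.fn y = ci.fn y - quadratic a b m (T y) := by
    intro y
    rw [hq]
    simp only [hc, CubicCoeff.fn, Fin.sum_univ_three, Pi.sub_apply]
    ring
  -- The four summands correspond to the derivatives of order 0 to 3 in the embedding: a power of
  -- the Poincaré constant times a power of the factor 3 of the edge derivatives.
  set K := poincareConst ^ 3 + 3 * poincareConst ^ 2 + 9 * poincareConst + 27 with hK
  have hK0 : 0 ≤ K := by positivity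
  set X := K * d ^ 6 * Z with hX
  have hX0 : 0 ≤ X := by positivity
  have hnode : ∀ y ∈ refNodes, |c.fn y| ≤ Real.sqrt (512 * lineConst ^ 6 * X / affDet T) := by
    intro y hy
    refine Real.abs_le_sqrt ?_
    rw [le_div_iff₀ hdet, hcf, hci, t.interp_eq _ hy]
    refine HasWeakGrad.sq_mul_affDet_le hd q1 q2 q3
      ((hu.sub (contDiff_quadratic a b m).continuous).continuousOn)
      ⟨y, refNodes_subset_refCube hy, rfl⟩ ?_ ?_ ?_ ?_
    · refine b0.trans ?_
      have : X = (poincareConst * d ^ 2) ^ 3 * Z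
          + (3 * poincareConst ^ 2 + 9 * poincareConst + 27) * d ^ 6 * Z := by
        rw [hX, hK]; ring
      rw [this]
      exact le_add_of_nonneg_right (by positivity)
    · refine (mul_le_mul_of_nonneg_left b1 (by positivity)).trans ?_
      have : X = 3 * d ^ 2 * ((poincareConst * d ^ 2) ^ 2 * Z)
          + (poincareConst ^ 3 + 9 * poincareConst + 27) * d ^ 6 * Z := by
        rw [hX, hK]; ring
      rw [this]
      exact le_add_of_nonneg_right (by positivity)
    · refine (mul_le_mul_of_nonneg_left b2 (by positivity)).trans ?_
      have : X = (3 * d ^ 2) ^ 2 * (poincareConst * d ^ 2 * Z)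
          + (poincareConst ^ 3 + 3 * poincareConst ^ 2 + 27) * d ^ 6 * Z := by
        rw [hX, hK]; ring
      rw [this]
      exact le_add_of_nonneg_right (by positivity)
    · have : X = (3 * d ^ 2) ^ 3 * Z
          + (poincareConst ^ 3 + 3 * poincareConst ^ 2 + 9 * poincareConst) * d ^ 6 * Z := by
        rw [hX, hK]; ring
      rw [this]
      exact le_add_of_nonneg_right (by positivity)
  set N := Real.sqrt (512 * lineConst ^ 6 * X / affDet T) with hN
  have hN2 : N ^ 2 = 512 * lineConst ^ 6 * X / affDet T := Real.sq_sqrt (by positivity)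
  have hgrad : ∀ j, ∫ x in T '' openCube, partialDeriv j (fun x => c.fn (T.symm x)) x ^ 2
      ≤ 8 * 84 ^ 2 * τ ^ 2 * (512 * lineConst ^ 6 * K) * d ^ 4 * Z := by
    intro j
    rw [setIntegral_affine_image]
    -- The constant is 84 = 3 · 28, from three entries of the inverse matrix.
    have hb : ∀ y ∈ openCube, |partialDeriv j (fun x => c.fn (T.symm x)) (T y)| ≤ 84 * β * N := by
      intro y hy
      rw [partialDeriv_comp_affine c.contDiff_fn T.symm j (T y)]
      simp only [AffineEquiv.symm_apply_apply, c.partialDeriv_fn]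
      refine (Finset.abs_sum_le_sum_abs _ _).trans ((Finset.sum_le_sum fun i _ =>
        abs_mul_le_of_le_of_le (hβ i j) (hct.abs_gradFn_le hnode i hy)).trans (le_of_eq ?_))
      simp
      ring
    have h4 : (β * d) ^ 2 ≤ τ ^ 2 := by
      refine pow_le_pow_left₀ (mul_nonneg hβ0 hd0) hτ 2
    calc affDet T * ∫ y in openCube, partialDeriv j (fun x => c.fn (T.symm x)) (T y) ^ 2
        ≤ affDet T * (8 * (84 * β * N) ^ 2) := by
          gcongr; exact setIntegral_sq_le_of_abs_le hb
      _ = 8 * 84 ^ 2 * β ^ 2 * (affDet T * N ^ 2) := by ring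
      _ = 8 * 84 ^ 2 * β ^ 2 * (512 * lineConst ^ 6 * X) := by
          rw [hN2, mul_div_cancel₀ _ hdet.ne']
      _ = 8 * 84 ^ 2 * (β * d) ^ 2 * (512 * lineConst ^ 6 * K) * d ^ 4 * Z := by rw [hX]; ring
      _ ≤ _ := by gcongr
  have hpd : ∀ j x, partialDeriv j (fun x => ci.fn (T.symm x)) x
      = affineFun (b j) (m j) x + partialDeriv j (fun x => c.fn (T.symm x)) x := by
    intro j x
    have e : (fun x => c.fn (T.symm x)) = fun x => ci.fn (T.symm x) - quadratic a b m x := by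
      funext x
      rw [hcf, AffineEquiv.apply_symm_apply]
    rw [e, partialDeriv_sub (contDiff_fn_comp T ci) (contDiff_quadratic a b m),
      partialDeriv_quadratic a b hm]
    ring
  have hmem : ∀ j, MemLp (partialDeriv j fun x => c.fn (T.symm x)) 2
      (volume.restrict (T '' openCube)) := fun j =>
    memLp_of_continuous_of_isBounded hB
      (contDiff_partialDeriv j (contDiff_fn_comp T c)).continuous
  have hterm : ∀ j, ∫ x in T '' openCube, (D1 j x
      - partialDeriv j (fun x => ci.fn (T.symm x)) x) ^ 2
      ≤ 2 * (∫ x in T '' openCube, (D1 j x - affineFun (b j) (m j) x) ^ 2)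
        + 2 * (8 * 84 ^ 2 * τ ^ 2 * (512 * lineConst ^ 6 * K) * d ^ 4 * Z) := by
    intro j
    have i1 := ((q1.2.1 j).integrable_sq).const_mul 2
    have i2 := ((hmem j).integrable_sq).const_mul 2
    have := integral_mono_of_nonneg (μ := volume.restrict (T '' openCube))
      (f := fun x => (D1 j x - partialDeriv j (fun x => ci.fn (T.symm x)) x) ^ 2)
      (Filter.Eventually.of_forall fun x => sq_nonneg _) (i1.add i2)
      (Filter.Eventually.of_forall fun x => by
        simp only [Pi.add_apply, hpd]
        nlinarith [sq_nonneg (D1 j x - affineFun (b j) (m j) x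
          + partialDeriv j (fun x => c.fn (T.symm x)) x)])
    refine this.trans ?_
    have e := integral_add i1 i2
    simp only [Pi.add_apply]
    rw [e, integral_const_mul, integral_const_mul]
    linarith [hgrad j]
  refine (Finset.sum_le_sum fun j _ => hterm j).trans ?_
  rw [Finset.sum_add_distrib, ← Finset.mul_sum]
  refine (add_le_add_left (mul_le_mul_of_nonneg_left b1 (by norm_num)) _).trans (le_of_eq ?_)
  simp only [Finset.sum_const, Finset.card_univ, Fintype.card_fin, interpConst, ← hK]
  ring

/-! ### Mesh quantities -/

theorem abs_apply_sub_le_dist (x y : E3) (i : Fin 3) : |x i - y i| ≤ dist x y := by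
  rw [dist_eq_norm, ← Real.norm_eq_abs]
  exact PiLp.norm_apply_le (x - y) i

theorem abs_affEntry_le_diam (T : E3 ≃ᵃ[ℝ] E3) (j i : Fin 3) :
    |affEntry T j i| ≤ Metric.diam (T '' refCube) := by
  have hx : EuclideanSpace.single i (1 : ℝ) ∈ refCube := by
    intro k
    by_cases h : k = i <;> simp [h]
  have h0 : (0 : E3) ∈ refCube := fun k => by simp
  have h := affine_apply_sub T (EuclideanSpace.single i (1 : ℝ)) 0 j
  have e : affEntry T j i = T (EuclideanSpace.single i (1 : ℝ)) j - T 0 j := by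
    rw [h]
    simp
  rw [e]
  refine (abs_apply_sub_le_dist _ _ j).trans (Metric.dist_le_diam_of_mem ?_ ⟨_, hx, rfl⟩
    ⟨_, h0, rfl⟩)
  exact (isCompact_refCube.image (continuous_affine T)).isBounded

/-- Moving by ρ/2 inside the ball changes a reference coordinate by at most 2, the width of the
cube. -/
theorem abs_affEntry_symm_le {T : E3 ≃ᵃ[ℝ] E3} {c : E3} {ρ : ℝ} (hρ : 0 < ρ)
    (h : Metric.closedBall c (ρ / 2) ⊆ T '' refCube) (i j : Fin 3) :
    |affEntry T.symm i j| ≤ 4 / ρ := by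
  have hmem : ∀ x ∈ Metric.closedBall c (ρ / 2), |T.symm x i| ≤ 1 := by
    intro x hx
    obtain ⟨y, hy, rfl⟩ := h hx
    simpa using hy i
  have h1 := hmem c (Metric.mem_closedBall_self (by positivity))
  have h2 := hmem (c + EuclideanSpace.single j (ρ / 2)) (by
    rw [Metric.mem_closedBall, dist_eq_norm]
    simp [abs_of_pos hρ])
  have h3 := affine_apply_sub T.symm (c + EuclideanSpace.single j (ρ / 2)) c i
  have e : affEntry T.symm i j * (ρ / 2)
      = T.symm (c + EuclideanSpace.single j (ρ / 2)) i - T.symm c i := by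
    rw [h3]
    simp
  have h4 : |affEntry T.symm i j * (ρ / 2)| ≤ 2 := by
    rw [e]
    exact (abs_sub _ _).trans (by linarith)
  rw [abs_mul, abs_of_pos (half_pos hρ)] at h4
  rw [le_div_iff₀ hρ]
  linarith

theorem HasWeakGrad.congr {U : Set E3} {g g' : E3 → ℝ} {G : Fin 3 → E3 → ℝ}
    (h : HasWeakGrad U g G) (e : g =ᵐ[volume.restrict U] g') : HasWeakGrad U g' G := by
  refine ⟨(memLp_congr_ae e).1 h.1, h.2.1, fun φ hφ i => ?_⟩
  rw [← h.2.2 φ hφ i]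
  refine integral_congr_ae ?_
  filter_upwards [e] with x hx
  rw [hx]

/-- The weak derivatives up to order three of a function in `H³`. -/
theorem MemSobolev.hasWeakGrad_three {U : Set E3} {u : E3 → ℝ} (h : MemSobolev U 3 u) :
    ∃ (D1 : Fin 3 → E3 → ℝ) (D2 : Fin 3 → Fin 3 → E3 → ℝ) (D3 : Fin 3 → Fin 3 → Fin 3 → E3 → ℝ),
      HasWeakGrad U u D1 ∧ (∀ j, HasWeakGrad U (D1 j) (D2 j)) ∧
      (∀ j k, HasWeakGrad U (D2 j k) (D3 j k)) ∧ (∀ j k, D2 j k = D2 k j) ∧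
      ∑ j, ∑ k, ∑ l, ∫ x in U, D3 j k l x ^ 2 ≤ 27 * sobolevNorm U 3 u ^ 2 := by
  have e1 : ∀ j : Fin 3, ∑ i, (Pi.single j 1 : Fin 3 → ℕ) i = 1 := fun j => by simp
  have e2 : ∀ j k : Fin 3, ∑ i, (Pi.single j 1 + Pi.single k 1 : Fin 3 → ℕ) i = 2 := fun j k => by
    simp only [Pi.add_apply, Finset.sum_add_distrib, e1]
  have e3 : ∀ j k l : Fin 3,
      ∑ i, (Pi.single j 1 + Pi.single k 1 + Pi.single l 1 : Fin 3 → ℕ) i = 3 := fun j k l => by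
    simp only [Pi.add_apply, Finset.sum_add_distrib, e1]
  refine ⟨fun j => weakDeriv U (Pi.single j 1) u,
    fun j k => weakDeriv U (Pi.single j 1 + Pi.single k 1) u,
    fun j k l => weakDeriv U (Pi.single j 1 + Pi.single k 1 + Pi.single l 1) u,
    h.hasWeakGrad (by norm_num), fun j => ?_, fun j k => ?_, fun j k => ?_, ?_⟩
  · exact (h.isWeakDeriv (by rw [e1]; norm_num)).hasWeakGrad fun i =>
      h.isWeakDeriv (by rw [e2]; norm_num)
  · exact (h.isWeakDeriv (by rw [e2]; norm_num)).hasWeakGrad fun i =>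
      h.isWeakDeriv (by rw [e3])
  · simp only [add_comm]
  · refine (Finset.sum_le_sum fun j _ => Finset.sum_le_sum fun k _ => Finset.sum_le_sum fun l _ =>
      integral_weakDeriv_sq_le (by rw [e3])).trans (le_of_eq ?_)
    simp
    ring

namespace BrickMesh

variable {S : E3 ≃ᵃ[ℝ] E3} (𝒯 : BrickMesh (boxDomain S))

theorem interior_cell (k : Fin 𝒯.n) : interior (𝒯.cell k) = 𝒯.T k '' openCube :=
  interior_affine_image _

theorem diam_cell_le (k : Fin 𝒯.n) : Metric.diam (𝒯.cell k) ≤ 𝒯.h :=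
  le_ciSup (f := fun k => Metric.diam (𝒯.cell k)) (Set.finite_range _).bddAbove k

/-- The nodal interpolant of a function. -/
def interp (t : SKType) (v : E3 → ℝ) (k : Fin 𝒯.n) (x : E3) : ℝ :=
  (t.interp fun y => v (𝒯.T k y)).fn ((𝒯.T k).symm x)

theorem interp_node (t : SKType) (v : E3 → ℝ) {z : E3} (hz : z ∈ 𝒯.nodes) {k : Fin 𝒯.n}
    (hk : z ∈ 𝒯.cell k) : 𝒯.interp t v k z = v z := by
  rw [interp, t.interp_eq _ (𝒯.symm_mem_refNodes hz hk), AffineEquiv.apply_symm_apply]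

theorem memNC0_interp (t : SKType) {v : E3 → ℝ}
    (hv : ∀ x ∈ S '' refCube, x ∉ S '' openCube → v x = 0) : 𝒯.MemNC0 t (𝒯.interp t v) := by
  refine ⟨fun k => (t.isOfType_interp _).isShapeFunction _, fun z hz k l hk hl => ?_,
    fun z hz hf k hk => ?_⟩
  · rw [𝒯.interp_node t v hz hk, 𝒯.interp_node t v hz hl]
  · rw [𝒯.interp_node t v hz hk]
    rw [frontier, closure_boxDomain, (isOpen_boxDomain S).interior_eq, boxDomain_eq] at hf
    exact hv z hf.1 hf.2

theorem MemNC0.sub {t : SKType} {v w : Fin 𝒯.n → E3 → ℝ} (hv : 𝒯.MemNC0 t v)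
    (hw : 𝒯.MemNC0 t w) : 𝒯.MemNC0 t fun k x => v k x - w k x := by
  refine ⟨fun k => (hv.1 k).sub (hw.1 k), fun z hz k l hk hl => ?_, fun z hz hf k hk => ?_⟩
  · beta_reduce
    rw [hv.2.1 z hz k l hk hl, hw.2.1 z hz k l hk hl]
  · beta_reduce
    rw [hv.2.2 z hz hf k hk, hw.2.2 z hz hf k hk, sub_zero]

theorem brokenForm_eq {v w : Fin 𝒯.n → E3 → ℝ} {V W : Fin 𝒯.n → Fin 3 → E3 → ℝ}
    (hv : ∀ k, HasWeakGrad (𝒯.T k '' openCube) (v k) (V k))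
    (hw : ∀ k, HasWeakGrad (𝒯.T k '' openCube) (w k) (W k)) :
    𝒯.brokenForm v w = ∑ k, ∑ i, ∫ x in 𝒯.T k '' openCube, V k i x * W k i x := by
  unfold brokenForm
  refine Finset.sum_congr rfl fun k _ => ?_
  rw [interior_cell]
  exact (hv k).dirichletForm_eq (isOpen_affine_image _) (hw k)

/-- The consistency error only involves the remainders of the companions. -/
theorem consistency_eq {f : E3 → ℝ} {D1 : Fin 3 → E3 → ℝ} {D2 : Fin 3 → Fin 3 → E3 → ℝ}
    (h2 : ∀ j, HasWeakGrad (S '' openCube) (D1 j) (D2 j))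
    (hf : f =ᵐ[volume.restrict (S '' openCube)] fun x => -∑ i, D2 i i x) {t : SKType}
    {w : Fin 𝒯.n → E3 → ℝ} (hw : 𝒯.MemNC0 t w) {c : Fin 𝒯.n → CubicCoeff}
    (hc : ∀ k x, w k x = (c k).fn ((𝒯.T k).symm x)) :
    (∑ k, ∑ j, ∫ x in 𝒯.T k '' openCube,
        D1 j x * partialDeriv j (fun x => (c k).fn ((𝒯.T k).symm x)) x)
      - ∑ k, ∫ x in interior (𝒯.cell k), f x * w k x
      = ∑ k, ∑ j, ∫ x in 𝒯.T k '' openCube,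
        (D1 j x * partialDeriv j (fun x => (c k).rem ((𝒯.T k).symm x)) x
          + D2 j j x * (c k).rem ((𝒯.T k).symm x)) := by
  have hcell : ∀ k, 𝒯.T k '' openCube ⊆ S '' openCube := fun k => by
    rw [← 𝒯.interior_cell k, ← boxDomain_eq]
    exact 𝒯.interior_cell_subset k
  have hU : MeasurableSet (S '' openCube) := (isOpen_affine_image S).measurableSet
  have hm : ∀ k j, HasWeakGrad (𝒯.T k '' openCube) (D1 j) (D2 j) := fun k j =>
    (h2 j).mono (hcell k) hU
  have hB : ∀ k, Bornology.IsBounded (𝒯.T k '' openCube) := fun k => isBounded_affine_image _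
  -- The companion is an admissible test function on all of Ω, so its share of the consistency error
  -- vanishes in the sum over the cells.
  have key : ∑ k, ∑ j, ∫ x in 𝒯.T k '' openCube,
      (D1 j x * partialDeriv j (fun x => companion (c k).fn ((𝒯.T k).symm x)) x
        + D2 j j x * companion (c k).fn ((𝒯.T k).symm x)) = 0 := by
    rw [Finset.sum_comm]
    refine Finset.sum_eq_zero fun j _ => ?_
    have h := 𝒯.sum_integral_companion (boxDomain_eq S ▸ h2 j) hw.2.1 hw.2.2 j
    rw [← h]
    refine Finset.sum_congr rfl fun k _ => ?_
    have e : (fun y => w k (𝒯.T k y)) = (c k).fn := by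
      funext y
      rw [hc, AffineEquiv.symm_apply_apply]
    rw [e, interior_cell]
  have hcomp : ∀ k, ContDiff ℝ ∞ fun x => companion (c k).fn ((𝒯.T k).symm x) := fun k =>
    (contDiff_companion _).comp (contDiff_affine _)
  have mem : ∀ k {ψ : E3 → ℝ}, ContDiff ℝ ∞ ψ → MemLp ψ 2 (volume.restrict (𝒯.T k '' openCube)) :=
    fun k ψ hψ => memLp_of_continuous_of_isBounded (hB k) hψ.continuous
  have int1 : ∀ k j {ψ : E3 → ℝ}, ContDiff ℝ ∞ ψ → Integrable (fun x => D1 j x * partialDeriv j ψ x)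
      (volume.restrict (𝒯.T k '' openCube)) := fun k j ψ hψ =>
    MemLp.integrable_mul_fun (hm k j).1 (mem k (contDiff_partialDeriv j hψ))
  have int2 : ∀ k j {ψ : E3 → ℝ}, ContDiff ℝ ∞ ψ → Integrable (fun x => D2 j j x * ψ x)
      (volume.restrict (𝒯.T k '' openCube)) := fun k j ψ hψ =>
    MemLp.integrable_mul_fun ((hm k j).2.1 j) (mem k hψ)
  have hload : ∀ k, ∫ x in interior (𝒯.cell k), f x * w k x
      = -∑ j, ∫ x in 𝒯.T k '' openCube, D2 j j x * (c k).fn ((𝒯.T k).symm x) := by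
    intro k
    rw [interior_cell, ← integral_finsetSum _ fun j _ => int2 k j (contDiff_fn_comp _ _),
      ← integral_neg]
    refine integral_congr_ae ?_
    filter_upwards [ae_restrict_of_ae_restrict_of_subset (hcell k) hf] with x hx
    rw [hx, hc, neg_mul, Finset.sum_mul]
  have hloc : ∀ k j, (∫ x in 𝒯.T k '' openCube,
        D1 j x * partialDeriv j (fun x => (c k).fn ((𝒯.T k).symm x)) x)
      + ∫ x in 𝒯.T k '' openCube, D2 j j x * (c k).fn ((𝒯.T k).symm x)
      = (∫ x in 𝒯.T k '' openCube,
        (D1 j x * partialDeriv j (fun x => (c k).rem ((𝒯.T k).symm x)) x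
          + D2 j j x * (c k).rem ((𝒯.T k).symm x)))
      + ∫ x in 𝒯.T k '' openCube,
        (D1 j x * partialDeriv j (fun x => companion (c k).fn ((𝒯.T k).symm x)) x
          + D2 j j x * companion (c k).fn ((𝒯.T k).symm x)) := by
    intro k j
    have hr := contDiff_rem_comp (𝒯.T k) (c k)
    have hF := contDiff_fn_comp (𝒯.T k) (c k)
    have hC := hcomp k
    have e : (fun x => (c k).rem ((𝒯.T k).symm x))
        = fun x => (c k).fn ((𝒯.T k).symm x) - companion (c k).fn ((𝒯.T k).symm x) := by
      funext x
      rw [CubicCoeff.fn_sub_companion]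
    refine (integral_add (int1 k j hF) (int2 k j hF)).symm.trans (Eq.trans ?_
      (integral_add ((int1 k j hr).add (int2 k j hr)) ((int1 k j hC).add (int2 k j hC))))
    refine integral_congr_ae (Filter.Eventually.of_forall fun x => ?_)
    beta_reduce
    rw [e, partialDeriv_sub hF hC, ← CubicCoeff.fn_sub_companion]
    ring
  have htot := Finset.sum_congr rfl fun k (_ : k ∈ Finset.univ) =>
    Finset.sum_congr rfl fun j (_ : j ∈ Finset.univ) => hloc k j
  simp only [Finset.sum_add_distrib] at htot
  rw [key, add_zero] at htot
  rw [← htot, Finset.sum_congr rfl fun k _ => hload k, Finset.sum_neg_distrib, sub_neg_eq_add]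

end BrickMesh

/-! ### The global error estimate -/

theorem sq_sum_integral_mul_le {μ : Measure E3} {p q : Fin 3 → E3 → ℝ}
    (hp : ∀ j, MemLp (p j) 2 μ) (hq : ∀ j, MemLp (q j) 2 μ) :
    (∑ j, ∫ x, p j x * q j x ∂μ) ^ 2 ≤ (∑ j, ∫ x, p j x ^ 2 ∂μ) * ∑ j, ∫ x, q j x ^ 2 ∂μ :=
  Finset.sum_sq_le_sum_mul_sum_of_sq_le_mul _ (fun _ _ => integral_nonneg fun _ => sq_nonneg _)
    (fun _ _ => integral_nonneg fun _ => sq_nonneg _) fun j _ => sq_integral_mul_le (hp j) (hq j)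

theorem interpConst_nonneg (τ : ℝ) : 0 ≤ interpConst τ := by
  have hP := poincareConst_pos
  have hL : 0 ≤ lineConst := by linarith [two_le_lineConst]
  unfold interpConst
  positivity

theorem consistencyConst_nonneg (τ : ℝ) : 0 ≤ consistencyConst τ := by
  have hP := poincareConst_pos
  unfold consistencyConst
  positivity

/-- The constant of the global error estimate. -/
def errorConst (σ : ℝ) : ℝ :=
  2 * interpConst (4 * σ) + 4 * (interpConst (4 * σ) + consistencyConst (4 * σ))

theorem errorConst_nonneg (σ : ℝ) : 0 ≤ errorConst σ := by
  have h1 := interpConst_nonneg (4 * σ)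
  have h2 := consistencyConst_nonneg (4 * σ)
  unfold errorConst
  positivity

namespace BrickMesh

variable {S : E3 ≃ᵃ[ℝ] E3} (𝒯 : BrickMesh (boxDomain S))

/-- The error estimate in terms of a chain of weak derivatives of a continuous solution. -/
theorem sum_integral_error_le {σ : ℝ} (hσ : 𝒯.IsShapeRegular σ) {t : SKType} {f u : E3 → ℝ}
    {D1 : Fin 3 → E3 → ℝ} {D2 : Fin 3 → Fin 3 → E3 → ℝ} {D3 : Fin 3 → Fin 3 → Fin 3 → E3 → ℝ}
    (h1 : HasWeakGrad (S '' openCube) u D1) (h2 : ∀ j, HasWeakGrad (S '' openCube) (D1 j) (D2 j))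
    (h3 : ∀ j k, HasWeakGrad (S '' openCube) (D2 j k) (D3 j k)) (hs : ∀ j k, D2 j k = D2 k j)
    (hf : f =ᵐ[volume.restrict (S '' openCube)] fun x => -∑ i, D2 i i x) (hu : Continuous u)
    (hu0 : ∀ x ∈ S '' refCube, x ∉ S '' openCube → u x = 0)
    {b : Fin 𝒯.n → CubicCoeff} {uh : Fin 𝒯.n → E3 → ℝ}
    (hb : ∀ k x, uh k x = (b k).fn ((𝒯.T k).symm x)) (huh : 𝒯.IsDiscreteSolution t f uh) :
    ∑ k, ∑ j, ∫ x in 𝒯.T k '' openCube,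
        (D1 j x - partialDeriv j (fun x => (b k).fn ((𝒯.T k).symm x)) x) ^ 2
      ≤ errorConst σ * 𝒯.h ^ 4 * ∑ j, ∑ k, ∑ l, ∫ x in S '' openCube, D3 j k l x ^ 2 := by
  set Z : Fin 𝒯.n → ℝ := fun k => ∑ i, ∑ j, ∑ l, ∫ x in 𝒯.T k '' openCube, D3 i j l x ^ 2 with hZ
  have hZ0 : ∀ k, 0 ≤ Z k := fun k => Finset.sum_nonneg fun _ _ => Finset.sum_nonneg fun _ _ =>
    Finset.sum_nonneg fun _ _ => integral_nonneg fun _ => sq_nonneg _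
  have hcell : ∀ k, 𝒯.T k '' openCube ⊆ S '' openCube := fun k => by
    rw [← 𝒯.interior_cell k, ← boxDomain_eq]
    exact 𝒯.interior_cell_subset k
  have hU : MeasurableSet (S '' openCube) := (isOpen_affine_image S).measurableSet
  have hZsum : ∑ k, Z k = ∑ j, ∑ k, ∑ l, ∫ x in S '' openCube, D3 j k l x ^ 2 := by
    have e : ∀ i j l, ∫ x in S '' openCube, D3 i j l x ^ 2
        = ∑ k, ∫ x in 𝒯.T k '' openCube, D3 i j l x ^ 2 := by
      intro i j l
      have hi : IntegrableOn (fun x => D3 i j l x ^ 2) (boxDomain S) := by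
        rw [boxDomain_eq]
        exact ((h3 i j).2.1 l).integrable_sq
      have := 𝒯.setIntegral_boxDomain hi
      simpa only [interior_cell, boxDomain_eq] using this
    simp only [e, hZ]
    rw [Finset.sum_comm]
    refine Finset.sum_congr rfl fun i _ => ?_
    rw [Finset.sum_comm]
    refine Finset.sum_congr rfl fun j _ => ?_
    rw [Finset.sum_comm]
  have g1 := fun k => h1.mono (hcell k) hU
  have g2 := fun k j => (h2 j).mono (hcell k) hU
  have g3 := fun k i j => (h3 i j).mono (hcell k) hU
  have hh0 : ∀ k, 0 ≤ Metric.diam (𝒯.cell k) := fun k => Metric.diam_nonneg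
  have hh4 : ∀ k, Metric.diam (𝒯.cell k) ^ 4 ≤ 𝒯.h ^ 4 := fun k =>
    pow_le_pow_left₀ (hh0 k) (𝒯.diam_cell_le k) 4
  -- Here β = 4/ρ, so shape regularity bounds β times the diameter by 4σ.
  have hβ : ∀ k, ∃ β, (∀ i j, |affEntry (𝒯.T k).symm i j| ≤ β) ∧
      β * Metric.diam (𝒯.cell k) ≤ 4 * σ := by
    intro k
    obtain ⟨c, ρ, hρ, hc, hd⟩ := hσ k
    refine ⟨4 / ρ, abs_affEntry_symm_le hρ hc, ?_⟩
    rw [div_mul_eq_mul_div, div_le_iff₀ hρ]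
    linarith
  set P := interpConst (4 * σ) with hP
  set Q := consistencyConst (4 * σ) with hQ
  have hP0 : 0 ≤ P := interpConst_nonneg _
  have hQ0 : 0 ≤ Q := consistencyConst_nonneg _
  set ci : Fin 𝒯.n → CubicCoeff := fun k => t.interp fun y => u (𝒯.T k y) with hci
  have hI : ∀ k, ∑ j, ∫ x in 𝒯.T k '' openCube,
      (D1 j x - partialDeriv j (fun x => (ci k).fn ((𝒯.T k).symm x)) x) ^ 2 ≤ P * 𝒯.h ^ 4 * Z k := by
    intro k
    obtain ⟨β, hb1, hb2⟩ := hβ k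
    refine (HasWeakGrad.interp_error_le (hh0 k) (abs_affEntry_le_diam _) hb1 hb2 (g1 k) (g2 k)
      (g3 k) hs hu t).trans ?_
    have := hZ0 k
    have := hh4 k
    gcongr
  have hwN : 𝒯.MemNC0 t fun k x => 𝒯.interp t u k x - uh k x :=
    MemNC0.sub 𝒯 (𝒯.memNC0_interp t hu0) huh.1
  set w : Fin 𝒯.n → E3 → ℝ := fun k x => 𝒯.interp t u k x - uh k x with hw
  choose c hc using fun k => (hwN.1 k).exists_eq_fn
  have hC : ∀ k, (∑ j, ∫ x in 𝒯.T k '' openCube,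
      (D1 j x * partialDeriv j (fun x => (c k).rem ((𝒯.T k).symm x)) x
        + D2 j j x * (c k).rem ((𝒯.T k).symm x))) ^ 2
      ≤ Q * 𝒯.h ^ 4 * Z k * cellEnergy (𝒯.T k) (c k) := by
    intro k
    obtain ⟨β, hb1, hb2⟩ := hβ k
    refine (HasWeakGrad.sq_consistency_le (hh0 k) (abs_affEntry_le_diam _) hb1 hb2 (g1 k) (g2 k)
      (g3 k) hs (c k)).trans ?_
    have := hZ0 k
    have := hh4 k
    have := cellEnergy_nonneg (𝒯.T k) (c k)
    gcongr
  have hpd : ∀ k j x, partialDeriv j (fun x => (c k).fn ((𝒯.T k).symm x)) x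
      = partialDeriv j (fun x => (ci k).fn ((𝒯.T k).symm x)) x
        - partialDeriv j (fun x => (b k).fn ((𝒯.T k).symm x)) x := by
    intro k j x
    have e : (fun x => (c k).fn ((𝒯.T k).symm x))
        = fun x => (ci k).fn ((𝒯.T k).symm x) - (b k).fn ((𝒯.T k).symm x) := by
      funext x
      rw [← hc, ← hb]
      rfl
    rw [e, partialDeriv_sub (contDiff_fn_comp _ _) (contDiff_fn_comp _ _)]
  have hB : ∀ k, Bornology.IsBounded (𝒯.T k '' openCube) := fun k => isBounded_affine_image _
  have mem : ∀ k j (c : CubicCoeff), MemLp (partialDeriv j fun x => c.fn ((𝒯.T k).symm x)) 2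
      (volume.restrict (𝒯.T k '' openCube)) := fun k j c =>
    memLp_of_continuous_of_isBounded (hB k)
      (contDiff_partialDeriv j (contDiff_fn_comp _ _)).continuous
  have gw : ∀ k, HasWeakGrad (𝒯.T k '' openCube) (w k)
      fun j => partialDeriv j fun x => (c k).fn ((𝒯.T k).symm x) := by
    intro k
    rw [show w k = fun x => (c k).fn ((𝒯.T k).symm x) from funext (hc k)]
    exact hasWeakGrad_of_contDiff (hB k) (contDiff_fn_comp _ _)
  have gu : ∀ k, HasWeakGrad (𝒯.T k '' openCube) (uh k)
      fun j => partialDeriv j fun x => (b k).fn ((𝒯.T k).symm x) := by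
    intro k
    rw [show uh k = fun x => (b k).fn ((𝒯.T k).symm x) from funext (hb k)]
    exact hasWeakGrad_of_contDiff (hB k) (contDiff_fn_comp _ _)
  have hdisc := huh.2 w hwN
  rw [𝒯.brokenForm_eq gu gw] at hdisc
  have hcons := 𝒯.consistency_eq h2 hf hwN hc
  rw [← hdisc] at hcons
  set E := ∑ k, cellEnergy (𝒯.T k) (c k) with hE
  have hE0 : 0 ≤ E := Finset.sum_nonneg fun k _ => cellEnergy_nonneg _ _
  set A : Fin 𝒯.n → ℝ := fun k => ∑ j, ∫ x in 𝒯.T k '' openCube,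
    (D1 j x - partialDeriv j (fun x => (ci k).fn ((𝒯.T k).symm x)) x)
      * partialDeriv j (fun x => (c k).fn ((𝒯.T k).symm x)) x with hA
  set B : Fin 𝒯.n → ℝ := fun k => ∑ j, ∫ x in 𝒯.T k '' openCube,
      (D1 j x * partialDeriv j (fun x => (c k).rem ((𝒯.T k).symm x)) x
        + D2 j j x * (c k).rem ((𝒯.T k).symm x)) with hBdef
  have hA2 : ∀ k, A k ^ 2 ≤ P * 𝒯.h ^ 4 * Z k * cellEnergy (𝒯.T k) (c k) := fun k =>
    (sq_sum_integral_mul_le (fun j => ((g1 k).2.1 j).sub (mem k j (ci k)))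
      fun j => mem k j (c k)).trans
      (mul_le_mul_of_nonneg_right (hI k) (cellEnergy_nonneg _ _))
  -- Strang's identity: a_h(w, w) is a_h(u, w) − a_h(u_h, w), the consistency error B, minus the
  -- interpolation term A.
  have hid : E = ∑ k, (B k - A k) := by
    rw [Finset.sum_sub_distrib, ← hcons, hE, sub_sub, eq_sub_iff_add_eq]
    simp only [hA, cellEnergy, ← Finset.sum_add_distrib]
    refine Finset.sum_congr rfl fun k _ => Finset.sum_congr rfl fun j _ => ?_
    have i1 := (mem k j (c k)).integrable_sq
    have i2 := MemLp.integrable_mul_fun (mem k j (b k)) (mem k j (c k))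
    have i3 := MemLp.integrable_mul_fun (((g1 k).2.1 j).sub (mem k j (ci k))) (mem k j (c k))
    refine ((congrArg _ (integral_add i2 i3)).symm.trans
      (integral_add i1 (i2.add i3)).symm).trans ?_
    refine integral_congr_ae (Filter.Eventually.of_forall fun x => ?_)
    simp only [Pi.add_apply, Pi.sub_apply, hpd]
    ring
  -- Cauchy–Schwarz over the cells, using (B − A)² ≤ 2B² + 2A²; one factor E then cancels.
  have hEsq : E ^ 2 ≤ (∑ k, 2 * (P + Q) * 𝒯.h ^ 4 * Z k) * E := by
    refine (congrArg (· ^ 2) hid).trans_le ?_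
    refine Finset.sum_sq_le_sum_mul_sum_of_sq_le_mul _ (fun k _ => ?_)
      (fun k _ => cellEnergy_nonneg _ _) fun k _ => ?_
    · have := hZ0 k
      have : 0 ≤ 𝒯.h ^ 4 := (pow_nonneg (hh0 k) 4).trans (hh4 k)
      positivity
    · have e1 := hA2 k
      have e2 := hC k
      nlinarith [sq_nonneg (A k + B k)]
  have hEle : E ≤ 2 * (P + Q) * 𝒯.h ^ 4 * ∑ k, Z k := by
    rw [Finset.mul_sum]
    rcases hE0.eq_or_lt with h | h
    · rw [← h]
      refine Finset.sum_nonneg fun k _ => ?_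
      have := hZ0 k
      have : 0 ≤ 𝒯.h ^ 4 := (pow_nonneg (hh0 k) 4).trans (hh4 k)
      positivity
    · rw [sq] at hEsq
      exact le_of_mul_le_mul_right hEsq h
  -- The triangle inequality in squared form: u − u_h is the interpolation error plus w.
  have hterm : ∀ k, ∑ j, ∫ x in 𝒯.T k '' openCube,
      (D1 j x - partialDeriv j (fun x => (b k).fn ((𝒯.T k).symm x)) x) ^ 2
      ≤ 2 * (P * 𝒯.h ^ 4 * Z k) + 2 * cellEnergy (𝒯.T k) (c k) := by
    intro k
    refine le_trans ?_ (add_le_add_left (mul_le_mul_of_nonneg_left (hI k) zero_le_two) _)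
    rw [cellEnergy, Finset.mul_sum, Finset.mul_sum, ← Finset.sum_add_distrib]
    refine Finset.sum_le_sum fun j _ => ?_
    have i1 := (((g1 k).2.1 j).sub (mem k j (ci k))).integrable_sq.const_mul 2
    have i2 := (mem k j (c k)).integrable_sq.const_mul 2
    rw [← integral_const_mul, ← integral_const_mul]
    refine le_trans ?_ (integral_add i1 i2).le
    refine integral_mono_of_nonneg (Filter.Eventually.of_forall fun x => sq_nonneg _) (i1.add i2)
      (Filter.Eventually.of_forall fun x => ?_)
    simp only [Pi.sub_apply]
    have e : D1 j x - partialDeriv j (fun x => (b k).fn ((𝒯.T k).symm x)) x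
        = (D1 j x - partialDeriv j (fun x => (ci k).fn ((𝒯.T k).symm x)) x)
          + partialDeriv j (fun x => (c k).fn ((𝒯.T k).symm x)) x := by
      rw [hpd]
      ring
    rw [e]
    nlinarith [sq_nonneg (D1 j x - partialDeriv j (fun x => (ci k).fn ((𝒯.T k).symm x)) x
      - partialDeriv j (fun x => (c k).fn ((𝒯.T k).symm x)) x)]
  refine (Finset.sum_le_sum fun k _ => hterm k).trans ?_
  rw [Finset.sum_add_distrib, ← Finset.mul_sum, ← Finset.mul_sum, ← Finset.mul_sum, ← hE, ← hZsum]
  refine (add_le_add_right (mul_le_mul_of_nonneg_left hEle zero_le_two) _).trans (le_of_eq ?_)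
  rw [errorConst]
  ring

end BrickMesh

end BrickFEM

end

/-! ### The error estimate -/

theorem theorem1 (t : SKType) (S : E3 ≃ᵃ[ℝ] E3) (σ : ℝ) :
    ∃ C : ℝ, 0 < C ∧
      ∀ 𝒯 : BrickMesh (boxDomain S), 𝒯.IsShapeRegular σ →
        ∀ f u : E3 → ℝ, ∀ uh : Fin 𝒯.n → E3 → ℝ,
          MemSobolev (boxDomain S) 1 f →
          MemSobolev (boxDomain S) 3 u →
          IsWeakSolution (boxDomain S) f u →
          𝒯.IsDiscreteSolution t f uh →
          𝒯.brokenNorm (fun k => u - uh k) ≤ C * 𝒯.h ^ 2 * sobolevNorm (boxDomain S) 3 u := by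
  -- The factor 27 counts the ordered triples of third derivatives; adding 1 only makes the constant
  -- positive.
  refine ⟨Real.sqrt (27 * errorConst σ) + 1, by positivity, fun 𝒯 hσ f u uh hf hu hsol huh => ?_⟩
  obtain ⟨D1, D2, D3, h1, h2, h3, hs, hD3⟩ := hu.hasWeakGrad_three
  have hlap := hsol.ae_eq_neg_laplacian (isOpen_boxDomain S) hf.1 h1 h2
  have hH10 := hsol.1
  rw [boxDomain_eq] at h1 h2 h3 hlap hH10
  -- The continuous representative has the same weak derivatives as u, so the estimate for v is the
  -- one for u.
  obtain ⟨v, hv, hvu, hv0⟩ := hH10.exists_continuous h1 h2 h3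
  choose b hb using fun k => (huh.1.1 k).exists_eq_fn
  have key := 𝒯.sum_integral_error_le hσ (h1.congr hvu) h2 h3 hs hlap hv hv0 hb huh
  have hg : ∀ k, HasWeakGrad (𝒯.T k '' openCube) (u - uh k)
      fun j x => D1 j x - partialDeriv j (fun x => (b k).fn ((𝒯.T k).symm x)) x := by
    intro k
    have hcell : 𝒯.T k '' openCube ⊆ S '' openCube := by
      rw [← 𝒯.interior_cell k, ← boxDomain_eq]
      exact 𝒯.interior_cell_subset k
    rw [show u - uh k = fun x => u x - (b k).fn ((𝒯.T k).symm x) from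
      funext fun x => by rw [Pi.sub_apply, hb]]
    exact (h1.mono hcell (isOpen_affine_image S).measurableSet).sub
      (hasWeakGrad_of_contDiff (isBounded_affine_image _) (contDiff_fn_comp _ _))
  have hform := 𝒯.brokenForm_eq hg hg
  have hC := errorConst_nonneg σ
  have hh : 0 ≤ 𝒯.h := Real.iSup_nonneg fun k => Metric.diam_nonneg
  have hN := sobolevNorm_nonneg (boxDomain S) 3 u
  rw [BrickMesh.brokenNorm, hform]
  refine (Real.sqrt_le_left (y := Real.sqrt (27 * errorConst σ) * 𝒯.h ^ 2
    * sobolevNorm (boxDomain S) 3 u) (by positivity)).2 ?_ |>.trans ?_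
  · simp only [← pow_two]
    rw [← boxDomain_eq] at key
    refine key.trans ?_
    refine (mul_le_mul_of_nonneg_left hD3 (by positivity)).trans (le_of_eq ?_)
    rw [mul_pow, mul_pow, Real.sq_sqrt (by positivity)]
    ring
  · gcongr
    linarith
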